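/- **Setting.** Let $X$ be a connected Kähler manifold and $\alpha$ a closed holomorphic one-form on $X$ with exactly one zero, which is nondegenerate (Morse), and with a single period, normalised to $2\pi i$. Let $\pi:\widetilde X\to X$ be the corresponding connected cyclic holomorphic cover with deck generator $\gamma$, let $W$ be holomorphic on $\widetilde X$ with $\pi^*\alpha=dW$ and $W\circ\gamma=W+2\pi i$, and let $Y$ be holomorphic on $\widetilde X$ with $Y\circ\gamma=Y+2\pi i$ (so that $W=Y+F$ with $F$ $\mathbb Z$-invariant). Let $p_0$ be a lift of the zero of $\alpha$, and let $\epsilon=t\epsilon_0$ with $\mathrm{Re}\,\epsilon_0>0$ fixed and $t\to0^+$. Put $W^{-\epsilon}=W-\tfrac12\epsilon Y^2$, let $\phi_k(\epsilon)$, $k\in\mathbb Z$, be the critical point of $W^{-\epsilon}$ tending to $\gamma^kp_0$, and let $z_k=\zeta^{-1}W^{-\epsilon}(\phi_k(\epsilon))$ with $\zeta=-i$, $z_{kl}=z_l-z_k$. Below, *stable* means: for all sufficiently small $t>0$ (how small may depend on the finite configuration considered). *Solitons.* A $kl$-soliton is a solution on $\mathbb R$, from $\phi_k$ to $\phi_l$,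 of $\dot\gamma^a=\zeta_{kl}\,g^{a\bar b}\,\overline{\partial_bW^{-\epsilon}}$, where $\zeta_{kl}$ is the phase of $W^{-\epsilon}(\phi_l)-W^{-\epsilon}(\phi_k)$, up to translation. For $k\ne l$ let $R_{kl}$ be the complex vector space whose basis is the set of stable $kl$-solitons (germs as $t\to0^+$ of continuous families of $kl$-solitons), and let $K_{kl}:R_{kl}\otimes R_{lk}\to\mathbb C$ be the pairing for which a soliton $s$ is dual to its reversal $\bar s$. Suppose the $R_{kl}$ are finite dimensional and are given an integral grading in which every $K_{kl}$ has degree $-1$, that is $|s|+|\bar s|=1$, and isomorphisms $R_{kl}\cong R_{k+1,l+1}$ permuting solitons and compatible with grading and pairings. *Webs.* A web in the plane or in a closed half-plane is a finite graph with straight edges, some of them going to infinity, whose faces are labelled by vacua $k\in\mathbb Z$, an edge with $k$ on its left and $l$ on its right being parallel to $z_{kl}$. It is taut if the only deformations of its vertices (boundary vertices staying on the boundary) preserving the slopes of the edges are the translations (along the boundary, in the half-plane case) and dilations. Decorate edges by solitons, internal edges carrying dual pairs. A web with a vector at each vertex is contracted by applying $K$ to the internal edges, with the signs given by the orientation of the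 moduli space of the web and the Koszul rule. Let $\beta$ be a $\mathbb Z$-invariant interior amplitude of degree $2$ (for example the one counting stable $\zeta$-instantons): a collection of numbers $N(s_1,\dots,s_m)$, one for each cyclic word of solitons of types $i_0i_1,i_1i_2,\dots,i_{m-1}i_0$, placed at the bulk vertices, which satisfies the $L_\infty$ Maurer–Cartan equation: for each fan at infinity the sum over all stable taut plane webs with $\beta$ inserted at all vertices vanishes. *Boundary algebras.* For a half-plane let $\widehat R_{kl}$ be spanned by the elements $s_1\otimes\dots\otimes s_r\in R_{ki_1}\otimes\dots\otimes R_{i_{r-1}l}$ for which $z_{ki_1},\dots,z_{i_{r-1}l}$ are, stably, in clockwise order in the open half-plane of directions pointing into the half-plane (a half-plane fan), with $\widehat R_{kk}=\mathbb C$ for $r=0$. Let $m_n$ be the sum over all stable taut webs with $n$ boundary vertices (the arguments) and with $\beta$ inserted at all bulk vertices; boundary vertices are ordered along the boundary so that $m_n$ maps $\widehat R_{k_0k_1}\otimes\dots\otimes\widehat R_{k_{n-1}k_n}$ to $\widehat R_{k_0k_n}$. Identify $\widehat R_{kl}\cong\widehat R_{k+1,l+1}$ by the $\mathbb Z$-action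 and set, for the right and the left half-plane respectively, $$A^{\mathrm R}=\bigoplus_n\widehat R^{\mathrm R}_{n,0},\qquad A^{\mathrm L}=\bigoplus_n\widehat R^{\mathrm L}_{0,n}.$$ **Theorem.** In each matrix element of each $m_n$ on $A^{\mathrm R}$ and on $A^{\mathrm L}$ only finitely many stable taut webs occur, and for fixed arguments only finitely many matrix elements are nonzero. 1. $(A^{\mathrm R},m_n)$ is a strictly unital $A_\infty$-algebra with unit the generator of $\widehat R_{00}=\mathbb C$, and the projection to $\widehat R_{00}$ is an augmentation. 2. $(A^{\mathrm L},m_n)$ is a unital differential graded algebra ($m_n=0$ for $n\ge3$), with differential $m_1$ and product $uv=(-1)^{|u|}m_2(u,v)$. 3. $A^{\mathrm L}$ is the cobar complex of $A^{\mathrm R}$. Precisely, let $(e_a)$ be the basis of half-plane fans of the augmentation ideal of $A^{\mathrm R}$ and let $C(A^{\mathrm R})$ be the tensor algebra on the dual basis $(e^a)$, with $|e^a|=1-|e_a|$. Then the graded derivation $\delta$ determined by $\delta e^a=\sum_k(m_k)^a_{a_1\cdots a_k}\,e^{a_1}\otimes\dots\otimes e^{a_k}$ is well defined and satisfies $\delta^2=0$;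 and there is a degree preserving linear isomorphism $\Phi:C(A^{\mathrm R})\to A^{\mathrm L}$ with $\Phi\delta=m_1\Phi$ and $\Phi(uv)=(-1)^{|u||v|}\Phi(v)\Phi(u)$ for words $u,v$, which sends $e^{a_1}\otimes\dots\otimes e^{a_k}$ to $(-1)^{d(d+1)/2}$ times the fan obtained by composing $e_{a_1},\dots,e_{a_k}$ (after translating them by the $\mathbb Z$-action to be composable), reading the composite backwards and replacing every soliton by its reversal; here $d$ is the degree. Thus $A^{\mathrm L}$ and $A^{\mathrm R}$ are Koszul dual. -/

import Mathlib

open scoped Manifold ContDiff Topology ComplexConjugate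
open Filter

noncomputable section

namespace KoszulWebs

universe u v

/-! ## Landau–Ginzburg models defined by a closed holomorphic one-form -/

/-- The model space `ℂⁿ` of a complex manifold of dimension `n`. -/
abbrev Cn (n : ℕ) : Type := EuclideanSpace ℂ (Fin n)

section Geometry

variable {n : ℕ} {X : Type*} [TopologicalSpace X] [ChartedSpace (Cn n) X]

/-- The differential of the inverse of the chart at `x₀`, at the point of coordinates `c`. -/
def chartFrame (x₀ : X) (c : Cn n) :
    Cn n →L[ℂ] TangentSpace 𝓘(ℂ, Cn n) ((extChartAt 𝓘(ℂ, Cn n) x₀).symm c) :=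
  mfderiv 𝓘(ℂ, Cn n) 𝓘(ℂ, Cn n) (extChartAt 𝓘(ℂ, Cn n) x₀).symm c

/-- The local expression, in the chart at `x₀`, of a `(1,0)`-form on `X`. -/
def formInChart (α : (x : X) → TangentSpace 𝓘(ℂ, Cn n) x →L[ℂ] ℂ) (x₀ : X) (c : Cn n) :
    Cn n →L[ℂ] ℂ :=
  (α ((extChartAt 𝓘(ℂ, Cn n) x₀).symm c)).comp (chartFrame x₀ c)

/-- `α` is a closed holomorphic one-form: in every chart its coefficients are holomorphic and
`∂_a α_b = ∂_b α_a`. -/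
def IsClosedHolomorphic (α : (x : X) → TangentSpace 𝓘(ℂ, Cn n) x →L[ℂ] ℂ) : Prop :=
  ∀ x₀ : X, DifferentiableOn ℂ (formInChart α x₀) (extChartAt 𝓘(ℂ, Cn n) x₀).target ∧
    ∀ c ∈ (extChartAt 𝓘(ℂ, Cn n) x₀).target, ∀ v w : Cn n,
      fderiv ℂ (formInChart α x₀) c v w = fderiv ℂ (formInChart α x₀) c w v

/-- `x₀` is the only zero of `α`, and it is Morse: the bilinear form `∂_a α_b` is
nondegenerate at `x₀`. -/
def IsUniqueMorseZero (α : (x : X) → TangentSpace 𝓘(ℂ, Cn n) x →L[ℂ] ℂ) (x₀ : X) : Prop :=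
  (∀ x, α x = 0 ↔ x = x₀) ∧
    ∀ v : Cn n, (∀ w : Cn n,
      fderiv ℂ (formInChart α x₀) (extChartAt 𝓘(ℂ, Cn n) x₀ x₀) v w = 0) → v = 0

/-- The local expression of a sesquilinear form on the tangent spaces in the chart at `x₀`. -/
def metricInChart
    (g : (x : X) → TangentSpace 𝓘(ℂ, Cn n) x →ₗ[ℂ] TangentSpace 𝓘(ℂ, Cn n) x →ₗ⋆[ℂ] ℂ)
    (x₀ : X) (v w c : Cn n) : ℂ :=
  g ((extChartAt 𝓘(ℂ, Cn n) x₀).symm c) (chartFrame x₀ c v) (chartFrame x₀ c w)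

/-- `g` (linear in the first, antilinear in the second variable) is a Kähler metric: it is
hermitian, positive definite and smooth, and the two-form `ω = Im g` is closed. -/
structure IsKahlerMetric
    (g : (x : X) → TangentSpace 𝓘(ℂ, Cn n) x →ₗ[ℂ] TangentSpace 𝓘(ℂ, Cn n) x →ₗ⋆[ℂ] ℂ) :
    Prop where
  hermitian : ∀ x v w, g x v w = conj (g x w v)
  pos : ∀ x v, v ≠ 0 → 0 < (g x v v).re
  smooth : ∀ (x₀ : X) (v w : Cn n),
    ContDiffOn ℝ ∞ (metricInChart g x₀ v w) (extChartAt 𝓘(ℂ, Cn n) x₀).target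
  closed : ∀ x₀ : X, ∀ c ∈ (extChartAt 𝓘(ℂ, Cn n) x₀).target, ∀ a b d : Cn n,
    fderiv ℝ (fun c' => (metricInChart g x₀ b d c').im) c a +
    fderiv ℝ (fun c' => (metricInChart g x₀ d a c').im) c b +
    fderiv ℝ (fun c' => (metricInChart g x₀ a b c').im) c d = 0

/-- The curve `γ` has velocity `v` at time `s` (in the preferred chart at `γ s`, with which
Mathlib identifies the tangent space at `γ s`). -/
def HasVelocity (γ : ℝ → X) (s : ℝ) (v : TangentSpace 𝓘(ℂ, Cn n) (γ s)) : Prop :=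
  ContinuousAt γ s ∧
    HasDerivAt (fun r => extChartAt 𝓘(ℂ, Cn n) (γ s) (γ r)) (show Cn n from v) s

end Geometry

/-- A Landau–Ginzburg model given by a closed holomorphic one-form `α` on a connected Kähler
manifold `X` with a single Morse zero and a single period, normalised to `2πi`, together with
its cyclic cover `p : X' → X`, on which `p^*α = dW`, and a function `Y` on the cover with
`W = Y + F`, where `Y` is shifted by `2πi` by the generator of the deck group and `F` is
invariant. -/
structure LGModel (n : ℕ) (X : Type v) (X' : Type u)
    [TopologicalSpace X] [ChartedSpace (Cn n) X]
    [TopologicalSpace X'] [ChartedSpace (Cn n) X'] where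
  /-- the Kähler metric of the target -/
  g : (x : X) → TangentSpace 𝓘(ℂ, Cn n) x →ₗ[ℂ] TangentSpace 𝓘(ℂ, Cn n) x →ₗ⋆[ℂ] ℂ
  kahler : IsKahlerMetric g
  /-- the one-form -/
  α : (x : X) → TangentSpace 𝓘(ℂ, Cn n) x →L[ℂ] ℂ
  closed : IsClosedHolomorphic α
  /-- the projection of the cyclic cover -/
  p : X' → X
  isCovering : IsCoveringMap p
  surjective : Function.Surjective p
  /-- the complex structure of the cover is the one pulled back along `p` -/
  holomorphic_p : IsLocalDiffeomorph 𝓘(ℂ, Cn n) 𝓘(ℂ, Cn n) ω p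
  /-- the generator of the deck group -/
  deck : X' ≃ₜ X'
  fibres : ∀ x y, p x = p y ↔ ∃ k : ℤ, y = (deck ^ k) x
  /-- the superpotential on the cover -/
  W : X' → ℂ
  holomorphic_W : MDifferentiable 𝓘(ℂ, Cn n) 𝓘(ℂ) W
  dW : ∀ x, mfderiv 𝓘(ℂ, Cn n) 𝓘(ℂ) W x =
    (α (p x)).comp (mfderiv 𝓘(ℂ, Cn n) 𝓘(ℂ, Cn n) p x)
  W_deck : ∀ x, W (deck x) = W x + 2 * Real.pi * Complex.I
  /-- the function in terms of which `W` is perturbed -/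
  Y : X' → ℂ
  holomorphic_Y : MDifferentiable 𝓘(ℂ, Cn n) 𝓘(ℂ) Y
  Y_deck : ∀ x, Y (deck x) = Y x + 2 * Real.pi * Complex.I
  /-- a lift to the cover of the zero of `α` -/
  base : X'
  morse : IsUniqueMorseZero α (p base)

namespace LGModel

variable {n : ℕ} {X : Type v} {X' : Type u}
  [TopologicalSpace X] [ChartedSpace (Cn n) X]
  [TopologicalSpace X'] [ChartedSpace (Cn n) X']

/-- The perturbed superpotential `W - ε Y² / 2`. -/
def pert (M : LGModel n X X') (ε : ℂ) (x : X') : ℂ := M.W x - ε * (M.Y x ^ 2 / 2)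

/-- `vac k t` is, for small `t > 0`, the perturbation of the `k`-th vacuum of `W` to a critical
point of the superpotential perturbed with `ε = t ε₀`. -/
def IsPerturbedVacua (M : LGModel n X X') (ε₀ : ℂ) (vac : ℤ → ℝ → X') : Prop :=
  ∀ k : ℤ, Tendsto (vac k) (𝓝[>] 0) (𝓝 ((M.deck ^ k) M.base)) ∧
    ∀ᶠ t : ℝ in 𝓝[>] 0, mfderiv 𝓘(ℂ, Cn n) 𝓘(ℂ) (M.pert (t * ε₀)) (vac k t) = 0

/-- The vacuum weights `z_k = ζ⁻¹ W^{-ε}(vac k)` with `ζ = -i` and `ε = t ε₀`. -/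
def weight (M : LGModel n X X') (ε₀ : ℂ) (vac : ℤ → ℝ → X') (t : ℝ) (k : ℤ) : ℂ :=
  Complex.I * M.pert (t * ε₀) (vac k t)

/-- The gradient flow equation `dγ^a/ds = ζ g^{a b̄} ∂_b̄ V̄` on the cover, for the superpotential
`V` and the Kähler metric pulled back from `X`. -/
def IsFlowLine (M : LGModel n X X') (V : X' → ℂ) (ζ : ℂ) (γ : ℝ → X') : Prop :=
  ∀ s : ℝ, ∃ v : TangentSpace 𝓘(ℂ, Cn n) (γ s), HasVelocity γ s v ∧
    ∀ w : TangentSpace 𝓘(ℂ, Cn n) (γ s),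
      M.g (M.p (γ s)) (mfderiv 𝓘(ℂ, Cn n) 𝓘(ℂ, Cn n) M.p (γ s) v)
        (mfderiv 𝓘(ℂ, Cn n) 𝓘(ℂ, Cn n) M.p (γ s) w) =
      ζ * conj (show ℂ from mfderiv 𝓘(ℂ, Cn n) 𝓘(ℂ) V (γ s) w)

/-- The phase of `W_l - W_k` for the superpotential perturbed with `ε`; here `a`, `b` are the
`k`-th and `l`-th perturbed vacua. -/
def phase (M : LGModel n X X') (ε : ℂ) (a b : X') : ℂ :=
  (M.pert ε b - M.pert ε a) / (‖M.pert ε b - M.pert ε a‖ : ℝ)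

/-- `γ` is a soliton from the vacuum `a` to the vacuum `b` of the perturbed superpotential. -/
def IsSoliton (M : LGModel n X X') (ε : ℂ) (a b : X') (γ : ℝ → X') : Prop :=
  M.IsFlowLine (M.pert ε) (M.phase ε a b) γ ∧ Tendsto γ atBot (𝓝 a) ∧ Tendsto γ atTop (𝓝 b)

/-- A family of solitons `γ t` from the `k`-th to the `l`-th perturbed vacuum which exists, and
is continuous, for all sufficiently small `ε = t ε₀`. -/
def IsStableFamily (M : LGModel n X X') (ε₀ : ℂ) (vac : ℤ → ℝ → X') (k l : ℤ)
    (γ : ℝ → ℝ → X') : Prop :=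
  ∃ t₀ > 0, ContinuousOn (Function.uncurry γ) (Set.Ioo 0 t₀ ×ˢ Set.univ) ∧
    ∀ t ∈ Set.Ioo 0 t₀, M.IsSoliton (t * ε₀) (vac k t) (vac l t) (γ t)

/-- Two families define the same stable soliton if, for small `t`, they agree up to
translation. -/
def stableSetoid (M : LGModel n X X') (ε₀ : ℂ) (vac : ℤ → ℝ → X') (k l : ℤ) :
    Setoid {γ : ℝ → ℝ → X' // M.IsStableFamily ε₀ vac k l γ} where
  r γ γ' := ∀ᶠ t : ℝ in 𝓝[>] 0, ∃ c : ℝ, ∀ s, γ'.1 t s = γ.1 t (s + c)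
  iseqv :=
    { refl := fun γ => Eventually.of_forall fun t => ⟨0, fun s => by simp⟩
      symm := fun {γ γ'} h => h.mono fun t ⟨c, hc⟩ => ⟨-c, fun s => by rw [hc]; simp⟩
      trans := fun {γ γ' γ''} h h' => by
        filter_upwards [h, h'] with t ⟨c, hc⟩ ⟨c', hc'⟩
        exact ⟨c' + c, fun s => by rw [hc', hc, add_assoc]⟩ }

/-- The set of stable solitons from the `k`-th to the `l`-th vacuum. -/
def StableSoliton (M : LGModel n X X') (ε₀ : ℂ) (vac : ℤ → ℝ → X') (k l : ℤ) : Type u :=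
  Quotient (M.stableSetoid ε₀ vac k l)

theorem hasVelocity_reverse {γ : ℝ → X'} {s : ℝ} {v : TangentSpace 𝓘(ℂ, Cn n) (γ (-s))}
    (h : HasVelocity γ (-s) v) :
    HasVelocity (fun r => γ (-r)) s (show TangentSpace 𝓘(ℂ, Cn n) (γ (-s)) from -v) := by
  refine ⟨ContinuousAt.comp (f := fun r : ℝ => -r) (g := γ) h.1 continuous_neg.continuousAt, ?_⟩
  have h2 := h.2
  have := HasDerivAt.scomp (h := fun r : ℝ => -r) s h2 (hasDerivAt_neg s)
  rw [neg_one_smul] at this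
  exact this

theorem phase_swap (M : LGModel n X X') (ε : ℂ) (a b : X') :
    M.phase ε b a = -M.phase ε a b := by
  unfold phase
  rw [norm_sub_rev, ← neg_div, neg_sub]

theorem IsSoliton.reverse {M : LGModel n X X'} {ε : ℂ} {a b : X'} {γ : ℝ → X'}
    (h : M.IsSoliton ε a b γ) : M.IsSoliton ε b a (fun s => γ (-s)) := by
  refine ⟨fun s => ?_, h.2.2.comp tendsto_neg_atBot_atTop, h.2.1.comp tendsto_neg_atTop_atBot⟩
  obtain ⟨v, hv, hw⟩ := h.1 (-s)
  refine ⟨-v, hasVelocity_reverse hv, fun w => ?_⟩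
  have := hw w
  rw [phase_swap, neg_mul, ← this]
  simp

theorem IsStableFamily.reverse {M : LGModel n X X'} {ε₀ : ℂ} {vac : ℤ → ℝ → X'} {k l : ℤ}
    {γ : ℝ → ℝ → X'} (h : M.IsStableFamily ε₀ vac k l γ) :
    M.IsStableFamily ε₀ vac l k (fun t s => γ t (-s)) := by
  obtain ⟨t₀, ht, hc, hs⟩ := h
  refine ⟨t₀, ht, ?_, fun t h' => (hs t h').reverse⟩
  exact hc.comp (f := fun q : ℝ × ℝ => (q.1, -q.2)) (by fun_prop) (fun q hq => ⟨hq.1, trivial⟩)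

/-- Reversing space, `s ↦ -s`, turns a stable `kl`-soliton into a stable `lk`-soliton. -/
def reverseSoliton (M : LGModel n X X') (ε₀ : ℂ) (vac : ℤ → ℝ → X') (k l : ℤ) :
    M.StableSoliton ε₀ vac k l → M.StableSoliton ε₀ vac l k :=
  Quotient.map' (s₁ := M.stableSetoid ε₀ vac k l) (s₂ := M.stableSetoid ε₀ vac l k)
    (fun γ => ⟨fun t s => γ.1 t (-s), γ.2.reverse⟩) fun γ γ' h => by
      refine Eventually.mono h fun t ⟨c, hc⟩ => ⟨-c, fun s => ?_⟩
      change γ'.1 t (-s) = γ.1 t (-(s + -c))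
      rw [hc]
      ring_nf

end LGModel

/-! ## Solitons, fans and interior amplitudes -/

/-- A soliton spectrum over the vacuum set `ℤ`: a set of generators, a generator `s` being a
basis vector of the space `R_{kl}` with `k = src s`, `l = tgt s`, `k ≠ l`. The pairing
`K_{kl} : R_{kl} ⊗ R_{lk} → ℂ` pairs `s` with `bar s` to `1`, and to `0` with all others. -/
structure Spectrum where
  Gen : Type u
  src : Gen → ℤ
  tgt : Gen → ℤ
  src_ne_tgt : ∀ s, src s ≠ tgt s
  bar : Gen → Gen
  bar_bar : ∀ s, bar (bar s) = s
  src_bar : ∀ s, src (bar s) = tgt s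
  tgt_bar : ∀ s, tgt (bar s) = src s

/-- The spectrum of stable solitons of the perturbed model. -/
def LGModel.spectrum {n : ℕ} {X : Type v} {X' : Type u}
    [TopologicalSpace X] [ChartedSpace (Cn n) X]
    [TopologicalSpace X'] [ChartedSpace (Cn n) X']
    (M : LGModel n X X') (ε₀ : ℂ) (vac : ℤ → ℝ → X') : Spectrum.{u} where
  Gen := Σ kl : {kl : ℤ × ℤ // kl.1 ≠ kl.2}, M.StableSoliton ε₀ vac kl.1.1 kl.1.2
  src s := s.1.1.1
  tgt s := s.1.1.2
  src_ne_tgt s := s.1.2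
  bar s := ⟨⟨(s.1.1.2, s.1.1.1), s.1.2.symm⟩, M.reverseSoliton ε₀ vac _ _ s.2⟩
  bar_bar := by
    rintro ⟨⟨⟨k, l⟩, h⟩, s⟩
    induction s using Quotient.inductionOn with
    | h γ =>
      refine congrArg (Sigma.mk _) (congrArg (Quotient.mk _) (Subtype.ext ?_))
      funext t s
      simp
  src_bar _ := rfl
  tgt_bar _ := rfl

section Combinatorics

variable {S : Spectrum.{u}}

/-- The sign `(-1)^d`. -/
def sgn (d : ℤ) : ℂ := if Even d then 1 else -1

/-- The direction `z_{kl} = z_l - z_k` of an edge carrying the soliton `s` of type `kl`. -/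
def Spectrum.dir (S : Spectrum.{u}) (z : ℤ → ℂ) (s : S.Gen) : ℂ := z (S.tgt s) - z (S.src s)

/-- The nonzero complex numbers `ds` are clockwise ordered, once around the origin. -/
def CyclicClockwise (ds : List ℂ) : Prop :=
  ∃ θ : Fin ds.length → ℝ, StrictAnti θ ∧ (∀ i j, θ i - θ j < 2 * Real.pi) ∧
    ∀ i, ∃ r : ℝ, 0 < r ∧ ds.get i = r * Complex.exp (θ i * Complex.I)

/-- The complex numbers `ds` lie in the open half-plane with inner normal `ν` and are clockwise
ordered. -/
def HalfPlaneClockwise (ν : ℂ) (ds : List ℂ) : Prop :=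
  (∀ d ∈ ds, 0 < (conj ν * d).re) ∧ ds.IsChain (fun a b => (conj a * b).im < 0)

/-- A basis vector of `R_{i₀ i₁} ⊗ R_{i₁ i₂} ⊗ ⋯ ⊗ R_{iₘ i₀}`, `m ≥ 1`, where `i₀` is the largest
of the vacua. This is how the solitons around a bulk vertex are listed. (Bulk vertices of valence
zero carry elements of degree zero and are not needed, since `β` has degree `2`.) -/
def IsCyclicWord (l : List S.Gen) : Prop :=
  2 ≤ l.length ∧ l.map S.tgt = (l.map S.src).rotate 1 ∧
    ∀ a ∈ l.head?, ∀ b ∈ l.tail, S.src b < S.src a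

/-- The vacua around the word form a cyclic fan. -/
def IsCyclicFan (z : ℤ → ℂ) (l : List S.Gen) : Prop :=
  IsCyclicWord l ∧ CyclicClockwise (l.map (S.dir z))

/-- A list of solitons together with a vacuum `start`. If it is composable, it is a basis vector
of `R_{i₀ i₁} ⊗ ⋯ ⊗ R_{iₘ₋₁ iₘ}` with `i₀ = start`; for the empty list (`m = 0`) this is the line
`ℂ` in degree zero. -/
@[ext]
structure Word (S : Spectrum.{u}) where
  start : ℤ
  letters : List S.Gen

namespace Word

/-- The vacua `i₀, …, iₘ`. -/
def vacua (w : Word S) : List ℤ := w.start :: w.letters.map S.tgt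

/-- The last vacuum `iₘ`. -/
def final (w : Word S) : ℤ := (w.letters.getLast?).elim w.start S.tgt

def Composable (w : Word S) : Prop := w.letters.map S.src = w.vacua.dropLast

/-- The vacua of the word form a half-plane fan. -/
def IsHalfPlaneFan (z : ℤ → ℂ) (ν : ℂ) (w : Word S) : Prop :=
  w.Composable ∧ HalfPlaneClockwise ν (w.letters.map (S.dir z))

end Word

/-- Grading, deck group action and interior amplitude on a soliton spectrum, all of it invariant
under the deck group `ℤ`. -/
structure InfraredData (S : Spectrum.{u}) where
  /-- the spaces `R_{kl}` are finite dimensional -/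
  finite : ∀ k l, {s | S.src s = k ∧ S.tgt s = l}.Finite
  /-- the cohomological degree (fermion number) -/
  deg : S.Gen → ℤ
  /-- the pairings have degree `-1` -/
  deg_bar : ∀ s, deg s + deg (S.bar s) = 1
  /-- the isomorphisms `R_{kl} ≅ R_{k+1,l+1}` -/
  shift : Equiv.Perm S.Gen
  src_shift : ∀ s, S.src (shift s) = S.src s + 1
  tgt_shift : ∀ s, S.tgt (shift s) = S.tgt s + 1
  deg_shift : ∀ s, deg (shift s) = deg s
  bar_shift : ∀ s, S.bar (shift s) = shift (S.bar s)
  /-- the coefficient of the cyclic word `l` in the element `β` -/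
  amp : List S.Gen → ℂ
  /-- `β` has degree `2` -/
  amp_deg : ∀ l, amp l ≠ 0 → (l.map deg).sum = 2
  amp_shift : ∀ l, amp (l.map shift) = amp l

namespace InfraredData

variable (D : InfraredData S)

/-- The action of `k ∈ ℤ` on words. -/
def shiftWord (k : ℤ) (w : Word S) : Word S :=
  ⟨w.start + k, w.letters.map (D.shift ^ k : Equiv.Perm S.Gen)⟩

/-- The degree of a word. -/
def degWord (w : Word S) : ℤ := (w.letters.map D.deg).sum

end InfraredData

/-! ## Webs

A web is a graph with straight edges drawn in the plane or in a half-plane. Its faces are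
labelled by vacua, and an edge with `i` on its left and `j` on its right is parallel to `z_{ij}`.
The labels are recorded at the corners: going clockwise around a vertex, one meets the vacua of
the word at the vertex, separated by the edges, which carry the solitons of the word. -/

/-- The combinatorial type of a web decorated by solitons. A position `p` in the list of all
solitons (first of the boundary vertices, in their order, then of the bulk vertices) stands for
the germ of an edge at a vertex. -/
structure Web (S : Spectrum.{u}) where
  /-- the boundary vertices, ordered along the boundary -/
  bdry : List (Word S)
  /-- the bulk vertices -/
  bulk : List (List S.Gen)
  /-- the internal edges, as pairs of positions -/
  edges : List (ℕ × ℕ)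
  /-- the external edges, which go to infinity, in clockwise order -/
  outs : List ℕ

namespace Web

variable (w : Web S)

/-- All edge germs: the vertex (boundary vertices are numbered first) and the soliton. -/
def germs : List (ℕ × S.Gen) :=
  ((w.bdry.map Word.letters ++ w.bulk).mapIdx fun i l => l.map fun s => (i, s)).flatten

/-- The vertex at which the germ `p` sits. -/
def owner (p : ℕ) : ℕ := (w.germs[p]?).elim 0 Prod.fst

/-- The soliton carried by the germ `p`. -/
def letter (p : ℕ) : Option S.Gen := (w.germs[p]?).map Prod.snd

/-- The direction of the germ `p`, pointing away from its vertex. -/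
def dir (z : ℤ → ℂ) (p : ℕ) : ℂ := (w.letter p).elim 0 (S.dir z)

def numVertices : ℕ := w.bdry.length + w.bulk.length

/-- The number of real coordinates: one for each boundary and two for each bulk vertex. -/
def dim : ℕ := w.bdry.length + 2 * w.bulk.length

/-- Every germ belongs to exactly one edge, an internal edge joins a germ of type `ij` to one of
type `ji` with dual solitons, and the vacua around each bulk vertex form a cyclic fan. Internal
edges are listed in the order of their first germs, so that each graph is listed once (up to the
numbering of the bulk vertices). -/
structure IsGraph (z : ℤ → ℂ) : Prop where
  germs_perm : (w.edges.flatMap (fun e => [e.1, e.2]) ++ w.outs).Perm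
    (List.range w.germs.length)
  edge_lt : ∀ e ∈ w.edges, e.1 < e.2
  edge_sorted : w.edges.Pairwise (fun e f => e.1 < f.1)
  edge_dual : ∀ e ∈ w.edges, w.letter e.2 = (w.letter e.1).map S.bar
  bulk_fan : ∀ b ∈ w.bulk, IsCyclicFan z b

/-- The position of the vertex `v`, for the coordinates `ξ`. The boundary of the half-plane is
the line `ℝ τ`. -/
def pos (τ : ℂ) (ξ : Fin w.dim → ℝ) (v : ℕ) : ℂ :=
  let c : ℕ → ℝ := fun j => if h : j < w.dim then ξ ⟨j, h⟩ else 0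
  if v < w.bdry.length then c v * τ
  else c (w.bdry.length + 2 * (v - w.bdry.length)) +
    c (w.bdry.length + 2 * (v - w.bdry.length) + 1) * Complex.I

/-- The edges as subsets of the plane: open segments and open rays. -/
def edgeSets (τ : ℂ) (z : ℤ → ℂ) (ξ : Fin w.dim → ℝ) : List (Set ℂ) :=
  (w.edges.map fun e => openSegment ℝ (w.pos τ ξ (w.owner e.1)) (w.pos τ ξ (w.owner e.2))) ++
  (w.outs.map fun p => {q | ∃ r : ℝ, 0 < r ∧ q = w.pos τ ξ (w.owner p) + r * w.dir z p})

/-- The coordinates `ξ` draw the graph in the plane: the slope constraint holds for the internal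
edges, and vertices and edges do not meet. -/
structure IsDrawing (τ : ℂ) (z : ℤ → ℂ) (ξ : Fin w.dim → ℝ) : Prop where
  slope : ∀ e ∈ w.edges, ∃ r : ℝ, 0 < r ∧
    w.pos τ ξ (w.owner e.2) - w.pos τ ξ (w.owner e.1) = r * w.dir z e.1
  vertices : ∀ v v', v < w.numVertices → v' < w.numVertices → v ≠ v' →
    w.pos τ ξ v ≠ w.pos τ ξ v'
  edges_disjoint : (w.edgeSets τ z ξ).Pairwise Disjoint
  vertex_edge : ∀ A ∈ w.edgeSets τ z ξ, ∀ v < w.numVertices, w.pos τ ξ v ∉ A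

/-- `w`, drawn with the coordinates `ξ`, is a plane web with fan of solitons `o` at infinity. -/
structure IsPlaneWeb (z : ℤ → ℂ) (o : List S.Gen) (ξ : Fin w.dim → ℝ) : Prop where
  graph : w.IsGraph z
  drawing : w.IsDrawing 0 z ξ
  no_bdry : w.bdry = []
  infinity : w.outs.map w.letter = o.map some
  infinity_fan : IsCyclicFan z o

/-- `w`, drawn with the coordinates `ξ`, is a web in the half-plane `{q | 0 ≤ Re (ν̄ q)}`, with
words `ws` at the boundary vertices and half-plane fan of solitons `o` at infinity. The boundary
vertices `c τ` are ordered by `c`, with `τ = -i ν`, so that the vacua of the boundary, read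
clockwise, are those of the consecutive words. -/
structure IsHalfPlaneWeb (ν : ℂ) (z : ℤ → ℂ) (ws : List (Word S)) (o : Word S)
    (ξ : Fin w.dim → ℝ) : Prop where
  graph : w.IsGraph z
  drawing : w.IsDrawing (-Complex.I * ν) z ξ
  bdry_eq : w.bdry = ws
  bdry_fan : ∀ b ∈ ws, b.IsHalfPlaneFan z ν
  bdry_order : ∀ i j : Fin w.dim, i < j → j.1 < w.bdry.length → ξ i < ξ j
  bulk_interior : ∀ v, w.bdry.length ≤ v → v < w.numVertices →
    0 < (conj ν * w.pos (-Complex.I * ν) ξ v).re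
  infinity : w.outs.map w.letter = o.letters.map some
  infinity_fan : o.IsHalfPlaneFan z ν
  label_bdry : ws.IsChain (fun a b => a.final = b.start)
  label_first : ∀ a ∈ ws.head?, a.start = o.start
  label_last : ∀ a ∈ ws.getLast?, a.final = o.final

/-- The linear form in the coordinates whose vanishing says that the edge `e` is parallel to its
central charge. -/
def slopeForm (τ : ℂ) (z : ℤ → ℂ) (e : ℕ × ℕ) (ξ : Fin w.dim → ℝ) : ℝ :=
  ((w.pos τ ξ (w.owner e.2) - w.pos τ ξ (w.owner e.1)) * conj (w.dir z e.1)).im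

/-- The dimension of the moduli space of deformations of a web: the moduli space is open in the
space of solutions of the slope constraints. -/
def moduliDim (τ : ℂ) (z : ℤ → ℂ) : ℕ :=
  Set.finrank ℝ {ξ : Fin w.dim → ℝ | ∀ e ∈ w.edges, w.slopeForm τ z e ξ = 0}

/-- The infinitesimal translation in the direction `d` (where `d = τ` if there are boundary
vertices), in coordinates. -/
def translation (d : ℂ) (j : Fin w.dim) : ℝ :=
  if j.1 < w.bdry.length then 1
  else if Even (j.1 - w.bdry.length) then d.re else d.im

/-- The orientation of a taut web: the sign of the determinant whose rows are the slope forms of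
the internal edges, the translations along `ds`, and the dilation. -/
def orientation (τ : ℂ) (ds : List ℂ) (z : ℤ → ℂ) (ξ : Fin w.dim → ℝ) : ℤ :=
  let rows : List (Fin w.dim → ℝ) :=
    w.edges.map (fun e j => w.slopeForm τ z e (Pi.single j 1)) ++ ds.map w.translation ++ [ξ]
  if h : rows.length = w.dim then
    (SignType.sign (Matrix.det (Matrix.of fun i j : Fin w.dim => rows.get (i.cast h.symm) j)) : ℤ)
  else 0

/-- For weights `z t` depending on a small parameter `t > 0`, and webs `P t ξ` of the type `w`:
for all sufficiently small `t`, the web exists and it is taut, that is, it has no moduli but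
the translations along `ds` and the dilations. -/
def IsStableTaut (τ : ℂ) (ds : List ℂ) (z : ℝ → ℤ → ℂ)
    (P : ℝ → (Fin w.dim → ℝ) → Prop) : Prop :=
  ∀ᶠ t : ℝ in 𝓝[>] 0, (∃ ξ, P t ξ) ∧ w.moduliDim τ (z t) = ds.length + 1

open Classical in
/-- The orientation of a stable taut web, for small `t`. -/
def stableSign (τ : ℂ) (ds : List ℂ) (z : ℝ → ℤ → ℂ) (P : ℝ → (Fin w.dim → ℝ) → Prop) : ℂ :=
  if ∀ᶠ t : ℝ in 𝓝[>] 0, ∀ ξ, P t ξ → w.orientation τ ds (z t) ξ = 1 then 1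
  else if ∀ᶠ t : ℝ in 𝓝[>] 0, ∀ ξ, P t ξ → w.orientation τ ds (z t) ξ = -1 then -1
  else 0

end Web

/-- The Koszul sign of the reordering of letters of degrees `d 0, d 1, …` into the order
given by the list of positions. -/
def koszul (d : ℕ → ℤ) : List ℕ → ℂ
  | [] => 1
  | a :: l => (l.map fun b => if b < a then sgn (d a * d b) else 1).prod * koszul d l

namespace InfraredData

variable (D : InfraredData S)

/-- The sign of moving odd symbols `θ_a`, one for the coordinate of each boundary vertex, to the
left in `θ₁ w₁ θ₂ w₂ ⋯ θₙ wₙ`. -/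
def bdrySign : List (Word S) → ℂ
  | [] => 1
  | w :: ws => sgn (D.degWord w * ws.length) * bdrySign ws

/-- The contraction defined by a web: the interior amplitude is inserted at the bulk vertices
and the pairings `K` are applied along the internal edges. The signs are the orientation of the
web, the Koszul sign of moving the two factors of each pairing next to each other, in front of
the factors at infinity, and the signs from the degrees of the pairings (`-1`) and of the
coordinates of the boundary vertices (`1`). The factor `1 / V!` removes the numbering of the
`V` bulk vertices. -/
def contraction (w : Web S) (orient : ℂ) : ℂ :=
  orient * sgn ((w.edges.length * (w.edges.length - 1) / 2 : ℕ)) * D.bdrySign w.bdry *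
    koszul (fun p => (w.letter p).elim 0 D.deg)
      (w.edges.flatMap (fun e => [e.1, e.2]) ++ w.outs) *
    (w.bulk.map D.amp).prod / (w.bulk.length.factorial : ℂ)

/-- The stable taut half-plane webs with words `ws` at the boundary and fan `o` at infinity. -/
def halfPlaneTaut (z : ℝ → ℤ → ℂ) (ν : ℂ) (ws : List (Word S)) (o : Word S) : Set (Web S) :=
  {w | w.IsStableTaut (-Complex.I * ν) [-Complex.I * ν] z
    (fun t ξ => w.IsHalfPlaneWeb ν (z t) ws o ξ)}

/-- The matrix element of the operation on the words `ws` in the direction of the word `o`: the sum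
over all stable taut half-plane webs. -/
def halfPlaneCoeff (z : ℝ → ℤ → ℂ) (ν : ℂ) (ws : List (Word S)) (o : Word S) : ℂ :=
  ∑ᶠ (w : Web S) (_ : w ∈ halfPlaneTaut z ν ws o),
    D.contraction w (w.stableSign (-Complex.I * ν) [-Complex.I * ν] z
      (fun t ξ => w.IsHalfPlaneWeb ν (z t) ws o ξ))

/-- The stable taut plane webs with fan `o` at infinity. -/
def planeTaut (z : ℝ → ℤ → ℂ) (o : List S.Gen) : Set (Web S) :=
  {w | w.IsStableTaut 0 [1, Complex.I] z (fun t ξ => w.IsPlaneWeb (z t) o ξ)}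

/-- The component along `o` of `∑ₙ λₙ(β, …, β) / n!`. -/
def planeCoeff (z : ℝ → ℤ → ℂ) (o : List S.Gen) : ℂ :=
  ∑ᶠ (w : Web S) (_ : w ∈ planeTaut z o),
    D.contraction w (w.stableSign 0 [1, Complex.I] z (fun t ξ => w.IsPlaneWeb (z t) o ξ))

/-- The `L_∞` Maurer–Cartan equation: `β` is an interior amplitude. -/
def IsInteriorAmplitude (z : ℝ → ℤ → ℂ) : Prop :=
  ∀ o : List S.Gen, D.planeCoeff z o = 0

end InfraredData

/-- The words whose vacua form a half-plane fan for all small `t`. -/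
def Word.IsStableFan (z : ℝ → ℤ → ℂ) (ν : ℂ) (w : Word S) : Prop :=
  ∀ᶠ t : ℝ in 𝓝[>] 0, w.IsHalfPlaneFan (z t) ν

/-- The basis of `A^R = ⊕ₙ R̂_{n,0}` (right half-plane, `ν = 1`). -/
def RightBasis (S : Spectrum.{u}) (z : ℝ → ℤ → ℂ) : Type u :=
  {w : Word S // w.IsStableFan z 1 ∧ w.final = 0}

/-- The basis of `A^L = ⊕ₙ R̂_{0,n}` (left half-plane, `ν = -1`). -/
def LeftBasis (S : Spectrum.{u}) (z : ℝ → ℤ → ℂ) : Type u :=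
  {w : Word S // w.IsStableFan z (-1) ∧ w.start = 0}

/-- The unit of `A^R`: the generator of `R̂_{00}`. -/
def RightBasis.one (S : Spectrum.{u}) (z : ℝ → ℤ → ℂ) : RightBasis S z :=
  ⟨⟨0, []⟩, Eventually.of_forall fun _ => by
    simp [Word.IsHalfPlaneFan, Word.Composable, Word.vacua, HalfPlaneClockwise], rfl⟩

/-- The unit of `A^L`: the generator of `R̂_{00}`. -/
def LeftBasis.one (S : Spectrum.{u}) (z : ℝ → ℤ → ℂ) : LeftBasis S z :=
  ⟨⟨0, []⟩, Eventually.of_forall fun _ => by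
    simp [Word.IsHalfPlaneFan, Word.Composable, Word.vacua, HalfPlaneClockwise], rfl⟩

namespace InfraredData

variable (D : InfraredData S)

/-- Words ending at `0` are moved by the deck group so that each ends where the next one begins
and the last one ends at `0`. -/
def placeRight : List (Word S) → List (Word S)
  | [] => []
  | w :: ws => D.shiftWord ((ws.map Word.start).sum) w :: placeRight ws

/-- Words beginning at `0` are moved by the deck group so that the first one begins at `0` and
each begins where the previous one ends. -/
def placeLeft : List (Word S) → List (Word S)
  | [] => []
  | w :: ws => w :: (placeLeft ws).map (D.shiftWord w.final)

end InfraredData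

end Combinatorics

/-! ## `A_∞`-algebras and the cobar complex -/

/-- An `A_∞`-structure on the graded vector space with homogeneous basis `B`: `m [b₁, …, bₙ]` is
`mₙ(b₁, …, bₙ)`. The operations have degree `2 - n`. The signs in the associativity relations are
those for which the operations are of degree `1` after a shift of the grading. -/
structure AInfinity (B : Type*) (deg : B → ℤ) where
  m : List B → B →₀ ℂ
  m_nil : m [] = 0
  degree : ∀ l b, m l b ≠ 0 → deg b = (l.map deg).sum + 2 - l.length
  assoc : ∀ l : List B, ∑ i ∈ Finset.range l.length, ∑ j ∈ Finset.range (l.length - i),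
    sgn (((l.take i).map fun b => deg b + 1).sum) •
      ((m ((l.drop i).take (j + 1))).sum fun c r =>
        r • m (l.take i ++ c :: l.drop (i + j + 1))) = 0

namespace AInfinity

variable {B : Type*} {deg : B → ℤ} (A : AInfinity B deg)

/-- The operation `m₁`, as a linear map. -/
def d : (B →₀ ℂ) →ₗ[ℂ] (B →₀ ℂ) := Finsupp.linearCombination ℂ fun b => A.m [b]

/-- The product `x y = (-1)^{|x|} m₂(x, y)`. -/
def mul : (B →₀ ℂ) →ₗ[ℂ] (B →₀ ℂ) →ₗ[ℂ] (B →₀ ℂ) :=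
  Finsupp.linearCombination ℂ fun b =>
    sgn (deg b) • Finsupp.linearCombination ℂ fun c => A.m [b, c]

/-- The basis vector `e` is a strict unit. -/
structure IsStrictUnit (e : B) : Prop where
  deg_unit : deg e = 0
  d_unit : A.m [e] = 0
  left : ∀ b, A.m [e, b] = Finsupp.single b 1
  right : ∀ b, A.m [b, e] = sgn (deg b) • Finsupp.single b 1
  higher : ∀ l, 3 ≤ l.length → e ∈ l → A.m l = 0

/-- The coefficient at the basis vector `e` is an augmentation, that is, a strict morphism
`ε : A → ℂ` of `A_∞`-algebras. The augmentation ideal is spanned by the other basis vectors. -/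
def IsAugmentedAt (e : B) : Prop :=
  deg e = 0 ∧ (∀ b, A.m [b] e = 0) ∧
    (∀ b c, A.m [b, c] e = Finsupp.single b (1 : ℂ) e * Finsupp.single c (1 : ℂ) e) ∧
    ∀ l, 3 ≤ l.length → A.m l e = 0

/-- `A` is a differential graded algebra: all `mₙ` with `n ≥ 3` vanish. -/
def IsDG : Prop := ∀ l, 3 ≤ l.length → A.m l = 0

end AInfinity

/-- The underlying algebra of the cobar complex: the tensor algebra on the (restricted) dual of the
augmentation ideal, with the words in the dual basis `e^a`, `a ≠ e`, as basis. -/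
abbrev Cobar {B : Type*} (e : B) : Type _ := MonoidAlgebra ℂ (FreeMonoid {b : B // b ≠ e})

namespace Cobar

variable {B : Type*} {e : B}

/-- The basis vector of the cobar complex given by a word. -/
def word (u : FreeMonoid {b : B // b ≠ e}) : Cobar e := MonoidAlgebra.of ℂ _ u

/-- The degree of a word: `|e^a| = 1 - |e_a|`. -/
def degree (deg : B → ℤ) (u : FreeMonoid {b : B // b ≠ e}) : ℤ :=
  (u.toList.map fun a => 1 - deg a.1).sum

/-- `δ` is the cobar differential: `δ e^a = ∑ (m_k)^a_{a₁ ⋯ a_k} e^{a₁} ⊗ ⋯ ⊗ e^{a_k}`, and `δ` is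
a graded derivation. -/
structure IsDifferential {deg : B → ℤ} (A : AInfinity B deg) (δ : Cobar e →ₗ[ℂ] Cobar e) :
    Prop where
  gen : ∀ (a : {b : B // b ≠ e}) (u : FreeMonoid {b : B // b ≠ e}),
    (δ (word (FreeMonoid.of a))).coeff u = A.m (u.toList.map Subtype.val) a.1
  leibniz : ∀ u v : FreeMonoid {b : B // b ≠ e},
    δ (word (u * v)) = δ (word u) * word v + sgn (degree deg u) • (word u * δ (word v))
  square : δ ∘ₗ δ = 0

end Cobar

section WebAlgebras

variable {S : Spectrum.{u}} (D : InfraredData S) (z : ℝ → ℤ → ℂ)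

/-- `A` is the web algebra `A^R` of the right half-plane: its matrix elements are the (finite)
sums over stable taut webs. -/
def IsRightWebAlgebra (A : AInfinity (RightBasis S z) fun b => D.degWord b.1) : Prop :=
  ∀ ws : List (RightBasis S z), ws ≠ [] → ∀ o : RightBasis S z,
    (InfraredData.halfPlaneTaut z 1 (D.placeRight (ws.map Subtype.val)) o.1).Finite ∧
    A.m ws o = D.halfPlaneCoeff z 1 (D.placeRight (ws.map Subtype.val)) o.1

/-- `A` is the web algebra `A^L` of the left half-plane. -/
def IsLeftWebAlgebra (A : AInfinity (LeftBasis S z) fun b => D.degWord b.1) : Prop :=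
  ∀ ws : List (LeftBasis S z), ws ≠ [] → ∀ o : LeftBasis S z,
    (InfraredData.halfPlaneTaut z (-1) (D.placeLeft (ws.map Subtype.val)) o.1).Finite ∧
    A.m ws o = D.halfPlaneCoeff z (-1) (D.placeLeft (ws.map Subtype.val)) o.1

variable {z}

/-- The word of `A^L` dual, under the pairings `K`, to the word `e^{w₁} ⊗ ⋯ ⊗ e^{wₖ}` of the cobar
complex of `A^R`: the words `w₁, …, wₖ` are composed to a word from `n` to `0`, which is read
backwards, with all solitons replaced by their duals. -/
def dualWord (u : FreeMonoid {b : RightBasis S z // b ≠ RightBasis.one S z}) : Word S :=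
  ⟨0, (((D.placeRight (u.toList.map fun a => a.1.1)).flatMap Word.letters).map S.bar).reverse⟩

/-- `A^L` is the cobar complex of the augmented `A_∞`-algebra `A^R`, with the opposite product: a
linear isomorphism `Φ` sends each word, up to the sign `(-1)^{d(d+1)/2}` where `d` is its degree,
to its dual word, commutes with the differentials, and satisfies `Φ(x y) = ± Φ(y) Φ(x)` with the
Koszul sign. -/
def IsKoszulDual (AR : AInfinity (RightBasis S z) fun b => D.degWord b.1)
    (AL : AInfinity (LeftBasis S z) fun b => D.degWord b.1) : Prop :=
  AR.IsStrictUnit (RightBasis.one S z) ∧ AR.IsAugmentedAt (RightBasis.one S z) ∧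
  AL.IsStrictUnit (LeftBasis.one S z) ∧ AL.IsDG ∧
  ∃ δ : Cobar (RightBasis.one S z) →ₗ[ℂ] Cobar (RightBasis.one S z),
    Cobar.IsDifferential AR δ ∧
    ∃ Φ : Cobar (RightBasis.one S z) ≃ₗ[ℂ] (LeftBasis S z →₀ ℂ),
      (∀ u, ∃ b : LeftBasis S z, b.1 = dualWord D u ∧
        D.degWord b.1 = Cobar.degree (fun b => D.degWord b.1) u ∧
        Φ (Cobar.word u) = sgn (D.degWord b.1 * (D.degWord b.1 + 1) / 2) •
          Finsupp.single b 1) ∧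
      (∀ x, Φ (δ x) = AL.d (Φ x)) ∧
      ∀ u v, Φ (Cobar.word (u * v)) =
        sgn (Cobar.degree (fun b => D.degWord b.1) u * Cobar.degree (fun b => D.degWord b.1) v) •
          AL.mul (Φ (Cobar.word v)) (Φ (Cobar.word u))

end WebAlgebras

end KoszulWebs

end

/-!
The weight of the vacuum `k` is `z_k = i (W₀ + 2πik - t ε₀ (Y₀ + 2πik)² / 2) + o(t)`: to first order
a critical value moves only by the perturbation at the unperturbed critical point
(`isLittleO_pert_vacuum`). Since `Re ε₀ > 0`, any finite set of weights is, for small `t`, in the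
position of points `-k + i k²` of a parabola (`isAsymptoticallyParabolic_of_isLittleO`). Everything
else follows from this.

Call a soliton from `k` to `l` *rising* if `k < l` and *falling* if `l < k`. A falling edge points
to the right, a rising one to the left, and consecutive rising edges turn clockwise. So a fan of the
right half-plane is empty or a single falling soliton, a fan of the left half-plane is any path of
rising solitons, and a cyclic fan is a falling soliton followed by a rising path, that is, a convex
polygon inscribed in the parabola (`isCyclicFan_iff`). Every bulk vertex thus has exactly one falling
germ, and an internal edge joins a falling germ to a rising one (`IsGraph.countP_isDown`). Comparing
the resulting number of edges with the dimension of the moduli space leaves few taut webs: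

* without bulk vertices, two words placed side by side on the boundary, which compose them;
* in the right half-plane, a star: one bulk vertex, joined to all boundary vertices and to infinity
  (`IsHalfPlaneWeb.eq_starWeb`);
* in the left half-plane and in the plane, a graft: two vertices joined by one edge, which replaces
  a soliton of the first vertex by a path (`IsPlaneWeb.eq_planeGraft`).

The operations of `A^R` on solitons are therefore the coefficients of the interior amplitude at the
polygon formed by the soliton at infinity and the duals of the arguments, and the Maurer–Cartan
equation is a sum over the diagonals of a polygon (`IsInteriorAmplitude.sum_eq_zero`). A diagonal
cuts out a consecutive subword of the arguments, to which the inner operation is applied, so that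
equation is the associativity relation (`rightOp_assoc_map_of`). The unit, on which only the product
is nonzero, is treated separately.

In `A^L` the product is composition of paths. The differential replaces a rising soliton `s` by a
path `K` with the coefficient of the amplitude at `bar s` followed by `K`, which is also the
coefficient with which the operations of `A^R` take the dual of `K` to the dual of `s`. Reading a
word of falling solitons backwards and reversing every soliton therefore turns the cobar
differential into that of `A^L` (`leftCoeff_singleton`). That the cobar differential squares to zero
is the associativity of `A^R`; this and the Leibniz rule are carried over to `A^L` by the
isomorphism `dualMap`, so that no second use of the Maurer–Cartan equation is made. The sign
`(-1)^{d(d+1)/2}` is the one which turns the cobar product into the opposite product.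
-/

noncomputable section

namespace KoszulWebs

universe u v

/-! ### Critical values of the perturbed superpotential -/

/-- Cauchy's estimate: the derivative of a holomorphic function of several variables is locally
bounded. -/
theorem eventually_norm_fderiv_le {E : Type*} [NormedAddCommGroup E] [NormedSpace ℂ E]
    {h : E → ℂ} {c₀ : E} (hh : ∀ᶠ c in 𝓝 c₀, DifferentiableAt ℂ h c) :
    ∃ C : ℝ, ∀ᶠ c in 𝓝 c₀, ‖fderiv ℂ h c‖ ≤ C := by
  have hcont : ContinuousAt h c₀ := hh.self_of_nhds.continuousAt
  obtain ⟨r, hr, hball⟩ := Metric.eventually_nhds_iff_ball.1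
    (hh.and (hcont.eventually (Metric.ball_mem_nhds (h c₀) one_pos)))
  refine ⟨2 / (r / 2), Metric.eventually_nhds_iff_ball.2 ⟨r / 2, by positivity, fun c hc => ?_⟩⟩
  have hsub : Metric.ball c (r / 2) ⊆ Metric.ball c₀ r := by
    refine Metric.ball_subset_ball' ?_
    rw [Metric.mem_ball] at hc
    linarith
  have hcr : c ∈ Metric.ball c₀ r := hsub (Metric.mem_ball_self (by positivity))
  refine Complex.norm_fderiv_le_div_of_mapsTo_ball
    (fun y hy => (hball y (hsub hy)).1.differentiableWithinAt) (fun y hy => ?_) (by positivity)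
  have h1 := (hball y (hsub hy)).2
  have h2 := (hball c hcr).2
  rw [Metric.mem_closedBall]
  calc dist (h y) (h c) ≤ dist (h y) (h c₀) + dist (h c) (h c₀) := dist_triangle_right _ _ _
    _ ≤ 2 := by linarith

/-- Moving a nondegenerate critical point `c₀` of `f` to a critical point `c t` of `f - t ε₀ h² / 2`
changes the value of `f` only by `o(t)`: nondegeneracy bounds the displacement by `O(t)`, and
`f` is stationary at `c₀`. -/
theorem isLittleO_critical_value {E : Type*} [NormedAddCommGroup E] [NormedSpace ℂ E]
    [FiniteDimensional ℂ E] {f h : E → ℂ} {A : E → E →L[ℂ] ℂ} {c₀ : E} {c : ℝ → E} {ε₀ : ℂ}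
    (hf : HasFDerivAt f (A c₀) c₀) (hh : ∀ᶠ x in 𝓝 c₀, DifferentiableAt ℂ h x)
    (hA : DifferentiableAt ℂ A c₀) (hA0 : A c₀ = 0)
    (hinj : ∀ v, (∀ w, fderiv ℂ A c₀ v w = 0) → v = 0)
    (hc : Tendsto c (𝓝[>] 0) (𝓝 c₀))
    (hcrit : ∀ᶠ t : ℝ in 𝓝[>] 0, A (c t) = (t * ε₀ * h (c t)) • fderiv ℂ h (c t)) :
    (fun t => f (c t) - f c₀) =o[𝓝[>] 0] (fun t : ℝ => t) := by
  obtain ⟨C, hC⟩ := eventually_norm_fderiv_le hh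
  have hAc : (fun t => A (c t)) =O[𝓝[>] 0] (fun t : ℝ => t) := by
    have hhb : ∀ᶠ x in 𝓝 c₀, ‖h x‖ ≤ ‖h c₀‖ + 1 := by
      have := hh.self_of_nhds.continuousAt.norm
      exact (this.eventually (gt_mem_nhds (lt_add_one _))).mono fun _ h => le_of_lt h
    refine Asymptotics.IsBigO.of_bound (‖ε₀‖ * (‖h c₀‖ + 1) * C) ?_
    filter_upwards [hcrit, hc.eventually hC, hc.eventually hhb] with t h1 h2 h3
    rw [h1, norm_smul, norm_mul, norm_mul, Complex.norm_real]
    calc ‖t‖ * ‖ε₀‖ * ‖h (c t)‖ * ‖fderiv ℂ h (c t)‖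
        ≤ ‖t‖ * ‖ε₀‖ * (‖h c₀‖ + 1) * C := by gcongr
      _ = _ := by ring
  have hlin : (fun t => c t - c₀) =O[𝓝[>] 0] (fun t => fderiv ℂ A c₀ (c t - c₀)) := by
    have hker : LinearMap.ker (fderiv ℂ A c₀ : E →ₗ[ℂ] E →L[ℂ] ℂ) = ⊥ := by
      rw [LinearMap.ker_eq_bot']
      intro v hv
      refine hinj v fun w => ?_
      have : fderiv ℂ A c₀ v = 0 := hv
      rw [this]; rfl
    obtain ⟨K, hK, hanti⟩ := LinearMap.exists_antilipschitzWith _ hker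
    refine Asymptotics.IsBigO.of_bound K (Eventually.of_forall fun t => ?_)
    simpa [dist_eq_norm] using hanti.le_mul_dist (c t - c₀) 0
  have hdisp : (fun t => c t - c₀) =O[𝓝[>] 0] (fun t : ℝ => t) := by
    have h1 := hA.hasFDerivAt.isLittleO
    have h2 : (fun t => A (c t) - A c₀ - fderiv ℂ A c₀ (c t - c₀)) =o[𝓝[>] 0]
        (fun t => fderiv ℂ A c₀ (c t - c₀)) :=
      (h1.comp_tendsto hc).trans_isBigO hlin
    have h3 := h2.right_isBigO_add
    refine hlin.trans (h3.trans ?_)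
    simpa [hA0] using hAc
  have := (hf.isLittleO.comp_tendsto hc).trans_isBigO hdisp
  simpa [Function.comp_def, hA0] using this

/-- The vacuum weights indexed by `F` lie on a convex curve, like the points `-k + i k²` of a
parabola: the real part decreases with the vacuum, and the chord from `k` to `l`, for `k < l`, turns
clockwise as `k + l` grows. -/
structure IsParabolicOn (F : Set ℤ) (z : ℤ → ℂ) : Prop where
  re_lt : ∀ k ∈ F, ∀ l ∈ F, k < l → (z l).re < (z k).re
  cross : ∀ k ∈ F, ∀ l ∈ F, ∀ m ∈ F, ∀ p ∈ F, k < l → m < p → k + l < m + p →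
    (conj (z l - z k) * (z p - z m)).im < 0

/-- Every finite set of vacuum weights is in parabolic position for small `t > 0`. -/
def IsAsymptoticallyParabolic (z : ℝ → ℤ → ℂ) : Prop :=
  ∀ F : Set ℤ, F.Finite → ∀ᶠ t in 𝓝[>] 0, IsParabolicOn F (z t)

/-- To zeroth order in `t` the weights lie on a horizontal line; the term of first order is quadratic
in the vacuum, and `0 < Re ε₀` fixes the side to which the parabola opens. -/
theorem isAsymptoticallyParabolic_of_isLittleO {z : ℝ → ℤ → ℂ} {W₀ Y₀ ε₀ : ℂ} (hε₀ : 0 < ε₀.re)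
    (hz : ∀ k : ℤ, (fun t => z t k - Complex.I * (W₀ + 2 * Real.pi * Complex.I * k -
      t * ε₀ * ((Y₀ + 2 * Real.pi * Complex.I * k) ^ 2 / 2))) =o[𝓝[>] 0] (fun t : ℝ => t)) :
    IsAsymptoticallyParabolic z := by
  have hpi := Real.pi_pos
  -- the edge vectors are `-2π(l - k) + t u(k, l) + o(t)`
  set u : ℤ → ℤ → ℂ := fun k l =>
    Real.pi * ε₀ * (l - k) * (2 * Y₀ + 2 * Real.pi * Complex.I * (k + l)) with hu
  have hq : ∀ k l : ℤ, Tendsto (fun t : ℝ => (z t l - z t k + 2 * Real.pi * (l - k)) / t)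
      (𝓝[>] 0) (𝓝 (u k l)) := by
    intro k l
    have h0 : (fun t : ℝ => t) =O[𝓝[>] 0] (fun t : ℝ => (t : ℂ)) :=
      Asymptotics.isBigO_of_le _ fun t => by simp
    have h1 := (((hz l).sub (hz k)).trans_isBigO h0).tendsto_div_nhds_zero
    have h2 := h1.add_const (u k l)
    rw [zero_add] at h2
    refine h2.congr' ?_
    filter_upwards [self_mem_nhdsWithin] with t ht
    have : (t : ℂ) ≠ 0 := by exact_mod_cast (ne_of_gt ht)
    rw [hu]
    field_simp
    linear_combination (-(4 : ℂ) * Real.pi * (l - k) + 4 * Real.pi ^ 2 * t * ε₀ * Complex.I *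
      (l ^ 2 - k ^ 2) + 4 * Real.pi * t * ε₀ * Y₀ * (l - k)) * Complex.I_sq
  have ht : Tendsto (fun t : ℝ => (t : ℂ)) (𝓝[>] 0) (𝓝 0) := by
    have : Tendsto (fun t : ℝ => (t : ℂ)) (𝓝 0) (𝓝 ((0 : ℝ) : ℂ)) :=
      Complex.continuous_ofReal.continuousAt
    simpa using this.mono_left nhdsWithin_le_nhds
  have hpos : ∀ᶠ t : ℝ in 𝓝[>] 0, 0 < t := self_mem_nhdsWithin
  have hzlim : ∀ k l : ℤ, Tendsto (fun t : ℝ => z t l - z t k) (𝓝[>] 0)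
      (𝓝 (-(2 * Real.pi * (l - k)))) := by
    intro k l
    have h := ((hq k l).mul ht).sub_const (2 * Real.pi * (l - k) : ℂ)
    simp only [mul_zero, zero_sub] at h
    refine h.congr' ?_
    filter_upwards [hpos] with t ht'
    have : (t : ℂ) ≠ 0 := by exact_mod_cast ht'.ne'
    field_simp
    ring
  have hre : ∀ k l : ℤ, k < l → ∀ᶠ t : ℝ in 𝓝[>] 0, (z t l).re < (z t k).re := by
    intro k l hkl
    have h := (Complex.continuous_re.tendsto _).comp (hzlim k l)
    have hneg : (-(2 * Real.pi * ((l : ℂ) - k))).re < 0 := by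
      have h' : (-(2 * Real.pi * ((l : ℂ) - k))) = ((-(2 * Real.pi * ((l : ℝ) - k)) : ℝ) : ℂ) := by
        push_cast; ring
      rw [h', Complex.ofReal_re]
      have : (k : ℝ) < l := by exact_mod_cast hkl
      nlinarith
    filter_upwards [h.eventually (gt_mem_nhds hneg)] with t ht'
    simpa using ht'
  have hcross : ∀ k l m p : ℤ, k < l → m < p → k + l < m + p → ∀ᶠ t : ℝ in 𝓝[>] 0,
      (conj (z t l - z t k) * (z t p - z t m)).im < 0 := by
    intro k l m p hkl hmp hs
    -- divided by `t`, the cross product converges to a negative number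
    have hlim : Tendsto (fun t : ℝ => (z t l - z t k).re *
          ((z t p - z t m + 2 * Real.pi * (p - m)) / t).im -
          ((z t l - z t k + 2 * Real.pi * (l - k)) / t).im * (z t p - z t m).re) (𝓝[>] 0)
        (𝓝 ((-(2 * Real.pi * ((l : ℂ) - k))).re * (u m p).im -
          (u k l).im * (-(2 * Real.pi * ((p : ℂ) - m))).re)) :=
      (((Complex.continuous_re.tendsto _).comp (hzlim k l)).mul
          ((Complex.continuous_im.tendsto _).comp (hq m p))).sub
        (((Complex.continuous_im.tendsto _).comp (hq k l)).mul
          ((Complex.continuous_re.tendsto _).comp (hzlim m p)))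
    have hneg : (-(2 * Real.pi * ((l : ℂ) - k))).re * (u m p).im -
          (u k l).im * (-(2 * Real.pi * ((p : ℂ) - m))).re =
        -(4 * Real.pi ^ 3 * ε₀.re * ((l - k : ℝ) * (p - m)) * ((m + p : ℝ) - (k + l))) := by
      simp [hu]
      ring
    have hkl' : (0 : ℝ) < l - k := by rw [sub_pos]; exact_mod_cast hkl
    have hmp' : (0 : ℝ) < p - m := by rw [sub_pos]; exact_mod_cast hmp
    have hs' : (0 : ℝ) < (m + p : ℝ) - (k + l) := by rw [sub_pos]; exact_mod_cast hs
    have hlt : -(4 * Real.pi ^ 3 * ε₀.re * ((l - k : ℝ) * (p - m)) *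
        ((m + p : ℝ) - (k + l))) < 0 := by
      rw [neg_lt_zero]; positivity
    rw [hneg] at hlim
    filter_upwards [hlim.eventually (gt_mem_nhds hlt), hpos] with t h1 h2
    have e : (conj (z t l - z t k) * (z t p - z t m)).im =
        t * ((z t l - z t k).re *
          ((z t p - z t m + 2 * Real.pi * (p - m)) / t).im -
          ((z t l - z t k + 2 * Real.pi * (l - k)) / t).im * (z t p - z t m).re) := by
      have ht0 : t ≠ 0 := h2.ne'
      rw [Complex.div_ofReal_im, Complex.div_ofReal_im]
      simp [Complex.mul_im]
      field_simp
      ring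
    rw [e]
    exact mul_neg_of_pos_of_neg h2 h1
  intro F hF
  have h1 : ∀ᶠ t in 𝓝[>] 0, ∀ k ∈ F, ∀ l ∈ F, k < l → (z t l).re < (z t k).re :=
    hF.eventually_all.2 fun k _ => hF.eventually_all.2 fun l _ =>
      eventually_imp_distrib_left.2 fun h => hre k l h
  have h2 : ∀ᶠ t in 𝓝[>] 0, ∀ k ∈ F, ∀ l ∈ F, ∀ m ∈ F, ∀ p ∈ F, k < l → m < p → k + l < m + p →
      (conj (z t l - z t k) * (z t p - z t m)).im < 0 :=
    hF.eventually_all.2 fun k _ => hF.eventually_all.2 fun l _ => hF.eventually_all.2 fun m _ =>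
      hF.eventually_all.2 fun p _ => eventually_imp_distrib_left.2 fun a =>
      eventually_imp_distrib_left.2 fun b => eventually_imp_distrib_left.2 fun d =>
        hcross k l m p a b d
  filter_upwards [h1, h2] with t a b using ⟨a, b⟩

namespace LGModel

variable {n : ℕ} {X : Type v} {X' : Type u}
  [TopologicalSpace X] [ChartedSpace (Cn n) X]
  [TopologicalSpace X'] [ChartedSpace (Cn n) X']

theorem zpow_deck_of_add_const (M : LGModel n X X') {f : X' → ℂ} {a : ℂ}
    (hf : ∀ x, f (M.deck x) = f x + a) (k : ℤ) (x : X') : f ((M.deck ^ k) x) = f x + a * k := by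
  have hmul : ∀ j : ℤ, (M.deck ^ (j + 1)) x = M.deck ((M.deck ^ j) x) := fun j => by
    rw [add_comm, zpow_add, zpow_one]; rfl
  induction k with
  | zero => simp
  | succ k ih => rw [hmul, hf, ih]; push_cast; ring
  | pred k ih =>
    have h := hmul (-(k : ℤ) - 1)
    rw [sub_add_cancel] at h
    rw [h, hf] at ih
    rw [eq_sub_of_add_eq ih]; push_cast; ring

theorem p_zpow_deck (M : LGModel n X X') (k : ℤ) (x : X') : M.p ((M.deck ^ k) x) = M.p x :=
  ((M.fibres x _).2 ⟨k, rfl⟩).symm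

/-- The critical value of the perturbed superpotential to first order in `ε = t ε₀`. The
computation is made in the chart of `X` at the zero of the one-form, transported to the cover by
the local inverse of the projection. -/
theorem isLittleO_pert_vacuum [IsManifold 𝓘(ℂ, Cn n) ω X] [IsManifold 𝓘(ℂ, Cn n) ω X']
    (M : LGModel n X X') {ε₀ : ℂ} {vac : ℤ → ℝ → X'} (hvac : M.IsPerturbedVacua ε₀ vac) (k : ℤ) :
    (fun t : ℝ => M.pert (t * ε₀) (vac k t) -
      (M.W M.base + 2 * Real.pi * Complex.I * k -
        t * ε₀ * ((M.Y M.base + 2 * Real.pi * Complex.I * k) ^ 2 / 2))) =o[𝓝[>] 0]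
      (fun t : ℝ => t) := by
  obtain ⟨hlim, hcrit⟩ := hvac k
  set xk : X' := (M.deck ^ k) M.base with hxk
  have hpx : M.p xk = M.p M.base := M.p_zpow_deck k _
  set x₀ : X := M.p M.base with hx₀
  have hWk : M.W xk = M.W M.base + 2 * Real.pi * Complex.I * k :=
    M.zpow_deck_of_add_const M.W_deck k _
  have hYk : M.Y xk = M.Y M.base + 2 * Real.pi * Complex.I * k :=
    M.zpow_deck_of_add_const M.Y_deck k _
  have hp := M.holomorphic_p xk
  set q := hp.localInverse with hq
  set φ := extChartAt 𝓘(ℂ, Cn n) x₀ with hφ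
  set c₀ : Cn n := φ x₀ with hc₀
  set σ : Cn n → X' := fun c => q (φ.symm c) with hσ
  have hφc₀ : φ.symm c₀ = x₀ := extChartAt_to_inv x₀
  have hqx₀ : q x₀ = xk := by
    rw [← hpx]; exact hp.localInverse_left_inv hp.localInverse_mem_target
  have hσ0 : σ c₀ = xk := by rw [hσ]; simp only; rw [hφc₀, hqx₀]
  have htarget : ∀ᶠ c in 𝓝 c₀, c ∈ φ.target := extChartAt_target_mem_nhds x₀
  have hsymm : ∀ c ∈ φ.target, MDifferentiableAt 𝓘(ℂ, Cn n) 𝓘(ℂ, Cn n) φ.symm c := fun c hc =>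
    (((contMDiffOn_extChartAt_symm (I := 𝓘(ℂ, Cn n)) (n := ω) x₀).contMDiffAt
      ((isOpen_extChartAt_target x₀).mem_nhds hc))).mdifferentiableAt (by simp)
  have hsymmcont : ContinuousAt φ.symm c₀ := (hsymm c₀ htarget.self_of_nhds).continuousAt
  have hqsource : ∀ᶠ c in 𝓝 c₀, φ.symm c ∈ q.source := by
    refine hsymmcont.eventually (q.open_source.mem_nhds ?_)
    rw [hφc₀, ← hpx]; exact hp.localInverse_mem_source
  have hqd : ∀ x ∈ q.source, MDifferentiableAt 𝓘(ℂ, Cn n) 𝓘(ℂ, Cn n) q x := fun x hx =>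
    q.mdifferentiableAt (by simp) hx
  have hσd : ∀ c ∈ φ.target, φ.symm c ∈ q.source →
      MDifferentiableAt 𝓘(ℂ, Cn n) 𝓘(ℂ, Cn n) σ c := fun c hc hc' =>
    (hqd _ hc').comp c (hsymm c hc)
  have hpσ : ∀ c, φ.symm c ∈ q.source → M.p (σ c) = φ.symm c := fun c hc =>
    hp.localInverse_right_inv hc
  have hgood : ∀ᶠ c in 𝓝 c₀, ∀ᶠ c' in 𝓝 c, c' ∈ φ.target ∧ φ.symm c' ∈ q.source :=
    (htarget.and hqsource).eventually_nhds
  -- the local expressions of the functions and of the one-form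
  have hA : ∀ᶠ c in 𝓝 c₀, HasFDerivAt (fun c => M.W (σ c)) (formInChart M.α x₀ c) c := by
    filter_upwards [hgood] with c hc
    obtain ⟨h1, h2⟩ := hc.self_of_nhds
    have hW := (M.holomorphic_W (σ c)).hasMFDerivAt.comp c (hσd c h1 h2).hasMFDerivAt
    have hpd : MDifferentiableAt 𝓘(ℂ, Cn n) 𝓘(ℂ, Cn n) M.p (σ c) :=
      M.holomorphic_p.mdifferentiable (by simp) _
    have hchain : mfderiv 𝓘(ℂ, Cn n) 𝓘(ℂ, Cn n) φ.symm c =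
        (mfderiv 𝓘(ℂ, Cn n) 𝓘(ℂ, Cn n) M.p (σ c)).comp
          (mfderiv 𝓘(ℂ, Cn n) 𝓘(ℂ, Cn n) σ c) := by
      rw [← mfderiv_comp c hpd (hσd c h1 h2)]
      refine Filter.EventuallyEq.mfderiv_eq ?_
      filter_upwards [hc] with c' hc'
      exact (hpσ c' hc'.2).symm
    have := hW.hasFDerivAt
    rw [M.dW] at this
    have key : ∀ y : X, y = φ.symm c → ∀ T : Cn n →L[ℂ] Cn n,
        (show Cn n →L[ℂ] ℂ from M.α y).comp T =
          (show Cn n →L[ℂ] ℂ from M.α (φ.symm c)).comp T := by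
      rintro _ rfl T; rfl
    have e : formInChart M.α x₀ c = ((M.α (M.p (σ c))).comp
        (mfderiv 𝓘(ℂ, Cn n) 𝓘(ℂ, Cn n) M.p (σ c))).comp (mfderiv 𝓘(ℂ, Cn n) 𝓘(ℂ, Cn n) σ c) := by
      have h3 := key _ (hpσ c h2) (mfderiv 𝓘(ℂ, Cn n) 𝓘(ℂ, Cn n) φ.symm c)
      refine Eq.trans h3.symm ?_
      rw [hchain]
      rfl
    rw [e]
    exact this
  have hY : ∀ᶠ c in 𝓝 c₀, DifferentiableAt ℂ (fun c => M.Y (σ c)) c := by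
    filter_upwards [hgood] with c hc
    obtain ⟨h1, h2⟩ := hc.self_of_nhds
    have := (M.holomorphic_Y (σ c)).hasMFDerivAt.comp c (hσd c h1 h2).hasMFDerivAt
    exact this.hasFDerivAt.differentiableAt
  have hσcont : ContinuousAt σ c₀ :=
    (hσd c₀ htarget.self_of_nhds hqsource.self_of_nhds).continuousAt
  -- the coordinates of the perturbed vacuum
  set c : ℝ → Cn n := fun t => φ (M.p (vac k t)) with hcdef
  have hplim : Tendsto (fun t => M.p (vac k t)) (𝓝[>] 0) (𝓝 x₀) := by
    rw [← hpx]
    exact (M.isCovering.continuous.tendsto xk).comp hlim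
  have hc : Tendsto c (𝓝[>] 0) (𝓝 c₀) := ((continuousAt_extChartAt x₀).tendsto).comp hplim
  have hσc : ∀ᶠ t in 𝓝[>] 0, σ (c t) = vac k t := by
    filter_upwards [hplim.eventually (extChartAt_source_mem_nhds (I := 𝓘(ℂ, Cn n)) x₀),
      hlim.eventually (q.open_target.mem_nhds hp.localInverse_mem_target)] with t h1 h2
    simp only [hσ, hcdef]
    rw [φ.left_inv h1]
    exact hp.localInverse_left_inv h2
  have hAcrit : ∀ᶠ t : ℝ in 𝓝[>] 0, formInChart M.α x₀ (c t) =
      (t * ε₀ * M.Y (σ (c t))) • fderiv ℂ (fun c => M.Y (σ c)) (c t) := by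
    filter_upwards [hcrit, hσc, hc.eventually hA, hc.eventually hY, hc.eventually htarget,
      hc.eventually hqsource] with t h1 h2 h3 h4 h5 h6
    have hd : MDifferentiableAt 𝓘(ℂ, Cn n) 𝓘(ℂ) (M.pert (t * ε₀)) (σ (c t)) := by
      have hYd := M.holomorphic_Y (σ (c t))
      have hWd := M.holomorphic_W (σ (c t))
      have h7 : MDifferentiableAt 𝓘(ℂ, Cn n) 𝓘(ℂ) (fun x => (t * ε₀ / 2) • (M.Y x * M.Y x))
          (σ (c t)) := (hYd.mul hYd).const_smul (t * ε₀ / 2 : ℂ)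
      have h8 := hWd.sub h7
      refine h8.congr_of_eventuallyEq (Eventually.of_forall fun x => ?_)
      simp only [pert, Pi.sub_apply, smul_eq_mul]
      ring
    have h7 := (hd.hasMFDerivAt.comp (c t) (hσd _ h5 h6).hasMFDerivAt).hasFDerivAt
    rw [h2, h1] at h7
    have h8 := (h3.sub ((h4.hasFDerivAt.pow 2).const_mul (t * ε₀ / 2 : ℂ))).congr_of_eventuallyEq
      (f₁ := M.pert (t * ε₀) ∘ σ) (Eventually.of_forall fun x => by
        simp only [pert, Function.comp_apply, Pi.sub_apply]; ring)
    have h9 := h8.unique (f₁' := 0) (by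
      refine h7.congr_fderiv ?_
      exact ContinuousLinearMap.zero_comp _)
    rw [sub_eq_zero] at h9
    rw [h9]
    ext v
    simp
    ring
  have hdA : DifferentiableAt ℂ (formInChart M.α x₀) c₀ :=
    ((M.closed x₀).1 c₀ htarget.self_of_nhds).differentiableAt htarget
  have hA0 : formInChart M.α x₀ c₀ = 0 := by
    have h1 : M.α x₀ = 0 := (M.morse.1 _).2 rfl
    have : ∀ y : X, y = x₀ → ∀ T : Cn n →L[ℂ] Cn n,
        (show Cn n →L[ℂ] ℂ from M.α y).comp T = 0 := by
      rintro _ rfl T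
      rw [h1]
      exact ContinuousLinearMap.zero_comp _
    exact this _ hφc₀ _
  have hmain := isLittleO_critical_value hA.self_of_nhds hY hdA hA0 M.morse.2 hc hAcrit
  have hYlim : Tendsto (fun t => M.Y (vac k t)) (𝓝[>] 0) (𝓝 (M.Y xk)) :=
    ((M.holomorphic_Y xk).continuousAt.tendsto).comp hlim
  have hrest : (fun t : ℝ => t * ε₀ * ((M.Y xk ^ 2 - M.Y (vac k t) ^ 2) / 2)) =o[𝓝[>] 0]
      (fun t : ℝ => t) := by
    have h1 : (fun t => ε₀ * ((M.Y xk ^ 2 - M.Y (vac k t) ^ 2) / 2)) =o[𝓝[>] 0]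
        (fun _ => (1 : ℝ)) := by
      rw [Asymptotics.isLittleO_one_iff]
      have := (((hYlim.pow 2).const_sub (M.Y xk ^ 2)).div_const 2).const_mul ε₀
      simpa using this
    have h2 : (fun t : ℝ => (t : ℂ)) =O[𝓝[>] 0] (fun t : ℝ => t) :=
      Asymptotics.isBigO_of_le _ fun t => by simp
    simpa [mul_assoc] using h2.mul_isLittleO h1
  refine (hmain.add hrest).congr' ?_ EventuallyEq.rfl
  filter_upwards [hσc] with t ht
  rw [ht, hσ0, pert, hWk, hYk]
  ring

end LGModel

theorem LGModel.isAsymptoticallyParabolic_weight {n : ℕ} {X : Type v} {X' : Type u}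
    [TopologicalSpace X] [ChartedSpace (Cn n) X]
    [TopologicalSpace X'] [ChartedSpace (Cn n) X']
    [IsManifold 𝓘(ℂ, Cn n) ω X] [IsManifold 𝓘(ℂ, Cn n) ω X']
    (M : LGModel n X X') {ε₀ : ℂ} (hε₀ : 0 < ε₀.re) {vac : ℤ → ℝ → X'}
    (hvac : M.IsPerturbedVacua ε₀ vac) : IsAsymptoticallyParabolic (M.weight ε₀ vac) := by
  refine isAsymptoticallyParabolic_of_isLittleO hε₀ (W₀ := M.W M.base) (Y₀ := M.Y M.base)
    fun k => ?_
  refine ((M.isLittleO_pert_vacuum hvac k).const_mul_left Complex.I).congr_left fun t => ?_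
  rw [weight]
  ring

/-! ### Paths of solitons -/

section Paths

variable {S : Spectrum.{u}}

/-- The soliton `s` lowers the vacuum; for weights in parabolic position its edge points to the
right. -/
def Spectrum.IsDown (S : Spectrum.{u}) (s : S.Gen) : Prop := S.tgt s < S.src s

/-- The soliton `s` raises the vacuum; for weights in parabolic position its edge points to the
left. -/
def Spectrum.IsUp (S : Spectrum.{u}) (s : S.Gen) : Prop := S.src s < S.tgt s

theorem Spectrum.not_isDown {s : S.Gen} : ¬ S.IsDown s ↔ S.IsUp s := by
  have := S.src_ne_tgt s
  unfold Spectrum.IsDown Spectrum.IsUp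
  omega

theorem Spectrum.not_isUp {s : S.Gen} : ¬ S.IsUp s ↔ S.IsDown s := by
  rw [← Spectrum.not_isDown, not_not]

@[simp]
theorem Spectrum.isDown_bar {s : S.Gen} : S.IsDown (S.bar s) ↔ S.IsUp s := by
  rw [Spectrum.IsDown, Spectrum.IsUp, S.src_bar, S.tgt_bar]

@[simp]
theorem Spectrum.isUp_bar {s : S.Gen} : S.IsUp (S.bar s) ↔ S.IsDown s := by
  rw [Spectrum.IsDown, Spectrum.IsUp, S.src_bar, S.tgt_bar]

@[simp]
theorem Spectrum.dir_bar (z : ℤ → ℂ) (s : S.Gen) : S.dir z (S.bar s) = -S.dir z s := by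
  rw [Spectrum.dir, Spectrum.dir, S.src_bar, S.tgt_bar]; ring

/-- The solitons `L` form a composable word from the vacuum `k` to the vacuum `l`. -/
def IsPath : ℤ → ℤ → List S.Gen → Prop
  | k, l, [] => k = l
  | k, l, s :: L => S.src s = k ∧ IsPath (S.tgt s) l L

@[simp]
theorem isPath_nil {k l : ℤ} : IsPath (S := S) k l [] ↔ k = l := Iff.rfl

@[simp]
theorem isPath_cons {k l : ℤ} {s : S.Gen} {L : List S.Gen} :
    IsPath k l (s :: L) ↔ S.src s = k ∧ IsPath (S.tgt s) l L := Iff.rfl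

theorem isPath_append {k l : ℤ} {L L' : List S.Gen} :
    IsPath k l (L ++ L') ↔ ∃ m, IsPath k m L ∧ IsPath m l L' := by
  induction L generalizing k with
  | nil => simp
  | cons s L ih => simp [ih, and_assoc]

theorem isPath_iff_map {k l : ℤ} {L : List S.Gen} :
    IsPath k l L ↔ k :: L.map S.tgt = L.map S.src ++ [l] := by
  induction L generalizing k with
  | nil => simp
  | cons s L ih => simp [ih, eq_comm]

theorem IsPath.end_unique {k l l' : ℤ} {L : List S.Gen} (h : IsPath k l L) (h' : IsPath k l' L) :
    l = l' := by
  induction L generalizing k with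
  | nil => exact h.symm.trans h'
  | cons s L ih => exact ih h.2 h'.2

theorem IsPath.start_unique {k k' l : ℤ} {L : List S.Gen} (h : IsPath k l L) (h' : IsPath k' l L) :
    k = k' := by
  cases L with
  | nil => exact h.trans h'.symm
  | cons s L => exact h.1.symm.trans h'.1

theorem Word.final_cons (k : ℤ) (s : S.Gen) (L : List S.Gen) :
    (⟨k, s :: L⟩ : Word S).final = (⟨S.tgt s, L⟩ : Word S).final := by
  cases L with
  | nil => simp [Word.final]
  | cons a L =>
    simp only [Word.final, List.getLast?_cons_cons]
    rw [List.getLast?_eq_some_getLast (List.cons_ne_nil a L)]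
    rfl

theorem IsPath.final_eq {k l : ℤ} {L : List S.Gen} (h : IsPath k l L) :
    (⟨k, L⟩ : Word S).final = l := by
  induction L generalizing k with
  | nil => exact h
  | cons s L ih => rw [Word.final_cons]; exact ih h.2

theorem Word.composable_iff {w : Word S} :
    w.Composable ↔ IsPath w.start w.final w.letters := by
  obtain ⟨k, L⟩ := w
  induction L generalizing k with
  | nil => simp [Word.Composable, Word.vacua, Word.final]
  | cons s L ih =>
    rw [Word.final_cons]
    have h := ih (S.tgt s)
    simp only [Word.Composable, Word.vacua, List.map_cons, List.dropLast_cons_cons] at h ⊢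
    rw [List.cons.injEq, h]
    rfl

theorem IsPath.le_of_isUp {k l : ℤ} {L : List S.Gen} (h : IsPath k l L)
    (hup : ∀ s ∈ L, S.IsUp s) : k ≤ l := by
  induction L generalizing k with
  | nil => exact le_of_eq h
  | cons s L ih =>
    have h1 : S.src s < S.tgt s := hup s (by simp)
    have h2 := ih h.2 fun a ha => hup a (by simp [ha])
    have := h.1
    omega

theorem IsPath.lt_of_isUp {k l : ℤ} {L : List S.Gen} (h : IsPath k l L)
    (hup : ∀ s ∈ L, S.IsUp s) (hL : L ≠ []) : k < l := by
  cases L with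
  | nil => exact absurd rfl hL
  | cons s L =>
    have h1 : S.src s < S.tgt s := hup s (by simp)
    have h2 := h.2.le_of_isUp fun a ha => hup a (by simp [ha])
    have := h.1
    omega

theorem IsPath.bounds_of_isUp {k l : ℤ} {L : List S.Gen} (h : IsPath k l L)
    (hup : ∀ s ∈ L, S.IsUp s) : ∀ s ∈ L, k ≤ S.src s ∧ S.tgt s ≤ l := by
  induction L generalizing k with
  | nil => simp
  | cons s L ih =>
    have h1 : S.src s < S.tgt s := hup s (by simp)
    have hup' : ∀ a ∈ L, S.IsUp a := fun a ha => hup a (by simp [ha])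
    have h2 := h.2.le_of_isUp hup'
    have h3 := h.1
    intro a ha
    rcases List.mem_cons.1 ha with rfl | ha
    · exact ⟨h3.ge, h2⟩
    · have := ih h.2 hup' a ha
      exact ⟨by omega, this.2⟩

theorem IsPath.pairwise_of_isUp {k l : ℤ} {L : List S.Gen} (h : IsPath k l L)
    (hup : ∀ s ∈ L, S.IsUp s) : L.Pairwise fun a b => S.tgt a ≤ S.src b := by
  induction L generalizing k with
  | nil => simp
  | cons s L ih =>
    have hup' : ∀ a ∈ L, S.IsUp a := fun a ha => hup a (by simp [ha])
    exact List.pairwise_cons.2 ⟨fun b hb => (h.2.bounds_of_isUp hup' b hb).1, ih h.2 hup'⟩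

theorem IsPath.pairwise_tgt_of_isUp {k l : ℤ} {L : List S.Gen} (h : IsPath k l L)
    (hup : ∀ s ∈ L, S.IsUp s) : L.Pairwise fun a b => S.tgt a < S.tgt b :=
  (h.pairwise_of_isUp hup).imp_of_mem fun {_ b} _ hb hab => lt_of_le_of_lt hab (hup b hb)

/-- All vacua met by the solitons in `L` belong to `F`. -/
def SupportedOn (F : Set ℤ) (L : List S.Gen) : Prop := ∀ s ∈ L, S.src s ∈ F ∧ S.tgt s ∈ F

theorem SupportedOn.of_subset {F : Set ℤ} {L L' : List S.Gen} (h : SupportedOn F L)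
    (hL : L' ⊆ L) : SupportedOn F L' := fun s hs => h s (hL hs)

theorem exists_supportedOn (L : List S.Gen) : ∃ F : Set ℤ, F.Finite ∧ SupportedOn F L :=
  ⟨{k | k ∈ L.map S.src ++ L.map S.tgt}, List.finite_toSet _, fun s hs => by
    simp only [Set.mem_ofPred_eq, List.mem_append, List.mem_map]
    exact ⟨Or.inl ⟨s, hs, rfl⟩, Or.inr ⟨s, hs, rfl⟩⟩⟩

end Paths

/-! ### Fans of vacua in parabolic position -/

section Fans

variable {S : Spectrum.{u}} {F : Set ℤ} {z : ℤ → ℂ}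

theorem IsParabolicOn.re_dir_neg (hz : IsParabolicOn F z) {s : S.Gen} (hs : SupportedOn F [s])
    (h : S.IsUp s) : (S.dir z s).re < 0 := by
  have := hs s (by simp)
  simpa [Spectrum.dir] using hz.re_lt _ this.1 _ this.2 h

theorem IsParabolicOn.re_dir_pos (hz : IsParabolicOn F z) {s : S.Gen} (hs : SupportedOn F [s])
    (h : S.IsDown s) : 0 < (S.dir z s).re := by
  have := hs s (by simp)
  simpa [Spectrum.dir] using hz.re_lt _ this.2 _ this.1 h

theorem IsParabolicOn.re_dir_neg_iff (hz : IsParabolicOn F z) {s : S.Gen}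
    (hs : SupportedOn F [s]) : (S.dir z s).re < 0 ↔ S.IsUp s := by
  refine ⟨fun h => ?_, hz.re_dir_neg hs⟩
  by_contra hn
  exact lt_asymm h (hz.re_dir_pos hs (Spectrum.not_isUp.1 hn))

theorem IsParabolicOn.re_dir_pos_iff (hz : IsParabolicOn F z) {s : S.Gen}
    (hs : SupportedOn F [s]) : 0 < (S.dir z s).re ↔ S.IsDown s := by
  refine ⟨fun h => ?_, hz.re_dir_pos hs⟩
  by_contra hn
  exact lt_asymm h (hz.re_dir_neg hs (Spectrum.not_isDown.1 hn))

theorem IsParabolicOn.dir_ne_zero (hz : IsParabolicOn F z) {s : S.Gen}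
    (hs : SupportedOn F [s]) : S.dir z s ≠ 0 := by
  intro h
  by_cases hd : S.IsDown s
  · have := hz.re_dir_pos hs hd
    simp [h] at this
  · have := hz.re_dir_neg hs (Spectrum.not_isDown.1 hd)
    simp [h] at this

/-- Consecutive rising edges turn clockwise. -/
theorem IsParabolicOn.cross_neg (hz : IsParabolicOn F z) {a b : S.Gen}
    (hs : SupportedOn F [a, b]) (ha : S.IsUp a) (hb : S.IsUp b) (hab : S.tgt a ≤ S.src b) :
    (conj (S.dir z a) * S.dir z b).im < 0 := by
  have h1 := hs a (by simp)
  have h2 := hs b (by simp)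
  refine hz.cross _ h1.1 _ h1.2 _ h2.1 _ h2.2 ha hb ?_
  unfold Spectrum.IsUp at ha hb
  omega

/-- Consecutive falling edges turn counterclockwise. -/
theorem IsParabolicOn.cross_pos (hz : IsParabolicOn F z) {a b : S.Gen}
    (hs : SupportedOn F [a, b]) (ha : S.IsDown a) (hb : S.IsDown b) (hab : S.src b ≤ S.tgt a) :
    0 < (conj (S.dir z a) * S.dir z b).im := by
  have h1 := hs a (by simp)
  have h2 := hs b (by simp)
  have := hz.cross_neg (a := S.bar b) (b := S.bar a)
    (by
      intro s hs
      simp only [List.mem_cons, List.not_mem_nil, or_false] at hs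
      rcases hs with rfl | rfl <;> simp [S.src_bar, S.tgt_bar, h1, h2])
    (by simpa using hb) (by simpa using ha) (by rw [S.tgt_bar, S.src_bar]; exact hab)
  rw [S.dir_bar, S.dir_bar] at this
  simp only [map_neg, neg_mul, mul_neg, neg_neg, Complex.mul_im, Complex.conj_re,
    Complex.conj_im] at this ⊢
  linarith

theorem im_conj_mul_polar (r r' α β : ℝ) :
    (conj ((r : ℂ) * Complex.exp (α * Complex.I)) * ((r' : ℂ) * Complex.exp (β * Complex.I))).im =
      r * r' * Real.sin (β - α) := by
  rw [Real.sin_sub]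
  simp only [Complex.exp_mul_I, Complex.mul_im, Complex.conj_re, Complex.conj_im, Complex.mul_re,
    Complex.ofReal_re, Complex.ofReal_im, Complex.add_re, Complex.add_im, Complex.I_re,
    Complex.I_im, ← Complex.ofReal_cos, ← Complex.ofReal_sin]
  ring

theorem re_polar (r α : ℝ) : ((r : ℂ) * Complex.exp (α * Complex.I)).re = r * Real.cos α := by
  simp only [Complex.exp_mul_I, Complex.mul_re, Complex.mul_im,
    Complex.ofReal_re, Complex.ofReal_im, Complex.add_re, Complex.add_im, Complex.I_re,
    Complex.I_im, ← Complex.ofReal_cos, ← Complex.ofReal_sin]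
  ring

theorem arg_lt_arg_of_cross_neg {a b : ℂ} (ha : 0 < a.re) (hb : 0 < b.re)
    (h : (conj a * b).im < 0) : b.arg < a.arg := by
  have h1 := Complex.abs_arg_lt_pi_div_two_iff.2 (Or.inl ha)
  have h2 := Complex.abs_arg_lt_pi_div_two_iff.2 (Or.inl hb)
  rw [← Complex.norm_mul_exp_arg_mul_I a, ← Complex.norm_mul_exp_arg_mul_I b,
    im_conj_mul_polar] at h
  by_contra hn
  rw [not_lt] at hn
  rw [abs_lt] at h1 h2
  have := Real.sin_nonneg_of_nonneg_of_le_pi (x := b.arg - a.arg) (by linarith) (by linarith)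
  have h3 : 0 ≤ ‖a‖ * ‖b‖ * Real.sin (b.arg - a.arg) := by positivity
  linarith

/-- One direction in the right half-plane, followed by directions in the left half-plane in
clockwise order. -/
theorem cyclicClockwise_cons {d : ℂ} {ds : List ℂ} (hd : 0 < d.re) (hds : ∀ a ∈ ds, a.re < 0)
    (hpair : ds.Pairwise fun a b => (conj a * b).im < 0) : CyclicClockwise (d :: ds) := by
  have h0 := abs_lt.1 (Complex.abs_arg_lt_pi_div_two_iff.2 (Or.inl hd))
  have hi : ∀ i : Fin ds.length, |Complex.arg (-ds.get i)| < Real.pi / 2 := fun i =>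
    Complex.abs_arg_lt_pi_div_two_iff.2 (Or.inl (by
      have := hds _ (List.get_mem ds i)
      simp only [Complex.neg_re]; linarith))
  have hij : ∀ i j : Fin ds.length, i < j → Complex.arg (-ds.get j) < Complex.arg (-ds.get i) := by
    intro i j hlt
    refine arg_lt_arg_of_cross_neg ?_ ?_ ?_
    · have := hds _ (List.get_mem ds i)
      simp only [Complex.neg_re]; linarith
    · have := hds _ (List.get_mem ds j)
      simp only [Complex.neg_re]; linarith
    · have := List.pairwise_iff_get.1 hpair i j hlt
      simpa using this
  have hpi := Real.pi_pos
  refine ⟨Fin.cons (Complex.arg d) fun i : Fin ds.length => Complex.arg (-ds.get i) - Real.pi,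
    ?_, ?_, ?_⟩
  · intro i j hlt
    induction i using Fin.cases with
    | zero =>
      induction j using Fin.cases with
      | zero => exact absurd hlt (lt_irrefl _)
      | succ j =>
        have := abs_lt.1 (hi j)
        simp only [Fin.cons_zero, Fin.cons_succ]
        linarith
    | succ i =>
      induction j using Fin.cases with
      | zero => exact absurd hlt (Fin.not_lt_zero _)
      | succ j =>
        have := hij i j (Fin.succ_lt_succ_iff.1 hlt)
        simp only [Fin.cons_succ]
        linarith
  · intro i j
    induction i using Fin.cases with
    | zero =>
      induction j using Fin.cases with
      | zero => simp only [Fin.cons_zero]; linarith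
      | succ j =>
        have := abs_lt.1 (hi j)
        simp only [Fin.cons_zero, Fin.cons_succ]
        linarith
    | succ i =>
      have h1 := abs_lt.1 (hi i)
      induction j using Fin.cases with
      | zero => simp only [Fin.cons_succ, Fin.cons_zero]; linarith
      | succ j =>
        have := abs_lt.1 (hi j)
        simp only [Fin.cons_succ]
        linarith
  · intro i
    induction i using Fin.cases with
    | zero =>
      refine ⟨‖d‖, norm_pos_iff.2 (by rintro rfl; simp at hd), ?_⟩
      simp only [Fin.cons_zero]
      exact (Complex.norm_mul_exp_arg_mul_I d).symm
    | succ i =>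
      have hne : ds.get i ≠ 0 := by
        intro h
        have := hds _ (List.get_mem ds i)
        rw [h] at this
        simp at this
      refine ⟨‖ds.get i‖, norm_pos_iff.2 hne, ?_⟩
      simp only [Fin.cons_succ]
      have h1 := Complex.norm_mul_exp_arg_mul_I (-ds.get i)
      rw [norm_neg] at h1
      have h2 : Complex.exp (((Complex.arg (-ds.get i) - Real.pi : ℝ) : ℂ) * Complex.I) =
          -Complex.exp ((Complex.arg (-ds.get i) : ℂ) * Complex.I) := by
        push_cast
        rw [sub_mul, Complex.exp_sub, Complex.exp_pi_mul_I]
        ring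
      rw [h2, mul_neg, h1, neg_neg]
      rfl

theorem exists_abs_sub_lt_of_cos_pos {x : ℝ} (hx : 0 < Real.cos x) :
    ∃ n : ℤ, |x - 2 * Real.pi * n| < Real.pi / 2 := by
  have hpi := Real.pi_pos
  refine ⟨round (x / (2 * Real.pi)), ?_⟩
  set n := round (x / (2 * Real.pi))
  have h1 : |x - 2 * Real.pi * n| ≤ Real.pi := by
    have := abs_sub_round (x / (2 * Real.pi))
    have h2 : x - 2 * Real.pi * n = 2 * Real.pi * (x / (2 * Real.pi) - n) := by field_simp
    rw [h2, abs_mul, abs_of_pos (by positivity : 0 < 2 * Real.pi)]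
    nlinarith
  by_contra hn
  rw [not_lt] at hn
  have h3 : Real.cos |x - 2 * Real.pi * n| ≤ 0 :=
    Real.cos_nonpos_of_pi_div_two_le_of_le hn (by linarith)
  rw [Real.cos_abs, mul_comm, Real.cos_sub_int_mul_two_pi] at h3
  linarith

theorem cos_pos_of_abs_sub_lt {x : ℝ} {n : ℤ} (h : |x - 2 * Real.pi * n| < Real.pi / 2) :
    0 < Real.cos x := by
  rw [← Real.cos_sub_int_mul_two_pi x n, mul_comm]
  exact Real.cos_pos_of_mem_Ioo (abs_lt.1 h)

theorem isCyclicWord_iff {l : List S.Gen} :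
    IsCyclicWord l ↔ ∃ r L, l = r :: L ∧ L ≠ [] ∧ IsPath (S.tgt r) (S.src r) L ∧
      ∀ b ∈ L, S.src b < S.src r := by
  cases l with
  | nil => simp [IsCyclicWord]
  | cons r L =>
    have h1 : 2 ≤ (r :: L).length ↔ L ≠ [] := by
      cases L <;> simp
    simp only [IsCyclicWord, h1, List.cons.injEq, isPath_iff_map, List.map_cons,
      List.rotate_cons_succ, List.rotate_zero, List.head?_cons, Option.mem_def,
      Option.some.injEq, List.tail_cons, forall_eq']
    exact ⟨fun h => ⟨r, L, ⟨rfl, rfl⟩, h⟩, by rintro ⟨_, _, ⟨rfl, rfl⟩, h⟩; exact h⟩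

/-- Cyclic fans are the polygons inscribed in the parabola: one falling edge, followed by rising
edges. -/
theorem isCyclicFan_iff (hz : IsParabolicOn F z) {l : List S.Gen} (hl : SupportedOn F l) :
    IsCyclicFan z l ↔ ∃ r L, l = r :: L ∧ L ≠ [] ∧ IsPath (S.tgt r) (S.src r) L ∧
      ∀ b ∈ L, S.IsUp b := by
  have hl1 : ∀ s ∈ l, SupportedOn F [s] := fun s hs => hl.of_subset (by simpa using hs)
  constructor
  · rintro ⟨hw, θ, hanti, hlt, hθ⟩
    obtain ⟨r, L, rfl, hL, hpath, hmax⟩ := isCyclicWord_iff.1 hw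
    refine ⟨r, L, rfl, hL, hpath, ?_⟩
    have hpi := Real.pi_pos
    have hlen : ((r :: L).map (S.dir z)).length = L.length + 1 := by simp
    have hcos : ∀ i (hi : i < (r :: L).length),
        0 < Real.cos (θ ⟨i, by simpa using hi⟩) ↔ S.IsDown (r :: L)[i] := by
      intro i hi
      obtain ⟨ρ, hρ, h⟩ := hθ ⟨i, by simpa using hi⟩
      have h' : S.dir z (r :: L)[i] = ρ * Complex.exp (θ ⟨i, by simpa using hi⟩ * Complex.I) := by
        rw [← h, List.get_eq_getElem, List.getElem_map]
      rw [← hz.re_dir_pos_iff (hl1 _ (List.getElem_mem hi)), h', re_polar]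
      exact (mul_pos_iff_of_pos_left hρ).symm
    have hL0 : 0 < L.length := List.length_pos_iff.2 hL
    have hr : S.IsDown r := by
      obtain ⟨a, L', rfl⟩ := List.exists_cons_of_ne_nil hL
      have h1 := hmax a (by simp)
      have h2 := hpath.1
      unfold Spectrum.IsDown; omega
    -- `r` falls, so its direction points to the right. If a later edge fell as well, its angle
    -- would lie in the same or in the preceding turn, which are the two cases below.
    obtain ⟨n, hn⟩ := exists_abs_sub_lt_of_cos_pos ((hcos 0 (by simp)).2 hr)
    intro b hb
    rw [← Spectrum.not_isDown]
    intro hbd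
    obtain ⟨p, hp, rfl⟩ := List.getElem_of_mem hb
    have hp' : p + 1 < (r :: L).length := by simpa using hp
    obtain ⟨n', hn'⟩ := exists_abs_sub_lt_of_cos_pos ((hcos (p + 1) hp').2 (by simpa using hbd))
    set i0 : Fin ((r :: L).map (S.dir z)).length := ⟨0, by simp⟩ with hi0
    set ip : Fin ((r :: L).map (S.dir z)).length := ⟨p + 1, by simpa using hp⟩ with hip
    have hxy : θ ip < θ i0 := hanti (Fin.mk_lt_mk.2 (Nat.succ_pos p))
    have hxy' := hlt i0 ip
    have hcase : n = n' ∨ n = n' + 1 := by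
      rw [abs_lt] at hn hn'
      have h1 : -(1 : ℝ) < n - n' := by
        by_contra hcon
        rw [not_lt] at hcon
        nlinarith
      have h2 : (n : ℝ) - n' < 2 := by
        by_contra hcon
        rw [not_lt] at hcon
        nlinarith
      have h1' : -1 < n - n' := by exact_mod_cast h1
      have h2' : n - n' < 2 := by exact_mod_cast h2
      omega
    rcases hcase with rfl | rfl
    · -- the second edge would point to the right, clockwise from the first one
      set i1 : Fin ((r :: L).map (S.dir z)).length := ⟨1, by simpa using hL0⟩ with hi1
      have h1 : θ i1 < θ i0 := hanti (Fin.mk_lt_mk.2 Nat.one_pos)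
      have h2 : θ ip ≤ θ i1 := hanti.antitone (by simp [hi1, hip])
      have h3 : 0 < Real.cos (θ i1) := by
        refine cos_pos_of_abs_sub_lt (n := n) ?_
        rw [abs_lt] at *
        constructor <;> linarith [hn.1, hn.2, hn'.1, hn'.2]
      have h4 := (hcos 1 (by simpa using hL0)).1 h3
      obtain ⟨a, L', rfl⟩ := List.exists_cons_of_ne_nil hL
      have h5 := hz.cross_pos (a := r) (b := a) (hl.of_subset (by simp)) hr
        (by simpa using h4) hpath.1.le
      obtain ⟨ρ0, hρ0, e0⟩ := hθ i0
      obtain ⟨ρ1, hρ1, e1⟩ := hθ i1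
      have e0' : S.dir z r = ρ0 * Complex.exp (θ i0 * Complex.I) := by
        rw [← e0]; simp [hi0]
      have e1' : S.dir z a = ρ1 * Complex.exp (θ i1 * Complex.I) := by
        rw [← e1]; simp [hi1]
      rw [e0', e1', im_conj_mul_polar] at h5
      have h6 : Real.sin (θ i1 - θ i0) < 0 := by
        refine Real.sin_neg_of_neg_of_neg_pi_lt (by linarith) ?_
        rw [abs_lt] at *
        linarith [hn.1, hn.2, hn'.1, hn'.2]
      have h7 : ρ0 * ρ1 * Real.sin (θ i1 - θ i0) < 0 :=
        mul_neg_of_pos_of_neg (by positivity) h6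
      linarith
    · -- the last edge would point to the right, but it ends at the largest vacuum
      set il : Fin ((r :: L).map (S.dir z)).length := ⟨L.length, by simp⟩ with hil
      have h1 : θ il ≤ θ ip := hanti.antitone (by simp only [hil, hip, Fin.mk_le_mk]; omega)
      have h2 := hlt i0 il
      have h3 : 0 < Real.cos (θ il) := by
        refine cos_pos_of_abs_sub_lt (n := n') ?_
        push_cast at hn
        rw [abs_lt] at *
        constructor <;> linarith [hn.1, hn.2, hn'.1, hn'.2]
      have h4 := (hcos L.length (by simp)).1 h3
      have h5 : (r :: L)[L.length] = L.getLast hL := by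
        rw [List.getLast_eq_getElem]
        obtain ⟨m, hm⟩ := Nat.exists_eq_add_of_lt hL0
        simp [hm]
      rw [h5] at h4
      have h6 := hmax _ (List.getLast_mem hL)
      have h7 : S.tgt (L.getLast hL) = S.src r := by
        have := isPath_iff_map.1 hpath
        have h8 := congrArg List.getLast? this
        rw [List.getLast?_concat, List.getLast?_cons, List.getLast?_map,
          List.getLast?_eq_some_getLast hL] at h8
        simpa using h8
      unfold Spectrum.IsDown at h4
      omega
  · rintro ⟨r, L, rfl, hL, hpath, hup⟩
    have hr : S.IsDown r := hpath.lt_of_isUp hup hL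
    refine ⟨isCyclicWord_iff.2 ⟨r, L, rfl, hL, hpath, fun b hb => ?_⟩, ?_⟩
    · have h1 := (hpath.bounds_of_isUp hup b hb).2
      have h2 : S.src b < S.tgt b := hup b hb
      omega
    · rw [List.map_cons]
      refine cyclicClockwise_cons (hz.re_dir_pos (hl1 r (by simp)) hr) ?_ ?_
      · simp only [List.mem_map, forall_exists_index, and_imp, forall_apply_eq_imp_iff₂]
        exact fun s hs => hz.re_dir_neg (hl1 s (by simp [hs])) (hup s hs)
      · rw [List.pairwise_map]
        refine (hpath.pairwise_of_isUp hup).imp_of_mem fun {a b} ha hb hab => ?_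
        refine hz.cross_neg (hl.of_subset ?_) (hup a ha) (hup b hb) hab
        simp [ha, hb]

/-- In the right half-plane falling words turn the wrong way, so that fans have at most one
letter. -/
theorem isHalfPlaneFan_right_iff (hz : IsParabolicOn F z) {w : Word S}
    (hw : SupportedOn F w.letters) :
    w.IsHalfPlaneFan z 1 ↔ IsPath w.start w.final w.letters ∧ w.letters.length ≤ 1 ∧
      ∀ s ∈ w.letters, S.IsDown s := by
  have hl1 : ∀ s ∈ w.letters, SupportedOn F [s] := fun s hs => hw.of_subset (by simpa using hs)
  rw [Word.IsHalfPlaneFan, Word.composable_iff]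
  refine and_congr_right fun hpath => ?_
  constructor
  · rintro ⟨hre, hchain⟩
    have hdown : ∀ s ∈ w.letters, S.IsDown s := fun s hs =>
      (hz.re_dir_pos_iff (hl1 s hs)).1 (by simpa using hre _ (List.mem_map_of_mem hs))
    refine ⟨?_, hdown⟩
    by_contra hlen
    obtain ⟨k, L⟩ := w
    rcases L with _ | ⟨a, _ | ⟨b, L⟩⟩
    · simp at hlen
    · simp at hlen
    · simp only [List.map_cons, List.isChain_cons_cons] at hchain
      have := hz.cross_pos (a := a) (b := b) (hw.of_subset (by simp)) (hdown a (by simp))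
        (hdown b (by simp)) hpath.2.1.le
      linarith [hchain.1]
  · rintro ⟨hlen, hdown⟩
    refine ⟨?_, ?_⟩
    · simp only [List.mem_map, forall_exists_index, and_imp, forall_apply_eq_imp_iff₂, map_one,
        one_mul]
      exact fun s hs => hz.re_dir_pos (hl1 s hs) (hdown s hs)
    · obtain ⟨k, L⟩ := w
      rcases L with _ | ⟨a, _ | ⟨b, L⟩⟩
      · simp
      · simp
      · simp at hlen

/-- In the left half-plane all rising words are fans. -/
theorem isHalfPlaneFan_left_iff (hz : IsParabolicOn F z) {w : Word S}
    (hw : SupportedOn F w.letters) :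
    w.IsHalfPlaneFan z (-1) ↔ IsPath w.start w.final w.letters ∧ ∀ s ∈ w.letters, S.IsUp s := by
  have hl1 : ∀ s ∈ w.letters, SupportedOn F [s] := fun s hs => hw.of_subset (by simpa using hs)
  rw [Word.IsHalfPlaneFan, Word.composable_iff]
  refine and_congr_right fun hpath => ?_
  constructor
  · rintro ⟨hre, hchain⟩ s hs
    refine (hz.re_dir_neg_iff (hl1 s hs)).1 ?_
    have := hre _ (List.mem_map_of_mem hs)
    simpa using this
  · intro hup
    refine ⟨?_, ?_⟩
    · simp only [List.mem_map, forall_exists_index, and_imp, forall_apply_eq_imp_iff₂, map_neg,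
        map_one, neg_mul, one_mul, Complex.neg_re, Left.neg_pos_iff]
      exact fun s hs => hz.re_dir_neg (hl1 s hs) (hup s hs)
    · refine List.Pairwise.isChain ?_
      rw [List.pairwise_map]
      refine (hpath.pairwise_of_isUp hup).imp_of_mem fun {a b} ha hb hab => ?_
      refine hz.cross_neg (hw.of_subset ?_) (hup a ha) (hup b hb) hab
      simp [ha, hb]

theorem isStableFan_right_iff {z : ℝ → ℤ → ℂ} (hz : IsAsymptoticallyParabolic z) {w : Word S} :
    w.IsStableFan z 1 ↔ IsPath w.start w.final w.letters ∧ w.letters.length ≤ 1 ∧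
      ∀ s ∈ w.letters, S.IsDown s := by
  obtain ⟨F, hF, hw⟩ := exists_supportedOn w.letters
  constructor
  · intro h
    obtain ⟨t, h1, h2⟩ := (h.and (hz F hF)).exists
    exact (isHalfPlaneFan_right_iff h2 hw).1 h1
  · intro h
    filter_upwards [hz F hF] with t ht
    exact (isHalfPlaneFan_right_iff ht hw).2 h

theorem isStableFan_left_iff {z : ℝ → ℤ → ℂ} (hz : IsAsymptoticallyParabolic z) {w : Word S} :
    w.IsStableFan z (-1) ↔ IsPath w.start w.final w.letters ∧ ∀ s ∈ w.letters, S.IsUp s := by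
  obtain ⟨F, hF, hw⟩ := exists_supportedOn w.letters
  constructor
  · intro h
    obtain ⟨t, h1, h2⟩ := (h.and (hz F hF)).exists
    exact (isHalfPlaneFan_left_iff h2 hw).1 h1
  · intro h
    filter_upwards [hz F hF] with t ht
    exact (isHalfPlaneFan_left_iff ht hw).2 h

end Fans

/-! ### Germs, edges and moduli of webs -/

section WebBasics

variable {S : Spectrum.{u}}

instance Spectrum.decidableIsDown (s : S.Gen) : Decidable (S.IsDown s) :=
  inferInstanceAs (Decidable (S.tgt s < S.src s))

theorem eq_of_perm_of_pairwise_map {l l' : List ℕ} (f : ℕ → ℤ) (h : l.Perm l')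
    (hl : (l.map f).Pairwise (· < ·)) (hl' : (l'.map f).Pairwise (· < ·)) : l = l' := by
  rw [List.pairwise_map] at hl hl'
  exact h.eq_of_pairwise (fun a b _ _ hab hba => absurd hab (not_lt_of_gt hba)) hl hl'

namespace Web

variable (w : Web S)

/-- The lists of solitons at the vertices, boundary vertices first. -/
def vertices : List (List S.Gen) := w.bdry.map Word.letters ++ w.bulk

theorem germs_map_snd : w.germs.map Prod.snd = w.vertices.flatten := by
  rw [germs, List.map_flatten]
  congr 1
  refine List.ext_getElem (by simp [vertices]) fun i h1 h2 => ?_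
  simp [vertices, Function.comp_def]

theorem letter_eq_getElem? (p : ℕ) : w.letter p = (w.vertices.flatten)[p]? := by
  rw [← germs_map_snd, List.getElem?_map, letter]

theorem length_germs : w.germs.length = w.vertices.flatten.length := by
  rw [← germs_map_snd, List.length_map]

theorem exists_vertex {p : ℕ} (hp : p < w.germs.length) :
    ∃ l s, w.vertices[w.owner p]? = some l ∧ s ∈ l ∧ w.letter p = some s := by
  have h1 : w.germs[p] ∈ w.germs := List.getElem_mem hp
  have h2 : w.germs[p] ∈ (w.vertices.mapIdx fun i l => l.map fun s => (i, s)).flatten := h1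
  rw [List.mem_flatten] at h2
  obtain ⟨l', hl', hg⟩ := h2
  rw [List.mem_mapIdx] at hl'
  obtain ⟨i, hi, rfl⟩ := hl'
  rw [List.mem_map] at hg
  obtain ⟨s, hs, he⟩ := hg
  have ho : w.owner p = i := by
    rw [owner, List.getElem?_eq_getElem hp, ← he]; rfl
  refine ⟨w.vertices[i], s, ?_, hs, ?_⟩
  · rw [ho, List.getElem?_eq_getElem hi]
  · rw [letter, List.getElem?_eq_getElem hp, ← he]; rfl

theorem exists_letter {p : ℕ} (hp : p < w.germs.length) : ∃ s, w.letter p = some s := by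
  obtain ⟨l, s, -, -, h⟩ := w.exists_vertex hp
  exact ⟨s, h⟩

theorem letter_mem {p : ℕ} {s : S.Gen} (h : w.letter p = some s) : s ∈ w.vertices.flatten := by
  rw [letter_eq_getElem?] at h
  exact List.mem_of_getElem? h

theorem dir_eq {p : ℕ} {s : S.Gen} (h : w.letter p = some s) (z : ℤ → ℂ) :
    w.dir z p = S.dir z s := by
  rw [dir, h]; rfl

variable {w}

theorem IsGraph.edge_lt_length {z : ℤ → ℂ} (h : w.IsGraph z) {e : ℕ × ℕ} (he : e ∈ w.edges) :
    e.1 < w.germs.length ∧ e.2 < w.germs.length := by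
  constructor
  · refine List.mem_range.1 (h.germs_perm.subset ?_)
    exact List.mem_append_left _ (List.mem_flatMap.2 ⟨e, he, by simp⟩)
  · refine List.mem_range.1 (h.germs_perm.subset ?_)
    exact List.mem_append_left _ (List.mem_flatMap.2 ⟨e, he, by simp⟩)

theorem IsGraph.exists_edge_letter {z : ℤ → ℂ} (h : w.IsGraph z) {e : ℕ × ℕ} (he : e ∈ w.edges) :
    ∃ s, w.letter e.1 = some s ∧ w.letter e.2 = some (S.bar s) := by
  obtain ⟨s, hs⟩ := w.exists_letter (h.edge_lt_length he).1
  exact ⟨s, hs, by rw [h.edge_dual e he, hs]; rfl⟩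

theorem IsGraph.length_germs_eq {z : ℤ → ℂ} (h : w.IsGraph z) :
    w.germs.length = 2 * w.edges.length + w.outs.length := by
  have := h.germs_perm.length_eq
  rw [List.length_range, List.length_append, List.length_flatMap] at this
  rw [← this]
  simp [mul_comm]

/-- Every internal edge has one falling and one rising end. -/
theorem IsGraph.countP_isDown {z : ℤ → ℂ} (h : w.IsGraph z) {o : List S.Gen}
    (ho : w.outs.map w.letter = o.map some) :
    w.edges.length + o.countP (fun s => S.IsDown s) =
      (w.vertices.map (List.countP fun s => S.IsDown s)).sum := by
  set f : ℕ → Bool := fun p => (w.letter p).any fun s => decide (S.IsDown s) with hf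
  have h1 := h.germs_perm.countP_eq f
  rw [List.countP_append] at h1
  have h2 : (w.edges.flatMap fun e => [e.1, e.2]).countP f = w.edges.length := by
    have : ∀ l : List (ℕ × ℕ), l ⊆ w.edges →
        (l.flatMap fun e => [e.1, e.2]).countP f = l.length := by
      intro l
      induction l with
      | nil => simp
      | cons e l ih =>
        intro hl
        rw [List.flatMap_cons, List.countP_append, ih fun x hx => hl (List.mem_cons_of_mem _ hx)]
        obtain ⟨s, h3, h4⟩ := h.exists_edge_letter (hl List.mem_cons_self)
        have h5 : f e.1 = decide (S.IsDown s) := by simp [hf, h3]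
        have h6 : f e.2 = !decide (S.IsDown s) := by
          rw [← Bool.decide_coe (f e.2)]
          simp [hf, h4, ← Spectrum.not_isDown]
        simp only [List.countP_cons, h5, h6, List.length_cons, List.countP_nil]
        by_cases hd : S.IsDown s <;> simp [hd, add_comm]
    exact this _ (List.Subset.refl _)
  have h3 : w.outs.countP f = o.countP (fun s => S.IsDown s) := by
    have : w.outs.countP f = (w.outs.map w.letter).countP
        (fun x : Option S.Gen => x.any fun s => decide (S.IsDown s)) := by
      rw [List.countP_map]; rfl
    rw [this, ho, List.countP_map]
    rfl
  have h4 : (List.range w.germs.length).countP f =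
      (w.vertices.map (List.countP fun s => S.IsDown s)).sum := by
    have : (List.range w.germs.length).map w.letter = w.vertices.flatten.map some := by
      rw [length_germs]
      generalize hL : w.vertices.flatten = L
      refine List.ext_getElem (by simp) fun i h5 h6 => ?_
      have h7 : i < L.length := by simpa using h6
      simp [letter_eq_getElem?, hL, List.getElem?_eq_getElem h7]
    have h8 : (List.range w.germs.length).countP f = ((List.range w.germs.length).map
        w.letter).countP (fun x : Option S.Gen => x.any fun s => decide (S.IsDown s)) := by
      rw [List.countP_map]; rfl
    rw [h8, this, List.countP_map, ← List.countP_flatten]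
    rfl
  rw [h2, h3, h4] at h1
  exact h1

theorem IsDrawing.owner_ne {z : ℤ → ℂ} {τ : ℂ} {ξ : Fin w.dim → ℝ} (h : w.IsDrawing τ z ξ)
    {e : ℕ × ℕ} (he : e ∈ w.edges) (hd : w.dir z e.1 ≠ 0) : w.owner e.1 ≠ w.owner e.2 := by
  intro heq
  obtain ⟨r, hr, h1⟩ := h.slope e he
  rw [heq, sub_self] at h1
  have : (r : ℂ) ≠ 0 := by exact_mod_cast hr.ne'
  exact mul_ne_zero this hd h1.symm

variable (w)

theorem pos_add (τ : ℂ) (ξ η : Fin w.dim → ℝ) (v : ℕ) :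
    w.pos τ (ξ + η) v = w.pos τ ξ v + w.pos τ η v := by
  simp only [pos, Pi.add_apply]
  split_ifs <;> push_cast <;> ring

theorem pos_smul (τ : ℂ) (r : ℝ) (ξ : Fin w.dim → ℝ) (v : ℕ) :
    w.pos τ (r • ξ) v = r * w.pos τ ξ v := by
  simp only [pos, Pi.smul_apply, smul_eq_mul]
  split_ifs <;> push_cast <;> ring

/-- The slope constraint of an edge, as a linear form. -/
def slopeLin (τ : ℂ) (z : ℤ → ℂ) (e : ℕ × ℕ) : (Fin w.dim → ℝ) →ₗ[ℝ] ℝ where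
  toFun := w.slopeForm τ z e
  map_add' ξ η := by
    simp only [slopeForm, pos_add]
    rw [← Complex.add_im]
    congr 1
    ring
  map_smul' r ξ := by
    simp only [slopeForm, pos_smul, RingHom.id_apply, smul_eq_mul]
    rw [← Complex.im_ofReal_mul]
    congr 1
    ring

/-- The space of deformations as the kernel of a linear map. -/
def slopeMap (τ : ℂ) (z : ℤ → ℂ) : (Fin w.dim → ℝ) →ₗ[ℝ] (Fin w.edges.length → ℝ) :=
  LinearMap.pi fun i => w.slopeLin τ z w.edges[i]

theorem moduliDim_eq (τ : ℂ) (z : ℤ → ℂ) :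
    w.moduliDim τ z = Module.finrank ℝ (LinearMap.ker (w.slopeMap τ z)) := by
  have : {ξ : Fin w.dim → ℝ | ∀ e ∈ w.edges, w.slopeForm τ z e ξ = 0} =
      (LinearMap.ker (w.slopeMap τ z) : Set (Fin w.dim → ℝ)) := by
    ext ξ
    simp only [Set.mem_ofPred_eq, SetLike.mem_coe, LinearMap.mem_ker, funext_iff, slopeMap,
      LinearMap.pi_apply, Pi.zero_apply, List.forall_mem_iff_get]
    rfl
  rw [moduliDim, this, Set.finrank, Submodule.span_eq]

theorem dim_le_moduliDim_add (τ : ℂ) (z : ℤ → ℂ) :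
    w.dim ≤ w.moduliDim τ z + w.edges.length := by
  have h1 := LinearMap.finrank_range_add_finrank_ker (w.slopeMap τ z)
  have h2 := Submodule.finrank_le (LinearMap.range (w.slopeMap τ z))
  rw [Module.finrank_fin_fun] at h1 h2
  rw [moduliDim_eq]
  omega

theorem moduliDim_le_dim (τ : ℂ) (z : ℤ → ℂ) : w.moduliDim τ z ≤ w.dim := by
  have h2 := Submodule.finrank_le (LinearMap.ker (w.slopeMap τ z))
  rw [Module.finrank_fin_fun] at h2
  rwa [moduliDim_eq]

/-- If the deformations are determined by `k` coordinates, there are at most `k` of them. -/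
theorem moduliDim_le (τ : ℂ) (z : ℤ → ℂ) {k : ℕ} (f : (Fin w.dim → ℝ) →ₗ[ℝ] (Fin k → ℝ))
    (hf : ∀ ξ, (∀ e ∈ w.edges, w.slopeForm τ z e ξ = 0) → f ξ = 0 → ξ = 0) :
    w.moduliDim τ z ≤ k := by
  rw [moduliDim_eq]
  have h : Function.Injective (f.domRestrict (LinearMap.ker (w.slopeMap τ z))) := by
    rw [← LinearMap.ker_eq_bot, LinearMap.ker_eq_bot']
    rintro ⟨ξ, hξ⟩ h0
    refine Subtype.ext (hf ξ ?_ h0)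
    rw [LinearMap.mem_ker, funext_iff] at hξ
    intro e he
    obtain ⟨i, hi, rfl⟩ := List.getElem_of_mem he
    exact hξ ⟨i, hi⟩
  have := LinearMap.finrank_le_finrank_of_injective h
  rwa [Module.finrank_fin_fun] at this

end Web

end WebBasics

/-! ### Webs without bulk vertices -/

section Pairs

variable {S : Spectrum.{u}}

theorem cross_eq (a b : ℂ) : (conj a * b).im = a.re * b.im - a.im * b.re := by
  simp [Complex.mul_im]; ring

namespace Web

variable {w : Web S}

theorem IsGraph.sum_countP_bulk {F : Set ℤ} {z : ℤ → ℂ} (hz : IsParabolicOn F z)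
    (hF : SupportedOn F w.vertices.flatten) (h : w.IsGraph z) :
    (w.bulk.map (List.countP fun s => S.IsDown s)).sum = w.bulk.length := by
  have hb : ∀ b ∈ w.bulk, b.countP (fun s => S.IsDown s) = 1 := by
    intro b hb
    have hsub : b ⊆ w.vertices.flatten := fun s hs =>
      List.mem_flatten.2 ⟨b, List.mem_append_right _ hb, hs⟩
    obtain ⟨r, L, rfl, hL, hpath, hup⟩ :=
      (isCyclicFan_iff hz (hF.of_subset hsub)).1 (h.bulk_fan b hb)
    have hr : S.IsDown r := hpath.lt_of_isUp hup hL
    rw [List.countP_cons]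
    simp only [hr, decide_true, if_true]
    rw [List.countP_eq_zero.2]
    intro a ha
    simpa [Spectrum.not_isDown] using hup a ha
  rw [List.map_congr_left hb]
  simp

theorem owner_of_vertices_eq {A B : List S.Gen} (h : w.vertices = [A, B]) {p : ℕ}
    (hp : p < A.length + B.length) : w.owner p = if p < A.length then 0 else 1 := by
  have hg : w.germs = A.map (fun s => (0, s)) ++ B.map (fun s => (1, s)) := by
    rw [germs, ← vertices, h]; simp
  rw [owner, hg]
  split_ifs with h1
  · rw [List.getElem?_append_left (by simpa using h1), List.getElem?_map,
      List.getElem?_eq_getElem h1]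
    rfl
  · have h2 : p - A.length < B.length := by omega
    rw [List.getElem?_append_right (by simpa using h1), List.length_map, List.getElem?_map,
      List.getElem?_eq_getElem h2]
    rfl

theorem stableSign_eq_one {τ : ℂ} {ds : List ℂ} {z : ℝ → ℤ → ℂ}
    {P : ℝ → (Fin w.dim → ℝ) → Prop}
    (h : ∀ᶠ t : ℝ in 𝓝[>] 0, ∀ ξ, P t ξ → w.orientation τ ds (z t) ξ = 1) :
    w.stableSign τ ds z P = 1 := by
  rw [stableSign, if_pos h]

theorem stableSign_eq_neg_one {τ : ℂ} {ds : List ℂ} {z : ℝ → ℤ → ℂ}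
    {P : ℝ → (Fin w.dim → ℝ) → Prop} (hex : ∀ᶠ t : ℝ in 𝓝[>] 0, ∃ ξ, P t ξ)
    (h : ∀ᶠ t : ℝ in 𝓝[>] 0, ∀ ξ, P t ξ → w.orientation τ ds (z t) ξ = -1) :
    w.stableSign τ ds z P = -1 := by
  rw [stableSign, if_neg, if_pos h]
  intro h'
  obtain ⟨t, ⟨ξ, h1⟩, h2, h3⟩ := (hex.and (h.and h')).exists
  have := (h2 ξ h1).symm.trans (h3 ξ h1)
  norm_num at this

end Web

theorem koszul_of_pairwise (d : ℕ → ℤ) {l : List ℕ} (h : l.Pairwise (· < ·)) : koszul d l = 1 := by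
  induction l with
  | nil => rfl
  | cons a l ih =>
    rw [List.pairwise_cons] at h
    rw [koszul, ih h.2, mul_one]
    refine List.prod_eq_one ?_
    simp only [List.mem_map]
    rintro _ ⟨b, hb, rfl⟩
    rw [if_neg (not_lt_of_gt (h.1 b hb))]

/-- The web consisting of two boundary vertices and of the rays emanating from them. -/
def pairWeb (w₁ w₂ : Word S) : Web S :=
  ⟨[w₁, w₂], [], [], List.range (w₁.letters.length + w₂.letters.length)⟩

theorem vertices_pairWeb (w₁ w₂ : Word S) :
    (pairWeb w₁ w₂).vertices = [w₁.letters, w₂.letters] := rfl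

theorem length_germs_pairWeb (w₁ w₂ : Word S) :
    (pairWeb w₁ w₂).germs.length = w₁.letters.length + w₂.letters.length := by
  rw [Web.length_germs, vertices_pairWeb]; simp

theorem letter_pairWeb (w₁ w₂ : Word S) (p : ℕ) :
    (pairWeb w₁ w₂).letter p = (w₁.letters ++ w₂.letters)[p]? := by
  rw [Web.letter_eq_getElem?, vertices_pairWeb]; simp

theorem map_letter_range {A : List S.Gen} {w : Web S} (hA : w.vertices.flatten = A) {n : ℕ}
    (hn : n = A.length) : (List.range n).map w.letter = A.map some := by
  subst hn
  refine List.ext_getElem (by simp) fun i h1 h2 => ?_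
  have h3 : i < A.length := by simpa using h2
  simp [Web.letter_eq_getElem?, hA, List.getElem?_eq_getElem h3]

theorem pos_pairWeb_zero (w₁ w₂ : Word S) (τ : ℂ) (ξ : Fin 2 → ℝ) :
    (pairWeb w₁ w₂).pos τ ξ 0 = ξ 0 * τ := rfl

theorem pos_pairWeb_one (w₁ w₂ : Word S) (τ : ℂ) (ξ : Fin 2 → ℝ) :
    (pairWeb w₁ w₂).pos τ ξ 1 = ξ 1 * τ := rfl

/-- A taut half-plane web without bulk vertices is a pair of boundary vertices: dilations and
translations are the only motions of two points on a line. -/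
theorem Web.IsHalfPlaneWeb.eq_pairWeb {w : Web S} {ν : ℂ} {z : ℤ → ℂ} {ws : List (Word S)}
    {o : Word S} {ξ : Fin w.dim → ℝ} (h : w.IsHalfPlaneWeb ν z ws o ξ) (hbulk : w.bulk = [])
    {τ : ℂ} (hm : w.moduliDim τ z = 2)
    (hsort : (ws.flatMap Word.letters).Pairwise fun a b => S.tgt a < S.tgt b)
    (hosort : o.letters.Pairwise fun a b => S.tgt a < S.tgt b) :
    ∃ w₁ w₂, ws = [w₁, w₂] ∧ w = pairWeb w₁ w₂ ∧ o.letters = w₁.letters ++ w₂.letters := by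
  have hv : w.vertices.flatten = ws.flatMap Word.letters := by
    rw [Web.vertices, hbulk, List.append_nil, h.bdry_eq, List.flatMap]
  -- the ends of an edge would point in opposite directions
  have hedges : w.edges = [] := by
    rw [List.eq_nil_iff_forall_not_mem]
    intro e he
    obtain ⟨s, h1, h2⟩ := h.graph.exists_edge_letter he
    have hpos : ∀ {p : ℕ} {s : S.Gen}, w.letter p = some s → 0 < (conj ν * S.dir z s).re := by
      intro p s hs
      have := w.letter_mem hs
      rw [hv, List.mem_flatMap] at this
      obtain ⟨b, hb, hsb⟩ := this
      exact (h.bdry_fan b hb).2.1 _ (List.mem_map_of_mem hsb)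
    have h3 := hpos h1
    have h4 := hpos h2
    rw [S.dir_bar, mul_neg, Complex.neg_re] at h4
    linarith
  have hdim : w.dim = 2 := by
    have h1 := w.dim_le_moduliDim_add τ z
    have h2 := w.moduliDim_le_dim τ z
    rw [hedges, List.length_nil] at h1
    omega
  rw [Web.dim, hbulk, List.length_nil, h.bdry_eq] at hdim
  obtain ⟨w₁, w₂, rfl⟩ := List.length_eq_two.1 (by omega : ws.length = 2)
  have hv' : w.vertices.flatten = w₁.letters ++ w₂.letters := by rw [hv]; simp
  have hlen : w.germs.length = w₁.letters.length + w₂.letters.length := by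
    rw [Web.length_germs, hv', List.length_append]
  have hperm := h.graph.germs_perm
  rw [hedges, List.flatMap_nil, List.nil_append] at hperm
  have hkey : ∀ {l : List ℕ} {L : List S.Gen}, l.map w.letter = L.map some →
      L.Pairwise (fun a b => S.tgt a < S.tgt b) →
      (l.map fun p => (w.letter p).elim 0 S.tgt).Pairwise (· < ·) := by
    intro l L hl hL
    have : (l.map fun p => (w.letter p).elim 0 S.tgt) = L.map S.tgt := by
      have := congrArg (List.map fun x : Option S.Gen => x.elim 0 S.tgt) hl
      simpa [List.map_map, Function.comp_def] using this
    rw [this, List.pairwise_map]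
    exact hL
  have hrange := map_letter_range hv' (by rw [hlen, List.length_append] : w.germs.length = _)
  have houts : w.outs = List.range w.germs.length := by
    refine eq_of_perm_of_pairwise_map _ hperm (hkey h.infinity hosort) (hkey hrange ?_)
    simpa using hsort
  refine ⟨w₁, w₂, rfl, ?_, ?_⟩
  · obtain ⟨bdry, bulk, edges, outs⟩ := w
    simp only at hbulk hedges houts
    have := h.bdry_eq
    simp only at this
    rw [hlen] at houts
    rw [pairWeb, hbulk, hedges, houts, this]
  · have := h.infinity
    rw [houts, hrange] at this
    exact ((List.map_injective_iff.2 (Option.some_injective _)) this).symm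

theorem pairWeb_isHalfPlaneWeb {w₁ w₂ o : Word S} {ν : ℂ} (hν : Complex.normSq ν = 1) {z : ℤ → ℂ}
    (h₁ : w₁.IsHalfPlaneFan z ν) (h₂ : w₂.IsHalfPlaneFan z ν) (ho : o.IsHalfPlaneFan z ν)
    (hlet : o.letters = w₁.letters ++ w₂.letters) (h12 : w₁.final = w₂.start)
    (hs : w₁.start = o.start) (hf : w₂.final = o.final)
    (hpair : o.letters.Pairwise fun a b => (conj (S.dir z a) * S.dir z b).im < 0) :
    ∃ ξ, (pairWeb w₁ w₂).IsHalfPlaneWeb ν z [w₁, w₂] o ξ := by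
  have hlen := length_germs_pairWeb w₁ w₂
  set N := w₁.letters.length + w₂.letters.length with hN
  have hνe : ν.re * ν.re + ν.im * ν.im = 1 := by rw [← hν, Complex.normSq_apply]
  have hpos : ∀ s ∈ w₁.letters ++ w₂.letters, 0 < (conj ν * S.dir z s).re := by
    intro s hs
    rw [← hlet] at hs
    exact ho.2.1 _ (List.mem_map_of_mem hs)
  have hgerm : ∀ i (hi : i < N), (pairWeb w₁ w₂).dir z i =
      S.dir z ((w₁.letters ++ w₂.letters)[i]'(by simpa using hi)) := by
    intro i hi
    refine Web.dir_eq _ ?_ z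
    rw [letter_pairWeb, List.getElem?_eq_getElem]
  set ξ : Fin 2 → ℝ := ![0, 1] with hξ
  have hpos0 : (pairWeb w₁ w₂).pos (-Complex.I * ν) ξ 0 = 0 := by
    rw [pos_pairWeb_zero]; simp [hξ]
  have hpos1 : (pairWeb w₁ w₂).pos (-Complex.I * ν) ξ 1 = -Complex.I * ν := by
    rw [pos_pairWeb_one]; simp [hξ]
  have hνre : ∀ d : ℂ, (conj ν * d).re = ν.re * d.re + ν.im * d.im := fun d => by
    simp [Complex.mul_re]
  have hτre : (-Complex.I * ν).re = ν.im := by simp [Complex.mul_re]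
  have hτim : (-Complex.I * ν).im = -ν.re := by simp [Complex.mul_im]
  have hown : ∀ i, i < N → (pairWeb w₁ w₂).owner i = if i < w₁.letters.length then 0 else 1 :=
    fun i hi => Web.owner_of_vertices_eq (vertices_pairWeb w₁ w₂) hi
  have hmem : ∀ A ∈ (pairWeb w₁ w₂).edgeSets (-Complex.I * ν) z ξ, ∃ i, ∃ _ : i < N,
      A = {q | ∃ r : ℝ, 0 < r ∧ q = (pairWeb w₁ w₂).pos (-Complex.I * ν) ξ
        ((pairWeb w₁ w₂).owner i) + r * (pairWeb w₁ w₂).dir z i} := by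
    intro A hA
    simp only [Web.edgeSets, pairWeb, List.map_nil, List.nil_append, List.mem_map,
      List.mem_range] at hA
    obtain ⟨i, hi, rfl⟩ := hA
    exact ⟨i, hi, rfl⟩
  refine ⟨ξ, ⟨?_, ?_, rfl, ?_, ?_, ?_, ?_, ho, ?_, ?_, ?_⟩⟩
  · refine ⟨?_, by simp [pairWeb], by simp [pairWeb], by simp [pairWeb], by simp [pairWeb]⟩
    rw [hlen]
    exact List.Perm.refl _
  · refine ⟨by simp [pairWeb], ?_, ?_, ?_⟩
    · have hne : -Complex.I * ν ≠ 0 := by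
        refine mul_ne_zero (by simp) ?_
        rintro rfl
        simp at hν
      intro v v' hv hv' hvv'
      have h2 : (pairWeb w₁ w₂).numVertices = 2 := rfl
      rw [h2] at hv hv'
      interval_cases v <;> interval_cases v'
      · exact absurd rfl hvv'
      · rw [hpos0, hpos1]; exact hne.symm
      · rw [hpos0, hpos1]; exact hne
      · exact absurd rfl hvv'
    · simp only [Web.edgeSets, pairWeb, List.map_nil, List.nil_append]
      rw [List.pairwise_map]
      refine List.pairwise_lt_range.imp_of_mem fun {i j} hi hj hij => ?_
      rw [List.mem_range] at hi hj
      change Disjoint {q | ∃ r : ℝ, 0 < r ∧ q = (pairWeb w₁ w₂).pos (-Complex.I * ν) ξ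
        ((pairWeb w₁ w₂).owner i) + r * (pairWeb w₁ w₂).dir z i} {q | ∃ r : ℝ, 0 < r ∧
          q = (pairWeb w₁ w₂).pos (-Complex.I * ν) ξ
        ((pairWeb w₁ w₂).owner j) + r * (pairWeb w₁ w₂).dir z j}
      rw [hgerm i hi, hgerm j hj, hown i hi, hown j hj]
      set a := (w₁.letters ++ w₂.letters)[i]'(by simpa using hi)
      set b := (w₁.letters ++ w₂.letters)[j]'(by simpa using hj)
      have hcross : (conj (S.dir z a) * S.dir z b).im < 0 := by
        rw [hlet] at hpair
        exact List.pairwise_iff_getElem.1 hpair i j _ _ hij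
      have ha := hpos a (List.getElem_mem _)
      have hb := hpos b (List.getElem_mem _)
      rw [cross_eq] at hcross
      rw [hνre] at ha hb
      rw [Set.disjoint_left]
      rintro x ⟨r, hr, rfl⟩ ⟨r', hr', hx⟩
      have hre := congrArg Complex.re hx
      have him := congrArg Complex.im hx
      have hsame : r * (S.dir z a).re = r' * (S.dir z b).re →
          r * (S.dir z a).im = r' * (S.dir z b).im → False := by
        intro e1 e2
        have : r * ((S.dir z a).re * (S.dir z b).im - (S.dir z a).im * (S.dir z b).re) = 0 := by
          linear_combination (S.dir z b).im * e1 - (S.dir z b).re * e2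
        rcases mul_eq_zero.1 this with h | h <;> linarith
      by_cases h1 : i < w₁.letters.length
      · by_cases h2 : j < w₁.letters.length
        · simp only [h1, h2, if_true, hpos0, zero_add, Complex.re_ofReal_mul,
            Complex.im_ofReal_mul] at hre him
          exact hsame hre him
        · simp only [h1, h2, if_true, if_false, hpos0, hpos1, zero_add, Complex.add_re,
            Complex.add_im, hτre, hτim, Complex.re_ofReal_mul, Complex.im_ofReal_mul] at hre him
          -- the first ray would have to lie on the far side of the second
          have e1 : r * (ν.re * (S.dir z a).re + ν.im * (S.dir z a).im) =
              r' * (ν.re * (S.dir z b).re + ν.im * (S.dir z b).im) := by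
            linear_combination ν.re * hre + ν.im * him
          have e2 : r * r' * ((S.dir z a).re * (S.dir z b).im - (S.dir z a).im * (S.dir z b).re) =
              r' * (ν.re * (S.dir z b).re + ν.im * (S.dir z b).im) := by
            linear_combination r' * (S.dir z b).im * hre - r' * (S.dir z b).re * him
          have e3 := mul_pos hr' hb
          have e4 := mul_neg_of_pos_of_neg (mul_pos hr hr') hcross
          linarith
      · have h2 : ¬ j < w₁.letters.length := by omega
        simp only [h1, h2, if_false, Complex.add_re, Complex.add_im, add_right_inj,
          Complex.re_ofReal_mul, Complex.im_ofReal_mul] at hre him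
        exact hsame hre him
    · intro A hA v hv
      obtain ⟨i, hi, rfl⟩ := hmem A hA
      have hv2 : v < 2 := hv
      rw [hgerm i hi, hown i hi]
      set a := (w₁.letters ++ w₂.letters)[i]'(by simpa using hi)
      have ha := hpos a (List.getElem_mem _)
      rw [hνre] at ha
      -- all vertices are on the boundary line, and the rays are in the open half-plane
      have hbd : ∀ v < 2, ν.re * ((pairWeb w₁ w₂).pos (-Complex.I * ν) ξ v).re +
          ν.im * ((pairWeb w₁ w₂).pos (-Complex.I * ν) ξ v).im = 0 := by
        intro v hv
        interval_cases v
        · rw [hpos0]; simp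
        · rw [hpos1, hτre, hτim]; ring
      rintro ⟨r, hr, hx⟩
      have hre := congrArg Complex.re hx
      have him := congrArg Complex.im hx
      simp only [Complex.add_re, Complex.add_im, Complex.re_ofReal_mul,
        Complex.im_ofReal_mul] at hre him
      have e1 := hbd v hv2
      have e2 := hbd (if i < w₁.letters.length then 0 else 1) (by split_ifs <;> norm_num)
      rw [hre, him] at e1
      have e3 : r * (ν.re * (S.dir z a).re + ν.im * (S.dir z a).im) = 0 := by
        linear_combination e1 - e2
      have e4 := mul_pos hr ha
      linarith
  · intro b hb
    simp only [List.mem_cons, List.not_mem_nil, or_false] at hb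
    rcases hb with rfl | rfl
    · exact h₁
    · exact h₂
  · have hstrict : ∀ i j : Fin 2, i < j → ξ i < ξ j := by
      intro i j hij
      fin_cases i <;> fin_cases j <;> simp [hξ] at hij ⊢
    intro i j hij _
    exact hstrict i j hij
  · intro v hv hv'
    have : (pairWeb w₁ w₂).numVertices = (pairWeb w₁ w₂).bdry.length := rfl
    omega
  · rw [hlet]
    refine map_letter_range ?_ ?_
    · rw [vertices_pairWeb]; simp
    · simp
  · simpa using h12
  · simpa using hs
  · simpa using hf

theorem moduliDim_pairWeb (w₁ w₂ : Word S) (τ : ℂ) (z : ℤ → ℂ) :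
    (pairWeb w₁ w₂).moduliDim τ z = 2 := by
  have h1 := (pairWeb w₁ w₂).dim_le_moduliDim_add τ z
  have h2 := (pairWeb w₁ w₂).moduliDim_le_dim τ z
  have h3 : (pairWeb w₁ w₂).dim = 2 := rfl
  have h4 : (pairWeb w₁ w₂).edges.length = 0 := rfl
  omega

theorem orientation_pairWeb {w₁ w₂ o : Word S} {ν : ℂ} {z : ℤ → ℂ}
    {ξ : Fin (pairWeb w₁ w₂).dim → ℝ}
    (h : (pairWeb w₁ w₂).IsHalfPlaneWeb ν z [w₁, w₂] o ξ) (τ : ℂ) :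
    (pairWeb w₁ w₂).orientation τ [τ] z ξ = 1 := by
  have hlt : ξ (0 : Fin 2) < ξ (1 : Fin 2) :=
    h.bdry_order (0 : Fin 2) (1 : Fin 2) Nat.one_pos Nat.one_lt_two
  rw [Web.orientation, dif_pos (by rfl)]
  have : Matrix.det (n := Fin 2) (Matrix.of fun i j : Fin 2 =>
      (((pairWeb w₁ w₂).edges.map (fun e j => (pairWeb w₁ w₂).slopeForm τ z e (Pi.single j 1)) ++
        [τ].map (pairWeb w₁ w₂).translation ++ [ξ] : List (Fin 2 → ℝ)).get (i.cast rfl) j)) =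
      ξ (1 : Fin 2) - ξ (0 : Fin 2) := by
    rw [Matrix.det_fin_two]
    change (1 : ℝ) * ξ (1 : Fin 2) - 1 * ξ (0 : Fin 2) = _
    ring
  erw [this]
  rw [sign_pos (sub_pos.2 hlt)]
  rfl

theorem InfraredData.contraction_pairWeb (D : InfraredData S) (w₁ w₂ : Word S) (c : ℂ) :
    D.contraction (pairWeb w₁ w₂) c = c * sgn (D.degWord w₁) := by
  have h : (pairWeb w₁ w₂).outs.Pairwise (· < ·) := List.pairwise_lt_range
  rw [InfraredData.contraction]
  simp only [pairWeb, List.flatMap_nil, List.nil_append] at h ⊢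
  rw [koszul_of_pairwise _ h]
  simp [InfraredData.bdrySign, sgn]

end Pairs

/-! ### Signs -/

section Signs

theorem sgn_add (a b : ℤ) : sgn (a + b) = sgn a * sgn b := by
  unfold sgn
  by_cases ha : Even a <;> by_cases hb : Even b <;> simp [Int.even_add, ha, hb]

theorem sgn_mul_self (a : ℤ) : sgn a * sgn a = 1 := by
  unfold sgn
  split_ifs <;> simp

@[simp]
theorem sgn_zero : sgn 0 = 1 := by simp [sgn]

theorem sgn_one : sgn 1 = -1 := by simp [sgn]

theorem sgn_congr {a b : ℤ} (h : Even (a - b)) : sgn a = sgn b := by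
  unfold sgn
  rw [Int.even_sub] at h
  simp [h]

theorem sgn_ne_zero (a : ℤ) : sgn a ≠ 0 := fun h => by
  have := sgn_mul_self a
  rw [h, zero_mul] at this
  exact zero_ne_one this

theorem prod_map_sgn {ι : Type*} (l : List ι) (f : ι → ℤ) :
    (l.map fun i => sgn (f i)).prod = sgn (l.map f).sum := by
  induction l with
  | nil => simp
  | cons a l ih => rw [List.map_cons, List.prod_cons, ih, List.map_cons, List.sum_cons, sgn_add]

theorem koszul_cons_of_lt (d : ℕ → ℤ) {a : ℕ} {l : List ℕ} (h : ∀ b ∈ l, a < b) :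
    koszul d (a :: l) = koszul d l := by
  rw [koszul]
  convert one_mul _
  refine List.prod_eq_one ?_
  simp only [List.mem_map]
  rintro _ ⟨b, hb, rfl⟩
  rw [if_neg (not_lt_of_gt (h b hb))]

theorem koszul_cons_of_gt (d : ℕ → ℤ) {a : ℕ} {l : List ℕ} (h : ∀ b ∈ l, b < a) :
    koszul d (a :: l) = sgn (d a * (l.map d).sum) * koszul d l := by
  rw [koszul]
  congr 1
  rw [List.map_congr_left fun b hb => if_pos (h b hb), prod_map_sgn, List.sum_map_mul_left]

end Signs

/-! ### Stars: webs with one bulk vertex -/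

section Star

variable {S : Spectrum.{u}}

/-- Reading a word backwards, with all solitons replaced by their duals. -/
theorem IsPath.reverse {k l : ℤ} {L : List S.Gen} (h : IsPath k l L) :
    IsPath l k (L.map S.bar).reverse := by
  induction L generalizing k with
  | nil => exact Eq.symm h
  | cons s L ih =>
    rw [List.map_cons, List.reverse_cons, isPath_append]
    exact ⟨S.tgt s, ih h.2, by rw [isPath_cons, S.src_bar, S.tgt_bar]; exact ⟨rfl, h.1⟩⟩

/-- The word with the single letter `s`. -/
def letterWord (s : S.Gen) : Word S := ⟨S.src s, [s]⟩

theorem flatMap_letters_letterWord (ss : List S.Gen) :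
    (ss.map letterWord).flatMap Word.letters = ss := by
  induction ss with
  | nil => rfl
  | cons s ss ih => rw [List.map_cons, List.flatMap_cons, ih]; rfl

theorem Word.eq_letterWord {w : Word S} (h : w.Composable) {s : S.Gen} (hs : w.letters = [s]) :
    w = letterWord s := by
  obtain ⟨k, L⟩ := w
  simp only at hs
  subst hs
  have := (Word.composable_iff.1 h).1
  simp only at this
  rw [letterWord, this]

theorem isPath_flatMap {ws : List (Word S)} (hw : ∀ b ∈ ws, b.Composable)
    (hc : ws.IsChain fun a b => a.final = b.start) {k l : ℤ} (hne : ws ≠ [])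
    (hk : ∀ a ∈ ws.head?, a.start = k) (hl : ∀ a ∈ ws.getLast?, a.final = l) :
    IsPath k l (ws.flatMap Word.letters) := by
  induction ws generalizing k with
  | nil => exact absurd rfl hne
  | cons a ws ih =>
    have ha := Word.composable_iff.1 (hw a (by simp))
    have hak : a.start = k := hk a (by simp)
    rw [List.flatMap_cons, isPath_append]
    cases ws with
    | nil =>
      have : a.final = l := hl a (by simp)
      exact ⟨l, by rw [← hak, ← this]; exact ha, rfl⟩
    | cons b ws =>
      rw [List.isChain_cons_cons] at hc
      refine ⟨a.final, hak ▸ ha, ih (fun c h => hw c (List.mem_cons_of_mem _ h)) hc.2 (by simp)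
        ?_ ?_⟩
      · simpa using hc.1.symm
      · intro c h
        refine hl c ?_
        rwa [List.getLast?_cons_cons]

/-- The web with one bulk vertex, to which the boundary vertices send one edge each. -/
def starWeb (ss : List S.Gen) (s : S.Gen) : Web S :=
  ⟨ss.map letterWord, [s :: (ss.map S.bar).reverse],
    (List.range ss.length).map fun j => (j, 2 * ss.length - j), [ss.length]⟩

theorem flatten_map_singleton {ι : Type*} (l : List ι) : (l.map fun x => [x]).flatten = l := by
  induction l with
  | nil => rfl
  | cons a l ih => rw [List.map_cons, List.flatten_cons, ih]; rfl

theorem Web.vertices_of_star {w : Web S} {ss b : List S.Gen} (hb : w.bdry = ss.map letterWord)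
    (hk : w.bulk = [b]) : w.vertices = ss.map (fun s => [s]) ++ [b] := by
  rw [Web.vertices, hb, hk, List.map_map]
  rfl

theorem Web.vertices_flatten_of_star {w : Web S} {ss b : List S.Gen}
    (hb : w.bdry = ss.map letterWord) (hk : w.bulk = [b]) : w.vertices.flatten = ss ++ b := by
  rw [w.vertices_of_star hb hk, List.flatten_append]
  congr 1
  · exact flatten_map_singleton ss
  · simp

theorem Web.owner_of_star {w : Web S} {ss b : List S.Gen} (hb : w.bdry = ss.map letterWord)
    (hk : w.bulk = [b]) {p : ℕ} (hp : p < ss.length + b.length) :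
    w.owner p = min p ss.length := by
  have hg : w.germs = ss.mapIdx (fun i s => (i, s)) ++ b.map (fun s => (ss.length, s)) := by
    rw [Web.germs, ← Web.vertices, w.vertices_of_star hb hk, List.mapIdx_append,
      List.flatten_append]
    congr 1
    · have : (ss.map (fun s => [s])).mapIdx (fun i l => l.map fun s => (i, s)) =
          (ss.mapIdx fun i s => (i, s)).map fun x => [x] := by
        refine List.ext_getElem (by simp) fun i h1 h2 => ?_
        simp
      rw [this, flatten_map_singleton]
    · simp
  rw [Web.owner, hg]
  by_cases h1 : p < ss.length
  · rw [List.getElem?_append_left (by simpa using h1), List.getElem?_mapIdx,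
      List.getElem?_eq_getElem h1, min_eq_left h1.le]
    rfl
  · have h2 : p - ss.length < b.length := by omega
    rw [List.getElem?_append_right (by simpa using h1), List.length_mapIdx, List.getElem?_map,
      List.getElem?_eq_getElem h2, min_eq_right (by omega)]
    rfl

theorem letter_starWeb (ss : List S.Gen) (s : S.Gen) (p : ℕ) :
    (starWeb ss s).letter p = (ss ++ s :: (ss.map S.bar).reverse)[p]? := by
  rw [Web.letter_eq_getElem?, Web.vertices_flatten_of_star rfl rfl]

theorem length_eq_one_of_sum {ws : List (Word S)} (h : ∀ b ∈ ws, b.letters.length ≤ 1)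
    (hs : ws.length ≤ (ws.flatMap Word.letters).length) : ∀ b ∈ ws, b.letters.length = 1 := by
  have hle : ∀ l : List (Word S), (∀ b ∈ l, b.letters.length ≤ 1) →
      (l.flatMap Word.letters).length ≤ l.length := by
    intro l hl
    induction l with
    | nil => simp
    | cons a l ih =>
      have h1 := ih fun b hb => hl b (by simp [hb])
      have h2 := hl a (by simp)
      rw [List.flatMap_cons, List.length_append, List.length_cons]
      omega
  induction ws with
  | nil => simp
  | cons a ws ih =>
    rw [List.flatMap_cons, List.length_append, List.length_cons] at hs
    have h1 := h a (by simp)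
    have h2 := hle ws fun b hb => h b (by simp [hb])
    intro b hb
    rcases List.mem_cons.1 hb with rfl | hb
    · omega
    · exact ih (fun c hc => h c (by simp [hc])) (by omega) b hb

/-- In the right half-plane a taut web with bulk vertices is a star: every bulk vertex has exactly
one edge leaving to the right, so that the number of constraints leaves room for a single bulk
vertex, and all its other edges come from the boundary. -/
theorem Web.IsHalfPlaneWeb.eq_starWeb {w : Web S} {F : Set ℤ} {z : ℤ → ℂ}
    (hz : IsParabolicOn F z) (hF : SupportedOn F w.vertices.flatten) {ws : List (Word S)}
    {o : Word S} {ξ : Fin w.dim → ℝ} (h : w.IsHalfPlaneWeb 1 z ws o ξ) (hne : ws ≠ [])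
    (hbulk : w.bulk ≠ []) {τ : ℂ} (hm : w.moduliDim τ z = 2) :
    ∃ ss s, ws = ss.map letterWord ∧ o.letters = [s] ∧ w = starWeb ss s := by
  have hFmem : ∀ s ∈ w.vertices.flatten, SupportedOn F [s] := fun s hs =>
    hF.of_subset (by simpa using hs)
  have hsub : ∀ b ∈ ws, b.letters ⊆ w.vertices.flatten := by
    intro b hb s hs
    rw [Web.vertices, List.flatten_append, h.bdry_eq]
    exact List.mem_append_left _ (List.mem_flatten.2 ⟨_, List.mem_map_of_mem hb, hs⟩)
  have hosub : o.letters ⊆ w.vertices.flatten := by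
    intro s hs
    have h1 : some s ∈ w.outs.map w.letter := by
      rw [h.infinity]; exact List.mem_map_of_mem hs
    obtain ⟨p, -, hp⟩ := List.mem_map.1 h1
    exact w.letter_mem hp
  have hws : ∀ b ∈ ws, IsPath b.start b.final b.letters ∧ b.letters.length ≤ 1 ∧
      ∀ s ∈ b.letters, S.IsDown s := fun b hb =>
    (isHalfPlaneFan_right_iff hz (hF.of_subset (hsub b hb))).1 (h.bdry_fan b hb)
  obtain ⟨hopath, holen, hodown⟩ :=
    (isHalfPlaneFan_right_iff hz (hF.of_subset hosub)).1 h.infinity_fan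
  have hpath : IsPath o.start o.final (ws.flatMap Word.letters) :=
    isPath_flatMap (fun b hb => (h.bdry_fan b hb).1) h.label_bdry hne h.label_first h.label_last
  have hdown : ∀ s ∈ ws.flatMap Word.letters, S.IsDown s := by
    intro s hs
    obtain ⟨b, hb, hsb⟩ := List.mem_flatMap.1 hs
    exact (hws b hb).2.2 s hsb
  have hcount := h.graph.countP_isDown h.infinity
  have hbsum := h.graph.sum_countP_bulk hz hF
  have hcb : (w.bdry.map Word.letters).flatten.countP (fun s => S.IsDown s) =
      (ws.flatMap Word.letters).length := by
    rw [h.bdry_eq, ← List.flatMap_def, List.countP_eq_length]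
    simpa using hdown
  have hco : o.letters.countP (fun s => S.IsDown s) = o.letters.length := by
    rw [List.countP_eq_length]
    simpa using hodown
  rw [Web.vertices, List.map_append, List.sum_append, hbsum, ← List.countP_flatten, hcb, hco]
    at hcount
  have hdim := w.dim_le_moduliDim_add τ z
  rw [hm, Web.dim, h.bdry_eq] at hdim
  -- Every boundary vertex carries at most one germ, so the edges are too few to cut the
  -- dimension down to two unless there is a single bulk vertex and one edge at infinity.
  have hn1 : (ws.flatMap Word.letters).length ≤ ws.length := by
    have : ∀ l : List (Word S), l ⊆ ws → (l.flatMap Word.letters).length ≤ l.length := by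
      intro l hl
      induction l with
      | nil => simp
      | cons a l ih =>
        have h1 := ih fun b hb => hl (by simp [hb])
        have h2 := (hws a (hl (by simp))).2.1
        rw [List.flatMap_cons, List.length_append, List.length_cons]
        omega
    exact this ws (List.Subset.refl _)
  have hV : 1 ≤ w.bulk.length := List.length_pos_iff.2 hbulk
  have hn : 1 ≤ ws.length := List.length_pos_iff.2 hne
  have hnoloop : ∀ e ∈ w.edges, w.owner e.1 ≠ w.owner e.2 := by
    intro e he
    refine h.drawing.owner_ne he ?_
    obtain ⟨s, hs, -⟩ := h.graph.exists_edge_letter he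
    rw [w.dir_eq hs]
    exact hz.dir_ne_zero (hFmem s (w.letter_mem hs))
  rcases ho : o.letters with _ | ⟨s, _ | ⟨s', L⟩⟩
  · -- without an edge at infinity nothing reaches the boundary, and the bulk is a loop
    exfalso
    have h1 : o.start = o.final := by rw [ho] at hopath; exact hopath
    have h2 : ws.flatMap Word.letters = [] := by
      by_contra hne'
      have h3 := hpath.reverse.lt_of_isUp (by
        intro s hs
        rw [List.mem_reverse, List.mem_map] at hs
        obtain ⟨a, ha, rfl⟩ := hs
        exact Spectrum.isUp_bar.2 (hdown a ha)) (by simpa using hne')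
      omega
    rw [ho, h2] at hcount
    simp only [List.length_nil] at hcount
    have hV1 : w.bulk.length = 1 := by omega
    have hwl : w.bdry.length = 1 := by rw [h.bdry_eq]; omega
    obtain ⟨b, hb⟩ := List.length_eq_one_iff.1 hV1
    obtain ⟨w₁, hw₁⟩ := List.length_eq_one_iff.1 hwl
    have hw₁l : w₁.letters = [] := by
      rw [← h.bdry_eq, hw₁] at h2
      simpa using h2
    obtain ⟨e, he⟩ : ∃ e, e ∈ w.edges := List.exists_mem_of_length_pos (by omega)
    have hown : ∀ p, p < w.germs.length → w.owner p = 1 := by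
      intro p hp
      have hvv : w.vertices = [w₁.letters, b] := by rw [Web.vertices, hb, hw₁]; rfl
      rw [Web.length_germs, hvv, hw₁l] at hp
      rw [Web.owner_of_vertices_eq hvv (by rw [hw₁l]; simpa using hp), hw₁l]
      simp
    obtain ⟨h5, h6⟩ := h.graph.edge_lt_length he
    exact hnoloop e he ((hown _ h5).trans (hown _ h6).symm)
  · rw [ho] at hcount
    simp only [List.length_singleton] at hcount
    have hV1 : w.bulk.length = 1 := by omega
    have hone := length_eq_one_of_sum (fun b hb => (hws b hb).2.1) (by omega)
    obtain ⟨b, hb⟩ := List.length_eq_one_iff.1 hV1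
    set ss := ws.flatMap Word.letters with hss
    have hwss : ws = ss.map letterWord := by
      have : ∀ l : List (Word S), l ⊆ ws → l = (l.flatMap Word.letters).map letterWord := by
        intro l hl
        induction l with
        | nil => rfl
        | cons a l ih =>
          obtain ⟨s, hs⟩ := List.length_eq_one_iff.1 (hone a (hl (by simp)))
          rw [List.flatMap_cons, List.map_append, ← ih fun x hx => hl (by simp [hx]), hs]
          simp only [List.map_cons, List.map_nil, List.singleton_append, List.cons.injEq, and_true]
          exact Word.eq_letterWord (h.bdry_fan a (hl (by simp))).1 hs
      exact this ws (List.Subset.refl _)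
    have hbd : w.bdry = ss.map letterWord := h.bdry_eq.trans hwss
    have hlen : ws.length = ss.length := by rw [hwss, List.length_map]
    have hfl := Web.vertices_flatten_of_star hbd hb
    set n := ss.length with hn'
    have hE : w.edges.length = n := by omega
    have hgl : w.germs.length = n + b.length := by rw [Web.length_germs, hfl, List.length_append]
    have hglen := h.graph.length_germs_eq
    have houtlen : w.outs.length = 1 := by
      have := congrArg List.length h.infinity
      rw [ho] at this
      simpa using this
    have hblen : b.length = n + 1 := by omega
    have hletter : ∀ p, w.letter p = (ss ++ b)[p]? := fun p => by
      rw [w.letter_eq_getElem?, hfl]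
    obtain ⟨r, L, hbL, hL, hLpath, hLup⟩ := (isCyclicFan_iff hz (hF.of_subset (by
      rw [hfl]; simp))).1 (h.graph.bulk_fan b (by rw [hb]; simp))
    have hr : S.IsDown r := hLpath.lt_of_isUp hLup hL
    have hLlen : L.length = n := by rw [hbL] at hblen; simpa using hblen
    have hletn : w.letter n = some r := by rw [hletter, hbL]; simp [hn']
    have howner : ∀ p, p < n + b.length → w.owner p = min p n := fun p hp =>
      Web.owner_of_star hbd hb hp
    have hedge : ∀ e ∈ w.edges, e.1 < n ∧ n < e.2 ∧ e.2 < 2 * n + 1 := by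
      intro e he
      obtain ⟨h5, h6⟩ := h.graph.edge_lt_length he
      have hlt := h.graph.edge_lt e he
      have hno := hnoloop e he
      rw [howner _ (by omega), howner _ (by omega)] at hno
      have h1 : e.1 < n := by
        by_contra hcon
        exact hno (by rw [min_eq_right (by omega), min_eq_right (by omega)])
      obtain ⟨a, ha, ha'⟩ := h.graph.exists_edge_letter he
      have had : S.IsDown a := by
        refine hdown a ?_
        rw [hletter, List.getElem?_append_left h1] at ha
        exact List.mem_of_getElem? ha
      have hup : S.IsUp (S.bar a) := Spectrum.isUp_bar.2 had
      refine ⟨h1, ?_, by omega⟩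
      rcases lt_trichotomy e.2 n with h7 | h7 | h7
      · exfalso
        rw [hletter, List.getElem?_append_left h7] at ha'
        exact Spectrum.not_isDown.2 hup (hdown _ (List.mem_of_getElem? ha'))
      · exfalso
        rw [h7, hletn, Option.some.injEq] at ha'
        rw [← ha'] at hup
        exact Spectrum.not_isDown.2 hup hr
      · exact h7
    -- the falling germ of the bulk vertex goes to infinity
    have houts : w.outs = [n] := by
      obtain ⟨x, hx⟩ := List.length_eq_one_iff.1 houtlen
      have h1 : n ∈ w.edges.flatMap (fun e => [e.1, e.2]) ++ w.outs :=
        h.graph.germs_perm.symm.subset (List.mem_range.2 (by omega))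
      rcases List.mem_append.1 h1 with h2 | h2
      · obtain ⟨e, he, hne'⟩ := List.mem_flatMap.1 h2
        have := hedge e he
        simp only [List.mem_cons, List.not_mem_nil, or_false] at hne'
        omega
      · rw [hx] at h2 ⊢
        rw [List.mem_singleton] at h2
        rw [h2]
    have hrs : r = s := by
      have := h.infinity
      rw [houts, ho, List.map_singleton, hletn] at this
      simpa using this
    -- the edges are listed in the order of their ends on the boundary
    have hfst : w.edges.map Prod.fst = List.range n := by
      refine eq_of_perm_of_pairwise_map (fun p => (p : ℤ)) ?_ ?_ ?_
      · refine List.Subperm.perm_of_length_le (List.subperm_of_subset ?_ ?_) (by simp [hE])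
        · rw [List.nodup_iff_pairwise_ne, List.pairwise_map]
          exact h.graph.edge_sorted.imp fun hab => ne_of_lt hab
        · intro p hp
          obtain ⟨e, he, rfl⟩ := List.mem_map.1 hp
          exact List.mem_range.2 (hedge e he).1
      · rw [List.pairwise_map, List.pairwise_map]
        exact h.graph.edge_sorted.imp fun hab => by exact_mod_cast hab
      · rw [List.pairwise_map]
        exact List.pairwise_lt_range.imp fun hab => by exact_mod_cast hab
    have hsnd_letter : (w.edges.map Prod.snd).map w.letter = (ss.map S.bar).map some := by
      have h1 : (w.edges.map Prod.snd).map w.letter =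
          ((w.edges.map Prod.fst).map w.letter).map (Option.map S.bar) := by
        rw [List.map_map, List.map_map, List.map_map]
        exact List.map_congr_left fun e he => h.graph.edge_dual e he
      have h2 : (List.range n).map w.letter = ss.map some := by
        refine List.ext_getElem (by simp [hn']) fun i h1 h2 => ?_
        have h3 : i < ss.length := by simpa using h2
        simp [hletter, List.getElem?_append_left h3]
      rw [h1, hfst, h2, List.map_map, List.map_map]
      rfl
    have hrev : IsPath o.final o.start (ss.map S.bar).reverse := hpath.reverse
    have hrevup : ∀ a ∈ (ss.map S.bar).reverse, S.IsUp a := by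
      intro a ha
      rw [List.mem_reverse, List.mem_map] at ha
      obtain ⟨c, hc, rfl⟩ := ha
      exact Spectrum.isUp_bar.2 (hdown c hc)
    have hLletter : (List.range' (n + 1) n).map w.letter = L.map some := by
      refine List.ext_getElem (by simp [hLlen]) fun i h1 h2 => ?_
      have h3 : i < L.length := by simpa using h2
      have h4 : n + 1 + i = ss.length + (i + 1) := by omega
      simp only [List.getElem_map, List.getElem_range', hletter, hbL, one_mul, h4]
      rw [List.getElem?_append_right (by omega)]
      simp [h3]
    have hsnd : (w.edges.map Prod.snd).reverse = List.range' (n + 1) n := by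
      have hkey : ∀ {l : List ℕ} {M : List S.Gen}, l.map w.letter = M.map some →
          M.Pairwise (fun a b => S.tgt a < S.tgt b) →
          (l.map fun p => (w.letter p).elim 0 S.tgt).Pairwise (· < ·) := by
        intro l M hl hM
        have : (l.map fun p => (w.letter p).elim 0 S.tgt) = M.map S.tgt := by
          have := congrArg (List.map fun x : Option S.Gen => x.elim 0 S.tgt) hl
          simpa [List.map_map, Function.comp_def] using this
        rw [this, List.pairwise_map]
        exact hM
      refine eq_of_perm_of_pairwise_map (fun p => (w.letter p).elim 0 S.tgt) ?_ ?_ ?_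
      · refine List.Subperm.perm_of_length_le (List.subperm_of_subset ?_ ?_) (by simp [hE])
        · rw [List.nodup_reverse]
          have h1 : (w.edges.flatMap (fun e => [e.1, e.2])).Nodup := by
            have := h.graph.germs_perm.nodup_iff.2 List.nodup_range
            exact (List.nodup_append.1 this).1
          have h2 : ∀ l : List (ℕ × ℕ), (l.map Prod.snd).Sublist
              (l.flatMap fun e => [e.1, e.2]) := by
            intro l
            induction l with
            | nil => simp
            | cons e l ih =>
              rw [List.map_cons, List.flatMap_cons]
              exact (ih.cons_cons _).cons _
          exact (h2 _).nodup h1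
        · intro p hp
          rw [List.mem_reverse] at hp
          obtain ⟨e, he, rfl⟩ := List.mem_map.1 hp
          have := hedge e he
          rw [List.mem_range'_1]
          omega
      · refine hkey (M := (ss.map S.bar).reverse) ?_ (hrev.pairwise_tgt_of_isUp hrevup)
        rw [List.map_reverse, List.map_reverse, hsnd_letter]
      · exact hkey hLletter (hLpath.pairwise_tgt_of_isUp hLup)
    have hLeq : L = (ss.map S.bar).reverse := by
      refine List.map_injective_iff.2 (Option.some_injective _) ?_
      rw [← hLletter, ← hsnd, List.map_reverse, hsnd_letter, List.map_reverse]
    have hedges : w.edges = (List.range n).map fun j => (j, 2 * n - j) := by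
      have h1 : w.edges.map Prod.snd = (List.range' (n + 1) n).reverse := by
        rw [← hsnd, List.reverse_reverse]
      refine List.ext_getElem (by simp [hE]) fun i h2 h3 => ?_
      have h4 : (w.edges.map Prod.fst)[i]'(by simpa using h2) = i := by
        simp only [hfst, List.getElem_range]
      have h5 : (w.edges.map Prod.snd)[i]'(by simpa using h2) = 2 * n - i := by
        simp only [h1, List.getElem_reverse, List.getElem_range', List.length_range']
        omega
      rw [List.getElem_map] at h4 h5
      rw [List.getElem_map, List.getElem_range]
      exact Prod.ext h4 h5
    refine ⟨ss, s, hwss, rfl, ?_⟩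
    obtain ⟨bdry, bulk, edges, outs⟩ := w
    simp only at hbd hb hedges houts
    rw [starWeb, hbd, hb, hedges, houts, hbL, hrs, hLeq]
  · rw [ho] at holen
    simp at holen

end Star

section Star

variable {S : Spectrum.{u}}

/-- The coordinates of a web, extended by zero to all natural numbers. -/
def Web.coord (w : Web S) (ξ : Fin w.dim → ℝ) (j : ℕ) : ℝ := if h : j < w.dim then ξ ⟨j, h⟩ else 0

theorem Web.pos_bdry (w : Web S) (τ : ℂ) (ξ : Fin w.dim → ℝ) {v : ℕ} (hv : v < w.bdry.length) :
    w.pos τ ξ v = w.coord ξ v * τ := by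
  rw [Web.pos]
  exact if_pos hv

theorem Web.pos_bulk (w : Web S) (τ : ℂ) (ξ : Fin w.dim → ℝ) (v : ℕ) :
    w.pos τ ξ (w.bdry.length + v) = w.coord ξ (w.bdry.length + 2 * v) +
      w.coord ξ (w.bdry.length + 2 * v + 1) * Complex.I := by
  rw [Web.pos, if_neg (by omega), Nat.add_sub_cancel_left]
  rfl

theorem Web.coord_of_lt (w : Web S) (ξ : Fin w.dim → ℝ) {j : ℕ} (h : j < w.dim) :
    w.coord ξ j = ξ ⟨j, h⟩ := dif_pos h

theorem dim_starWeb (ss : List S.Gen) (s : S.Gen) : (starWeb ss s).dim = ss.length + 2 := by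
  simp [Web.dim, starWeb]

theorem bdry_length_starWeb (ss : List S.Gen) (s : S.Gen) :
    (starWeb ss s).bdry.length = ss.length := by
  simp [starWeb]

theorem length_germs_starWeb (ss : List S.Gen) (s : S.Gen) :
    (starWeb ss s).germs.length = 2 * ss.length + 1 := by
  rw [Web.length_germs, Web.vertices_flatten_of_star rfl rfl]
  simp only [List.length_append, List.length_cons, List.length_reverse, List.length_map]
  omega

theorem pos_starWeb_bdry (ss : List S.Gen) (s : S.Gen) (τ : ℂ)
    (ξ : Fin (starWeb ss s).dim → ℝ) {j : ℕ} (hj : j < ss.length) :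
    (starWeb ss s).pos τ ξ j = (starWeb ss s).coord ξ j * τ :=
  Web.pos_bdry _ τ ξ (by rw [bdry_length_starWeb]; exact hj)

theorem pos_starWeb_bulk (ss : List S.Gen) (s : S.Gen) (τ : ℂ)
    (ξ : Fin (starWeb ss s).dim → ℝ) :
    (starWeb ss s).pos τ ξ ss.length = (starWeb ss s).coord ξ ss.length +
      (starWeb ss s).coord ξ (ss.length + 1) * Complex.I := by
  have := Web.pos_bulk (starWeb ss s) τ ξ 0
  rwa [mul_zero, add_zero, bdry_length_starWeb] at this

theorem owner_starWeb (ss : List S.Gen) (s : S.Gen) {p : ℕ} (hp : p < 2 * ss.length + 1) :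
    (starWeb ss s).owner p = min p ss.length := by
  refine Web.owner_of_star rfl rfl ?_
  simp only [List.length_cons, List.length_reverse, List.length_map]
  omega

theorem letter_starWeb_bdry (ss : List S.Gen) (s : S.Gen) {j : ℕ} (hj : j < ss.length) :
    (starWeb ss s).letter j = some ss[j] := by
  rw [letter_starWeb, List.getElem?_append_left hj, List.getElem?_eq_getElem hj]

theorem letter_starWeb_root (ss : List S.Gen) (s : S.Gen) :
    (starWeb ss s).letter ss.length = some s := by
  rw [letter_starWeb]; simp

theorem letter_starWeb_bulk (ss : List S.Gen) (s : S.Gen) {j : ℕ} (hj : j < ss.length) :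
    (starWeb ss s).letter (2 * ss.length - j) = some (S.bar ss[j]) := by
  have h1 : 2 * ss.length - j = ss.length + (ss.length - 1 - j + 1) := by omega
  have h2 : ss.length - 1 - j < ((ss.map S.bar).reverse).length := by simp; omega
  rw [letter_starWeb, h1, List.getElem?_append_right (by omega), Nat.add_sub_cancel_left,
    List.getElem?_cons_succ, List.getElem?_eq_getElem h2, List.getElem_reverse, List.getElem_map]
  congr 3
  simp
  omega

theorem mem_edges_starWeb {ss : List S.Gen} {s : S.Gen} {e : ℕ × ℕ} :
    e ∈ (starWeb ss s).edges ↔ ∃ j < ss.length, e = (j, 2 * ss.length - j) := by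
  simp only [starWeb, List.mem_map, List.mem_range, eq_comm]

theorem edge_owners_starWeb {ss : List S.Gen} {s : S.Gen} {j : ℕ} (hj : j < ss.length) :
    (starWeb ss s).owner j = j ∧ (starWeb ss s).owner (2 * ss.length - j) = ss.length := by
  rw [owner_starWeb ss s (by omega), owner_starWeb ss s (by omega)]
  omega

theorem slopeForm_starWeb (ss : List S.Gen) (s : S.Gen) (z : ℤ → ℂ)
    (ξ : Fin (starWeb ss s).dim → ℝ) {j : ℕ} (hj : j < ss.length) :
    (starWeb ss s).slopeForm (-Complex.I * 1) z (j, 2 * ss.length - j) ξ =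
      (S.dir z ss[j]).re * ((starWeb ss s).coord ξ (ss.length + 1) + (starWeb ss s).coord ξ j) -
        (S.dir z ss[j]).im * (starWeb ss s).coord ξ ss.length := by
  obtain ⟨h1, h2⟩ := edge_owners_starWeb (s := s) hj
  rw [Web.slopeForm]
  simp only [h1, h2]
  rw [pos_starWeb_bdry ss s _ ξ hj, pos_starWeb_bulk,
    Web.dir_eq _ (letter_starWeb_bdry ss s hj)]
  simp [Complex.mul_im]
  ring

theorem perm_starWeb (n : ℕ) : (((List.range n).map fun j => (j, 2 * n - j)).flatMap
    (fun e => [e.1, e.2]) ++ [n]).Perm (List.range (2 * n + 1)) := by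
  have hN : (List.range (2 * n + 1)).Nodup := List.nodup_range
  refine (List.Subperm.perm_of_length_le (List.subperm_of_subset ?_ ?_) ?_).symm
  · exact hN
  · intro p hp
    rw [List.mem_range] at hp
    rw [List.mem_append, List.mem_flatMap]
    rcases lt_trichotomy p n with h | h | h
    · exact Or.inl ⟨(p, 2 * n - p), List.mem_map.2 ⟨p, List.mem_range.2 h, rfl⟩, by simp⟩
    · exact Or.inr (by simp [h])
    · refine Or.inl ⟨(2 * n - p, p), List.mem_map.2 ⟨2 * n - p, List.mem_range.2 (by omega), ?_⟩,
        by simp⟩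
      ext
      · rfl
      · simp only
        omega
  · rw [List.length_append, List.length_flatMap]
    simp [Function.comp_def]
    omega

theorem isGraph_starWeb {F : Set ℤ} {z : ℤ → ℂ} (hz : IsParabolicOn F z) {ss : List S.Gen}
    {s : S.Gen} (hF : SupportedOn F (s :: (ss.map S.bar).reverse)) (hne : ss ≠ [])
    (hpath : IsPath (S.src s) (S.tgt s) ss) (hdown : ∀ a ∈ ss, S.IsDown a) :
    (starWeb ss s).IsGraph z := by
  refine ⟨?_, ?_, ?_, ?_, ?_⟩
  · rw [length_germs_starWeb]
    exact perm_starWeb ss.length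
  · intro e he
    obtain ⟨j, hj, rfl⟩ := mem_edges_starWeb.1 he
    simp only
    omega
  · rw [starWeb, List.pairwise_map]
    exact List.pairwise_lt_range
  · intro e he
    obtain ⟨j, hj, rfl⟩ := mem_edges_starWeb.1 he
    rw [letter_starWeb_bdry ss s hj, letter_starWeb_bulk ss s hj]
    rfl
  · intro b hb
    simp only [starWeb, List.mem_singleton] at hb
    subst hb
    refine (isCyclicFan_iff hz hF).2 ⟨_, _, rfl, by simpa using hne, hpath.reverse, ?_⟩
    intro a ha
    rw [List.mem_reverse, List.mem_map] at ha
    obtain ⟨c, hc, rfl⟩ := ha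
    exact Spectrum.isUp_bar.2 (hdown c hc)

/-- The star can be drawn: the edges from the bulk vertex, extended to the left, meet the boundary
in the right order. -/
theorem starWeb_isHalfPlaneWeb {F : Set ℤ} {z : ℤ → ℂ} (hz : IsParabolicOn F z)
    {ss : List S.Gen} {s : S.Gen} {o : Word S} (hF : SupportedOn F (s :: (ss.map S.bar).reverse))
    (hFs : SupportedOn F ss) (hne : ss ≠ []) (hdown : ∀ a ∈ ss, S.IsDown a)
    (hpath : IsPath o.start o.final ss) (hol : o.letters = [s])
    (hopath : IsPath o.start o.final o.letters) :
    ∃ ξ, (starWeb ss s).IsHalfPlaneWeb 1 z (ss.map letterWord) o ξ := by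
  have hF1 : ∀ a ∈ ss, SupportedOn F [a] := fun a ha => hFs.of_subset (by simpa using ha)
  have hFsgl : SupportedOn F [s] := hF.of_subset (by simp)
  obtain ⟨hos, hot⟩ : S.src s = o.start ∧ S.tgt s = o.final := by
    rw [hol] at hopath; exact hopath
  have hss : IsPath (S.src s) (S.tgt s) ss := by rw [hos, hot]; exact hpath
  have hs : S.IsDown s := by
    have := hss.reverse.lt_of_isUp (by
      intro a ha
      rw [List.mem_reverse, List.mem_map] at ha
      obtain ⟨c, hc, rfl⟩ := ha
      exact Spectrum.isUp_bar.2 (hdown c hc)) (by simpa using hne)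
    exact this
  set n := ss.length with hn
  set w := starWeb ss s with hw
  have hdim : w.dim = n + 2 := dim_starWeb ss s
  have hre : ∀ j (hj : j < n), 0 < (S.dir z ss[j]).re := fun j hj =>
    hz.re_dir_pos (hF1 _ (List.getElem_mem hj)) (hdown _ (List.getElem_mem hj))
  have hres := hz.re_dir_pos hFsgl hs
  -- the slopes of the edges increase along the boundary
  have hpairss : ss.Pairwise fun a b => S.src b ≤ S.tgt a := by
    have := hss.reverse.pairwise_of_isUp (by
      intro a ha
      rw [List.mem_reverse, List.mem_map] at ha
      obtain ⟨c, hc, rfl⟩ := ha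
      exact Spectrum.isUp_bar.2 (hdown c hc))
    rw [List.pairwise_reverse, List.pairwise_map] at this
    simpa only [S.src_bar, S.tgt_bar] using this
  -- the bulk vertex is placed at `1`, so that the height of a boundary vertex is, up to sign,
  -- the slope of its edge
  set f : ℕ → ℝ := fun j => (ss[j]?).elim (if j = n then 1 else 0)
    fun a => (S.dir z a).im / (S.dir z a).re with hf
  have hfj : ∀ j (hj : j < n), f j = (S.dir z ss[j]).im / (S.dir z ss[j]).re := fun j hj => by
    simp [hf, List.getElem?_eq_getElem hj]
  have hfn : f n = 1 := by simp [hf, hn]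
  have hfn1 : f (n + 1) = 0 := by simp [hf, hn]
  have hmono : ∀ i j (_ : i < n) (_ : j < n), i < j → f i < f j := by
    intro i j hi hj hij
    rw [hfj i hi, hfj j hj, div_lt_div_iff₀ (hre i hi) (hre j hj)]
    have h1 := hz.cross_pos (a := ss[i]) (b := ss[j]) (hFs.of_subset (by simp))
      (hdown _ (List.getElem_mem hi)) (hdown _ (List.getElem_mem hj))
      (List.pairwise_iff_getElem.1 hpairss i j hi hj hij)
    rw [cross_eq] at h1
    linarith
  set ξ : Fin w.dim → ℝ := fun j => f j.1 with hξ
  have hcoord : ∀ j, j < n + 2 → w.coord ξ j = f j := fun j hj =>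
    w.coord_of_lt ξ (by rw [hdim]; exact hj)
  have hposj : ∀ j, j < n → w.pos (-Complex.I * 1) ξ j = f j * (-Complex.I * 1) := fun j hj => by
    rw [← hcoord j (by omega)]
    exact pos_starWeb_bdry ss s _ ξ hj
  have hposn : w.pos (-Complex.I * 1) ξ n = 1 := by
    have h1 : w.pos (-Complex.I * 1) ξ n = w.coord ξ n + w.coord ξ (n + 1) * Complex.I :=
      pos_starWeb_bulk ss s _ ξ
    rw [h1, hcoord n (by omega), hcoord (n + 1) (by omega), hfn, hfn1]
    simp
  have hrej : ∀ j, j < n → (w.pos (-Complex.I * 1) ξ j).re = 0 ∧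
      (w.pos (-Complex.I * 1) ξ j).im = -f j := by
    intro j hj
    rw [hposj j hj]
    simp
  have hnum : w.numVertices = n + 1 := by
    rw [Web.numVertices, hw, bdry_length_starWeb]; rfl
  have hseg : ∀ j, j < n → ∀ x ∈ openSegment ℝ (w.pos (-Complex.I * 1) ξ j)
      (w.pos (-Complex.I * 1) ξ n), 0 < x.re ∧ x.re < 1 ∧ x.im = -(1 - x.re) * f j := by
    rintro j hj x ⟨a, b, ha, hb, hab, rfl⟩
    rw [hposn, hposj j hj]
    have h1 : (a • ((f j : ℂ) * (-Complex.I * 1)) + b • (1 : ℂ)).re = b := by simp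
    have h2 : (a • ((f j : ℂ) * (-Complex.I * 1)) + b • (1 : ℂ)).im = -(a * f j) := by simp
    rw [h1, h2]
    exact ⟨hb, by linarith, by rw [← hab]; ring⟩
  have howner : ∀ j, j < n → w.owner j = j ∧ w.owner (2 * n - j) = n := fun j hj =>
    edge_owners_starWeb hj
  have hownern : w.owner n = n := by
    rw [hw, hn, owner_starWeb ss s (by omega), min_self]
  have hdirn : w.dir z n = S.dir z s := Web.dir_eq _ (letter_starWeb_root ss s) z
  have hray : ∀ x ∈ {q | ∃ r : ℝ, 0 < r ∧ q = w.pos (-Complex.I * 1) ξ (w.owner n) +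
      r * w.dir z n}, 1 < x.re := by
    rintro x ⟨r, hr, rfl⟩
    rw [hownern, hposn, hdirn, Complex.add_re, Complex.one_re, Complex.re_ofReal_mul]
    have := mul_pos hr hres
    linarith
  have hsets : w.edgeSets (-Complex.I * 1) z ξ =
      ((List.range n).map fun j => openSegment ℝ (w.pos (-Complex.I * 1) ξ j)
        (w.pos (-Complex.I * 1) ξ n)) ++ [{q | ∃ r : ℝ, 0 < r ∧
          q = w.pos (-Complex.I * 1) ξ (w.owner n) + r * w.dir z n}] := by
    rw [Web.edgeSets]
    congr 1
    change List.map _ ((List.range ss.length).map fun j => (j, 2 * ss.length - j)) = _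
    rw [List.map_map]
    refine List.map_congr_left fun j hj => ?_
    rw [List.mem_range] at hj
    simp only [Function.comp_apply]
    rw [(howner j hj).1, (howner j hj).2]
  refine ⟨ξ, ⟨isGraph_starWeb hz hF hne hss hdown, ?_, rfl, ?_, ?_, ?_, ?_, ?_, ?_, ?_, ?_⟩⟩
  · refine ⟨?_, ?_, ?_, ?_⟩
    · intro e he
      obtain ⟨j, hj, rfl⟩ := mem_edges_starWeb.1 he
      refine ⟨1 / (S.dir z ss[j]).re, one_div_pos.2 (hre j hj), ?_⟩
      simp only
      rw [(howner j hj).1, (howner j hj).2, hposn, hposj j hj,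
        Web.dir_eq _ (letter_starWeb_bdry ss s hj), hfj j hj]
      have h0 := (hre j hj).ne'
      refine Complex.ext ?_ ?_
      · rw [Complex.re_ofReal_mul]
        field_simp
        simp
      · rw [Complex.im_ofReal_mul]
        simp
        ring
    · have haux : ∀ v v', v < v' → v' < n + 1 →
          w.pos (-Complex.I * 1) ξ v ≠ w.pos (-Complex.I * 1) ξ v' := by
        intro v v' hvv' hv' heq
        rcases Nat.lt_succ_iff_lt_or_eq.1 hv' with h1 | h1
        · have := congrArg Complex.im heq
          rw [(hrej v (by omega)).2, (hrej v' h1).2] at this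
          have := hmono v v' (by omega) h1 hvv'
          linarith
        · rw [h1, hposn] at heq
          have := congrArg Complex.re heq
          rw [(hrej v (by omega)).1] at this
          simp at this
      intro v v' hv hv' hne'
      rw [hnum] at hv hv'
      rcases lt_or_gt_of_ne hne' with h1 | h1
      · exact haux v v' h1 hv'
      · exact (haux v' v h1 hv).symm
    · rw [hsets, List.pairwise_append]
      refine ⟨?_, by simp, ?_⟩
      · rw [List.pairwise_map]
        refine List.pairwise_lt_range.imp_of_mem fun {i j} hi hj hij => ?_
        rw [List.mem_range] at hi hj
        rw [Set.disjoint_left]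
        intro x hx hx'
        obtain ⟨h1, h2, h3⟩ := hseg i hi x hx
        obtain ⟨-, -, h4⟩ := hseg j hj x hx'
        have h5 := hmono i j hi hj hij
        nlinarith
      · intro A hA B hB
        rw [List.mem_map] at hA
        obtain ⟨j, hj, rfl⟩ := hA
        rw [List.mem_range] at hj
        rw [List.mem_singleton] at hB
        subst hB
        rw [Set.disjoint_left]
        intro x hx hx'
        have h1 := (hseg j hj x hx).2.1
        have h2 := hray x hx'
        linarith
    · intro A hA v hv
      rw [hnum] at hv
      have hvre : (w.pos (-Complex.I * 1) ξ v).re ≤ 0 ∨ (w.pos (-Complex.I * 1) ξ v).re = 1 := by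
        rcases Nat.lt_succ_iff_lt_or_eq.1 hv with h1 | h1
        · exact Or.inl (hrej v h1).1.le
        · rw [h1, hposn]; exact Or.inr Complex.one_re
      intro hmem
      rw [hsets, List.mem_append, List.mem_map, List.mem_singleton] at hA
      rcases hA with ⟨j, hj, rfl⟩ | rfl
      · rw [List.mem_range] at hj
        obtain ⟨h1, h2, -⟩ := hseg j hj _ hmem
        rcases hvre with h3 | h3 <;> linarith
      · have := hray _ hmem
        rcases hvre with h3 | h3 <;> linarith
  · intro b hb
    obtain ⟨a, ha, rfl⟩ := List.mem_map.1 hb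
    refine (isHalfPlaneFan_right_iff hz (hF1 a ha)).2 ⟨⟨rfl, ?_⟩, by simp [letterWord], ?_⟩
    · simp [letterWord, Word.final]
    · simpa [letterWord] using hdown a ha
  · intro i j hij hj
    have hj' : j.1 < n := lt_of_lt_of_eq hj (bdry_length_starWeb ss s)
    exact hmono i j (lt_trans hij hj') hj' hij
  · intro v hv hv'
    rw [hw, bdry_length_starWeb, ← hn] at hv
    rw [hnum] at hv'
    have : v = n := by omega
    rw [this, hposn]
    simp
  · rw [hol]
    change [w.letter n] = [some s]
    rw [hw, hn, letter_starWeb_root ss s]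
  · refine (isHalfPlaneFan_right_iff hz (by rw [hol]; exact hFsgl)).2 ⟨hopath, by rw [hol]; simp,
    ?_⟩
    rw [hol]
    simpa using hs
  · rw [List.isChain_map]
    have hchain : ∀ {k l : ℤ} {L : List S.Gen}, IsPath k l L →
        L.IsChain fun a b => (letterWord a).final = (letterWord b).start := by
      intro k l L
      induction L generalizing k with
      | nil => simp
      | cons a L ih =>
        intro h
        cases L with
        | nil => simp
        | cons b L =>
          rw [List.isChain_cons_cons]
          refine ⟨?_, ih h.2⟩
          simpa [letterWord, Word.final] using h.2.1.symm
    exact hchain hss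
  · obtain ⟨a, L, hL⟩ := List.exists_cons_of_ne_nil hne
    rw [hL] at hpath ⊢
    simpa [letterWord] using hpath.1
  · intro a ha
    have h1 := isPath_iff_map.1 hpath
    have h2 := congrArg List.getLast? h1
    rw [List.getLast?_concat, List.getLast?_cons, List.getLast?_map] at h2
    rw [List.getLast?_map] at ha
    obtain ⟨c, hc, rfl⟩ := Option.mem_map.1 ha
    rw [Option.mem_def] at hc
    rw [hc] at h2
    simpa [letterWord, Word.final] using h2

theorem moduliDim_starWeb {z : ℤ → ℂ} (ss : List S.Gen) (s : S.Gen)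
    (hre : ∀ a ∈ ss, (S.dir z a).re ≠ 0) :
    (starWeb ss s).moduliDim (-Complex.I * 1) z = 2 := by
  have hdim := dim_starWeb ss s
  have h1 := (starWeb ss s).dim_le_moduliDim_add (-Complex.I * 1) z
  have h2 : (starWeb ss s).edges.length = ss.length := by simp [starWeb]
  have h3 : (starWeb ss s).moduliDim (-Complex.I * 1) z ≤ 2 := by
    -- the position of the bulk vertex determines the positions of the boundary vertices
    refine (starWeb ss s).moduliDim_le _ z (LinearMap.funLeft ℝ ℝ fun i : Fin 2 =>
      (⟨ss.length + i.1, by omega⟩ : Fin (starWeb ss s).dim)) ?_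
    intro ξ hξ h0
    have hx : (starWeb ss s).coord ξ ss.length = 0 := by
      rw [Web.coord_of_lt _ ξ (by omega)]; exact congrFun h0 0
    have hy : (starWeb ss s).coord ξ (ss.length + 1) = 0 := by
      rw [Web.coord_of_lt _ ξ (by omega)]; exact congrFun h0 1
    have hc : ∀ j, (starWeb ss s).coord ξ j = 0 := by
      intro j
      rcases lt_trichotomy j ss.length with h | h | h
      · have h4 := hξ _ (mem_edges_starWeb.2 ⟨j, h, rfl⟩)
        rw [slopeForm_starWeb ss s z ξ h, hx, hy, zero_add, mul_zero, sub_zero] at h4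
        exact (mul_eq_zero.1 h4).resolve_left (hre _ (List.getElem_mem h))
      · rw [h, hx]
      · rcases Nat.lt_or_ge (ss.length + 1) j with h5 | h5
        · exact dif_neg (by omega)
        · rw [show j = ss.length + 1 by omega, hy]
    funext j
    rw [← Web.coord_of_lt _ ξ j.2]
    exact hc j
  omega

end Star

section Star

variable {S : Spectrum.{u}}

/-- Block elimination: the determinant of a matrix with invertible diagonal upper left block. -/
theorem det_fromBlocks_diagonal {n : ℕ} (a : Fin n → ℝ) (B : Matrix (Fin n) (Fin 2) ℝ)
    (C : Matrix (Fin 2) (Fin n) ℝ) (E : Matrix (Fin 2) (Fin 2) ℝ) (ha : ∀ i, a i ≠ 0) :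
    (Matrix.fromBlocks (Matrix.diagonal a) B C E).det =
      (∏ i, a i) * (E - C * Matrix.of fun i j => B i j / a i).det := by
  set G : Matrix (Fin n) (Fin 2) ℝ := Matrix.of fun i j => B i j / a i with hG
  have hAG : Matrix.diagonal a * G = B := by
    ext i j
    rw [Matrix.diagonal_mul, hG, Matrix.of_apply]
    field_simp [ha i]
  have h1 : Matrix.fromBlocks (Matrix.diagonal a) B C E * Matrix.fromBlocks 1 (-G) 0 1 =
      Matrix.fromBlocks (Matrix.diagonal a) 0 C (E - C * G) := by
    rw [Matrix.fromBlocks_multiply]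
    congr 1
    · simp
    · rw [Matrix.mul_neg, hAG]; simp
    · simp
    · rw [Matrix.mul_neg, Matrix.mul_one]; abel
  have h2 := congrArg Matrix.det h1
  rw [Matrix.det_mul, Matrix.det_fromBlocks_zero₂₁, Matrix.det_fromBlocks_zero₁₂,
    Matrix.det_diagonal] at h2
  simpa using h2

/-- The sign of a determinant of rows can be computed on any index type. -/
theorem det_rows_eq {d m : ℕ} {rows : List (Fin d → ℝ)} (h : rows.length = d)
    (e : Fin m ⊕ Fin 2 ≃ Fin d) (M : Matrix (Fin m ⊕ Fin 2) (Fin m ⊕ Fin 2) ℝ)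
    (hM : ∀ i j, (rows[(e i).1]'(by rw [h]; exact (e i).2)) (e j) = M i j) :
    (Matrix.of fun i j : Fin d => rows.get (i.cast h.symm) j).det = M.det := by
  rw [← Matrix.det_submatrix_equiv_self e]
  congr 1
  ext i j
  rw [Matrix.submatrix_apply, Matrix.of_apply, ← hM]
  rfl

/-- A star is positively oriented. -/
theorem orientation_starWeb {z : ℤ → ℂ} {ss : List S.Gen} {s : S.Gen} {o : Word S}
    (hre : ∀ a ∈ ss, 0 < (S.dir z a).re) {ξ : Fin (starWeb ss s).dim → ℝ}
    (h : (starWeb ss s).IsHalfPlaneWeb 1 z (ss.map letterWord) o ξ) :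
    (starWeb ss s).orientation (-Complex.I * 1) [-Complex.I * 1] z ξ = 1 := by
  set n := ss.length with hn
  have hdim : (starWeb ss s).dim = n + 2 := dim_starWeb ss s
  set c := (starWeb ss s).coord ξ with hc
  set a : Fin n → ℝ := fun j => (S.dir z ss[j]).re with ha
  set b : Fin n → ℝ := fun j => (S.dir z ss[j]).im with hb
  have hapos : ∀ j, 0 < a j := fun j => hre _ (List.getElem_mem _)
  set x := c n with hx
  set y := c (n + 1) with hy
  have hxpos : 0 < x := by
    have h1 := h.bulk_interior n (by rw [bdry_length_starWeb])
      (by rw [Web.numVertices, bdry_length_starWeb]; exact Nat.lt_succ_self n)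
    have h2 := pos_starWeb_bulk ss s (-Complex.I * 1) ξ
    rw [h2] at h1
    simpa using h1
  -- the edges have the prescribed slopes, so the position of the bulk vertex determines those of
  -- the boundary vertices
  have hconstraint : ∀ j : Fin n, c j = b j / a j * x - y := by
    intro j
    have hmem := mem_edges_starWeb (s := s).2 ⟨j.1, j.2, rfl⟩
    obtain ⟨r, hr, h1⟩ := h.drawing.slope _ hmem
    have h2 := slopeForm_starWeb ss s z ξ j.2
    have h3 : (starWeb ss s).slopeForm (-Complex.I * 1) z (j.1, 2 * ss.length - j.1) ξ = 0 := by
      rw [Web.slopeForm, h1, mul_assoc, Complex.mul_conj, ← Complex.ofReal_mul, Complex.ofReal_im]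
    rw [h3] at h2
    have h4 : 0 = a j * (y + c j) - b j * x := h2
    have h5 := (hapos j).ne'
    field_simp
    linarith
  have hE' : (starWeb ss s).edges.length = n := by simp [starWeb, hn]
  set rows : List (Fin (starWeb ss s).dim → ℝ) :=
    (starWeb ss s).edges.map (fun e j => (starWeb ss s).slopeForm (-Complex.I * 1) z e
      (Pi.single j 1)) ++ [-Complex.I * 1].map (starWeb ss s).translation ++ [ξ] with hrows
  have hlen : rows.length = (starWeb ss s).dim := by
    refine Eq.trans ?_ hdim.symm
    simp [hrows, hE']
  rw [Web.orientation, dif_pos hlen]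
  set B : Matrix (Fin n) (Fin 2) ℝ := Matrix.of fun i j => ![-b i, a i] j with hB
  set C : Matrix (Fin 2) (Fin n) ℝ := Matrix.of fun i j => ![1, c j] i with hC
  set E : Matrix (Fin 2) (Fin 2) ℝ := !![0, -1; x, y] with hE
  let e : Fin n ⊕ Fin 2 ≃ Fin (starWeb ss s).dim := finSumFinEquiv.trans (finCongr hdim.symm)
  have hel : ∀ i : Fin n, (e (Sum.inl i)).1 = i.1 := fun i => rfl
  have her : ∀ i : Fin 2, (e (Sum.inr i)).1 = n + i.1 := fun i => rfl
  have hedgelen : ((starWeb ss s).edges.map (fun e j => (starWeb ss s).slopeForm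
      (-Complex.I * 1) z e (Pi.single j (1 : ℝ)))).length = n := by
    simp [starWeb, hn]
  have hcs : ∀ (k : Fin (starWeb ss s).dim) (j : ℕ),
      (starWeb ss s).coord (Pi.single k (1 : ℝ)) j = if j = k.1 then 1 else 0 := by
    intro k j
    by_cases hj : j < (starWeb ss s).dim
    · rw [Web.coord_of_lt _ _ hj, Pi.single_apply]
      simp only [Fin.ext_iff]
    · rw [Web.coord, dif_neg hj, if_neg]
      have := k.2
      omega
  have hdet := det_rows_eq hlen e (Matrix.fromBlocks (Matrix.diagonal a) B C E) (by
    intro i j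
    rcases i with i | i
    · have h1 : rows[(e (Sum.inl i)).1]'(by rw [hlen]; exact (e _).2) =
          fun j => (starWeb ss s).slopeForm (-Complex.I * 1) z (i.1, 2 * ss.length - i.1)
            (Pi.single j 1) := by
        simp only [hrows, hel]
        rw [List.getElem_append_left (by simp [hE']),
          List.getElem_append_left (by rw [hedgelen]; exact i.2)]
        simp [starWeb]
      rw [h1]
      simp only
      rw [slopeForm_starWeb ss s z _ i.2, hcs, hcs, hcs]
      rcases j with j | j
      · have h2 := j.2
        rw [hel, if_neg (show ¬ ss.length + 1 = j.1 by omega),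
          if_neg (show ¬ ss.length = j.1 by omega), Matrix.fromBlocks_apply₁₁,
          Matrix.diagonal_apply]
        simp only [Fin.ext_iff]
        split_ifs <;> simp [ha]
      · have h2 := i.2
        rw [her, Matrix.fromBlocks_apply₁₂, hB, Matrix.of_apply]
        fin_cases j
        · rw [if_neg (show ¬ ss.length + 1 = n + 0 by omega), if_neg (show ¬ i.1 = n + 0 by omega),
            if_pos (show ss.length = n + 0 by omega)]
          simp [hb]
        · rw [if_pos (show ss.length + 1 = n + 1 by omega), if_neg (show ¬ i.1 = n + 1 by omega),
            if_neg (show ¬ ss.length = n + 1 by omega)]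
          simp [ha]
    · fin_cases i
      · have h1 : rows[(e (Sum.inr 0)).1]'(by rw [hlen]; exact (e _).2) =
            (starWeb ss s).translation (-Complex.I * 1) := by
          simp only [hrows, her]
          rw [List.getElem_append_left (by simp [hE']),
            List.getElem_append_right (by rw [hedgelen]; simp)]
          simp
        refine (congrFun h1 (e j)).trans ?_
        rw [Web.translation, bdry_length_starWeb]
        rcases j with j | j
        · rw [hel, if_pos j.2]; rfl
        · rw [her, if_neg (by omega), ← hn, Nat.add_sub_cancel_left]
          fin_cases j <;> simp [hE]
      · have h1 : rows[(e (Sum.inr 1)).1]'(by rw [hlen]; exact (e _).2) = ξ := by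
          simp only [hrows, her]
          rw [List.getElem_append_right (by simp [hE'])]
          simp
        refine (congrFun h1 (e j)).trans ?_
        rw [← Web.coord_of_lt _ ξ (e j).2]
        rcases j with j | j
        · rw [hel]; rfl
        · rw [her]
          fin_cases j <;> simp [hE, hx, hy, hc])
  have hpos : 0 < (Matrix.fromBlocks (Matrix.diagonal a) B C E).det := by
    rw [det_fromBlocks_diagonal a B C E fun i => (hapos i).ne']
    refine mul_pos (Finset.prod_pos fun i _ => hapos i) ?_
    rw [Matrix.det_fin_two]
    simp only [Matrix.sub_apply, Matrix.mul_apply, Matrix.of_apply, hB, hC, hE,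
      Matrix.cons_val_zero, Matrix.cons_val_one, one_mul, Matrix.cons_val', Matrix.cons_val_fin_one]
    set β : Fin n → ℝ := fun j => b j / a j with hβ
    have e1 : ∑ j : Fin n, -b j / a j = -∑ j, β j := by
      rw [← Finset.sum_neg_distrib]
      exact Finset.sum_congr rfl fun j _ => by rw [hβ]; ring
    have e2 : ∑ j : Fin n, a j / a j = n := by
      rw [Finset.sum_congr rfl fun j _ => div_self (hapos j).ne']
      simp
    have e3 : ∑ j : Fin n, c j * (-b j / a j) = -(x * ∑ j, β j ^ 2 - y * ∑ j, β j) := by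
      rw [Finset.mul_sum, Finset.mul_sum, ← Finset.sum_sub_distrib, ← Finset.sum_neg_distrib]
      refine Finset.sum_congr rfl fun j _ => ?_
      rw [hconstraint j, hβ]
      ring
    have e4 : ∑ j : Fin n, c j * (a j / a j) = x * ∑ j, β j - n * y := by
      rw [Finset.mul_sum]
      have : (n : ℝ) * y = ∑ _j : Fin n, y := by simp
      rw [this, ← Finset.sum_sub_distrib]
      refine Finset.sum_congr rfl fun j _ => ?_
      rw [div_self (hapos j).ne', hconstraint j, hβ]
      ring
    rw [e1, e2, e3, e4]
    -- the two-by-two determinant left after eliminating the edges is positive by Cauchy–Schwarz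
    have hcs : (∑ j, β j) ^ 2 ≤ n * ∑ j, β j ^ 2 := by
      have := sq_sum_le_card_mul_sum_sq (s := (Finset.univ : Finset (Fin n))) (f := β)
      simpa using this
    have hQ : 0 ≤ ∑ j, β j ^ 2 := Finset.sum_nonneg fun j _ => sq_nonneg _
    have hn0 : (0 : ℝ) ≤ n := Nat.cast_nonneg n
    have h1 : 0 ≤ x * (n * ∑ j, β j ^ 2 - (∑ j, β j) ^ 2) :=
      mul_nonneg hxpos.le (by linarith)
    have h2 : 0 ≤ x * (n + ∑ j, β j ^ 2) := mul_nonneg hxpos.le (by linarith)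
    nlinarith
  rw [hdet, sign_pos hpos]
  rfl

end Star

section StarSign

variable {S : Spectrum.{u}}

/-- The Koszul sign of a family of nested pairs of total degree one, around a central symbol. -/
theorem koszul_nested (d : ℕ → ℤ) {n : ℕ} (hd : ∀ j < n, d j + d (2 * n - j) = 1) (k a : ℕ)
    (ha : a + k = n) :
    koszul d ((List.range' a k).flatMap (fun j => [j, 2 * n - j]) ++ [n]) =
      sgn ((List.range' a k).map fun j => d (2 * n - j) * ((n - 1 - j : ℤ) + d n)).sum := by
  induction k generalizing a with
  | zero => simp [koszul]
  | succ k ih =>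
    have hsum : ∀ l : List ℕ, (∀ j ∈ l, j < n) →
        ((l.flatMap fun j => [j, 2 * n - j]).map d).sum = l.length := by
      intro l hl
      induction l with
      | nil => simp
      | cons j l ih' =>
        rw [List.flatMap_cons, List.map_append, List.sum_append,
          ih' fun i hi => hl i (by simp [hi])]
        have := hd j (hl j (by simp))
        simp only [List.map_cons, List.map_nil, List.sum_cons, List.sum_nil, List.length_cons]
        push_cast
        linarith
    have hmem : ∀ b ∈ (List.range' (a + 1) k).flatMap (fun j => [j, 2 * n - j]) ++ [n],
        a < b ∧ b < 2 * n - a := by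
      intro b hb
      simp only [List.mem_append, List.mem_flatMap, List.mem_range'_1, List.mem_cons,
        List.not_mem_nil, or_false] at hb
      rcases hb with ⟨j, hj, rfl | rfl⟩ | rfl <;> omega
    rw [List.range'_succ, List.flatMap_cons, List.cons_append, List.cons_append,
      List.singleton_append, List.cons_append, koszul_cons_of_lt, koszul_cons_of_gt,
      ih (a + 1) (by omega), List.map_append, List.sum_append, hsum, List.map_cons, List.sum_cons,
      List.map_cons, List.sum_cons, sgn_add]
    · congr 2
      rw [List.length_range']
      have : (k : ℤ) = n - 1 - a := by omega
      simp [this]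
    · intro j hj
      rw [List.mem_range'_1] at hj
      omega
    · exact fun b hb => (hmem b hb).2
    · intro b hb
      rcases List.mem_cons.1 hb with rfl | hb
      · omega
      · exact (hmem b hb).1

theorem bdrySign_letterWord (D : InfraredData S) (d : ℕ → ℤ) {n : ℕ} (ss : List S.Gen) (a : ℕ)
    (ha : a + ss.length = n) (hd : ∀ i (hi : i < ss.length), d (a + i) = D.deg ss[i]) :
    D.bdrySign (ss.map letterWord) =
      sgn ((List.range' a ss.length).map fun j => d j * (n - 1 - j : ℤ)).sum := by
  induction ss generalizing a with
  | nil => simp [InfraredData.bdrySign]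
  | cons s ss ih =>
    rw [List.length_cons] at ha
    rw [List.map_cons, InfraredData.bdrySign, List.length_cons, List.range'_succ, List.map_cons,
      List.sum_cons, sgn_add, ih (a + 1) (by omega)]
    · congr 2
      have h0 := hd 0 (by simp)
      rw [add_zero] at h0
      have h1 : D.degWord (letterWord s) = D.deg s := by simp [InfraredData.degWord, letterWord]
      rw [h0, h1, List.length_map, List.getElem_cons_zero]
      congr 1
      omega
    · intro i hi
      have := hd (i + 1) (by simpa using hi)
      rw [List.getElem_cons_succ] at this
      rw [← this]
      congr 1
      omega

theorem sum_range'_sub (n : ℕ) :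
    ((List.range' 0 n).map fun j : ℕ => (n - 1 - j : ℤ)).sum = (n * (n - 1) / 2 : ℕ) := by
  have h : ((List.range' 0 n).map fun j : ℕ => (n - 1 - j : ℤ)).sum =
      ∑ j ∈ Finset.range n, ((n - 1 - j : ℕ) : ℤ) := by
    rw [← List.range_eq_range', ← Finset.sum_map_val]
    simp only [Finset.range_val, Multiset.range, Multiset.map_coe, Multiset.sum_coe]
    refine congrArg List.sum (List.map_congr_left fun j hj => ?_)
    have := List.mem_range.1 hj
    omega
  rw [h, Finset.sum_range_reflect fun j : ℕ => (j : ℤ), ← Nat.cast_sum, Finset.sum_range_id]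

/-- The contraction of a star is, up to the sign given by the degree of the outgoing soliton, the
coefficient of the interior amplitude. -/
theorem InfraredData.contraction_starWeb (D : InfraredData S) (ss : List S.Gen) (s : S.Gen)
    (c : ℂ) :
    D.contraction (starWeb ss s) c =
      c * sgn (D.deg s) * D.amp (s :: (ss.map S.bar).reverse) := by
  set n := ss.length with hn
  set d : ℕ → ℤ := fun p => ((starWeb ss s).letter p).elim 0 D.deg with hd
  have hdj : ∀ j (hj : j < n), d j = D.deg ss[j] := fun j hj => by
    rw [hd]; simp only; rw [letter_starWeb_bdry ss s hj]; rfl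
  have hdj' : ∀ j (hj : j < n), d (2 * n - j) = D.deg (S.bar ss[j]) := fun j hj => by
    rw [hd]; simp only; rw [letter_starWeb_bulk ss s hj]; rfl
  have hdn : d n = D.deg s := by
    rw [hd]; simp only; rw [letter_starWeb_root ss s]; rfl
  have hone : ∀ j < n, d j + d (2 * n - j) = 1 := fun j hj => by
    rw [hdj j hj, hdj' j hj, D.deg_bar]
  have hk : koszul d ((starWeb ss s).edges.flatMap (fun e => [e.1, e.2]) ++ (starWeb ss s).outs) =
      sgn ((List.range' 0 n).map fun j => d (2 * n - j) * ((n - 1 - j : ℤ) + d n)).sum := by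
    rw [← koszul_nested d hone n 0 (by omega)]
    congr 2
    change ((List.range n).map fun j => (j, 2 * n - j)).flatMap _ = _
    rw [List.flatMap_map, List.range_eq_range']
  have hb : D.bdrySign (starWeb ss s).bdry =
      sgn ((List.range' 0 n).map fun j => d j * (n - 1 - j : ℤ)).sum :=
    bdrySign_letterWord D d ss 0 (by omega) fun i hi => by rw [zero_add]; exact hdj i hi
  have hE : (starWeb ss s).edges.length = n := by simp [starWeb, hn]
  have hsum : ((List.range' 0 n).map fun j => d (2 * n - j)).sum =
      ((ss.map S.bar).reverse.map D.deg).sum := by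
    rw [List.map_reverse, List.sum_reverse, List.map_map, ← List.range_eq_range']
    congr 1
    refine List.ext_getElem (by simp [hn]) fun i h1 h2 => ?_
    have h3 : i < n := by simpa using h1
    simp [hdj' i h3]
  -- the boundary sign and the Koszul sign of the nested pairs combine, since `|a| + |bar a| = 1`,
  -- to the sign of moving the outgoing soliton past the duals of the arguments
  have hsgn : sgn ((n * (n - 1) / 2 : ℕ)) * sgn ((List.range' 0 n).map fun j =>
      d j * (n - 1 - j : ℤ)).sum * sgn ((List.range' 0 n).map fun j =>
      d (2 * n - j) * ((n - 1 - j : ℤ) + d n)).sum =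
      sgn (((ss.map S.bar).reverse.map D.deg).sum * D.deg s) := by
    have h1 : ((List.range' 0 n).map fun j => d j * (n - 1 - j : ℤ)).sum +
        ((List.range' 0 n).map fun j => d (2 * n - j) * ((n - 1 - j : ℤ) + d n)).sum =
        (n * (n - 1) / 2 : ℕ) + ((ss.map S.bar).reverse.map D.deg).sum * D.deg s := by
      rw [← sum_range'_sub, ← hsum, ← hdn, ← List.sum_map_mul_right, ← List.sum_map_add,
        ← List.sum_map_add]
      refine congrArg List.sum (List.map_congr_left fun j hj => ?_)
      rw [List.mem_range'_1] at hj
      have := hone j (by omega)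
      linear_combination (n - 1 - j : ℤ) * this
    rw [mul_assoc, ← sgn_add, h1, sgn_add, ← mul_assoc, sgn_mul_self, one_mul]
  rw [InfraredData.contraction, hE, hb, hk]
  have hbulk : (starWeb ss s).bulk = [s :: (ss.map S.bar).reverse] := rfl
  rw [hbulk]
  simp only [List.map_cons, List.map_nil, List.prod_cons, List.prod_nil, List.length_singleton,
    Nat.factorial_one, Nat.cast_one, div_one, mul_one]
  by_cases h0 : D.amp (s :: (ss.map S.bar).reverse) = 0
  · rw [h0]; ring
  · have hdeg := D.amp_deg _ h0
    rw [List.map_cons, List.sum_cons] at hdeg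
    congr 1
    rw [mul_assoc, mul_assoc, ← mul_assoc (sgn _), hsgn]
    congr 1
    refine sgn_congr ?_
    rw [show ((ss.map S.bar).reverse.map D.deg).sum = 2 - D.deg s by linarith]
    have := Int.even_mul_succ_self (D.deg s)
    have h2 : (2 - D.deg s) * D.deg s - D.deg s =
        2 * D.deg s - D.deg s * (D.deg s + 1) := by ring
    rw [h2]
    exact (even_two_mul _).sub this

end StarSign

/-! ### The operations of the right half-plane -/

section RightCoeff

variable {S : Spectrum.{u}} {D : InfraredData S} {z : ℝ → ℤ → ℂ}

theorem IsAsymptoticallyParabolic.eventually_supportedOn (hz : IsAsymptoticallyParabolic z)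
    (L : List S.Gen) : ∃ F : Set ℤ, SupportedOn F L ∧ ∀ᶠ t : ℝ in 𝓝[>] 0,
      IsParabolicOn F (z t) := by
  obtain ⟨F, hF, hL⟩ := exists_supportedOn L
  exact ⟨F, hL, hz F hF⟩

theorem eventually_of_mem_halfPlaneTaut {ν : ℂ} {ws : List (Word S)} {o : Word S} {w : Web S}
    (h : w ∈ InfraredData.halfPlaneTaut z ν ws o) :
    ∀ᶠ t : ℝ in 𝓝[>] 0, (∃ ξ, w.IsHalfPlaneWeb ν (z t) ws o ξ) ∧
      w.moduliDim (-Complex.I * ν) (z t) = 2 := h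

theorem halfPlaneCoeff_eq_of_unique {ν : ℂ} {ws : List (Word S)} {o : Word S} {w : Web S}
    (h : w ∈ InfraredData.halfPlaneTaut z ν ws o)
    (huniq : ∀ w' ∈ InfraredData.halfPlaneTaut z ν ws o, w' = w) :
    D.halfPlaneCoeff z ν ws o = D.contraction w (w.stableSign (-Complex.I * ν) [-Complex.I * ν] z
      (fun t ξ => w.IsHalfPlaneWeb ν (z t) ws o ξ)) := by
  have : InfraredData.halfPlaneTaut z ν ws o = {w} :=
    Set.eq_singleton_iff_unique_mem.2 ⟨h, huniq⟩
  rw [InfraredData.halfPlaneCoeff, this]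
  exact finsum_mem_singleton

theorem exists_halfPlaneTaut_of_coeff_ne_zero {ν : ℂ} {ws : List (Word S)} {o : Word S}
    (h : D.halfPlaneCoeff z ν ws o ≠ 0) : ∃ w, w ∈ InfraredData.halfPlaneTaut z ν ws o := by
  obtain ⟨w, hw, -⟩ := exists_ne_zero_of_finsum_mem_ne_zero h
  exact ⟨w, hw⟩

theorem label_first_of_coeff_ne_zero {ν : ℂ} {ws : List (Word S)} {o : Word S}
    (h : D.halfPlaneCoeff z ν ws o ≠ 0) : ∀ a ∈ ws.head?, a.start = o.start := by
  obtain ⟨w, hw⟩ := exists_halfPlaneTaut_of_coeff_ne_zero h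
  obtain ⟨t, ⟨ξ, hξ⟩, -⟩ := (eventually_of_mem_halfPlaneTaut hw).exists
  exact hξ.label_first

theorem mem_halfPlaneTaut_right (hz : IsAsymptoticallyParabolic z) {ws : List (Word S)} {o : Word S}
    (hne : ws ≠ []) {w : Web S} (hw : w ∈ InfraredData.halfPlaneTaut z 1 ws o) :
    (∃ w₁ w₂, ws = [w₁, w₂] ∧ w = pairWeb w₁ w₂ ∧ o.letters = w₁.letters ++ w₂.letters) ∨
      ∃ ss s, ws = ss.map letterWord ∧ o.letters = [s] ∧ w = starWeb ss s := by
  obtain ⟨F, hF, hpar⟩ := hz.eventually_supportedOn w.vertices.flatten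
  obtain ⟨t, ⟨⟨ξ, hξ⟩, hm⟩, hzt⟩ := ((eventually_of_mem_halfPlaneTaut hw).and hpar).exists
  by_cases hb : w.bulk = []
  · left
    have hv : w.vertices.flatten = ws.flatMap Word.letters := by
      rw [Web.vertices, hb, List.append_nil, hξ.bdry_eq, List.flatMap]
    have hdown : ∀ s ∈ w.vertices.flatten, S.IsDown s := by
      intro s hs
      rw [hv, List.mem_flatMap] at hs
      obtain ⟨b, hb, hsb⟩ := hs
      refine ((isHalfPlaneFan_right_iff hzt (hF.of_subset ?_)).1 (hξ.bdry_fan b hb)).2.2 s hsb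
      intro a ha
      rw [hv]
      exact List.mem_flatMap.2 ⟨b, hb, ha⟩
    have hedges : w.edges = [] := by
      rw [List.eq_nil_iff_forall_not_mem]
      intro e he
      obtain ⟨s, h1, h2⟩ := hξ.graph.exists_edge_letter he
      exact Spectrum.not_isDown.2 (Spectrum.isUp_bar.2 (hdown s (w.letter_mem h1)))
        (hdown _ (w.letter_mem h2))
    have hosub : o.letters ⊆ w.vertices.flatten := by
      intro s hs
      have h1 : some s ∈ w.outs.map w.letter := by
        rw [hξ.infinity]; exact List.mem_map_of_mem hs
      obtain ⟨p, -, hp⟩ := List.mem_map.1 h1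
      exact w.letter_mem hp
    have holen := ((isHalfPlaneFan_right_iff hzt (hF.of_subset hosub)).1 hξ.infinity_fan).2.1
    have hlen : (ws.flatMap Word.letters).length = o.letters.length := by
      have h1 := hξ.graph.length_germs_eq
      have h2 := congrArg List.length hξ.infinity
      rw [hedges, Web.length_germs, hv] at h1
      simp only [List.length_map, List.length_nil] at h1 h2
      omega
    have hshort : ∀ l : List S.Gen, l.length ≤ 1 → l.Pairwise fun a b => S.tgt a < S.tgt b := by
      intro l hl
      rcases l with _ | ⟨a, _ | ⟨b, l⟩⟩
      · simp
      · simp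
      · simp at hl
    exact hξ.eq_pairWeb hb hm (hshort _ (by omega)) (hshort _ holen)
  · right
    exact hξ.eq_starWeb hzt hF hne hb hm

theorem halfPlaneTaut_right_unique (hz : IsAsymptoticallyParabolic z) {ws : List (Word S)}
    {o : Word S} (hne : ws ≠ []) : ∀ w ∈ InfraredData.halfPlaneTaut z 1 ws o,
      ∀ w' ∈ InfraredData.halfPlaneTaut z 1 ws o, w = w' := by
  have hinj : Function.Injective (letterWord (S := S)) := fun a b h => by
    simpa [letterWord] using congrArg Word.letters h
  have hmix : ∀ {w₁ w₂ : Word S} {ss : List S.Gen} {s : S.Gen}, ws = [w₁, w₂] →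
      o.letters = w₁.letters ++ w₂.letters → ws = ss.map letterWord → o.letters = [s] → False := by
    intro w₁ w₂ ss s h1 h2 h3 h4
    have h5 := congrArg (List.flatMap Word.letters) (h1.symm.trans h3)
    rw [flatMap_letters_letterWord] at h5
    have h6 := congrArg List.length h5
    have h7 := congrArg List.length (h1.symm.trans h3)
    rw [h2] at h4
    have h8 := congrArg List.length h4
    simp at h6 h7 h8
    omega
  intro w hw w' hw'
  rcases mem_halfPlaneTaut_right hz hne hw with ⟨w₁, w₂, h1, rfl, h3⟩ | ⟨ss, s, h1, h2, rfl⟩ <;>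
    rcases mem_halfPlaneTaut_right hz hne hw' with ⟨w₁', w₂', h1', rfl, h3'⟩ |
      ⟨ss', s', h1', h2', rfl⟩
  · rw [h1] at h1'
    simp only [List.cons.injEq, and_true] at h1'
    rw [h1'.1, h1'.2]
  · exact (hmix h1 h3 h1' h2').elim
  · exact (hmix h1' h3' h1 h2).elim
  · rw [h1] at h1'
    rw [h2, List.cons.injEq] at h2'
    rw [List.map_injective_iff.2 hinj h1', h2'.1]

theorem halfPlaneTaut_right_finite (hz : IsAsymptoticallyParabolic z) {ws : List (Word S)}
    {o : Word S} (hne : ws ≠ []) : (InfraredData.halfPlaneTaut z 1 ws o).Finite :=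
  Set.Subsingleton.finite fun w hw w' hw' => halfPlaneTaut_right_unique hz hne w hw w' hw'

theorem shape_of_halfPlaneCoeff_right_ne_zero (hz : IsAsymptoticallyParabolic z)
    {ws : List (Word S)} {o : Word S} (hne : ws ≠ []) (h : D.halfPlaneCoeff z 1 ws o ≠ 0) :
    (∃ w₁ w₂, ws = [w₁, w₂] ∧ o.letters = w₁.letters ++ w₂.letters) ∨
      ∃ (ss : List S.Gen) (s : S.Gen), ws = ss.map letterWord ∧ o.letters = [s] := by
  obtain ⟨w, hw⟩ := exists_halfPlaneTaut_of_coeff_ne_zero h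
  rcases mem_halfPlaneTaut_right hz hne hw with ⟨w₁, w₂, h1, -, h2⟩ | ⟨ss, s, h1, h2, -⟩
  · exact Or.inl ⟨w₁, w₂, h1, h2⟩
  · exact Or.inr ⟨ss, s, h1, h2⟩

theorem halfPlaneCoeff_star (hz : IsAsymptoticallyParabolic z) {ss : List S.Gen} {s : S.Gen}
    {o : Word S} (hne : ss ≠ []) (hdown : ∀ a ∈ ss, S.IsDown a)
    (hpath : IsPath o.start o.final ss) (hol : o.letters = [s]) (hoc : o.Composable) :
    D.halfPlaneCoeff z 1 (ss.map letterWord) o =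
      sgn (D.deg s) * D.amp (s :: (ss.map S.bar).reverse) := by
  obtain ⟨F, hF, hpar⟩ := hz.eventually_supportedOn (ss ++ s :: (ss.map S.bar).reverse)
  have hFs : SupportedOn F ss := hF.of_subset (by simp)
  have hre : ∀ t, IsParabolicOn F (z t) → ∀ a ∈ ss, 0 < (S.dir (z t) a).re := fun t ht a ha =>
    ht.re_dir_pos (hFs.of_subset (by simpa using ha)) (hdown a ha)
  have hne' : ss.map letterWord ≠ [] := by simpa using hne
  have hmem : starWeb ss s ∈ InfraredData.halfPlaneTaut z 1 (ss.map letterWord) o := by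
    refine hpar.mono fun t ht => ⟨?_, moduliDim_starWeb ss s fun a ha => (hre t ht a ha).ne'⟩
    exact starWeb_isHalfPlaneWeb ht (hF.of_subset (by simp)) hFs hne hdown hpath hol
      (Word.composable_iff.1 hoc)
  rw [halfPlaneCoeff_eq_of_unique hmem
      fun w' hw' => halfPlaneTaut_right_unique hz hne' w' hw' _ hmem,
    Web.stableSign_eq_one, D.contraction_starWeb, one_mul]
  exact hpar.mono fun t ht ξ hξ => orientation_starWeb (hre t ht) hξ

theorem halfPlaneCoeff_pair_right (hz : IsAsymptoticallyParabolic z) {w₁ w₂ o : Word S}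
    (h₁ : w₁.IsStableFan z 1) (h₂ : w₂.IsStableFan z 1) (ho : o.IsStableFan z 1)
    (hlet : o.letters = w₁.letters ++ w₂.letters) (h12 : w₁.final = w₂.start)
    (hs : w₁.start = o.start) (hf : w₂.final = o.final) :
    D.halfPlaneCoeff z 1 [w₁, w₂] o = sgn (D.degWord w₁) := by
  have hlen : o.letters.length ≤ 1 := ((isStableFan_right_iff hz).1 ho).2.1
  have hmem : pairWeb w₁ w₂ ∈ InfraredData.halfPlaneTaut z 1 [w₁, w₂] o := by
    filter_upwards [h₁, h₂, ho] with t h1 h2 h3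
    refine ⟨pairWeb_isHalfPlaneWeb (by simp) h1 h2 h3 hlet h12 hs hf ?_, moduliDim_pairWeb _ _ _ _⟩
    rcases h : o.letters with _ | ⟨a, _ | ⟨b, L⟩⟩
    · simp
    · simp
    · simp [h] at hlen
  rw [halfPlaneCoeff_eq_of_unique hmem
      fun w' hw' => halfPlaneTaut_right_unique hz (by simp) w' hw' _ hmem,
    Web.stableSign_eq_one, D.contraction_pairWeb, one_mul]
  exact Eventually.of_forall fun t ξ hξ => orientation_pairWeb hξ _

end RightCoeff

/-! ### Grafts: webs with two vertices joined by an edge -/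

section Rays

/-- The open ray from `p` in the direction `d`. -/
def ray (p d : ℂ) : Set ℂ := {q | ∃ r : ℝ, 0 < r ∧ q = p + r * d}

theorem mem_ray {p d q : ℂ} : q ∈ ray p d ↔ ∃ r : ℝ, 0 < r ∧ q = p + r * d := Iff.rfl

theorem re_lt_of_mem_ray {p d q : ℂ} (hd : d.re < 0) (h : q ∈ ray p d) : q.re < p.re := by
  obtain ⟨r, hr, rfl⟩ := mem_ray.1 h
  rw [Complex.add_re, Complex.re_ofReal_mul]
  nlinarith

theorem lt_re_of_mem_ray {p d q : ℂ} (hd : 0 < d.re) (h : q ∈ ray p d) : p.re < q.re := by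
  obtain ⟨r, hr, rfl⟩ := mem_ray.1 h
  rw [Complex.add_re, Complex.re_ofReal_mul]
  nlinarith

theorem mem_openSegment_add {p d q : ℂ} (h : q ∈ openSegment ℝ p (p + d)) :
    ∃ r : ℝ, 0 < r ∧ r < 1 ∧ q = p + r * d := by
  obtain ⟨a, b, ha, hb, hab, rfl⟩ := h
  refine ⟨b, hb, by linarith, ?_⟩
  have : (a : ℂ) = 1 - b := by rw [show a = 1 - b by linarith]; push_cast; ring
  rw [Complex.real_smul, Complex.real_smul, this]
  ring

/-- Two points `p + r a` and `p + r' b` coincide only if `a` and `b` are parallel. -/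
theorem ne_of_cross_ne_zero {p a b : ℂ} (h : (conj a * b).im ≠ 0) {r r' : ℝ} (hr : r ≠ 0) :
    p + r' * a ≠ p + r * b := by
  intro heq
  have h1 : (r' : ℂ) * a = r * b := add_left_cancel heq
  have h2 := congrArg (fun x => (conj a * x).im) h1
  simp only [cross_eq, Complex.re_ofReal_mul, Complex.im_ofReal_mul] at h2
  rw [cross_eq] at h
  have h3 : r * (a.re * b.im - a.im * b.re) = 0 := by linear_combination -h2
  exact (mul_ne_zero hr h) h3

theorem cross_swap (a b : ℂ) : (conj a * b).im = -(conj b * a).im := by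
  rw [cross_eq, cross_eq]; ring

theorem disjoint_ray_ray {p a b : ℂ} (h : (conj a * b).im ≠ 0) : Disjoint (ray p a) (ray p b) := by
  rw [Set.disjoint_left]
  intro q h1 h2
  obtain ⟨r, hr, rfl⟩ := mem_ray.1 h1
  obtain ⟨r', hr', h'⟩ := mem_ray.1 h2
  exact ne_of_cross_ne_zero h hr'.ne' h'

theorem disjoint_openSegment_ray {p a d : ℂ} (h : (conj a * d).im ≠ 0) :
    Disjoint (openSegment ℝ p (p + d)) (ray p a) := by
  rw [Set.disjoint_left]
  intro q h1 h2
  obtain ⟨r, hr, -, rfl⟩ := mem_openSegment_add h1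
  obtain ⟨r', hr', h'⟩ := mem_ray.1 h2
  exact ne_of_cross_ne_zero h hr.ne' h'.symm

/-- A ray from `p` does not meet a ray from `p + d` which leaves to the same side. -/
theorem disjoint_ray_ray_add {p a b d : ℂ} (hd : (conj a * d).im < 0) (hb : (conj a * b).im < 0) :
    Disjoint (ray p a) (ray (p + d) b) := by
  rw [Set.disjoint_left]
  intro q h1 h2
  obtain ⟨r, hr, rfl⟩ := mem_ray.1 h1
  obtain ⟨r', hr', h'⟩ := mem_ray.1 h2
  rw [add_assoc] at h'
  have h3 := congrArg (fun x => (conj a * x).im) (add_left_cancel h')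
  simp only [cross_eq, Complex.re_ofReal_mul, Complex.im_ofReal_mul, Complex.add_re,
    Complex.add_im] at h3
  rw [cross_eq] at hd hb
  nlinarith

theorem disjoint_ray_ray_add' {p a b d : ℂ} (hd : (conj d * a).im < 0) (hb : (conj b * a).im < 0) :
    Disjoint (ray p a) (ray (p + d) b) := by
  rw [Set.disjoint_left]
  intro q h1 h2
  obtain ⟨r, hr, rfl⟩ := mem_ray.1 h1
  obtain ⟨r', hr', h'⟩ := mem_ray.1 h2
  rw [add_assoc] at h'
  have h3 := congrArg (fun x => (conj a * x).im) (add_left_cancel h')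
  simp only [cross_eq, Complex.re_ofReal_mul, Complex.im_ofReal_mul, Complex.add_re,
    Complex.add_im] at h3
  rw [cross_eq] at hd hb
  nlinarith

end Rays

section Graft

variable {S : Spectrum.{u}}

/-- The web `w` consists of two vertices, numbered `a` and `b`, with solitons `X₁ ++ s :: X₂` and
`bar s :: K`, and of an edge joining the germs of `s` and `bar s`. The edges at infinity carry
`X₁ ++ K ++ X₂`. -/
structure Web.IsGraft (w : Web S) (X₁ : List S.Gen) (s : S.Gen) (X₂ K : List S.Gen) (a b : ℕ) :
    Prop where
  numVertices : w.numVertices = 2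
  ab : a = 0 ∧ b = 1 ∨ a = 1 ∧ b = 0
  perm : (w.edges.flatMap (fun e => [e.1, e.2]) ++ w.outs).Perm (List.range w.germs.length)
  edge : ∃ p q, w.edges = [(p, q)] ∧ p < q ∧
    (w.owner p = a ∧ w.owner q = b ∧ w.letter p = some s ∧ w.letter q = some (S.bar s) ∨
      w.owner p = b ∧ w.owner q = a ∧ w.letter p = some (S.bar s) ∧ w.letter q = some s)
  outs : w.outs.map (fun p => (w.owner p, w.letter p)) =
    X₁.map (fun x => (a, some x)) ++ K.map (fun x => (b, some x)) ++ X₂.map (fun x => (a, some x))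

namespace Web

variable {w : Web S} {X₁ X₂ K : List S.Gen} {s : S.Gen} {a b : ℕ}

theorem IsGraft.outs_letter (h : w.IsGraft X₁ s X₂ K a b) :
    w.outs.map w.letter = (X₁ ++ K ++ X₂).map some := by
  have := congrArg (List.map Prod.snd) h.outs
  simpa [List.map_map, Function.comp_def] using this

theorem map_range'_eq {a m : ℕ} {X : List S.Gen}
    (h : ∀ j (hj : j < X.length), w.owner (m + j) = a ∧ w.letter (m + j) = some X[j]) :
    (List.range' m X.length).map (fun p => (w.owner p, w.letter p)) =
      X.map fun x => (a, some x) := by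
  refine List.ext_getElem (by simp) fun i h1 h2 => ?_
  have h3 : i < X.length := by simpa using h2
  simp [h i h3]

theorem length_germs_of_vertices_eq {A B : List S.Gen} (hv : w.vertices = [A, B]) :
    w.germs.length = A.length + B.length := by
  rw [length_germs, hv]; simp

theorem letter_of_vertices_eq {A B : List S.Gen} (hv : w.vertices = [A, B]) (p : ℕ) :
    w.letter p = (A ++ B)[p]? := by
  rw [letter_eq_getElem?, hv]; simp

theorem numVertices_of_vertices_eq {A B : List S.Gen} (hv : w.vertices = [A, B]) :
    w.numVertices = 2 := by
  have := congrArg List.length hv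
  simpa [vertices, numVertices] using this

theorem isGraft_of_first (hv : w.vertices = [X₁ ++ s :: X₂, S.bar s :: K])
    (hE : w.edges = [(X₁.length, X₁.length + 1 + X₂.length)])
    (hO : w.outs = List.range' 0 X₁.length ++ List.range' (X₁.length + 1 + X₂.length + 1)
      K.length ++
      List.range' (X₁.length + 1) X₂.length) : w.IsGraft X₁ s X₂ K 0 1 := by
  have hg := length_germs_of_vertices_eq hv
  simp only [List.length_append, List.length_cons] at hg
  have hown : ∀ p, p < w.germs.length →
      w.owner p = if p < X₁.length + 1 + X₂.length then 0 else 1 := by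
    intro p hp
    rw [owner_of_vertices_eq hv (by simp; omega)]
    simp only [List.length_append, List.length_cons]
    congr 1
    simp; omega
  have hlet := letter_of_vertices_eq hv
  refine ⟨numVertices_of_vertices_eq hv, Or.inl ⟨rfl, rfl⟩, ?_, ⟨_, _, hE, by omega,
    Or.inl ⟨?_, ?_, ?_, ?_⟩⟩, ?_⟩
  · refine (List.Subperm.perm_of_length_le (List.subperm_of_subset List.nodup_range ?_) ?_).symm
    · intro p hp
      rw [List.mem_range] at hp
      simp only [hE, hO, List.flatMap_cons, List.flatMap_nil, List.append_nil, List.mem_append,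
        List.mem_cons, List.not_mem_nil, or_false, List.mem_range'_1]
      omega
    · simp [hE, hO]
      omega
  · rw [hown _ (by omega), if_pos (by omega)]
  · rw [hown _ (by omega), if_neg (by omega)]
  · rw [hlet]; simp
  · have h1 : X₁.length + 1 + X₂.length - (X₁ ++ s :: X₂).length = 0 := by simp; omega
    rw [hlet, List.getElem?_append_right (by simp; omega), h1]
    rfl
  · rw [hO, List.map_append, List.map_append]
    refine congrArg₂ _ (congrArg₂ _ (map_range'_eq ?_) (map_range'_eq ?_)) (map_range'_eq ?_)
    · intro j hj
      rw [hown _ (by omega), if_pos (by omega), hlet]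
      simp [List.getElem?_append_left, hj]
    · intro j hj
      rw [hown _ (by omega), if_neg (by omega), hlet, List.getElem?_append_right (by simp; omega)]
      have : X₁.length + 1 + X₂.length + 1 + j - (X₁ ++ s :: X₂).length = j + 1 := by simp; omega
      rw [this]
      simp [hj]
    · intro j hj
      have h1 : X₁.length + 1 + j - X₁.length = j + 1 := by omega
      rw [hown _ (by omega), if_pos (by omega), hlet, List.getElem?_append_left (by simp; omega),
        List.getElem?_append_right (by omega), h1]
      simp [hj]

theorem isGraft_of_second (hv : w.vertices = [S.bar s :: K, X₁ ++ s :: X₂])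
    (hE : w.edges = [(0, K.length + 1 + X₁.length)])
    (hO : w.outs = List.range' (K.length + 1) X₁.length ++ List.range' 1 K.length ++
      List.range' (K.length + 1 + X₁.length + 1) X₂.length) : w.IsGraft X₁ s X₂ K 1 0 := by
  have hg := length_germs_of_vertices_eq hv
  simp only [List.length_append, List.length_cons] at hg
  have hown : ∀ p, p < w.germs.length → w.owner p = if p < K.length + 1 then 0 else 1 := by
    intro p hp
    rw [owner_of_vertices_eq hv (by simp; omega)]
    simp only [List.length_cons]
  have hlet := letter_of_vertices_eq hv
  refine ⟨numVertices_of_vertices_eq hv, Or.inr ⟨rfl, rfl⟩, ?_, ⟨_, _, hE, by omega,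
    Or.inr ⟨?_, ?_, ?_, ?_⟩⟩, ?_⟩
  · refine (List.Subperm.perm_of_length_le (List.subperm_of_subset List.nodup_range ?_) ?_).symm
    · intro p hp
      rw [List.mem_range] at hp
      simp only [hE, hO, List.flatMap_cons, List.flatMap_nil, List.append_nil, List.mem_append,
        List.mem_cons, List.not_mem_nil, or_false, List.mem_range'_1]
      omega
    · simp [hE, hO]
      omega
  · rw [hown _ (by omega), if_pos (by omega)]
  · rw [hown _ (by omega), if_neg (by omega)]
  · rw [hlet]; simp
  · rw [hlet, List.getElem?_append_right (by simp)]
    simp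
  · rw [hO, List.map_append, List.map_append]
    refine congrArg₂ _ (congrArg₂ _ (map_range'_eq ?_) (map_range'_eq ?_)) (map_range'_eq ?_)
    · intro j hj
      rw [hown _ (by omega), if_neg (by omega), hlet, List.getElem?_append_right (by simp)]
      simp [List.getElem?_append_left, hj]
    · intro j hj
      rw [hown _ (by omega), if_pos (by omega), hlet, add_comm]
      simp [List.getElem?_append_left, hj]
    · intro j hj
      have h1 : K.length + 1 + X₁.length + 1 + j - (S.bar s :: K).length = X₁.length + (j + 1) := by
        simp; omega
      rw [hown _ (by omega), if_neg (by omega), hlet, List.getElem?_append_right (by simp; omega),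
        h1,
        List.getElem?_append_right (by omega)]
      simp [hj]

/-- The edges at infinity of a web are determined by the vacua at infinity. -/
theorem outs_eq {l : List ℕ} {o o' : List S.Gen} (hperm : w.outs.Perm l)
    (ho : w.outs.map w.letter = o.map some) (hl : l.map w.letter = o'.map some)
    (hos : o.Pairwise fun a b => S.tgt a < S.tgt b)
    (hos' : o'.Pairwise fun a b => S.tgt a < S.tgt b) : w.outs = l ∧ o = o' := by
  have hkey : ∀ {l : List ℕ} {L : List S.Gen}, l.map w.letter = L.map some →
      L.Pairwise (fun a b => S.tgt a < S.tgt b) →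
      (l.map fun p => (w.letter p).elim 0 S.tgt).Pairwise (· < ·) := by
    intro l L hl hL
    have : (l.map fun p => (w.letter p).elim 0 S.tgt) = L.map S.tgt := by
      have := congrArg (List.map fun x : Option S.Gen => x.elim 0 S.tgt) hl
      simpa [List.map_map, Function.comp_def] using this
    rw [this, List.pairwise_map]
    exact hL
  have h1 := eq_of_perm_of_pairwise_map _ hperm (hkey ho hos) (hkey hl hos')
  refine ⟨h1, ?_⟩
  rw [h1, hl] at ho
  exact ((List.map_injective_iff.2 (Option.some_injective _)) ho).symm

theorem IsGraft.slopeForm_edge (h : w.IsGraft X₁ s X₂ K a b) (τ : ℂ) (z : ℤ → ℂ)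
    (ξ : Fin w.dim → ℝ) : ∀ e ∈ w.edges, w.slopeForm τ z e ξ =
      ((w.pos τ ξ b - w.pos τ ξ a) * conj (S.dir z s)).im := by
  obtain ⟨p, q, hE, -, h1 | h1⟩ := h.edge
  · intro e he
    rw [hE, List.mem_singleton] at he
    rw [he, slopeForm]
    simp only
    rw [h1.1, h1.2.1, w.dir_eq h1.2.2.1]
  · intro e he
    rw [hE, List.mem_singleton] at he
    rw [he, slopeForm]
    simp only
    rw [h1.1, h1.2.1, w.dir_eq h1.2.2.1, S.dir_bar]
    congr 1
    rw [map_neg]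
    ring

theorem IsGraft.exists_pos (h : w.IsGraft X₁ s X₂ K a b) {τ : ℂ} {z : ℤ → ℂ} {ξ : Fin w.dim → ℝ}
    (hd : w.IsDrawing τ z ξ) : ∃ r : ℝ, 0 < r ∧
      w.pos τ ξ b - w.pos τ ξ a = r * S.dir z s := by
  obtain ⟨p, q, hE, -, h1 | h1⟩ := h.edge <;>
    obtain ⟨r, hr, h2⟩ := hd.slope (p, q) (by rw [hE]; simp) <;> refine ⟨r, hr, ?_⟩ <;>
    simp only [h1.1, h1.2.1, w.dir_eq h1.2.2.1, S.dir_bar] at h2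
  · exact h2
  · linear_combination -h2

/-- A graft whose second vertex lies at the end of the edge `s` is drawn without crossings: the
replaced path `K` lies between the slopes of the edges `Y` before and `X₂` after `s`. Here `R` is
empty in the left half-plane, and the falling edge of the polygon in the plane. -/
theorem IsGraft.isDrawing (h : w.IsGraft X₁ s X₂ K a b) {F : Set ℤ} {z : ℤ → ℂ}
    (hz : IsParabolicOn F z) (hF : SupportedOn F (X₁ ++ s :: X₂ ++ K)) {R Y : List S.Gen}
    (hX : X₁ = R ++ Y) (hR : R.length ≤ 1) (hRd : ∀ r ∈ R, S.IsDown r) {k l : ℤ}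
    (hpath : IsPath k l (Y ++ s :: X₂)) (hup : ∀ x ∈ Y ++ s :: X₂, S.IsUp x)
    (hK : IsPath (S.src s) (S.tgt s) K) (hKup : ∀ x ∈ K, S.IsUp x) {τ : ℂ} {ξ : Fin w.dim → ℝ}
    (hpos : w.pos τ ξ b = w.pos τ ξ a + S.dir z s) : w.IsDrawing τ z ξ := by
  subst hX
  have hF1 : ∀ x ∈ R ++ Y ++ s :: X₂ ++ K, SupportedOn F [x] := fun x hx =>
    hF.of_subset (by simpa using hx)
  have hsup : S.IsUp s := hup s (by simp)
  have hsre := hz.re_dir_neg (hF1 s (by simp)) hsup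
  have hRre : ∀ r ∈ R, 0 < (S.dir z r).re := fun r hr =>
    hz.re_dir_pos (hF1 r (by simp [hr])) (hRd r hr)
  have hYre : ∀ x ∈ Y, (S.dir z x).re < 0 := fun x hx =>
    hz.re_dir_neg (hF1 x (by simp [hx])) (hup x (by simp [hx]))
  have hXre : ∀ x ∈ X₂, (S.dir z x).re < 0 := fun x hx =>
    hz.re_dir_neg (hF1 x (by simp [hx])) (hup x (by simp [hx]))
  have hKre : ∀ x ∈ K, (S.dir z x).re < 0 := fun x hx =>
    hz.re_dir_neg (hF1 x (by simp [hx])) (hKup x hx)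
  have hcross : ∀ x ∈ Y ++ s :: X₂ ++ K, ∀ y ∈ Y ++ s :: X₂ ++ K, S.tgt x ≤ S.src y →
      (conj (S.dir z x) * S.dir z y).im < 0 := by
    have hall : ∀ x ∈ Y ++ s :: X₂ ++ K, S.IsUp x := by
      intro x hx
      rcases List.mem_append.1 hx with h1 | h1
      · exact hup x h1
      · exact hKup x h1
    intro x hx y hy hxy
    refine hz.cross_neg (hF.of_subset ?_) (hall x hx) (hall y hy) hxy
    intro c hc
    simp only [List.mem_cons, List.not_mem_nil, or_false] at hc
    simp only [List.append_assoc] at hx hy ⊢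
    rcases hc with rfl | rfl
    · exact List.mem_append_right _ hx
    · exact List.mem_append_right _ hy
  have hpair := hpath.pairwise_of_isUp hup
  rw [List.pairwise_append, List.pairwise_cons] at hpair
  obtain ⟨hpY, ⟨hpsX, hpX⟩, hpYX⟩ := hpair
  have hpK := hK.pairwise_of_isUp hKup
  have hKb := hK.bounds_of_isUp hKup
  have hYs : ∀ x ∈ Y, (conj (S.dir z x) * S.dir z s).im < 0 := fun x hx =>
    hcross x (by simp [hx]) s (by simp) (hpYX x hx s (by simp))
  have hYK : ∀ x ∈ Y, ∀ y ∈ K, (conj (S.dir z x) * S.dir z y).im < 0 := fun x hx y hy =>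
    hcross x (by simp [hx]) y (by simp [hy]) ((hpYX x hx s (by simp)).trans (hKb y hy).1)
  have hsX : ∀ x ∈ X₂, (conj (S.dir z s) * S.dir z x).im < 0 := fun x hx =>
    hcross s (by simp) x (by simp [hx]) (hpsX x hx)
  have hKX : ∀ y ∈ K, ∀ x ∈ X₂, (conj (S.dir z y) * S.dir z x).im < 0 := fun y hy x hx =>
    hcross y (by simp [hy]) x (by simp [hx]) ((hKb y hy).2.trans (hpsX x hx))
  have hYX : ∀ y ∈ Y, ∀ x ∈ X₂, (conj (S.dir z y) * S.dir z x).im < 0 := fun y hy x hx =>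
    hcross y (by simp [hy]) x (by simp [hx]) (hpYX y hy x (by simp [hx]))
  set p := w.pos τ ξ a with hp
  have hne : S.dir z s ≠ 0 := by intro h0; rw [h0] at hsre; simp at hsre
  obtain ⟨e₁, e₂, hE, -, hedge⟩ := h.edge
  have hseg : w.edges.map (fun e => openSegment ℝ (w.pos τ ξ (w.owner e.1))
      (w.pos τ ξ (w.owner e.2))) = [openSegment ℝ p (p + S.dir z s)] := by
    rw [hE, List.map_singleton]
    rcases hedge with h1 | h1
    · simp only [h1.1, h1.2.1, hpos, hp]
    · simp only [h1.1, h1.2.1, hpos, hp]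
      rw [openSegment_symm]
  have hrays : w.outs.map (fun q =>
      {x | ∃ r : ℝ, 0 < r ∧ x = w.pos τ ξ (w.owner q) + r * w.dir z q}) =
      R.map (fun x => ray p (S.dir z x)) ++ Y.map (fun x => ray p (S.dir z x)) ++
        K.map (fun x => ray (p + S.dir z s) (S.dir z x)) ++
          X₂.map (fun x => ray p (S.dir z x)) := by
    have h1 := congrArg (List.map fun x : ℕ × Option S.Gen =>
      ray (w.pos τ ξ x.1) (x.2.elim 0 (S.dir z))) h.outs
    rw [List.map_map] at h1
    refine h1.trans ?_
    simp only [List.map_append, List.map_map, Function.comp_def, Option.elim_some, hpos, hp]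
  have hsets : w.edgeSets τ z ξ = openSegment ℝ p (p + S.dir z s) ::
      (R.map (fun x => ray p (S.dir z x)) ++ Y.map (fun x => ray p (S.dir z x)) ++
        K.map (fun x => ray (p + S.dir z s) (S.dir z x)) ++
          X₂.map (fun x => ray p (S.dir z x))) := by
    rw [edgeSets, hseg, hrays]; rfl
  -- The vertex `b` lies to the left of `a`. Edges on different sides of a vertical line through
  -- a vertex are separated by their real parts, the others by the order of their slopes.
  have hsegre : ∀ q ∈ openSegment ℝ p (p + S.dir z s), (p + S.dir z s).re < q.re ∧ q.re < p.re := by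
    intro q hq
    obtain ⟨r, hr, hr1, rfl⟩ := mem_openSegment_add hq
    simp only [Complex.add_re, Complex.re_ofReal_mul]
    constructor <;> nlinarith
  have hKray : ∀ x ∈ K, ∀ q ∈ ray (p + S.dir z s) (S.dir z x), q.re < (p + S.dir z s).re :=
    fun x hx q hq => re_lt_of_mem_ray (hKre x hx) hq
  have hpre : (p + S.dir z s).re < p.re := by rw [Complex.add_re]; linarith
  have hRray : ∀ x ∈ R, ∀ A : Set ℂ, (∀ q ∈ A, q.re < p.re) → Disjoint (ray p (S.dir z x)) A := by
    intro x hx A hA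
    rw [Set.disjoint_left]
    intro q h1 h2
    have := lt_re_of_mem_ray (hRre x hx) h1
    have := hA q h2
    linarith
  refine ⟨?_, ?_, ?_, ?_⟩
  · intro e he
    rw [hE, List.mem_singleton] at he
    subst he
    refine ⟨1, one_pos, ?_⟩
    rcases hedge with h1 | h1
    · simp only [h1.1, h1.2.1, hpos, w.dir_eq h1.2.2.1]
      push_cast
      ring
    · simp only [h1.1, h1.2.1, hpos, w.dir_eq h1.2.2.1, S.dir_bar]
      push_cast
      ring
  · have hab : w.pos τ ξ a ≠ w.pos τ ξ b := by
      rw [hpos]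
      intro h0
      exact hne (by linear_combination -h0)
    have hcases : ∀ v < 2, v = a ∨ v = b := by
      intro v hv
      rcases h.ab with ⟨rfl, rfl⟩ | ⟨rfl, rfl⟩ <;> omega
    intro v v' hv hv' hvv'
    rw [h.numVertices] at hv hv'
    rcases hcases v hv with rfl | rfl <;> rcases hcases v' hv' with rfl | rfl
    · exact absurd rfl hvv'
    · exact hab
    · exact hab.symm
    · exact absurd rfl hvv'
  · rw [hsets]
    simp only [List.pairwise_cons, List.pairwise_append, List.pairwise_map, List.mem_append,
      List.mem_map]
    refine ⟨?_, ⟨⟨⟨?_, ?_, ?_⟩, ?_, ?_⟩, ?_, ?_⟩⟩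
    · rintro A (((⟨x, hx, rfl⟩ | ⟨x, hx, rfl⟩) | ⟨x, hx, rfl⟩) | ⟨x, hx, rfl⟩)
      · exact (hRray x hx _ fun q hq => (hsegre q hq).2).symm
      · exact disjoint_openSegment_ray (hYs x hx).ne
      · rw [Set.disjoint_left]
        intro q h1 h2
        have := (hsegre q h1).1
        have := hKray x hx q h2
        linarith
      · refine disjoint_openSegment_ray ?_
        rw [cross_swap]
        exact (neg_pos.2 (hsX x hx)).ne'
    · rcases R with _ | ⟨r, _ | ⟨r', R⟩⟩
      · simp
      · simp
      · simp at hR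
    · exact hpY.imp_of_mem fun {x y} hx hy hxy => disjoint_ray_ray
        (hcross x (by simp [hx]) y (by simp [hy]) hxy).ne
    · rintro A ⟨x, hx, rfl⟩ B ⟨y, hy, rfl⟩
      exact hRray x hx _ fun q hq => re_lt_of_mem_ray (hYre y hy) hq
    · exact hpK.imp_of_mem fun {x y} hx hy hxy => disjoint_ray_ray
        (hcross x (by simp [hx]) y (by simp [hy]) hxy).ne
    · rintro A (⟨x, hx, rfl⟩ | ⟨x, hx, rfl⟩) B ⟨y, hy, rfl⟩
      · exact hRray x hx _ fun q hq => (hKray y hy q hq).trans hpre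
      · exact disjoint_ray_ray_add (hYs x hx) (hYK x hx y hy)
    · exact hpX.imp_of_mem fun {x y} hx hy hxy => disjoint_ray_ray
        (hcross x (by simp [hx]) y (by simp [hy]) hxy).ne
    · rintro A ((⟨x, hx, rfl⟩ | ⟨x, hx, rfl⟩) | ⟨x, hx, rfl⟩) B ⟨y, hy, rfl⟩
      · exact hRray x hx _ fun q hq => re_lt_of_mem_ray (hXre y hy) hq
      · exact disjoint_ray_ray (hYX x hx y hy).ne
      · exact (disjoint_ray_ray_add' (hsX y hy) (hKX x hx y hy)).symm
  · have hv : ∀ v < w.numVertices, w.pos τ ξ v = p ∨ w.pos τ ξ v = p + S.dir z s := by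
      intro v hv
      rw [h.numVertices] at hv
      rcases h.ab with ⟨rfl, rfl⟩ | ⟨rfl, rfl⟩ <;> interval_cases v <;> simp [hp, hpos]
    have hrayne : ∀ x, (conj (S.dir z x) * S.dir z s).im ≠ 0 →
        p + S.dir z s ∉ ray p (S.dir z x) := by
      intro x hx hmem
      obtain ⟨r, hr, h1⟩ := mem_ray.1 hmem
      refine ne_of_cross_ne_zero (p := p) (r := 1) (r' := r) hx one_ne_zero ?_
      rw [← h1]
      simp
    intro A hA v hv'
    rw [hsets] at hA
    simp only [List.mem_cons, List.mem_append, List.mem_map] at hA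
    have hvp := hv v hv'
    intro hmem
    rcases hA with rfl | (((⟨x, hx, rfl⟩ | ⟨x, hx, rfl⟩) | ⟨x, hx, rfl⟩) | ⟨x, hx, rfl⟩)
    · have := hsegre _ hmem
      rcases hvp with h1 | h1 <;> rw [h1] at this <;> linarith
    · have := lt_re_of_mem_ray (hRre x hx) hmem
      rcases hvp with h1 | h1 <;> rw [h1] at this <;> linarith
    · rcases hvp with h1 | h1 <;> rw [h1] at hmem
      · have := re_lt_of_mem_ray (hYre x hx) hmem
        linarith
      · exact hrayne x (hYs x hx).ne hmem
    · have := hKray x hx _ hmem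
      rcases hvp with h1 | h1 <;> rw [h1] at this <;> linarith
    · rcases hvp with h1 | h1 <;> rw [h1] at hmem
      · have := re_lt_of_mem_ray (hXre x hx) hmem
        linarith
      · refine hrayne x ?_ hmem
        rw [cross_swap]
        exact (neg_pos.2 (hsX x hx)).ne'

end Web

end Graft

section GraftSigns

/-- The part of the Koszul sign due to moving the symbols of `B` past those of `A`. -/
def crossSign (d : ℕ → ℤ) (A B : List ℕ) : ℂ :=
  (A.map fun a => (B.map fun b => if b < a then sgn (d a * d b) else 1).prod).prod

theorem crossSign_cons (d : ℕ → ℤ) (a : ℕ) (A B : List ℕ) : crossSign d (a :: A) B =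
    (B.map fun b => if b < a then sgn (d a * d b) else 1).prod * crossSign d A B := by
  rw [crossSign, List.map_cons, List.prod_cons]; rfl

theorem koszul_append (d : ℕ → ℤ) (A B : List ℕ) :
    koszul d (A ++ B) = koszul d A * crossSign d A B * koszul d B := by
  induction A with
  | nil => simp [koszul, crossSign]
  | cons a A ih =>
    rw [List.cons_append, koszul, ih, koszul, List.map_append, List.prod_append, crossSign_cons]
    ring

theorem crossSign_append_left (d : ℕ → ℤ) (A A' B : List ℕ) :
    crossSign d (A ++ A') B = crossSign d A B * crossSign d A' B := by
  rw [crossSign, List.map_append, List.prod_append]; rfl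

theorem crossSign_of_lt (d : ℕ → ℤ) {A B : List ℕ} (h : ∀ a ∈ A, ∀ b ∈ B, a < b) :
    crossSign d A B = 1 := by
  refine List.prod_eq_one fun x hx => ?_
  obtain ⟨a, ha, rfl⟩ := List.mem_map.1 hx
  refine List.prod_eq_one fun x hx => ?_
  obtain ⟨b, hb, rfl⟩ := List.mem_map.1 hx
  exact if_neg (not_lt_of_gt (h a ha b hb))

theorem crossSign_of_gt (d : ℕ → ℤ) {A B : List ℕ} (h : ∀ a ∈ A, ∀ b ∈ B, b < a) :
    crossSign d A B = sgn ((A.map d).sum * (B.map d).sum) := by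
  rw [crossSign, ← List.sum_map_mul_right, ← prod_map_sgn]
  refine congrArg List.prod (List.map_congr_left fun a ha => ?_)
  rw [List.map_congr_left fun b hb => if_pos (h a ha b hb), prod_map_sgn, List.sum_map_mul_left]

theorem koszul_first (d : ℕ → ℤ) {i N : ℕ} {A B C : List ℕ} (hA : A.Pairwise (· < ·))
    (hB : B.Pairwise (· < ·)) (hC : C.Pairwise (· < ·)) (hAi : ∀ a ∈ A, a < i)
    (hCi : ∀ c ∈ C, i < c ∧ c < N) (hBN : ∀ b ∈ B, N < b) (hiN : i < N) :
    koszul d (i :: N :: (A ++ B ++ C)) =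
      sgn (d i * (A.map d).sum + d N * (A.map d).sum + d N * (C.map d).sum +
        (B.map d).sum * (C.map d).sum) := by
  have h : i :: N :: (A ++ B ++ C) = [i] ++ [N] ++ A ++ B ++ C := by simp
  have hAB : ∀ a ∈ A, ∀ b ∈ B, a < b := fun a ha b hb => by
    have := hAi a ha; have := hBN b hb; omega
  have hAC : ∀ a ∈ A, ∀ c ∈ C, a < c := fun a ha c hc => (hAi a ha).trans (hCi c hc).1
  have hBC : ∀ b ∈ B, ∀ c ∈ C, c < b := fun b hb c hc => (hCi c hc).2.trans (hBN b hb)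
  have hAN : ∀ a ∈ A, a < N := fun a ha => (hAi a ha).trans hiN
  have hiB : ∀ b ∈ B, i < b := fun b hb => hiN.trans (hBN b hb)
  rw [h]
  simp only [koszul_append, crossSign_append_left, koszul_of_pairwise d hA, koszul_of_pairwise d hB,
    koszul_of_pairwise d hC, koszul_of_pairwise d (List.pairwise_singleton _ _)]
  rw [crossSign_of_lt d (A := [i]) (B := [N]) (by simpa using hiN),
    crossSign_of_gt d (A := [i]) (B := A) (by simpa using hAi),
    crossSign_of_gt d (A := [N]) (B := A) (by simpa using hAN),
    crossSign_of_lt d (A := [i]) (B := B) (by simpa using hiB),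
    crossSign_of_lt d (A := [N]) (B := B) (by simpa using hBN),
    crossSign_of_lt d hAB,
    crossSign_of_lt d (A := [i]) (B := C) (by simpa using fun c hc => (hCi c hc).1),
    crossSign_of_gt d (A := [N]) (B := C) (by simpa using fun c hc => (hCi c hc).2),
    crossSign_of_lt d hAC, crossSign_of_gt d hBC]
  simp only [List.map_cons, List.map_nil, List.sum_cons, List.sum_nil, add_zero, sgn_add]
  ring

theorem koszul_second (d : ℕ → ℤ) {q : ℕ} {A B C : List ℕ} (hA : A.Pairwise (· < ·))
    (hB : B.Pairwise (· < ·)) (hC : C.Pairwise (· < ·)) (hB0 : ∀ b ∈ B, 0 < b)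
    (hBA : ∀ a ∈ A, ∀ b ∈ B, b < a) (hAq : ∀ a ∈ A, a < q)
    (hBq : ∀ b ∈ B, b < q) (hqC : ∀ c ∈ C, q < c) (hq : 0 < q) :
    koszul d (0 :: q :: (A ++ B ++ C)) =
      sgn (d q * (A.map d).sum + d q * (B.map d).sum + (A.map d).sum * (B.map d).sum) := by
  have h : 0 :: q :: (A ++ B ++ C) = [0] ++ [q] ++ A ++ B ++ C := by simp
  have h0C : ∀ c ∈ C, 0 < c := fun c hc => hq.trans (hqC c hc)
  have hAC : ∀ a ∈ A, ∀ c ∈ C, a < c := fun a ha c hc => (hAq a ha).trans (hqC c hc)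
  have hBC : ∀ b ∈ B, ∀ c ∈ C, b < c := fun b hb c hc => (hBq b hb).trans (hqC c hc)
  have h0A : ∀ a ∈ A, 0 < a ∨ B = [] := fun a ha => by
    rcases B with _ | ⟨b, B⟩
    · exact Or.inr rfl
    · exact Or.inl (lt_of_le_of_lt (Nat.zero_le _) (hBA a ha b (by simp)))
  rw [h]
  have h0A' : crossSign d [0] A = 1 := by simp [crossSign]
  simp only [koszul_append, crossSign_append_left, koszul_of_pairwise d hA, koszul_of_pairwise d hB,
    koszul_of_pairwise d hC, koszul_of_pairwise d (List.pairwise_singleton _ _)]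
  rw [crossSign_of_lt d (A := [0]) (B := [q]) (by simpa using hq), h0A',
    crossSign_of_gt d (A := [q]) (B := A) (by simpa using hAq),
    crossSign_of_lt d (A := [0]) (B := B) (by simpa using hB0),
    crossSign_of_gt d (A := [q]) (B := B) (by simpa using hBq),
    crossSign_of_gt d hBA,
    crossSign_of_lt d (A := [0]) (B := C) (by simpa using h0C),
    crossSign_of_lt d (A := [q]) (B := C) (by simpa using hqC),
    crossSign_of_lt d hAC, crossSign_of_lt d hBC]
  simp only [List.map_cons, List.map_nil, List.sum_cons, List.sum_nil, add_zero, sgn_add]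
  ring

end GraftSigns

section Graft

variable {S : Spectrum.{u}}

/-- A boundary vertex and a bulk vertex joined by an edge. -/
def leftGraft (k : ℤ) (X₁ : List S.Gen) (s : S.Gen) (X₂ K : List S.Gen) : Web S :=
  ⟨[⟨k, X₁ ++ s :: X₂⟩], [S.bar s :: K], [(X₁.length, X₁.length + 1 + X₂.length)],
    List.range' 0 X₁.length ++ List.range' (X₁.length + 1 + X₂.length + 1) K.length ++
      List.range' (X₁.length + 1) X₂.length⟩

/-- Two bulk vertices joined by an edge, which rises from the first. -/
def planeGraft (X₁ : List S.Gen) (s : S.Gen) (X₂ K : List S.Gen) : Web S :=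
  ⟨[], [X₁ ++ s :: X₂, S.bar s :: K], [(X₁.length, X₁.length + 1 + X₂.length)],
    List.range' 0 X₁.length ++ List.range' (X₁.length + 1 + X₂.length + 1) K.length ++
      List.range' (X₁.length + 1) X₂.length⟩

/-- The same web as `planeGraft`, with the opposite numbering of the vertices. -/
def planeGraft' (X₁ : List S.Gen) (s : S.Gen) (X₂ K : List S.Gen) : Web S :=
  ⟨[], [S.bar s :: K, X₁ ++ s :: X₂], [(0, K.length + 1 + X₁.length)],
    List.range' (K.length + 1) X₁.length ++ List.range' 1 K.length ++
      List.range' (K.length + 1 + X₁.length + 1) X₂.length⟩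

variable (k : ℤ) (X₁ : List S.Gen) (s : S.Gen) (X₂ K : List S.Gen)

theorem isGraft_leftGraft : (leftGraft k X₁ s X₂ K).IsGraft X₁ s X₂ K 0 1 :=
  Web.isGraft_of_first rfl rfl rfl

theorem isGraft_planeGraft : (planeGraft X₁ s X₂ K).IsGraft X₁ s X₂ K 0 1 :=
  Web.isGraft_of_first rfl rfl rfl

theorem isGraft_planeGraft' : (planeGraft' X₁ s X₂ K).IsGraft X₁ s X₂ K 1 0 :=
  Web.isGraft_of_second rfl rfl rfl

variable {X₁ s X₂ K}

theorem Web.IsGraft.sum_deg {w : Web S} {a b : ℕ} (h : w.IsGraft X₁ s X₂ K a b) (D : InfraredData S)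
    {A B C : List ℕ} (hO : w.outs = A ++ B ++ C) (hA : A.length = X₁.length)
    (hB : B.length = K.length) :
    (A.map fun p => (w.letter p).elim 0 D.deg).sum = (X₁.map D.deg).sum ∧
    (B.map fun p => (w.letter p).elim 0 D.deg).sum = (K.map D.deg).sum ∧
    (C.map fun p => (w.letter p).elim 0 D.deg).sum = (X₂.map D.deg).sum := by
  have h1 := h.outs_letter
  rw [hO] at h1
  simp only [List.map_append] at h1
  obtain ⟨h2, h3⟩ := List.append_inj h1 (by simp [hA, hB])
  obtain ⟨h4, h5⟩ := List.append_inj h2 (by simp [hA])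
  have key : ∀ {P : List ℕ} {L : List S.Gen}, P.map w.letter = L.map some →
      (P.map fun p => (w.letter p).elim 0 D.deg).sum = (L.map D.deg).sum := by
    intro P L hPL
    have := congrArg (fun l => (l.map fun x : Option S.Gen => x.elim 0 D.deg).sum) hPL
    simpa [List.map_map, Function.comp_def] using this
  exact ⟨key h4, key h5, key h3⟩

theorem Web.IsGraft.koszul_eq {w : Web S} {a b : ℕ} (h : w.IsGraft X₁ s X₂ K a b)
    (D : InfraredData S) (hdeg : D.deg (S.bar s) + (K.map D.deg).sum = 2)
    (hw : w.edges = [(X₁.length, X₁.length + 1 + X₂.length)] ∧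
        w.outs = List.range' 0 X₁.length ++
          List.range' (X₁.length + 1 + X₂.length + 1) K.length ++
          List.range' (X₁.length + 1) X₂.length ∧
        w.letter X₁.length = some s ∧ w.letter (X₁.length + 1 + X₂.length) = some (S.bar s) ∨
      w.edges = [(0, K.length + 1 + X₁.length)] ∧
        w.outs = List.range' (K.length + 1) X₁.length ++ List.range' 1 K.length ++
          List.range' (K.length + 1 + X₁.length + 1) X₂.length ∧
        w.letter (K.length + 1 + X₁.length) = some s) :
    koszul (fun p => (w.letter p).elim 0 D.deg)
      (w.edges.flatMap (fun e => [e.1, e.2]) ++ w.outs) = sgn (X₁.map D.deg).sum := by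
  have hbar := D.deg_bar s
  have hK : (K.map D.deg).sum = 1 + D.deg s := by linarith
  rcases hw with ⟨hE, hO, hs, hbs⟩ | ⟨hE, hO, hs⟩
  · obtain ⟨h1, h2, h3⟩ := h.sum_deg D hO (by simp) (by simp)
    rw [hE, hO]
    simp only [List.flatMap_cons, List.flatMap_nil, List.append_nil, List.cons_append,
      List.nil_append]
    rw [koszul_first _ List.pairwise_lt_range' List.pairwise_lt_range' List.pairwise_lt_range',
      h1, h2, h3, hs, hbs]
    · refine sgn_congr ⟨(X₂.map D.deg).sum, ?_⟩
      simp only [Option.elim_some]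
      rw [hK, show D.deg (S.bar s) = 1 - D.deg s by linarith]
      ring
    all_goals
      try simp only [List.mem_range'_1]
      intros
      omega
  · obtain ⟨h1, h2, h3⟩ := h.sum_deg D hO (by simp) (by simp)
    rw [hE, hO]
    simp only [List.flatMap_cons, List.flatMap_nil, List.append_nil, List.cons_append,
      List.nil_append]
    rw [koszul_second _ List.pairwise_lt_range' List.pairwise_lt_range' List.pairwise_lt_range',
      h1, h2, hs]
    · have h4 := Int.even_mul_succ_self (D.deg s)
      refine sgn_congr ?_
      simp only [Option.elim_some]
      rw [hK]
      have h5 : D.deg s * (X₁.map D.deg).sum + D.deg s * (1 + D.deg s) +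
          (X₁.map D.deg).sum * (1 + D.deg s) - (X₁.map D.deg).sum =
          2 * (D.deg s * (X₁.map D.deg).sum) + D.deg s * (D.deg s + 1) := by ring
      rw [h5]
      exact (even_two_mul _).add h4
    all_goals
      try simp only [List.mem_range'_1]
      intros
      omega

variable (X₁ s X₂ K)

theorem InfraredData.contraction_leftGraft (D : InfraredData S) (c : ℂ) :
    D.contraction (leftGraft k X₁ s X₂ K) c =
      c * sgn (X₁.map D.deg).sum * D.amp (S.bar s :: K) := by
  by_cases h0 : D.amp (S.bar s :: K) = 0
  · simp [InfraredData.contraction, leftGraft, h0]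
  · have hdeg := D.amp_deg _ h0
    rw [List.map_cons, List.sum_cons] at hdeg
    rw [InfraredData.contraction, (isGraft_leftGraft k X₁ s X₂ K).koszul_eq D hdeg]
    · simp [leftGraft, InfraredData.bdrySign]
    · left
      refine ⟨rfl, rfl, ?_, ?_⟩
      · rw [Web.letter_of_vertices_eq rfl]; simp
      · have h1 : X₁.length + 1 + X₂.length - (X₁ ++ s :: X₂).length = 0 := by simp; omega
        rw [Web.letter_of_vertices_eq rfl, List.getElem?_append_right (by simp; omega), h1]
        rfl

theorem InfraredData.contraction_planeGraft (D : InfraredData S) (c : ℂ) :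
    D.contraction (planeGraft X₁ s X₂ K) c =
      c * sgn (X₁.map D.deg).sum * (D.amp (X₁ ++ s :: X₂) * D.amp (S.bar s :: K)) / 2 := by
  by_cases h0 : D.amp (S.bar s :: K) = 0
  · simp [InfraredData.contraction, planeGraft, h0]
  · have hdeg := D.amp_deg _ h0
    rw [List.map_cons, List.sum_cons] at hdeg
    rw [InfraredData.contraction, (isGraft_planeGraft X₁ s X₂ K).koszul_eq D hdeg]
    · simp [planeGraft, InfraredData.bdrySign]
    · left
      refine ⟨rfl, rfl, ?_, ?_⟩
      · rw [Web.letter_of_vertices_eq rfl]; simp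
      · have h1 : X₁.length + 1 + X₂.length - (X₁ ++ s :: X₂).length = 0 := by simp; omega
        rw [Web.letter_of_vertices_eq rfl, List.getElem?_append_right (by simp; omega), h1]
        rfl

theorem InfraredData.contraction_planeGraft' (D : InfraredData S) (c : ℂ) :
    D.contraction (planeGraft' X₁ s X₂ K) c =
      c * sgn (X₁.map D.deg).sum * (D.amp (X₁ ++ s :: X₂) * D.amp (S.bar s :: K)) / 2 := by
  by_cases h0 : D.amp (S.bar s :: K) = 0
  · simp [InfraredData.contraction, planeGraft', h0]
  · have hdeg := D.amp_deg _ h0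
    rw [List.map_cons, List.sum_cons] at hdeg
    rw [InfraredData.contraction, (isGraft_planeGraft' X₁ s X₂ K).koszul_eq D hdeg]
    · simp [planeGraft', InfraredData.bdrySign, mul_comm (D.amp (S.bar s :: K))]
    · right
      refine ⟨rfl, rfl, ?_⟩
      rw [Web.letter_of_vertices_eq rfl, List.getElem?_append_right (by simp)]
      simp

theorem pos_leftGraft (τ : ℂ) (ξ : Fin 3 → ℝ) :
    (leftGraft k X₁ s X₂ K).pos τ ξ 0 = ξ 0 * τ ∧
      (leftGraft k X₁ s X₂ K).pos τ ξ 1 = ξ 1 + ξ 2 * Complex.I := ⟨rfl, rfl⟩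

theorem pos_planeGraft (τ : ℂ) (ξ : Fin 4 → ℝ) :
    (planeGraft X₁ s X₂ K).pos τ ξ 0 = ξ 0 + ξ 1 * Complex.I ∧
      (planeGraft X₁ s X₂ K).pos τ ξ 1 = ξ 2 + ξ 3 * Complex.I := ⟨rfl, rfl⟩

theorem pos_planeGraft' (τ : ℂ) (ξ : Fin 4 → ℝ) :
    (planeGraft' X₁ s X₂ K).pos τ ξ 0 = ξ 0 + ξ 1 * Complex.I ∧
      (planeGraft' X₁ s X₂ K).pos τ ξ 1 = ξ 2 + ξ 3 * Complex.I := ⟨rfl, rfl⟩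

theorem slopeForm_leftGraft (z : ℤ → ℂ) (ξ : Fin 3 → ℝ) :
    (leftGraft k X₁ s X₂ K).slopeForm (-Complex.I * -1) z
      (X₁.length, X₁.length + 1 + X₂.length) ξ =
      (ξ 2 - ξ 0) * (S.dir z s).re - ξ 1 * (S.dir z s).im := by
  obtain ⟨h1, h2⟩ := pos_leftGraft k X₁ s X₂ K (-Complex.I * -1) ξ
  rw [(isGraft_leftGraft k X₁ s X₂ K).slopeForm_edge _ z ξ _ (List.mem_singleton_self _), h1, h2]
  simp [Complex.mul_im]
  ring

theorem slopeForm_planeGraft (z : ℤ → ℂ) (ξ : Fin 4 → ℝ) :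
    (planeGraft X₁ s X₂ K).slopeForm 0 z (X₁.length, X₁.length + 1 + X₂.length) ξ =
      (ξ 3 - ξ 1) * (S.dir z s).re - (ξ 2 - ξ 0) * (S.dir z s).im := by
  obtain ⟨h1, h2⟩ := pos_planeGraft X₁ s X₂ K 0 ξ
  rw [(isGraft_planeGraft X₁ s X₂ K).slopeForm_edge _ z ξ _ (List.mem_singleton_self _), h1, h2]
  simp [Complex.mul_im]
  ring

theorem slopeForm_planeGraft' (z : ℤ → ℂ) (ξ : Fin 4 → ℝ) :
    (planeGraft' X₁ s X₂ K).slopeForm 0 z (0, K.length + 1 + X₁.length) ξ =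
      (ξ 1 - ξ 3) * (S.dir z s).re - (ξ 0 - ξ 2) * (S.dir z s).im := by
  obtain ⟨h1, h2⟩ := pos_planeGraft' X₁ s X₂ K 0 ξ
  rw [(isGraft_planeGraft' X₁ s X₂ K).slopeForm_edge _ z ξ _ (List.mem_singleton_self _), h1, h2]
  simp [Complex.mul_im]
  ring

theorem moduliDim_leftGraft {z : ℤ → ℂ} (hs : (S.dir z s).re ≠ 0) :
    (leftGraft k X₁ s X₂ K).moduliDim (-Complex.I * -1) z = 2 := by
  have h1 := (leftGraft k X₁ s X₂ K).dim_le_moduliDim_add (-Complex.I * -1) z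
  have h2 : (leftGraft k X₁ s X₂ K).dim = 3 := rfl
  have h3 : (leftGraft k X₁ s X₂ K).edges.length = 1 := rfl
  have h4 : (leftGraft k X₁ s X₂ K).moduliDim (-Complex.I * -1) z ≤ 2 := by
    refine (leftGraft k X₁ s X₂ K).moduliDim_le _ z (LinearMap.funLeft ℝ ℝ (n := Fin 3) ![1, 2]) ?_
    intro (ξ : Fin 3 → ℝ) hξ h0
    have hx : ξ 1 = 0 := congrFun h0 0
    have hy : ξ 2 = 0 := congrFun h0 1
    have h5 := (slopeForm_leftGraft k X₁ s X₂ K z ξ).symm.trans (hξ _ (List.mem_singleton_self _))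
    rw [hx, hy, zero_sub, zero_mul, sub_zero, neg_mul, neg_eq_zero] at h5
    have h6 := (mul_eq_zero.1 h5).resolve_right hs
    funext (j : Fin 3)
    fin_cases j
    · exact h6
    · exact hx
    · exact hy
  omega

theorem moduliDim_planeGraft {z : ℤ → ℂ} (hs : (S.dir z s).re ≠ 0) :
    (planeGraft X₁ s X₂ K).moduliDim 0 z = 3 := by
  have h1 := (planeGraft X₁ s X₂ K).dim_le_moduliDim_add 0 z
  have h2 : (planeGraft X₁ s X₂ K).dim = 4 := rfl
  have h3 : (planeGraft X₁ s X₂ K).edges.length = 1 := rfl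
  have h4 : (planeGraft X₁ s X₂ K).moduliDim 0 z ≤ 3 := by
    refine (planeGraft X₁ s X₂ K).moduliDim_le _ z
      (LinearMap.funLeft ℝ ℝ (n := Fin 4) ![0, 1, 2]) ?_
    intro (ξ : Fin 4 → ℝ) hξ h0
    have e0 : ξ 0 = 0 := congrFun h0 0
    have e1 : ξ 1 = 0 := congrFun h0 1
    have e2 : ξ 2 = 0 := congrFun h0 2
    have h5 := (slopeForm_planeGraft X₁ s X₂ K z ξ).symm.trans (hξ _ (List.mem_singleton_self _))
    rw [e0, e1, e2, sub_zero, sub_zero, zero_mul, sub_zero] at h5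
    have h6 := (mul_eq_zero.1 h5).resolve_right hs
    funext (j : Fin 4)
    fin_cases j
    · exact e0
    · exact e1
    · exact e2
    · exact h6
  omega

theorem moduliDim_planeGraft' {z : ℤ → ℂ} (hs : (S.dir z s).re ≠ 0) :
    (planeGraft' X₁ s X₂ K).moduliDim 0 z = 3 := by
  have h1 := (planeGraft' X₁ s X₂ K).dim_le_moduliDim_add 0 z
  have h2 : (planeGraft' X₁ s X₂ K).dim = 4 := rfl
  have h3 : (planeGraft' X₁ s X₂ K).edges.length = 1 := rfl
  have h4 : (planeGraft' X₁ s X₂ K).moduliDim 0 z ≤ 3 := by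
    refine (planeGraft' X₁ s X₂ K).moduliDim_le _ z
      (LinearMap.funLeft ℝ ℝ (n := Fin 4) ![0, 1, 2]) ?_
    intro (ξ : Fin 4 → ℝ) hξ h0
    have e0 : ξ 0 = 0 := congrFun h0 0
    have e1 : ξ 1 = 0 := congrFun h0 1
    have e2 : ξ 2 = 0 := congrFun h0 2
    have h5 := (slopeForm_planeGraft' X₁ s X₂ K z ξ).symm.trans (hξ _ (List.mem_singleton_self _))
    rw [e0, e1, e2, sub_zero, zero_mul, sub_zero, zero_sub, neg_mul, neg_eq_zero] at h5
    have h6 := (mul_eq_zero.1 h5).resolve_right hs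
    funext (j : Fin 4)
    fin_cases j
    · exact e0
    · exact e1
    · exact e2
    · exact h6
  omega

variable {X₁ s X₂ K} {k}

theorem orientation_leftGraft {z : ℤ → ℂ} {ξ : Fin (leftGraft k X₁ s X₂ K).dim → ℝ}
    (hs : (S.dir z s).re ≠ 0)
    (hd : (leftGraft k X₁ s X₂ K).IsDrawing (-Complex.I * -1) z ξ) :
    (leftGraft k X₁ s X₂ K).orientation (-Complex.I * -1) [-Complex.I * -1] z ξ = 1 := by
  obtain ⟨r, hr, h1⟩ := (isGraft_leftGraft k X₁ s X₂ K).exists_pos hd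
  obtain ⟨h2, h3⟩ := pos_leftGraft k X₁ s X₂ K (-Complex.I * -1) ξ
  rw [h2, h3] at h1
  have hre := congrArg Complex.re h1
  have him := congrArg Complex.im h1
  simp at hre him
  rw [Web.orientation, dif_pos (by rfl)]
  set f : (Fin 3 → ℝ) → ℝ := (leftGraft k X₁ s X₂ K).slopeForm (-Complex.I * -1) z
      (X₁.length, X₁.length + 1 + X₂.length) with hf
  have hf' : ∀ ξ, f ξ = (ξ 2 - ξ 0) * (S.dir z s).re - ξ 1 * (S.dir z s).im :=
    slopeForm_leftGraft k X₁ s X₂ K z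
  have : Matrix.det (n := Fin 3) (Matrix.of fun i j : Fin 3 =>
      (((leftGraft k X₁ s X₂ K).edges.map (fun e j =>
          (leftGraft k X₁ s X₂ K).slopeForm (-Complex.I * -1) z e (Pi.single j 1)) ++
        [-Complex.I * -1].map (leftGraft k X₁ s X₂ K).translation ++
        [ξ] : List (Fin 3 → ℝ)).get (i.cast rfl) j)) =
      r * (2 * (S.dir z s).re ^ 2 + (S.dir z s).im ^ 2) := by
    rw [Matrix.det_fin_three]
    change f (Pi.single 0 1) * (-Complex.I * -1).re * ξ (2 : Fin 3) -
      f (Pi.single 0 1) * (-Complex.I * -1).im * ξ (1 : Fin 3) -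
      f (Pi.single 1 1) * 1 * ξ (2 : Fin 3) +
      f (Pi.single 1 1) * (-Complex.I * -1).im * ξ (0 : Fin 3) +
      f (Pi.single 2 1) * 1 * ξ (1 : Fin 3) -
      f (Pi.single 2 1) * (-Complex.I * -1).re * ξ (0 : Fin 3) = _
    simp only [hf']
    simp
    rw [hre]
    linear_combination (S.dir z s).im * him
  erw [this]
  rw [sign_pos]
  · rfl
  · have := sq_pos_of_ne_zero hs
    have := sq_nonneg (S.dir z s).im
    exact mul_pos hr (by linarith)

/-- The determinant which gives the orientation of a graft in the plane. -/
theorem det_plane (f : (Fin 4 → ℝ) → ℝ) {a b : ℝ} (ξ : Fin 4 → ℝ)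
    (hf : ∀ ξ, f ξ = (ξ 3 - ξ 1) * a - (ξ 2 - ξ 0) * b) :
    (Matrix.of ![fun j => f (Pi.single j 1), ![1, 0, 1, 0], ![0, 1, 0, 1], ξ]).det =
      -(2 * ((ξ 2 - ξ 0) * a + (ξ 3 - ξ 1) * b)) := by
  have h0 : f (Pi.single 0 1) = b := by rw [hf]; simp
  have h1 : f (Pi.single 1 1) = -a := by rw [hf]; simp
  have h2 : f (Pi.single 2 1) = -b := by rw [hf]; simp
  have h3 : f (Pi.single 3 1) = a := by rw [hf]; simp
  have h : (fun j => f (Pi.single j 1)) = ![b, -a, -b, a] := by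
    funext j
    fin_cases j
    · exact h0
    · exact h1
    · exact h2
    · exact h3
  rw [h]
  simp [Matrix.det_succ_row_zero, Fin.sum_univ_succ, Fin.succAbove]
  ring

theorem rows_plane (f : (Fin 4 → ℝ) → ℝ) (ξ t₁ t₂ : Fin 4 → ℝ) (i j : Fin 4) :
    ([fun j => f (Pi.single j 1), t₁, t₂, ξ] : List (Fin 4 → ℝ)).get i j =
      Matrix.of ![fun j => f (Pi.single j 1), t₁, t₂, ξ] i j := by
  fin_cases i <;> rfl

theorem orientation_planeGraft {z : ℤ → ℂ} {ξ : Fin (planeGraft X₁ s X₂ K).dim → ℝ}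
    (hs : (S.dir z s).re ≠ 0) (hd : (planeGraft X₁ s X₂ K).IsDrawing 0 z ξ) :
    (planeGraft X₁ s X₂ K).orientation 0 [1, Complex.I] z ξ = -1 := by
  obtain ⟨r, hr, h1⟩ := (isGraft_planeGraft X₁ s X₂ K).exists_pos hd
  obtain ⟨h2, h3⟩ := pos_planeGraft X₁ s X₂ K 0 ξ
  rw [h2, h3] at h1
  have hre := congrArg Complex.re h1
  have him := congrArg Complex.im h1
  simp at hre him
  rw [Web.orientation, dif_pos (by rfl)]
  set f : (Fin 4 → ℝ) → ℝ := (planeGraft X₁ s X₂ K).slopeForm 0 z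
      (X₁.length, X₁.length + 1 + X₂.length) with hf
  have ht : (planeGraft X₁ s X₂ K).translation 1 = ![1, 0, 1, 0] := by
    funext (j : Fin 4)
    fin_cases j <;> simp [Web.translation, planeGraft, (by decide : Odd 3)]
  have ht' : (planeGraft X₁ s X₂ K).translation Complex.I = ![0, 1, 0, 1] := by
    funext (j : Fin 4)
    fin_cases j <;> simp [Web.translation, planeGraft, (by decide : Odd 3)]
  have hdet := det_plane f ξ (slopeForm_planeGraft X₁ s X₂ K z)
  rw [hre, him] at hdet
  have : Matrix.det (n := Fin 4) (Matrix.of fun i j : Fin 4 =>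
      (((planeGraft X₁ s X₂ K).edges.map (fun e j =>
          (planeGraft X₁ s X₂ K).slopeForm 0 z e (Pi.single j 1)) ++
        [1, Complex.I].map (planeGraft X₁ s X₂ K).translation ++
        [ξ] : List (Fin 4 → ℝ)).get (i.cast rfl) j)) =
      -(2 * (r * (S.dir z s).re * (S.dir z s).re + r * (S.dir z s).im * (S.dir z s).im)) := by
    rw [← hdet, ← ht, ← ht']
    congr 1
    ext i j
    exact rows_plane f ξ _ _ i j
  erw [this]
  rw [sign_neg]
  · rfl
  · have := mul_pos hr (sq_pos_of_ne_zero hs)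
    have := mul_nonneg hr.le (sq_nonneg (S.dir z s).im)
    nlinarith

theorem orientation_planeGraft' {z : ℤ → ℂ} {ξ : Fin (planeGraft' X₁ s X₂ K).dim → ℝ}
    (hs : (S.dir z s).re ≠ 0) (hd : (planeGraft' X₁ s X₂ K).IsDrawing 0 z ξ) :
    (planeGraft' X₁ s X₂ K).orientation 0 [1, Complex.I] z ξ = -1 := by
  obtain ⟨r, hr, h1⟩ := (isGraft_planeGraft' X₁ s X₂ K).exists_pos hd
  obtain ⟨h2, h3⟩ := pos_planeGraft' X₁ s X₂ K 0 ξ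
  rw [h2, h3] at h1
  have hre := congrArg Complex.re h1
  have him := congrArg Complex.im h1
  simp at hre him
  rw [Web.orientation, dif_pos (by rfl)]
  set f : (Fin 4 → ℝ) → ℝ := (planeGraft' X₁ s X₂ K).slopeForm 0 z
      (0, K.length + 1 + X₁.length) with hf
  have ht : (planeGraft' X₁ s X₂ K).translation 1 = ![1, 0, 1, 0] := by
    funext (j : Fin 4)
    fin_cases j <;> simp [Web.translation, planeGraft', (by decide : Odd 3)]
  have ht' : (planeGraft' X₁ s X₂ K).translation Complex.I = ![0, 1, 0, 1] := by
    funext (j : Fin 4)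
    fin_cases j <;> simp [Web.translation, planeGraft', (by decide : Odd 3)]
  have hdet := det_plane f (a := -(S.dir z s).re) (b := -(S.dir z s).im) ξ fun ξ => by
    rw [hf, slopeForm_planeGraft' X₁ s X₂ K z]; ring
  have hval : -(2 * ((ξ (2 : Fin 4) - ξ (0 : Fin 4)) * -(S.dir z s).re +
      (ξ (3 : Fin 4) - ξ (1 : Fin 4)) * -(S.dir z s).im)) =
      -(2 * (r * (S.dir z s).re * (S.dir z s).re + r * (S.dir z s).im * (S.dir z s).im)) := by
    linear_combination -2 * (S.dir z s).re * hre - 2 * (S.dir z s).im * him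
  rw [hval] at hdet
  have : Matrix.det (n := Fin 4) (Matrix.of fun i j : Fin 4 =>
      (((planeGraft' X₁ s X₂ K).edges.map (fun e j =>
          (planeGraft' X₁ s X₂ K).slopeForm 0 z e (Pi.single j 1)) ++
        [1, Complex.I].map (planeGraft' X₁ s X₂ K).translation ++
        [ξ] : List (Fin 4 → ℝ)).get (i.cast rfl) j)) =
      -(2 * (r * (S.dir z s).re * (S.dir z s).re + r * (S.dir z s).im * (S.dir z s).im)) := by
    rw [← hdet, ← ht, ← ht']
    congr 1
    ext i j
    exact rows_plane f ξ _ _ i j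
  erw [this]
  rw [sign_neg]
  · rfl
  · have := mul_pos hr (sq_pos_of_ne_zero hs)
    have := mul_nonneg hr.le (sq_nonneg (S.dir z s).im)
    nlinarith

end Graft

/-! ### The operations of the left half-plane -/

section LeftCoeff

variable {S : Spectrum.{u}}

theorem IsPath.graft {k l : ℤ} {X₁ X₂ K : List S.Gen} {s : S.Gen}
    (h : IsPath k l (X₁ ++ s :: X₂)) (hK : IsPath (S.src s) (S.tgt s) K) :
    IsPath k l (X₁ ++ K ++ X₂) := by
  obtain ⟨m, h1, h2, h3⟩ := isPath_append.1 h
  rw [List.append_assoc]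
  refine isPath_append.2 ⟨m, h1, isPath_append.2 ⟨S.tgt s, ?_, h3⟩⟩
  rw [← h2]
  exact hK

theorem IsPath.ne_nil {s : S.Gen} {K : List S.Gen} (hK : IsPath (S.src s) (S.tgt s) K)
    : K ≠ [] := by
  rintro rfl
  exact S.src_ne_tgt s hK

theorem exists_append_of_getElem? {ι : Type*} {l : List ι} {p : ℕ} {x : ι} (h : l[p]? = some x) :
    ∃ l₁ l₂, l = l₁ ++ x :: l₂ ∧ l₁.length = p := by
  obtain ⟨hp, rfl⟩ := List.getElem?_eq_some_iff.1 h
  refine ⟨l.take p, l.drop (p + 1), ?_, by simp; omega⟩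
  rw [List.getElem_cons_drop, List.take_append_drop]

namespace Web

variable {w : Web S} {s : S.Gen} {A K : List S.Gen} {p : ℕ}

theorem exists_graft_first {r : S.Gen} (hv : w.vertices = [A, r :: K])
    (hE : w.edges = [(p, A.length)]) (hp : p < A.length)
    (hperm : (w.edges.flatMap (fun e => [e.1, e.2]) ++ w.outs).Perm (List.range w.germs.length))
    (hs : w.letter p = some s) (hr : w.letter A.length = some (S.bar s)) :
    ∃ X₁ X₂, A = X₁ ++ s :: X₂ ∧ r = S.bar s ∧
      w.edges = [(X₁.length, X₁.length + 1 + X₂.length)] ∧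
      ∀ o, w.outs.map w.letter = o.map some → (o.Pairwise fun a b => S.tgt a < S.tgt b) →
        ((X₁ ++ K ++ X₂).Pairwise fun a b => S.tgt a < S.tgt b) →
        w.outs = List.range' 0 X₁.length ++
          List.range' (X₁.length + 1 + X₂.length + 1) K.length ++
          List.range' (X₁.length + 1) X₂.length ∧ o = X₁ ++ K ++ X₂ := by
  rw [letter_of_vertices_eq hv] at hs hr
  rw [List.getElem?_append_left hp] at hs
  rw [List.getElem?_append_right le_rfl, Nat.sub_self] at hr
  have hr' : r = S.bar s := by simpa using hr
  subst hr'
  obtain ⟨X₁, X₂, rfl, rfl⟩ := exists_append_of_getElem? hs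
  have hE' : w.edges = [(X₁.length, X₁.length + 1 + X₂.length)] := by
    rw [hE]; simp; omega
  refine ⟨X₁, X₂, rfl, rfl, hE', fun o ho hos hos' => ?_⟩
  set w' : Web S := ⟨w.bdry, w.bulk, w.edges, List.range' 0 X₁.length ++
    List.range' (X₁.length + 1 + X₂.length + 1) K.length ++ List.range' (X₁.length + 1) X₂.length⟩
  have hw' : w'.IsGraft X₁ s X₂ K 0 1 := isGraft_of_first hv hE' rfl
  refine outs_eq ?_ ho hw'.outs_letter hos hos'
  exact (List.perm_append_left_iff _).1 (hperm.trans hw'.perm.symm)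

theorem exists_graft_second {r : S.Gen} (hv : w.vertices = [r :: K, A])
    (hE : w.edges = [(0, K.length + 1 + p)])
    (hperm : (w.edges.flatMap (fun e => [e.1, e.2]) ++ w.outs).Perm (List.range w.germs.length))
    (hs : w.letter (K.length + 1 + p) = some s) (hr : r = S.bar s) :
    ∃ X₁ X₂, A = X₁ ++ s :: X₂ ∧ w.edges = [(0, K.length + 1 + X₁.length)] ∧
      ∀ o, w.outs.map w.letter = o.map some → (o.Pairwise fun a b => S.tgt a < S.tgt b) →
        ((X₁ ++ K ++ X₂).Pairwise fun a b => S.tgt a < S.tgt b) →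
        w.outs = List.range' (K.length + 1) X₁.length ++ List.range' 1 K.length ++
          List.range' (K.length + 1 + X₁.length + 1) X₂.length ∧ o = X₁ ++ K ++ X₂ := by
  rw [letter_of_vertices_eq hv, List.getElem?_append_right (by simp)] at hs
  have h1 : K.length + 1 + p - (r :: K).length = p := by simp
  rw [h1] at hs
  subst hr
  obtain ⟨X₁, X₂, rfl, rfl⟩ := exists_append_of_getElem? hs
  refine ⟨X₁, X₂, rfl, hE, fun o ho hos hos' => ?_⟩
  set w' : Web S := ⟨w.bdry, w.bulk, w.edges, List.range' (K.length + 1) X₁.length ++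
    List.range' 1 K.length ++ List.range' (K.length + 1 + X₁.length + 1) X₂.length⟩
  have hw' : w'.IsGraft X₁ s X₂ K 1 0 := isGraft_of_second hv hE rfl
  refine outs_eq ?_ ho hw'.outs_letter hos hos'
  exact (List.perm_append_left_iff _).1 (hperm.trans hw'.perm.symm)

theorem edge_lt_of_owner_ne {A B : List S.Gen} (hv : w.vertices = [A, B]) {p q : ℕ} (hpq : p < q)
    (hq : q < w.germs.length) (h : w.owner p ≠ w.owner q) : p < A.length ∧ A.length ≤ q := by
  rw [length_germs_of_vertices_eq hv] at hq
  rw [owner_of_vertices_eq hv (by omega), owner_of_vertices_eq hv (by omega)] at h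
  by_cases h1 : p < A.length <;> by_cases h2 : q < A.length
  · simp [h1, h2] at h
  · exact ⟨h1, by omega⟩
  · omega
  · simp [h1, h2] at h

/-- A taut web in the left half-plane is a pair of boundary vertices or a bulk vertex grafted to
a boundary vertex: every bulk vertex is attached by its falling edge. -/
theorem IsHalfPlaneWeb.eq_pairWeb_or_leftGraft {F : Set ℤ} {z : ℤ → ℂ}
    (hz : IsParabolicOn F z) (hF : SupportedOn F w.vertices.flatten) {ws : List (Word S)}
    {o : Word S} {ξ : Fin w.dim → ℝ} (h : w.IsHalfPlaneWeb (-1) z ws o ξ) (hne : ws ≠ [])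
    {τ : ℂ} (hm : w.moduliDim τ z = 2) :
    (∃ w₁ w₂, ws = [w₁, w₂] ∧ w = pairWeb w₁ w₂ ∧ o.letters = w₁.letters ++ w₂.letters) ∨
      ∃ w₁ X₁ s X₂ K, ws = [w₁] ∧ w₁.letters = X₁ ++ s :: X₂ ∧ o.letters = X₁ ++ K ++ X₂ ∧
        IsPath (S.src s) (S.tgt s) K ∧ w = leftGraft w₁.start X₁ s X₂ K := by
  have hFmem : ∀ s ∈ w.vertices.flatten, SupportedOn F [s] := fun s hs =>
    hF.of_subset (by simpa using hs)
  have hsub : ∀ b ∈ ws, b.letters ⊆ w.vertices.flatten := by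
    intro b hb s hs
    rw [Web.vertices, List.flatten_append, h.bdry_eq]
    exact List.mem_append_left _ (List.mem_flatten.2 ⟨_, List.mem_map_of_mem hb, hs⟩)
  have hosub : o.letters ⊆ w.vertices.flatten := by
    intro s hs
    have h1 : some s ∈ w.outs.map w.letter := by
      rw [h.infinity]; exact List.mem_map_of_mem hs
    obtain ⟨p, -, hp⟩ := List.mem_map.1 h1
    exact w.letter_mem hp
  have hws : ∀ b ∈ ws, IsPath b.start b.final b.letters ∧ ∀ s ∈ b.letters, S.IsUp s := fun b hb =>
    (isHalfPlaneFan_left_iff hz (hF.of_subset (hsub b hb))).1 (h.bdry_fan b hb)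
  obtain ⟨hopath, houp⟩ :=
    (isHalfPlaneFan_left_iff hz (hF.of_subset hosub)).1 h.infinity_fan
  have hpath : IsPath o.start o.final (ws.flatMap Word.letters) :=
    isPath_flatMap (fun b hb => (h.bdry_fan b hb).1) h.label_bdry hne h.label_first h.label_last
  have hup : ∀ s ∈ ws.flatMap Word.letters, S.IsUp s := by
    intro s hs
    obtain ⟨b, hb, hsb⟩ := List.mem_flatMap.1 hs
    exact (hws b hb).2 s hsb
  have hosort := hopath.pairwise_tgt_of_isUp houp
  have hcount := h.graph.countP_isDown h.infinity
  have hbsum := h.graph.sum_countP_bulk hz hF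
  have hzero : ∀ {L : List S.Gen}, (∀ s ∈ L, S.IsUp s) → L.countP (fun s => S.IsDown s) = 0 := by
    intro L hL
    rw [List.countP_eq_zero]
    intro s hs
    simpa using Spectrum.not_isDown.2 (hL s hs)
  have hcb : (w.bdry.map Word.letters).flatten.countP (fun s => S.IsDown s) = 0 := by
    rw [h.bdry_eq, ← List.flatMap_def]
    exact hzero hup
  rw [Web.vertices, List.map_append, List.sum_append, hbsum, ← List.countP_flatten, hcb,
    hzero houp, add_zero, zero_add] at hcount
  have hdim := w.dim_le_moduliDim_add τ z
  rw [hm, Web.dim, h.bdry_eq] at hdim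
  have hn : 1 ≤ ws.length := List.length_pos_iff.2 hne
  by_cases hb : w.bulk = []
  · exact Or.inl (h.eq_pairWeb hb hm (hpath.pairwise_tgt_of_isUp hup) hosort)
  · right
    have hV : 1 ≤ w.bulk.length := List.length_pos_iff.2 hb
    obtain ⟨b, hb⟩ := List.length_eq_one_iff.1 (show w.bulk.length = 1 by omega)
    obtain ⟨w₁, hw₁⟩ := List.length_eq_one_iff.1 (show ws.length = 1 by omega)
    obtain ⟨e, hE⟩ := List.length_eq_one_iff.1 (show w.edges.length = 1 by omega)
    subst hw₁
    have hv : w.vertices = [w₁.letters, b] := by rw [Web.vertices, h.bdry_eq, hb]; rfl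
    obtain ⟨r, K, rfl, hKne, hK, hKup⟩ := (isCyclicFan_iff hz (hF.of_subset (by
      rw [hv]; simp))).1 (h.graph.bulk_fan b (by rw [hb]; simp))
    have he : e ∈ w.edges := by rw [hE]; simp
    obtain ⟨s, hs, hs'⟩ := h.graph.exists_edge_letter he
    have hlt := h.graph.edge_lt e he
    have hown := h.drawing.owner_ne he (by
      rw [w.dir_eq hs]
      exact hz.dir_ne_zero (hFmem s (w.letter_mem hs)))
    obtain ⟨h1, h2⟩ := edge_lt_of_owner_ne hv hlt (h.graph.edge_lt_length he).2 hown
    have hsup : S.IsUp s := by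
      rw [letter_of_vertices_eq hv, List.getElem?_append_left h1] at hs
      exact (hws w₁ (by simp)).2 s (List.mem_of_getElem? hs)
    -- the other end of the edge is the falling germ of the bulk vertex
    have he2 : e.2 = w₁.letters.length := by
      by_contra hcon
      have h3 : e.2 - w₁.letters.length = (e.2 - w₁.letters.length - 1) + 1 := by omega
      have hs2 := hs'
      rw [letter_of_vertices_eq hv, List.getElem?_append_right h2, h3,
        List.getElem?_cons_succ] at hs2
      exact Spectrum.not_isDown.2 (hKup _ (List.mem_of_getElem? hs2)) (Spectrum.isDown_bar.2 hsup)
    obtain ⟨X₁, X₂, hX, hr, hE', hout⟩ := exists_graft_first hv (p := e.1) (by rw [hE, ← he2]) h1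
      h.graph.germs_perm hs (by rw [← he2]; exact hs')
    subst hr
    rw [S.tgt_bar, S.src_bar] at hK
    have hw₁path := (hws w₁ (by simp)).1
    rw [hX] at hw₁path
    have hw₁up := (hws w₁ (by simp)).2
    rw [hX] at hw₁up
    obtain ⟨h3, h4⟩ := hout o.letters h.infinity hosort
      ((hw₁path.graft hK).pairwise_tgt_of_isUp (by
        intro x hx
        simp only [List.mem_append] at hx
        rcases hx with (hx | hx) | hx
        · exact hw₁up x (by simp [hx])
        · exact hKup x hx
        · exact hw₁up x (by simp [hx])))
    refine ⟨w₁, X₁, s, X₂, K, rfl, hX, h4, hK, ?_⟩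
    obtain ⟨bdry, bulk, edges, outs⟩ := w
    have hbd := h.bdry_eq
    simp only at hbd hb hE' h3
    rw [leftGraft, hbd, hb, hE', h3, ← hX]

end Web

theorem leftGraft_isHalfPlaneWeb {F : Set ℤ} {z : ℤ → ℂ} (hz : IsParabolicOn F z)
    {X₁ X₂ K : List S.Gen} {s : S.Gen} {o : Word S} (hF : SupportedOn F (X₁ ++ s :: X₂ ++ K))
    (hX : IsPath o.start o.final (X₁ ++ s :: X₂)) (hup : ∀ x ∈ X₁ ++ s :: X₂, S.IsUp x)
    (hK : IsPath (S.src s) (S.tgt s) K) (hKup : ∀ x ∈ K, S.IsUp x)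
    (ho : o.letters = X₁ ++ K ++ X₂) :
    ∃ ξ, (leftGraft o.start X₁ s X₂ K).IsHalfPlaneWeb (-1) z [⟨o.start, X₁ ++ s :: X₂⟩] o ξ := by
  set w := leftGraft o.start X₁ s X₂ K with hw
  have hg : w.IsGraft X₁ s X₂ K 0 1 := isGraft_leftGraft o.start X₁ s X₂ K
  have hsup : S.IsUp s := hup s (by simp)
  have hsF : SupportedOn F [s] := hF.of_subset (by simp)
  have hre := hz.re_dir_neg hsF hsup
  set ξ : Fin 3 → ℝ := ![0, (S.dir z s).re, (S.dir z s).im] with hξ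
  obtain ⟨hp0, hp1⟩ := pos_leftGraft o.start X₁ s X₂ K (-Complex.I * -1) ξ
  have hq0 : w.pos (-Complex.I * -1) ξ 0 = 0 := by
    refine hp0.trans ?_
    simp [hξ]
  have hq1 : w.pos (-Complex.I * -1) ξ 1 = S.dir z s := by
    refine hp1.trans ?_
    simp [hξ, Complex.re_add_im]
  have hbar : SupportedOn F (S.bar s :: K) := by
    intro x hx
    rcases List.mem_cons.1 hx with rfl | hx
    · rw [S.src_bar, S.tgt_bar]
      exact (hsF s (by simp)).symm
    · exact hF x (by simp [hx])
  have hfin : (⟨o.start, X₁ ++ s :: X₂⟩ : Word S).final = o.final := hX.final_eq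
  have hfan : (⟨o.start, X₁ ++ s :: X₂⟩ : Word S).IsHalfPlaneFan z (-1) := by
    refine (isHalfPlaneFan_left_iff hz (hF.of_subset (List.subset_append_left _ _))).2 ⟨?_, hup⟩
    rw [hfin]
    exact hX
  refine ⟨ξ, ⟨⟨hg.perm, ?_, ?_, ?_, ?_⟩, ?_, rfl, ?_, ?_, ?_, ?_, ?_, ?_, ?_, ?_⟩⟩
  · obtain ⟨p, q, hE, hpq, -⟩ := hg.edge
    intro e he
    rw [hE, List.mem_singleton] at he
    rw [he]
    exact hpq
  · exact List.pairwise_singleton _ _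
  · obtain ⟨p, q, hE, -, h1 | h1⟩ := hg.edge <;> intro e he <;>
      rw [hE, List.mem_singleton] at he <;> rw [he] <;> simp only [h1.2.2.1, h1.2.2.2] <;>
      simp [S.bar_bar]
  · intro b hb
    have : b = S.bar s :: K := by simpa [hw, leftGraft] using hb
    subst this
    refine (isCyclicFan_iff hz hbar).2 ⟨_, K, rfl, hK.ne_nil, ?_, hKup⟩
    rw [S.src_bar, S.tgt_bar]
    exact hK
  · refine hg.isDrawing hz hF (R := []) (Y := X₁) rfl (by simp) (by simp) hX hup hK hKup ?_
    rw [hq0, hq1, zero_add]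
  · intro b hb
    rw [List.mem_singleton] at hb
    subst hb
    exact hfan
  · intro i j hij hj
    have hj' : j.1 < 1 := hj
    have hij' : i.1 < j.1 := hij
    omega
  · intro v hv hv'
    have h1 : 1 ≤ v := hv
    rw [hg.numVertices] at hv'
    have : v = 1 := by omega
    rw [this, hq1]
    simpa using hre
  · rw [ho]
    exact hg.outs_letter
  · refine (isHalfPlaneFan_left_iff hz ?_).2 ⟨?_, ?_⟩
    · rw [ho]
      refine hF.of_subset fun x hx => ?_
      simp only [List.mem_append, List.mem_cons] at hx ⊢
      tauto
    · rw [ho]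
      exact hX.graft hK
    · intro x hx
      rw [ho] at hx
      simp only [List.mem_append] at hx
      rcases hx with (hx | hx) | hx
      · exact hup x (by simp [hx])
      · exact hKup x hx
      · exact hup x (by simp [hx])
  · simp
  · simp
  · intro a ha
    have : a = ⟨o.start, X₁ ++ s :: X₂⟩ := by simpa using ha.symm
    rw [this]
    exact hfin

variable {D : InfraredData S} {z : ℝ → ℤ → ℂ}

theorem mem_halfPlaneTaut_left (hz : IsAsymptoticallyParabolic z) {ws : List (Word S)} {o : Word S}
    (hne : ws ≠ []) {w : Web S} (hw : w ∈ InfraredData.halfPlaneTaut z (-1) ws o) :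
    (∃ w₁ w₂, ws = [w₁, w₂] ∧ w = pairWeb w₁ w₂ ∧ o.letters = w₁.letters ++ w₂.letters) ∨
      ∃ w₁ X₁ s X₂ K, ws = [w₁] ∧ w₁.letters = X₁ ++ s :: X₂ ∧ o.letters = X₁ ++ K ++ X₂ ∧
        IsPath (S.src s) (S.tgt s) K ∧ w = leftGraft w₁.start X₁ s X₂ K := by
  obtain ⟨F, hF, hpar⟩ := hz.eventually_supportedOn w.vertices.flatten
  obtain ⟨t, ⟨⟨ξ, hξ⟩, hm⟩, hzt⟩ := ((eventually_of_mem_halfPlaneTaut hw).and hpar).exists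
  exact hξ.eq_pairWeb_or_leftGraft hzt hF hne hm

/-- The graft of a bulk vertex to the `i`-th edge of `w` for which the vacua at infinity are
those of `o`. -/
def graftAt (w o : Word S) (i : Fin w.letters.length) : Web S :=
  leftGraft w.start (w.letters.take i) w.letters[i] (w.letters.drop (i + 1))
    ((o.letters.drop i).take (o.letters.length + 1 - w.letters.length))

/-- The word at infinity is obtained from the word at the boundary by replacing the `i`-th
letter by a path. -/
def IsGraftAt (w o : Word S) (i : Fin w.letters.length) : Prop :=
  o.letters = w.letters.take i ++ (o.letters.drop i).take (o.letters.length + 1 - w.letters.length)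
    ++ w.letters.drop (i + 1) ∧ IsPath (S.src w.letters[i]) (S.tgt w.letters[i])
      ((o.letters.drop i).take (o.letters.length + 1 - w.letters.length))

theorem exists_isGraftAt {w o : Word S} {X₁ X₂ K : List S.Gen} {s : S.Gen}
    (hw : w.letters = X₁ ++ s :: X₂) (ho : o.letters = X₁ ++ K ++ X₂)
    (hK : IsPath (S.src s) (S.tgt s) K) :
    ∃ i, IsGraftAt w o i ∧ leftGraft w.start X₁ s X₂ K = graftAt w o i := by
  obtain ⟨k, L⟩ := w
  obtain ⟨l, M⟩ := o
  simp only at hw ho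
  subst hw ho
  have hKeq : ((X₁ ++ K ++ X₂).drop X₁.length).take
      ((X₁ ++ K ++ X₂).length + 1 - (X₁ ++ s :: X₂).length) = K := by
    have : (X₁ ++ K ++ X₂).length + 1 - (X₁ ++ s :: X₂).length = K.length := by simp; omega
    rw [this, List.append_assoc, List.drop_left, List.take_left]
  have h1 : (X₁ ++ s :: X₂).take X₁.length = X₁ := List.take_left
  have h2 : (X₁ ++ s :: X₂).drop (X₁.length + 1) = X₂ := by
    rw [← List.drop_drop, List.drop_left]; rfl
  have h3 : (X₁ ++ s :: X₂)[X₁.length]'(by simp) = s := by simp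
  refine ⟨⟨X₁.length, by simp⟩, ⟨?_, ?_⟩, ?_⟩
  · simp only [hKeq, h1, h2]
  · simp only [hKeq, Fin.getElem_fin, h3]
    exact hK
  · simp only [graftAt, hKeq, h1, h2, Fin.getElem_fin, h3]

theorem graftAt_injective (w o : Word S) : Function.Injective (graftAt w o) := by
  intro i j h
  have h1 := congrArg Web.edges h
  simp only [graftAt, leftGraft, List.cons.injEq, Prod.mk.injEq, List.length_take] at h1
  have := i.2
  have := j.2
  ext
  omega

theorem mem_halfPlaneTaut_left_one (hz : IsAsymptoticallyParabolic z) {w o : Word S}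
    (hw : w.IsStableFan z (-1)) (ho : o.IsStableFan z (-1)) (hs : w.start = o.start)
    (hf : w.final = o.final) {w' : Web S} : w' ∈ InfraredData.halfPlaneTaut z (-1) [w] o ↔
      ∃ i, IsGraftAt w o i ∧ w' = graftAt w o i := by
  constructor
  · intro h
    rcases mem_halfPlaneTaut_left hz (by simp) h with ⟨w₁, w₂, h1, -, -⟩ |
      ⟨w₁, X₁, s, X₂, K, h1, h2, h3, h4, rfl⟩
    · simp at h1
    · rw [List.cons.injEq] at h1
      obtain ⟨rfl, -⟩ := h1
      exact exists_isGraftAt h2 h3 h4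
  · rintro ⟨i, ⟨h1, h2⟩, rfl⟩
    obtain ⟨hwpath, hwup⟩ := (isStableFan_left_iff hz).1 hw
    have houp := ((isStableFan_left_iff hz).1 ho).2
    have hsplit : w.letters.take i ++ w.letters[i] :: w.letters.drop (i + 1) = w.letters := by
      rw [Fin.getElem_fin, List.getElem_cons_drop, List.take_append_drop]
    set K := (o.letters.drop i).take (o.letters.length + 1 - w.letters.length) with hK
    have hKup : ∀ x ∈ K, S.IsUp x := fun x hx => houp x (by rw [h1]; simp [hx])
    obtain ⟨F, hF, hpar⟩ := hz.eventually_supportedOn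
      (w.letters.take i ++ w.letters[i] :: w.letters.drop (i + 1) ++ K)
    refine hpar.mono fun t ht => ⟨?_, moduliDim_leftGraft _ _ _ _ _ ?_⟩
    · have := leftGraft_isHalfPlaneWeb (o := o) ht hF (by rw [hsplit, ← hs, ← hf]; exact hwpath)
        (by rw [hsplit]; exact hwup) h2 hKup h1
      rw [hsplit, ← hs] at this
      exact this
    · exact (ht.re_dir_neg (hF.of_subset (by simp)) (hwup _ (List.getElem_mem _))).ne

open Classical in
theorem halfPlaneCoeff_left_one (hz : IsAsymptoticallyParabolic z) {w o : Word S}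
    (hw : w.IsStableFan z (-1)) (ho : o.IsStableFan z (-1)) (hs : w.start = o.start)
    (hf : w.final = o.final) : D.halfPlaneCoeff z (-1) [w] o =
      ∑ i : Fin w.letters.length, if IsGraftAt w o i then
        sgn ((w.letters.take i).map D.deg).sum * D.amp (S.bar w.letters[i] ::
          (o.letters.drop i).take (o.letters.length + 1 - w.letters.length)) else 0 := by
  have hset : InfraredData.halfPlaneTaut z (-1) [w] o = graftAt w o ''
      ((Finset.univ.filter fun i => IsGraftAt w o i : Finset (Fin w.letters.length)) :
        Set (Fin w.letters.length)) := by
    ext w'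
    rw [mem_halfPlaneTaut_left_one hz hw ho hs hf]
    simp only [Finset.coe_filter, Finset.mem_univ, true_and, Set.mem_image]
    exact ⟨fun ⟨i, h1, h2⟩ => ⟨i, h1, h2.symm⟩, fun ⟨i, h1, h2⟩ => ⟨i, h1, h2.symm⟩⟩
  rw [InfraredData.halfPlaneCoeff, hset, finsum_mem_image (graftAt_injective w o).injOn,
    finsum_mem_coe_finset, Finset.sum_filter]
  refine Finset.sum_congr rfl fun i _ => ?_
  refine ite_congr rfl (fun hi => ?_) fun _ => rfl
  have hup := ((isStableFan_left_iff hz).1 hw).2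
  have hre : ∀ᶠ t : ℝ in 𝓝[>] 0, (S.dir (z t) w.letters[i]).re ≠ 0 := by
    obtain ⟨F, hF, hpar⟩ := hz.eventually_supportedOn [w.letters[i]]
    exact hpar.mono fun t ht => (ht.re_dir_neg hF (hup _ (List.getElem_mem _))).ne
  rw [Web.stableSign_eq_one, graftAt, D.contraction_leftGraft, one_mul]
  exact hre.mono fun t ht ξ hξ => orientation_leftGraft ht hξ.drawing

theorem halfPlaneTaut_left_finite (hz : IsAsymptoticallyParabolic z) {ws : List (Word S)}
    {o : Word S} (hne : ws ≠ []) : (InfraredData.halfPlaneTaut z (-1) ws o).Finite := by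
  rcases ws with _ | ⟨w₁, _ | ⟨w₂, ws⟩⟩
  · exact absurd rfl hne
  · refine (Set.finite_range (graftAt w₁ o)).subset fun w hw => ?_
    rcases mem_halfPlaneTaut_left hz hne hw with ⟨w₁, w₂, h1, -, -⟩ |
      ⟨w₁, X₁, s, X₂, K, h1, h2, h3, h4, rfl⟩
    · simp at h1
    · rw [List.cons.injEq] at h1
      obtain ⟨rfl, -⟩ := h1
      obtain ⟨i, -, hi⟩ := exists_isGraftAt h2 h3 h4
      exact ⟨i, hi.symm⟩
  · refine (Set.finite_singleton (pairWeb w₁ w₂)).subset fun w hw => ?_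
    rcases mem_halfPlaneTaut_left hz hne hw with ⟨w₁, w₂, h1, rfl, -⟩ |
      ⟨w₁, X₁, s, X₂, K, h1, -⟩
    · simp only [List.cons.injEq] at h1
      rw [h1.1, h1.2.1]
      exact Set.mem_singleton _
    · simp at h1

theorem shape_of_halfPlaneCoeff_left_ne_zero (hz : IsAsymptoticallyParabolic z)
    {ws : List (Word S)} {o : Word S} (hne : ws ≠ []) (h : D.halfPlaneCoeff z (-1) ws o ≠ 0) :
    (∃ w₁ w₂, ws = [w₁, w₂] ∧ o.letters = w₁.letters ++ w₂.letters) ∨ ∃ w₁, ws = [w₁] := by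
  obtain ⟨w, hw⟩ := exists_halfPlaneTaut_of_coeff_ne_zero h
  rcases mem_halfPlaneTaut_left hz hne hw with ⟨w₁, w₂, h1, -, h2⟩ | ⟨w₁, X₁, s, X₂, K, h1, -⟩
  · exact Or.inl ⟨w₁, w₂, h1, h2⟩
  · exact Or.inr ⟨w₁, h1⟩

theorem halfPlaneCoeff_pair_left (hz : IsAsymptoticallyParabolic z) {w₁ w₂ o : Word S}
    (h₁ : w₁.IsStableFan z (-1)) (h₂ : w₂.IsStableFan z (-1)) (ho : o.IsStableFan z (-1))
    (hlet : o.letters = w₁.letters ++ w₂.letters) (h12 : w₁.final = w₂.start)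
    (hs : w₁.start = o.start) (hf : w₂.final = o.final) :
    D.halfPlaneCoeff z (-1) [w₁, w₂] o = sgn (D.degWord w₁) := by
  obtain ⟨hopath, houp⟩ := (isStableFan_left_iff hz).1 ho
  obtain ⟨F, hF, hpar⟩ := hz.eventually_supportedOn o.letters
  have hmem : pairWeb w₁ w₂ ∈ InfraredData.halfPlaneTaut z (-1) [w₁, w₂] o := by
    filter_upwards [h₁, h₂, ho, hpar] with t h1 h2 h3 h4
    refine ⟨pairWeb_isHalfPlaneWeb (by simp) h1 h2 h3 hlet h12 hs hf ?_, moduliDim_pairWeb _ _ _ _⟩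
    refine (hopath.pairwise_of_isUp houp).imp_of_mem fun {a b} ha hb hab => ?_
    exact h4.cross_neg (hF.of_subset (by simp [ha, hb])) (houp a ha) (houp b hb) hab
  rw [halfPlaneCoeff_eq_of_unique hmem, Web.stableSign_eq_one, D.contraction_pairWeb, one_mul]
  · exact Eventually.of_forall fun t ξ hξ => orientation_pairWeb hξ _
  · intro w hw
    rcases mem_halfPlaneTaut_left hz (by simp) hw with ⟨w₁', w₂', h1, rfl, -⟩ |
      ⟨w₁, X₁, s, X₂, K, h1, -⟩
    · simp only [List.cons.injEq, and_true] at h1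
      rw [h1.1, h1.2]
    · simp at h1

end LeftCoeff

/-! ### The Maurer–Cartan equation -/

section Plane

variable {S : Spectrum.{u}}

theorem IsPath.pairwise_tgt_cons {r : S.Gen} {l : ℤ} {L : List S.Gen} (h : IsPath (S.tgt r) l L)
    (hup : ∀ x ∈ L, S.IsUp x) : (r :: L).Pairwise fun a b => S.tgt a < S.tgt b :=
  List.pairwise_cons.2 ⟨fun b hb => lt_of_le_of_lt (h.bounds_of_isUp hup b hb).1 (hup b hb),
    h.pairwise_tgt_of_isUp hup⟩

theorem isUp_graft {X₁ X₂ K : List S.Gen} {s : S.Gen} (hup : ∀ x ∈ X₁ ++ s :: X₂, S.IsUp x)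
    (hK : ∀ x ∈ K, S.IsUp x) : ∀ x ∈ X₁ ++ K ++ X₂, S.IsUp x := by
  intro x hx
  simp only [List.mem_append] at hx
  rcases hx with (hx | hx) | hx
  · exact hup x (by simp [hx])
  · exact hK x hx
  · exact hup x (by simp [hx])

theorem append_cons_eq_cons {A B L : List S.Gen} {r s : S.Gen} (h : A ++ s :: B = r :: L)
    (hA : A ≠ []) : ∃ Y, A = r :: Y ∧ L = Y ++ s :: B := by
  cases A with
  | nil => exact absurd rfl hA
  | cons a A =>
    rw [List.cons_append, List.cons.injEq] at h
    exact ⟨A, by rw [h.1], h.2.symm⟩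

namespace Web

variable {w : Web S}

/-- A taut plane web consists of two vertices joined by an edge. -/
theorem IsPlaneWeb.eq_planeGraft {F : Set ℤ} {z : ℤ → ℂ} (hz : IsParabolicOn F z)
    (hF : SupportedOn F w.vertices.flatten) {o : List S.Gen} {ξ : Fin w.dim → ℝ}
    (h : w.IsPlaneWeb z o ξ) {τ : ℂ} (hm : w.moduliDim τ z = 3) :
    ∃ r Y s X₂ K, o = r :: (Y ++ K ++ X₂) ∧ IsPath (S.tgt r) (S.src r) (Y ++ s :: X₂) ∧
      (∀ x ∈ Y ++ s :: X₂, S.IsUp x) ∧ IsPath (S.src s) (S.tgt s) K ∧ (∀ x ∈ K, S.IsUp x) ∧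
      (w = planeGraft (r :: Y) s X₂ K ∨ w = planeGraft' (r :: Y) s X₂ K) := by
  have hFmem : ∀ s ∈ w.vertices.flatten, SupportedOn F [s] := fun s hs =>
    hF.of_subset (by simpa using hs)
  have hosub : o ⊆ w.vertices.flatten := by
    intro s hs
    have h1 : some s ∈ w.outs.map w.letter := by
      rw [h.infinity]; exact List.mem_map_of_mem hs
    obtain ⟨p, -, hp⟩ := List.mem_map.1 h1
    exact w.letter_mem hp
  have hfan : ∀ b : List S.Gen, SupportedOn F b → IsCyclicFan z b → ∃ r L, b = r :: L ∧ S.IsDown r ∧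
      IsPath (S.tgt r) (S.src r) L ∧ ∀ x ∈ L, S.IsUp x := by
    intro b hb hc
    obtain ⟨r, L, rfl, hL, hpath, hup⟩ := (isCyclicFan_iff hz hb).1 hc
    exact ⟨r, L, rfl, hpath.lt_of_isUp hup hL, hpath, hup⟩
  obtain ⟨ro, Lo, ho, hrod, hLo, hLoup⟩ := hfan o (hF.of_subset hosub) h.infinity_fan
  have hosort : o.Pairwise fun a b => S.tgt a < S.tgt b := by
    rw [ho]; exact hLo.pairwise_tgt_cons hLoup
  have hcount := h.graph.countP_isDown h.infinity
  have hbsum := h.graph.sum_countP_bulk hz hF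
  have hco : o.countP (fun s => S.IsDown s) = 1 := by
    rw [ho, List.countP_cons, List.countP_eq_zero.2]
    · simp [hrod]
    · intro a ha
      simpa using Spectrum.not_isDown.2 (hLoup a ha)
  rw [Web.vertices, h.no_bdry, List.map_nil, List.nil_append, hbsum, hco] at hcount
  have hdim := w.dim_le_moduliDim_add τ z
  have hdim' := w.moduliDim_le_dim τ z
  rw [hm, Web.dim, h.no_bdry, List.length_nil] at hdim hdim'
  -- each vertex has one falling germ and so has infinity, hence there is one edge less than
  -- vertices; the dimension then gives two vertices
  obtain ⟨A, B, hAB⟩ := List.length_eq_two.1 (show w.bulk.length = 2 by omega)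
  obtain ⟨e, hE⟩ := List.length_eq_one_iff.1 (show w.edges.length = 1 by omega)
  have hv : w.vertices = [A, B] := by rw [Web.vertices, h.no_bdry, hAB]; rfl
  obtain ⟨rA, LA, rfl, hrA, hLA, hLAup⟩ := hfan A (hF.of_subset (by rw [hv]; simp))
    (h.graph.bulk_fan A (by rw [hAB]; simp))
  obtain ⟨rB, LB, rfl, hrB, hLB, hLBup⟩ := hfan B (hF.of_subset (by rw [hv]; simp))
    (h.graph.bulk_fan B (by rw [hAB]; simp))
  have he : e ∈ w.edges := by rw [hE]; simp
  obtain ⟨s, hs, hs'⟩ := h.graph.exists_edge_letter he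
  have hlt := h.graph.edge_lt e he
  have hown := h.drawing.owner_ne he (by
    rw [w.dir_eq hs]
    exact hz.dir_ne_zero (hFmem s (w.letter_mem hs)))
  obtain ⟨h1, h2⟩ := edge_lt_of_owner_ne hv hlt (h.graph.edge_lt_length he).2 hown
  obtain ⟨m, hm'⟩ := Nat.exists_eq_add_of_le h2
  have hs1 := hs
  have hs2 := hs'
  rw [letter_of_vertices_eq hv, List.getElem?_append_left h1] at hs1
  rw [letter_of_vertices_eq hv, hm', List.getElem?_append_right (by omega),
    Nat.add_sub_cancel_left] at hs2
  have hup_of_succ : ∀ {r : S.Gen} {L : List S.Gen} {p : ℕ} {x : S.Gen}, (∀ y ∈ L, S.IsUp y) →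
      (r :: L)[p + 1]? = some x → S.IsUp x := fun hL hx => by
    rw [List.getElem?_cons_succ] at hx
    exact hL _ (List.mem_of_getElem? hx)
  rcases Nat.eq_zero_or_pos e.1 with h0 | h0
  · -- the edge leaves the first vertex along its falling germ
    rw [h0, List.getElem?_cons_zero, Option.some.injEq] at hs1
    subst hs1
    have hm0 : m ≠ 0 := by
      rintro rfl
      rw [List.getElem?_cons_zero, Option.some.injEq] at hs2
      rw [hs2, Spectrum.isDown_bar] at hrB
      exact Spectrum.not_isDown.2 hrB hrA
    have he2 : e.2 = LA.length + 1 + m := by rw [hm', List.length_cons]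
    obtain ⟨X₁, X₂, hX, hE', hout⟩ := exists_graft_second hv (p := m) (s := S.bar rA)
      (by rw [hE, ← he2, ← h0]) h.graph.germs_perm (by rw [← he2]; exact hs') (S.bar_bar rA).symm
    have hX1 : X₁ ≠ [] := by
      rintro rfl
      rw [List.nil_append, List.cons.injEq] at hX
      rw [hX.1, Spectrum.isDown_bar] at hrB
      exact Spectrum.not_isDown.2 hrB hrA
    obtain ⟨Y, rfl, rfl⟩ := append_cons_eq_cons hX.symm hX1
    have hK : IsPath (S.src (S.bar rA)) (S.tgt (S.bar rA)) LA := by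
      rw [S.src_bar, S.tgt_bar]; exact hLA
    obtain ⟨h3, h4⟩ := hout o h.infinity hosort (by
      rw [List.cons_append, List.cons_append]
      exact (hLB.graft hK).pairwise_tgt_cons (isUp_graft hLBup hLAup))
    refine ⟨rB, Y, S.bar rA, X₂, LA, by rw [h4]; simp, hLB, hLBup, hK, hLAup, Or.inr ?_⟩
    obtain ⟨bdry, bulk, edges, outs⟩ := w
    have hbd := h.no_bdry
    simp only at hbd hAB hE' h3
    rw [planeGraft', hbd, hAB, hE', h3, S.bar_bar, hX]
  · -- the edge leaves the first vertex along a rising germ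
    obtain ⟨p, hp⟩ := Nat.exists_eq_add_of_le' h0
    have hsup : S.IsUp s := hup_of_succ hLAup (p := p) (by rw [← hp]; exact hs1)
    have hm0 : m = 0 := by
      by_contra hcon
      obtain ⟨m', rfl⟩ := Nat.exists_eq_succ_of_ne_zero hcon
      exact Spectrum.not_isDown.2 (hup_of_succ hLBup hs2) (Spectrum.isDown_bar.2 hsup)
    rw [hm0, add_zero] at hm'
    obtain ⟨X₁, X₂, hX, hr, hE', hout⟩ := exists_graft_first hv (p := e.1) (by rw [hE, ← hm']) h1
      h.graph.germs_perm hs (by rw [← hm']; exact hs')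
    have hX1 : X₁ ≠ [] := by
      rintro rfl
      rw [List.nil_append, List.cons.injEq] at hX
      rw [hX.1] at hrA
      exact Spectrum.not_isDown.2 hsup hrA
    obtain ⟨Y, rfl, rfl⟩ := append_cons_eq_cons hX.symm hX1
    have hK : IsPath (S.src s) (S.tgt s) LB := by
      rw [hr, S.src_bar, S.tgt_bar] at hLB; exact hLB
    obtain ⟨h3, h4⟩ := hout o h.infinity hosort (by
      rw [List.cons_append, List.cons_append]
      exact (hLA.graft hK).pairwise_tgt_cons (isUp_graft hLAup hLBup))
    refine ⟨rA, Y, s, X₂, LB, by rw [h4]; simp, hLA, hLAup, hK, hLBup, Or.inl ?_⟩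
    obtain ⟨bdry, bulk, edges, outs⟩ := w
    have hbd := h.no_bdry
    simp only at hbd hAB hE' h3
    rw [planeGraft, hbd, hAB, hE', h3, hr, hX]

theorem IsGraft.isPlaneWeb {F : Set ℤ} {z : ℤ → ℂ} (hz : IsParabolicOn F z)
    {r s : S.Gen} {Y X₂ K : List S.Gen} {a b : ℕ} (hg : w.IsGraft (r :: Y) s X₂ K a b)
    (hF : SupportedOn F (r :: Y ++ s :: X₂ ++ K))
    (hX : IsPath (S.tgt r) (S.src r) (Y ++ s :: X₂)) (hup : ∀ x ∈ Y ++ s :: X₂, S.IsUp x)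
    (hK : IsPath (S.src s) (S.tgt s) K) (hKup : ∀ x ∈ K, S.IsUp x)
    (hbdry : w.bdry = []) (hbulk : ∀ c ∈ w.bulk, c = r :: (Y ++ s :: X₂) ∨ c = S.bar s :: K)
    {ξ : Fin w.dim → ℝ} (hpos : w.pos 0 ξ b = w.pos 0 ξ a + S.dir z s) :
    w.IsPlaneWeb z (r :: (Y ++ K ++ X₂)) ξ := by
  have hr : S.IsDown r := hX.lt_of_isUp hup (by simp)
  have hbar : SupportedOn F (S.bar s :: K) := by
    intro x hx
    rcases List.mem_cons.1 hx with rfl | hx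
    · rw [S.src_bar, S.tgt_bar]
      exact (hF s (by simp)).symm
    · exact hF x (by simp [hx])
  refine ⟨⟨hg.perm, ?_, ?_, ?_, ?_⟩, ?_, hbdry, ?_, ?_⟩
  · obtain ⟨p, q, hE, hpq, -⟩ := hg.edge
    intro e he
    rw [hE, List.mem_singleton] at he
    rw [he]
    exact hpq
  · obtain ⟨p, q, hE, -⟩ := hg.edge
    rw [hE]
    exact List.pairwise_singleton _ _
  · obtain ⟨p, q, hE, -, h1 | h1⟩ := hg.edge <;> intro e he <;>
      rw [hE, List.mem_singleton] at he <;> rw [he] <;> simp only [h1.2.2.1, h1.2.2.2] <;>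
      simp [S.bar_bar]
  · intro c hc
    rcases hbulk c hc with rfl | rfl
    · exact (isCyclicFan_iff hz (hF.of_subset (List.subset_append_left _ _))).2
        ⟨r, _, rfl, by simp, hX, hup⟩
    · refine (isCyclicFan_iff hz hbar).2 ⟨_, K, rfl, hK.ne_nil, ?_, hKup⟩
      rw [S.src_bar, S.tgt_bar]
      exact hK
  · exact hg.isDrawing hz hF (R := [r]) (Y := Y) rfl (by simp) (by simpa using hr) hX hup hK hKup
      hpos
  · rw [hg.outs_letter]
    simp
  · refine (isCyclicFan_iff hz ?_).2 ⟨r, _, rfl, ?_, hX.graft hK, isUp_graft hup hKup⟩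
    · refine hF.of_subset fun x hx => ?_
      simp only [List.mem_append, List.mem_cons] at hx ⊢
      tauto
    · have := hK.ne_nil
      simp [this]

end Web

variable {D : InfraredData S} {z : ℝ → ℤ → ℂ}

theorem eventually_of_mem_planeTaut {o : List S.Gen} {w : Web S}
    (h : w ∈ InfraredData.planeTaut z o) :
    ∀ᶠ t : ℝ in 𝓝[>] 0, (∃ ξ, w.IsPlaneWeb (z t) o ξ) ∧ w.moduliDim 0 (z t) = 3 := h

/-- The fan at infinity and the web, for a graft in the plane. -/
def IsPlaneGraft (o : List S.Gen) (w : Web S) : Prop :=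
  ∃ r Y s X₂ K, o = r :: (Y ++ K ++ X₂) ∧ IsPath (S.tgt r) (S.src r) (Y ++ s :: X₂) ∧
      (∀ x ∈ Y ++ s :: X₂, S.IsUp x) ∧ IsPath (S.src s) (S.tgt s) K ∧ (∀ x ∈ K, S.IsUp x) ∧
      (w = planeGraft (r :: Y) s X₂ K ∨ w = planeGraft' (r :: Y) s X₂ K)

theorem mem_planeTaut_iff (hz : IsAsymptoticallyParabolic z) {o : List S.Gen} {w : Web S} :
    w ∈ InfraredData.planeTaut z o ↔ IsPlaneGraft o w := by
  constructor
  · intro hw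
    obtain ⟨F, hF, hpar⟩ := hz.eventually_supportedOn w.vertices.flatten
    obtain ⟨t, ⟨⟨ξ, hξ⟩, hm⟩, hzt⟩ := ((eventually_of_mem_planeTaut hw).and hpar).exists
    exact hξ.eq_planeGraft hzt hF hm
  · rintro ⟨r, Y, s, X₂, K, rfl, hX, hup, hK, hKup, rfl | rfl⟩
    all_goals
      obtain ⟨F, hF, hpar⟩ := hz.eventually_supportedOn (r :: Y ++ s :: X₂ ++ K)
      refine hpar.mono fun t ht => ?_
      have hre := ht.re_dir_neg (hF.of_subset (L' := [s]) (by simp)) (hup s (by simp))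
    · refine ⟨⟨(![0, 0, (S.dir (z t) s).re, (S.dir (z t) s).im] : Fin 4 → ℝ),
        (isGraft_planeGraft _ _ _ _).isPlaneWeb ht hF hX hup hK hKup rfl ?_ ?_⟩,
        moduliDim_planeGraft _ _ _ _ hre.ne⟩
      · simp [planeGraft]
      · obtain ⟨h1, h2⟩ := pos_planeGraft (r :: Y) s X₂ K 0
          (![0, 0, (S.dir (z t) s).re, (S.dir (z t) s).im] : Fin 4 → ℝ)
        refine h2.trans (Eq.trans ?_ (congrArg (· + S.dir (z t) s) h1.symm))
        simp [Complex.re_add_im]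
    · refine ⟨⟨(![(S.dir (z t) s).re, (S.dir (z t) s).im, 0, 0] : Fin 4 → ℝ),
        (isGraft_planeGraft' _ _ _ _).isPlaneWeb ht hF hX hup hK hKup rfl ?_ ?_⟩,
        moduliDim_planeGraft' _ _ _ _ hre.ne⟩
      · simp [planeGraft']
      · obtain ⟨h1, h2⟩ := pos_planeGraft' (r :: Y) s X₂ K 0
          (![(S.dir (z t) s).re, (S.dir (z t) s).im, 0, 0] : Fin 4 → ℝ)
        refine h1.trans (Eq.trans ?_ (congrArg (· + S.dir (z t) s) h2.symm))
        simp [Complex.re_add_im]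

/-- The vacuum reached from `k` after the first `i` solitons of `L`. -/
def vacuumAt (k : ℤ) (L : List S.Gen) (i : ℕ) : ℤ := (⟨k, L.take i⟩ : Word S).final

theorem IsPath.split {k l : ℤ} {L : List S.Gen} (h : IsPath k l L) (i : ℕ) :
    IsPath k (vacuumAt k L i) (L.take i) ∧ IsPath (vacuumAt k L i) l (L.drop i) := by
  have h' := h
  rw [← List.take_append_drop i L] at h'
  obtain ⟨m, h1, h2⟩ := isPath_append.1 h'
  have : vacuumAt k L i = m := h1.final_eq
  rw [this]
  exact ⟨h1, h2⟩

theorem IsPath.split_mid {k l : ℤ} {L : List S.Gen} (h : IsPath k l L) (i j : ℕ) :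
    IsPath (vacuumAt k L i) (vacuumAt k L (i + j)) ((L.drop i).take j) ∧
      IsPath (vacuumAt k L (i + j)) l (L.drop (i + j)) := by
  obtain ⟨h1, h2⟩ := h.split (i + j)
  refine ⟨?_, h2⟩
  rw [List.take_add] at h1
  obtain ⟨m, h3, h4⟩ := isPath_append.1 h1
  have : vacuumAt k L i = m := h3.final_eq
  rw [this]
  exact h4

/-- The Maurer–Cartan equation, written out: the sum over all ways to separate a polygon with
vertices on the parabola into two. -/
theorem InfraredData.IsInteriorAmplitude.sum_eq_zero (hz : IsAsymptoticallyParabolic z)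
    (hβ : D.IsInteriorAmplitude z) {r : S.Gen} {L : List S.Gen}
    (hL : IsPath (S.tgt r) (S.src r) L) (hup : ∀ x ∈ L, S.IsUp x) :
    ∑ i ∈ Finset.range L.length, ∑ j ∈ Finset.range (L.length - i),
      sgn ((L.take i).map D.deg).sum *
        ∑ s ∈ (D.finite (vacuumAt (S.tgt r) L i) (vacuumAt (S.tgt r) L (i + (j + 1)))).toFinset,
          D.amp (r :: (L.take i ++ s :: L.drop (i + (j + 1)))) *
            D.amp (S.bar s :: (L.drop i).take (j + 1)) = 0 := by
  classical
  -- the diagonals of the polygon: the position and length of the part cut off, and the soliton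
  -- on the edge
  set I : Finset (Σ _ : ℕ, Σ _ : ℕ, S.Gen) := (Finset.range L.length).sigma fun i =>
    (Finset.range (L.length - i)).sigma fun j =>
      (D.finite (vacuumAt (S.tgt r) L i) (vacuumAt (S.tgt r) L (i + (j + 1)))).toFinset with hI
  set g : (Σ _ : ℕ, Σ _ : ℕ, S.Gen) → Web S := fun x => planeGraft (r :: L.take x.1) x.2.2
    (L.drop (x.1 + (x.2.1 + 1))) ((L.drop x.1).take (x.2.1 + 1)) with hg
  set g' : (Σ _ : ℕ, Σ _ : ℕ, S.Gen) → Web S := fun x => planeGraft' (r :: L.take x.1) x.2.2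
    (L.drop (x.1 + (x.2.1 + 1))) ((L.drop x.1).take (x.2.1 + 1)) with hg'
  have hmemI : ∀ x, x ∈ I ↔ x.1 < L.length ∧ x.2.1 < L.length - x.1 ∧
      S.src x.2.2 = vacuumAt (S.tgt r) L x.1 ∧
        S.tgt x.2.2 = vacuumAt (S.tgt r) L (x.1 + (x.2.1 + 1)) := by
    intro x
    simp [hI, Finset.mem_sigma]
  have hbar : Function.Injective S.bar := fun a b h => by rw [← S.bar_bar a, h, S.bar_bar]
  have hginj : Set.InjOn g I := by
    rintro ⟨i, j, s⟩ hx ⟨i', j', s'⟩ hx' h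
    have h1 := (hmemI _).1 hx
    have h2 := (hmemI _).1 hx'
    simp only at h1 h2
    have h3 := congrArg Web.edges h
    have h4 := congrArg Web.bulk h
    simp only [hg, planeGraft, List.cons.injEq, Prod.mk.injEq, and_true, List.length_cons,
      List.length_take, List.length_drop] at h3 h4
    have hi : i = i' := by omega
    have hj : j = j' := by omega
    have hs : s = s' := hbar h4.2.1
    subst hi hj hs
    rfl
  have hginj' : Set.InjOn g' I := by
    rintro ⟨i, j, s⟩ hx ⟨i', j', s'⟩ hx' h
    have h1 := (hmemI _).1 hx
    have h2 := (hmemI _).1 hx'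
    simp only at h1 h2
    have h3 := congrArg Web.edges h
    have h4 := congrArg Web.bulk h
    simp only [hg', planeGraft', List.cons.injEq, Prod.mk.injEq, and_true, List.length_cons,
      List.length_take, List.length_drop, true_and] at h3 h4
    have h5 := congrArg List.length h4.1.2
    simp only [List.length_take, List.length_drop] at h5
    have hi : i = i' := by omega
    have hj : j = j' := by omega
    have hs : s = s' := hbar h4.1.1
    subst hi hj hs
    rfl
  have hdisj : Disjoint (g '' I) (g' '' I) := by
    rw [Set.disjoint_left]
    rintro _ ⟨x, -, rfl⟩ ⟨y, -, hxy⟩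
    have h3 := congrArg Web.edges hxy
    simp [hg, hg', planeGraft, planeGraft'] at h3
  have hset : InfraredData.planeTaut z (r :: L) = g '' I ∪ g' '' I := by
    ext w
    rw [mem_planeTaut_iff hz]
    constructor
    · rintro ⟨r', Y, s, X₂, K, ho, hX, hXup, hK, hKup, hw⟩
      rw [List.cons.injEq] at ho
      obtain ⟨rfl, rfl⟩ := ho
      have hKlen : 0 < K.length := List.length_pos_iff.2 hK.ne_nil
      have e1 : (Y ++ K ++ X₂).take Y.length = Y := by rw [List.append_assoc, List.take_left]
      have e2 : ((Y ++ K ++ X₂).drop Y.length).take (K.length - 1 + 1) = K := by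
        rw [Nat.sub_add_cancel hKlen, List.append_assoc, List.drop_left, List.take_left]
      have e3 : (Y ++ K ++ X₂).drop (Y.length + (K.length - 1 + 1)) = X₂ := by
        rw [Nat.sub_add_cancel hKlen, ← List.length_append, List.drop_left]
      have hmem : (⟨Y.length, K.length - 1, s⟩ : Σ _ : ℕ, Σ _ : ℕ, S.Gen) ∈ I := by
        obtain ⟨m, hY, hm1, hm2⟩ := isPath_append.1 hX
        have h1 : IsPath (S.tgt r) (S.src s) Y := by rw [hm1]; exact hY
        have h2 : IsPath (S.tgt r) (S.tgt s) (Y ++ K) := isPath_append.2 ⟨_, h1, hK⟩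
        refine (hmemI _).2 ⟨by simp; omega, by simp; omega, ?_, ?_⟩
        · simp only [vacuumAt, e1]
          exact h1.final_eq.symm
        · simp only [vacuumAt]
          rw [Nat.sub_add_cancel hKlen, ← List.length_append, List.take_left]
          exact h2.final_eq.symm
      rcases hw with rfl | rfl
      · exact Or.inl ⟨_, hmem, by simp only [hg, e1, e2, e3]⟩
      · exact Or.inr ⟨_, hmem, by simp only [hg', e1, e2, e3]⟩
    · have key : ∀ x ∈ I, ∀ w, w = g x ∨ w = g' x → IsPlaneGraft (r :: L) w := by
        rintro ⟨i, j, s⟩ hx w hw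
        obtain ⟨h1, h2, h3, h4⟩ := (hmemI _).1 hx
        simp only at h1 h2 h3 h4
        obtain ⟨hmid, hend⟩ := hL.split_mid i (j + 1)
        have hmidup : ∀ x ∈ (L.drop i).take (j + 1), S.IsUp x := fun x hx =>
          hup x (List.mem_of_mem_drop (List.mem_of_mem_take hx))
        have hK : IsPath (S.src s) (S.tgt s) ((L.drop i).take (j + 1)) := by rw [h3, h4]; exact hmid
        refine ⟨r, L.take i, s, L.drop (i + (j + 1)), (L.drop i).take (j + 1), ?_, ?_, ?_, hK,
          hmidup, hw⟩
        · rw [← List.take_add, List.take_append_drop]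
        · exact isPath_append.2 ⟨_, (hL.split i).1, h3, by rw [h4]; exact hend⟩
        · intro x hx
          simp only [List.mem_append, List.mem_cons] at hx
          rcases hx with hx | rfl | hx
          · exact hup x (List.mem_of_mem_take hx)
          · exact hK.lt_of_isUp hmidup hK.ne_nil
          · exact hup x (List.mem_of_mem_drop hx)
      rintro (⟨x, hx, rfl⟩ | ⟨x, hx, rfl⟩)
      · exact key x hx _ (Or.inl rfl)
      · exact key x hx _ (Or.inr rfl)
  have hMC := hβ (r :: L)
  have hre : ∀ x ∈ I, ∀ᶠ t : ℝ in 𝓝[>] 0, (S.dir (z t) x.2.2).re ≠ 0 := by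
    intro x hx
    obtain ⟨F, hF, hpar⟩ := hz.eventually_supportedOn [x.2.2]
    refine hpar.mono fun t ht => ?_
    by_cases hd : S.IsDown x.2.2
    · exact (ht.re_dir_pos hF hd).ne'
    · exact (ht.re_dir_neg hF (Spectrum.not_isDown.1 hd)).ne
  have hex : ∀ w ∈ InfraredData.planeTaut z (r :: L),
      ∀ᶠ t : ℝ in 𝓝[>] 0, ∃ ξ, w.IsPlaneWeb (z t) (r :: L) ξ := fun w hw =>
    (eventually_of_mem_planeTaut hw).mono fun t ht => ht.1
  rw [InfraredData.planeCoeff, hset, finsum_mem_union hdisj (I.finite_toSet.image g)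
    (I.finite_toSet.image g'), finsum_mem_image hginj, finsum_mem_image hginj',
    finsum_mem_coe_finset, finsum_mem_coe_finset, ← Finset.sum_add_distrib] at hMC
  -- The two numberings of the vertices give distinct webs, of orientation `-1` both, and
  -- `contraction` divides by the number of numberings.
  have hterm : ∀ x ∈ I, D.contraction (g x) ((g x).stableSign 0 [1, Complex.I] z
        fun t ξ => (g x).IsPlaneWeb (z t) (r :: L) ξ) +
      D.contraction (g' x) ((g' x).stableSign 0 [1, Complex.I] z
        fun t ξ => (g' x).IsPlaneWeb (z t) (r :: L) ξ) =
      -sgn (D.deg r) * (sgn ((L.take x.1).map D.deg).sum *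
        (D.amp (r :: (L.take x.1 ++ x.2.2 :: L.drop (x.1 + (x.2.1 + 1)))) *
          D.amp (S.bar x.2.2 :: (L.drop x.1).take (x.2.1 + 1)))) := by
    intro x hx
    rw [Web.stableSign_eq_neg_one
        (hex _ (by rw [hset]; exact Or.inl (Set.mem_image_of_mem g hx)))
        ((hre x hx).mono fun t ht ξ hξ => orientation_planeGraft ht hξ.drawing),
      Web.stableSign_eq_neg_one
        (hex _ (by rw [hset]; exact Or.inr (Set.mem_image_of_mem g' hx)))
        ((hre x hx).mono fun t ht ξ hξ => orientation_planeGraft' ht hξ.drawing), hg, hg']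
    simp only
    rw [D.contraction_planeGraft, D.contraction_planeGraft', List.map_cons, List.sum_cons, sgn_add,
      List.cons_append]
    ring
  rw [Finset.sum_congr rfl hterm, ← Finset.mul_sum] at hMC
  have h0 := (mul_eq_zero.1 hMC).resolve_left (neg_ne_zero.2 (sgn_ne_zero _))
  rw [hI, Finset.sum_sigma] at h0
  rw [← h0]
  refine Finset.sum_congr rfl fun i _ => ?_
  rw [Finset.sum_sigma]
  refine Finset.sum_congr rfl fun j _ => ?_
  rw [Finset.mul_sum]

end Plane

/-! ### The deck group -/

section Shift

variable {S : Spectrum.{u}} (D : InfraredData S)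

namespace InfraredData

theorem src_zpow (k : ℤ) (s : S.Gen) : S.src ((D.shift ^ k) s) = S.src s + k := by
  induction k generalizing s with
  | zero => simp
  | succ k ih => rw [zpow_add_one, Equiv.Perm.mul_apply, ih, D.src_shift]; ring
  | pred k ih =>
    have h := D.src_shift (D.shift.symm s)
    rw [Equiv.apply_symm_apply] at h
    rw [zpow_sub_one, Equiv.Perm.mul_apply, ih, Equiv.Perm.inv_def]
    linarith

theorem tgt_zpow (k : ℤ) (s : S.Gen) : S.tgt ((D.shift ^ k) s) = S.tgt s + k := by
  induction k generalizing s with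
  | zero => simp
  | succ k ih => rw [zpow_add_one, Equiv.Perm.mul_apply, ih, D.tgt_shift]; ring
  | pred k ih =>
    have h := D.tgt_shift (D.shift.symm s)
    rw [Equiv.apply_symm_apply] at h
    rw [zpow_sub_one, Equiv.Perm.mul_apply, ih, Equiv.Perm.inv_def]
    linarith

theorem deg_zpow (k : ℤ) (s : S.Gen) : D.deg ((D.shift ^ k) s) = D.deg s := by
  induction k generalizing s with
  | zero => simp
  | succ k ih => rw [zpow_add_one, Equiv.Perm.mul_apply, ih, D.deg_shift]
  | pred k ih =>
    have h := D.deg_shift (D.shift.symm s)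
    rw [Equiv.apply_symm_apply] at h
    rw [zpow_sub_one, Equiv.Perm.mul_apply, ih, Equiv.Perm.inv_def, h]

theorem bar_zpow (k : ℤ) (s : S.Gen) : S.bar ((D.shift ^ k) s) = (D.shift ^ k) (S.bar s) := by
  induction k generalizing s with
  | zero => simp
  | succ k ih => rw [zpow_add_one, Equiv.Perm.mul_apply, Equiv.Perm.mul_apply, ih, D.bar_shift]
  | pred k ih =>
    have h := D.bar_shift (D.shift.symm s)
    rw [Equiv.apply_symm_apply] at h
    rw [zpow_sub_one, Equiv.Perm.mul_apply, Equiv.Perm.mul_apply, ih, Equiv.Perm.inv_def, h,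
      Equiv.symm_apply_apply]

theorem amp_map_zpow (k : ℤ) (L : List S.Gen) : D.amp (L.map (D.shift ^ k)) = D.amp L := by
  induction k generalizing L with
  | zero => simp
  | succ k ih =>
    rw [zpow_add_one, Equiv.Perm.coe_mul, ← List.map_map, ih]
    exact D.amp_shift L
  | pred k ih =>
    rw [zpow_sub_one, Equiv.Perm.coe_mul, ← List.map_map, ih, ← D.amp_shift, List.map_map]
    congr 1
    exact (List.map_congr_left fun s _ => D.shift.apply_symm_apply _).trans (List.map_id _)

theorem zpow_apply_zpow (k l : ℤ) (s : S.Gen) :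
    (D.shift ^ k) ((D.shift ^ l) s) = (D.shift ^ (k + l)) s := by
  rw [zpow_add, Equiv.Perm.mul_apply]

theorem isDown_zpow {k : ℤ} {s : S.Gen} : S.IsDown ((D.shift ^ k) s) ↔ S.IsDown s := by
  rw [Spectrum.IsDown, Spectrum.IsDown, D.src_zpow, D.tgt_zpow, add_lt_add_iff_right]

theorem shiftWord_letterWord (k : ℤ) (s : S.Gen) :
    D.shiftWord k (letterWord s) = letterWord ((D.shift ^ k) s) := by
  simp [shiftWord, letterWord, D.src_zpow]

/-- Solitons ending at `0` are moved by the deck group so that they form a path ending at `0`. -/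
def place : List S.Gen → List S.Gen
  | [] => []
  | s :: L => (D.shift ^ (L.map S.src).sum) s :: place L

@[simp]
theorem length_place (L : List S.Gen) : (D.place L).length = L.length := by
  induction L with
  | nil => rfl
  | cons s L ih => simp [place, ih]

theorem placeRight_map_letterWord (L : List S.Gen) :
    D.placeRight (L.map letterWord) = (D.place L).map letterWord := by
  induction L with
  | nil => rfl
  | cons s L ih =>
    simp only [List.map_cons, placeRight, place, ih, List.cons.injEq, and_true, List.map_map]
    exact D.shiftWord_letterWord _ _

theorem isPath_place {L : List S.Gen} (h : ∀ s ∈ L, S.tgt s = 0) :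
    IsPath (L.map S.src).sum 0 (D.place L) := by
  induction L with
  | nil => rfl
  | cons s L ih =>
    refine ⟨?_, ?_⟩
    · rw [D.src_zpow, List.map_cons, List.sum_cons]
    · rw [D.tgt_zpow, h s (by simp), zero_add]
      exact ih fun a ha => h a (by simp [ha])

theorem isDown_place {L : List S.Gen} (h : ∀ s ∈ L, S.IsDown s) :
    ∀ s ∈ D.place L, S.IsDown s := by
  induction L with
  | nil => simp [place]
  | cons s L ih =>
    intro a ha
    rcases List.mem_cons.1 ha with rfl | ha
    · exact D.isDown_zpow.2 (h s (by simp))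
    · exact ih (fun a ha => h a (by simp [ha])) a ha

theorem map_deg_place (L : List S.Gen) : (D.place L).map D.deg = L.map D.deg := by
  induction L with
  | nil => rfl
  | cons s L ih => simp [place, ih, D.deg_zpow]

theorem place_append (L L' : List S.Gen) :
    D.place (L ++ L') = (D.place L).map (D.shift ^ (L'.map S.src).sum) ++ D.place L' := by
  induction L with
  | nil => rfl
  | cons s L ih =>
    simp only [List.cons_append, place, ih, List.map_cons, D.zpow_apply_zpow, List.map_append,
      List.sum_append, add_comm]

end InfraredData

end Shift

/-! ### Strict units -/

section Units

theorem sum_range_range_eq_zero {V : Type*} [AddCommGroup V] {n : ℕ} (T : ℕ → ℕ → V)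
    {i₁ j₁ i₂ j₂ : ℕ} (h₁ : i₁ < n) (h₁' : j₁ < n - i₁) (h₂ : i₂ < n) (h₂' : j₂ < n - i₂)
    (hne : ¬ (i₁ = i₂ ∧ j₁ = j₂)) (hT : T i₁ j₁ + T i₂ j₂ = 0)
    (h0 : ∀ i j, i < n → j < n - i → ¬ (i = i₁ ∧ j = j₁) → ¬ (i = i₂ ∧ j = j₂) → T i j = 0) :
    ∑ i ∈ Finset.range n, ∑ j ∈ Finset.range (n - i), T i j = 0 := by
  rw [Finset.sum_sigma', Finset.sum_eq_add ⟨i₁, j₁⟩ ⟨i₂, j₂⟩, hT]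
  · simpa using hne
  · rintro ⟨i, j⟩ hx ⟨hx₁, hx₂⟩
    rw [Finset.mem_sigma, Finset.mem_range, Finset.mem_range] at hx
    exact h0 i j hx.1 hx.2 (by simpa using hx₁) (by simpa using hx₂)
  · simp [h₁, h₁']
  · simp [h₂, h₂']

variable {B : Type*} {deg : B → ℤ} {m : List B → B →₀ ℂ} {e : B}

/-- The associativity relations hold for arguments one of which is a strict unit: the two products
of the unit with its neighbours cancel, and at an end of the word the product of the unit with
its neighbour cancels against its product with the result of the operation on the rest. -/
theorem assoc_of_mem_unit
    (degree : ∀ l b, m l b ≠ 0 → deg b = (l.map deg).sum + 2 - l.length)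
    (hdeg : deg e = 0) (hd : m [e] = 0) (left : ∀ b, m [e, b] = Finsupp.single b 1)
    (right : ∀ b, m [b, e] = sgn (deg b) • Finsupp.single b 1)
    (higher : ∀ l, 3 ≤ l.length → e ∈ l → m l = 0) {l : List B} (hl : e ∈ l) :
    ∑ i ∈ Finset.range l.length, ∑ j ∈ Finset.range (l.length - i),
      sgn (((l.take i).map fun b => deg b + 1).sum) •
        ((m ((l.drop i).take (j + 1))).sum fun c r =>
          r • m (l.take i ++ c :: l.drop (i + j + 1))) = 0 := by
  have inner : ∀ l' : List B, e ∈ l' → l'.length ≠ 2 → m l' = 0 := by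
    intro l' h h'
    rcases l' with _ | ⟨a, _ | ⟨b, l'⟩⟩
    · simp at h
    · rw [List.mem_singleton] at h; rw [← h, hd]
    · refine higher _ ?_ h
      rcases l' with _ | _
      · simp at h'
      · simp
  have sum_single : ∀ (a : B) (x : ℂ) (f : B → B →₀ ℂ),
      ((x • Finsupp.single a 1 : B →₀ ℂ).sum fun c r => r • f c) = x • f a := by
    intro a x f
    rw [Finsupp.smul_single, Finsupp.sum_single_index (by simp)]
    simp
  obtain ⟨p, q, rfl⟩ := List.append_of_mem hl
  have hlen : (p ++ e :: q).length = p.length + q.length + 1 := by simp; omega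
  -- the term vanishes if the unit is among the arguments of the inner operation
  have hin : ∀ i j, i ≤ p.length → p.length < i + j + 1 → j ≠ 1 → j < (p ++ e :: q).length - i →
      m (((p ++ e :: q).drop i).take (j + 1)) = 0 := by
    intro i j h1 h2 h3 h4
    refine inner _ ?_ (by simp only [List.length_take, List.length_drop]; omega)
    rw [List.drop_append_of_le_length h1, List.take_append, List.length_drop,
      show j + 1 - (p.length - i) = j - (p.length - i) + 1 by omega]
    simp
  -- the term vanishes if the unit is among the arguments of the outer operation
  have hout : ∀ i j, i < (p ++ e :: q).length → j < (p ++ e :: q).length - i →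
      (p.length < i ∨ i + j + 1 ≤ p.length) → j + 2 ≠ (p ++ e :: q).length →
      ∀ c, m ((p ++ e :: q).take i ++ c :: (p ++ e :: q).drop (i + j + 1)) = 0 := by
    intro i j h1 h2 h3 h4 c
    refine inner _ ?_ (by simp only [List.length_append, List.length_take, List.length_cons,
      List.length_drop] at *; omega)
    rcases h3 with h3 | h3
    · refine List.mem_append_left _ ?_
      rw [List.take_append, show i - p.length = i - p.length - 1 + 1 by omega]
      simp
    · refine List.mem_append_right _ (List.mem_cons_of_mem _ ?_)
      rw [List.drop_append_of_le_length h3]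
      simp
  rcases List.eq_nil_or_concat p with rfl | ⟨p, a, rfl⟩
  · rcases q with _ | ⟨b, q⟩
    · simp [hd]
    · refine sum_range_range_eq_zero _ (i₁ := 0) (j₁ := 1) (i₂ := 1) (j₂ := q.length)
        (by simp) (by simp) (by simp) (by simp) (by simp) ?_ ?_
      · simp only [List.nil_append, List.take_zero, List.map_nil, List.sum_nil, sgn_zero, one_smul,
          List.drop_zero, List.take_succ_cons, List.drop_succ_cons, List.map_cons, List.sum_cons,
          List.take_of_length_le (show (b :: q).length ≤ q.length + 1 by simp), hdeg, zero_add,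
          add_zero, sgn_one, left]
        rw [Finsupp.sum_single_index (by simp), one_smul]
        simp only [add_comm 1 q.length, List.drop_succ_cons, List.drop_length, List.cons_append,
          List.nil_append, left, neg_smul, one_smul]
        rw [Finsupp.sum_congr (g2 := fun c r => Finsupp.single c r) fun c _ => by simp,
          Finsupp.sum_single, add_neg_cancel]
      · intro i j h1 h2 h3 h4
        rcases Nat.eq_zero_or_pos i with rfl | hi
        · rw [hin 0 j le_rfl (by simp) (by simpa using h3) h2]
          simp
        · have h5 : ∀ c, _ := hout i j h1 h2 (Or.inl hi) (by simp at h2 h4 ⊢; omega)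
          simp only [h5, smul_zero]
          simp
  · rw [List.concat_eq_append] at *
    have hsum : ∀ x : List B, ((x ++ [a]).map fun b => deg b + 1).sum =
        (x.map fun b => deg b + 1).sum + (deg a + 1) := by simp
    have hneg : ∀ x : ℤ, sgn (x + (deg a + 1)) = - (sgn x * sgn (deg a)) := by
      intro x; rw [sgn_add, sgn_add, sgn_one]; ring
    rcases q with _ | ⟨b, q⟩
    · refine sum_range_range_eq_zero _ (i₁ := p.length) (j₁ := 1) (i₂ := 0) (j₂ := p.length)
        (by simp) (by simp) (by simp) (by simp) (by rintro ⟨h, h'⟩; omega) ?_ ?_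
      · have e1 : (p ++ [a] ++ [e]).take p.length = p := by simp
        have e2 : ((p ++ [a] ++ [e]).drop p.length).take (1 + 1) = [a, e] := by simp
        have e3 : (p ++ [a] ++ [e]).drop (p.length + 1 + 1) = [] := by simp
        have e4 : (p ++ [a] ++ [e]).take (p.length + 1) = p ++ [a] := by
          rw [List.take_append_of_le_length (by simp), List.take_of_length_le (by simp)]
        have e5 : (p ++ [a] ++ [e]).drop (p.length + 1) = [e] := by
          rw [List.drop_append_of_le_length (by simp), List.drop_eq_nil_of_le (by simp)]
          rfl
        simp only [e1, e2, e3, List.drop_zero, List.take_zero, e4, zero_add, e5, right, sum_single,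
          List.map_nil, List.sum_nil, sgn_zero, one_smul, List.nil_append]
        have e6 : ((m (p ++ [a])).sum fun c r => r • sgn (deg c) • Finsupp.single c (1 : ℂ)) =
            (sgn ((p.map fun b => deg b + 1).sum + (deg a + 1))) • m (p ++ [a]) := by
          rw [← Finsupp.sum_single (m (p ++ [a])), Finsupp.smul_sum, Finsupp.sum_single]
          refine Finsupp.sum_congr fun c hc => ?_
          have h := degree _ _ (Finsupp.mem_support_iff.1 hc)
          have h' : ((p ++ [a]).map fun b => deg b + 1).sum =
              ((p ++ [a]).map deg).sum + ((p ++ [a]).length : ℤ) := by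
            rw [List.sum_map_add]; simp
          rw [hsum] at h'
          rw [sgn_congr (a := deg c) (b := (p.map fun b => deg b + 1).sum + (deg a + 1)),
            smul_comm, Finsupp.smul_single, smul_eq_mul, mul_one]
          rw [h, h']
          exact ⟨1 - ((p ++ [a]).length : ℤ), by ring⟩
        rw [e6, hneg, smul_smul, neg_smul, add_neg_cancel]
      · intro i j h1 h2 h3 h4
        rcases Nat.lt_or_ge (p ++ [a]).length (i + j + 1) with h5 | h5
        · rcases Nat.lt_or_ge (p ++ [a]).length i with h6 | h6
          · simp at h1 h6; omega
          · rw [hin i j h6 h5 (by rintro rfl; simp at h1 h2 h3 h5; omega) h2]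
            simp
        · have h7 : ∀ c, _ := hout i j h1 h2 (Or.inr h5) (by simp at h2 h4 h5 ⊢; omega)
          simp only [h7, smul_zero]
          simp
    · refine sum_range_range_eq_zero _ (i₁ := p.length) (j₁ := 1) (i₂ := p.length + 1) (j₂ := 1)
        (by simp) (by simp) (by simp) (by simp; omega) (by simp) ?_ ?_
      · have e1 : (p ++ [a] ++ e :: b :: q).take p.length = p := by simp
        have e2 : ((p ++ [a] ++ e :: b :: q).drop p.length).take (1 + 1) = [a, e] := by simp
        have e3 : (p ++ [a] ++ e :: b :: q).drop (p.length + 1 + 1) = b :: q := by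
          rw [show p ++ [a] ++ e :: b :: q = (p ++ [a, e]) ++ b :: q by simp,
            List.drop_left' (by simp)]
        have e4 : (p ++ [a] ++ e :: b :: q).take (p.length + 1) = p ++ [a] := by
          rw [List.take_append_of_le_length (by simp), List.take_of_length_le (by simp)]
        have e5 : ((p ++ [a] ++ e :: b :: q).drop (p.length + 1)).take (1 + 1) = [e, b] := by
          rw [List.drop_append_of_le_length (by simp), List.drop_eq_nil_of_le (by simp)]
          simp
        have e6 : (p ++ [a] ++ e :: b :: q).drop (p.length + 1 + 1 + 1) = q := by
          rw [show p ++ [a] ++ e :: b :: q = (p ++ [a, e, b]) ++ q by simp,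
            List.drop_left' (by simp)]
        simp only [e1, e2, e3, e4, e5, e6, right, left, sum_single]
        rw [Finsupp.sum_single_index (by simp), one_smul, hsum, hneg, smul_smul, neg_smul,
          List.append_assoc, List.singleton_append, add_neg_cancel]
      · intro i j h1 h2 h3 h4
        by_cases h5 : i ≤ (p ++ [a]).length ∧ (p ++ [a]).length < i + j + 1
        · rw [hin i j h5.1 h5.2 (by rintro rfl; simp at h3 h4 h5; omega) h2]
          simp
        · have h7 : ∀ c, _ := hout i j h1 h2 (by omega) (by simp at h1 h2 h5 ⊢; omega)
          simp only [h7, smul_zero]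
          simp

end Units

/-! ### The algebra of the right half-plane -/

section Right

variable {S : Spectrum.{u}} {z : ℝ → ℤ → ℂ} (D : InfraredData S)

/-- The solitons ending at the vacuum `0` whose edges point to the right: the basis of the
augmentation ideal of `A^R`. -/
abbrev RightGen (S : Spectrum.{u}) : Type u := {s : S.Gen // S.IsDown s ∧ S.tgt s = 0}

theorem final_letterWord (s : S.Gen) : (letterWord s).final = S.tgt s := by
  simp [Word.final, letterWord]

/-- The word of a basis vector of `A^R`. -/
def RightBasis.toWord (b : RightBasis S z) : Word S := b.1

theorem RightBasis.isStableFan (b : RightBasis S z) : b.toWord.IsStableFan z 1 := b.2.1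

theorem RightBasis.final_toWord (b : RightBasis S z) : b.toWord.final = 0 := b.2.2

@[simp]
theorem RightBasis.toWord_one : (RightBasis.one S z).toWord = ⟨0, []⟩ := rfl

/-- The basis vector of `A^R` given by a single soliton. -/
def RightBasis.of (hz : IsAsymptoticallyParabolic z) (a : RightGen S) : RightBasis S z :=
  ⟨letterWord a.1, (isStableFan_right_iff hz).2
    ⟨⟨rfl, (final_letterWord a.1).symm⟩, by simp [letterWord], by simp [letterWord, a.2.1]⟩,
    (final_letterWord a.1).trans a.2.2⟩

@[simp]
theorem RightBasis.toWord_of (hz : IsAsymptoticallyParabolic z) (a : RightGen S) :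
    (RightBasis.of hz a).toWord = letterWord a.1 := rfl

theorem RightBasis.of_injective (hz : IsAsymptoticallyParabolic z) :
    Function.Injective (RightBasis.of (S := S) hz) := fun a b h => by
  have := congrArg (fun w : RightBasis S z => w.toWord.letters) h
  simpa [letterWord, Subtype.ext_iff] using this

theorem RightBasis.of_ne_one (hz : IsAsymptoticallyParabolic z) (a : RightGen S) :
    RightBasis.of hz a ≠ RightBasis.one S z := fun h => by
  have := congrArg (fun w : RightBasis S z => w.toWord.letters) h
  simp [letterWord] at this

theorem RightBasis.eq_one_or_of (hz : IsAsymptoticallyParabolic z) (b : RightBasis S z) :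
    b = RightBasis.one S z ∨ ∃ a, b = RightBasis.of hz a := by
  obtain ⟨⟨k, L⟩, hb, hf⟩ := b
  obtain ⟨hp, hlen, hdown⟩ := (isStableFan_right_iff hz).1 hb
  rcases L with _ | ⟨s, _ | ⟨s', L⟩⟩
  · left
    have : k = 0 := hf
    subst this
    rfl
  · right
    rw [Word.final_cons] at hf
    refine ⟨⟨s, hdown s (by simp), hf⟩, Subtype.ext ?_⟩
    exact Word.ext hp.1.symm rfl
  · simp at hlen

theorem RightBasis.exists_eq_map_of (hz : IsAsymptoticallyParabolic z)
    {l : List (RightBasis S z)} (h : RightBasis.one S z ∉ l) :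
    ∃ gs : List (RightGen S), l = gs.map (RightBasis.of hz) := by
  induction l with
  | nil => exact ⟨[], rfl⟩
  | cons b l ih =>
    obtain ⟨gs, rfl⟩ := ih fun h' => h (List.mem_cons_of_mem _ h')
    obtain rfl | ⟨a, rfl⟩ := RightBasis.eq_one_or_of hz b
    · exact absurd (by simp) h
    · exact ⟨a :: gs, rfl⟩

theorem RightBasis.eq_of_letters (hz : IsAsymptoticallyParabolic z) {b c : RightBasis S z}
    (h : b.toWord.letters = c.toWord.letters) : b = c := by
  obtain rfl | ⟨a, rfl⟩ := RightBasis.eq_one_or_of hz b <;>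
    obtain rfl | ⟨a', rfl⟩ := RightBasis.eq_one_or_of hz c
  · rfl
  · simp [letterWord] at h
  · simp [letterWord] at h
  · simp only [RightBasis.toWord_of, letterWord, List.cons.injEq, and_true] at h
    rw [Subtype.ext h]

@[simp]
theorem degWord_one : D.degWord (RightBasis.one S z).toWord = 0 := by
  simp [InfraredData.degWord]

@[simp]
theorem degWord_of (hz : IsAsymptoticallyParabolic z) (a : RightGen S)
    : D.degWord (RightBasis.of hz a).toWord = D.deg a.1 := by
  simp [InfraredData.degWord, letterWord]

theorem finite_rightBasis_start (D : InfraredData S) (hz : IsAsymptoticallyParabolic z) (k : ℤ)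
    : {o : RightBasis S z | o.toWord.start = k}.Finite := by
  have h1 : ({a : RightGen S | S.src a.1 = k} : Set (RightGen S)).Finite :=
    Set.Finite.of_finite_image ((D.finite k 0).subset (by
      rintro _ ⟨a, ha, rfl⟩
      exact ⟨ha, a.2.2⟩)) (Subtype.val_injective.injOn)
  refine ((h1.image (RightBasis.of hz)).insert (RightBasis.one S z)).subset fun o ho => ?_
  obtain rfl | ⟨a, rfl⟩ := RightBasis.eq_one_or_of hz o
  · exact Set.mem_insert _ _
  · exact Set.mem_insert_of_mem _ ⟨a, ho, rfl⟩

/-- The matrix elements of the operations on `A^R`. -/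
def rightCoeff (z : ℝ → ℤ → ℂ) (ws : List (RightBasis S z)) (o : RightBasis S z) : ℂ :=
  if ws = [] then 0 else D.halfPlaneCoeff z 1 (D.placeRight (ws.map RightBasis.toWord)) o.toWord

theorem placeRight_ne_nil {ws : List (Word S)} (h : ws ≠ []) : D.placeRight ws ≠ [] := by
  cases ws with
  | nil => exact absurd rfl h
  | cons w ws => exact List.cons_ne_nil _ _

theorem length_placeRight (ws : List (Word S)) : (D.placeRight ws).length = ws.length := by
  induction ws with
  | nil => rfl
  | cons w ws ih => simp [InfraredData.placeRight, ih]

theorem rightCoeff_support_finite (hz : IsAsymptoticallyParabolic z) (ws : List (RightBasis S z)) :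
    (Function.support (rightCoeff D z ws)).Finite := by
  rcases ws with _ | ⟨w, ws⟩
  · simp [rightCoeff, Function.support]
  · refine (finite_rightBasis_start D hz
      (w.toWord.start + ((ws.map RightBasis.toWord).map Word.start).sum)).subset fun o ho => ?_
    rw [Function.mem_support, rightCoeff, if_neg (List.cons_ne_nil _ _)] at ho
    exact (label_first_of_coeff_ne_zero ho _ rfl).symm

/-- The operations of `A^R` on basis vectors. -/
def rightOp (hz : IsAsymptoticallyParabolic z) (ws : List (RightBasis S z)) : RightBasis S z →₀ ℂ :=
  Finsupp.ofSupportFinite (rightCoeff D z ws) (rightCoeff_support_finite D hz ws)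

theorem rightOp_apply (hz : IsAsymptoticallyParabolic z) (ws : List (RightBasis S z))
    (o : RightBasis S z) :
    rightOp D hz ws o = rightCoeff D z ws o := rfl

theorem rightOp_nil (hz : IsAsymptoticallyParabolic z) : rightOp D hz [] = 0 := by
  ext o
  simp [rightOp_apply, rightCoeff]

theorem exists_letters_eq_nil_of_one_mem {ws : List (RightBasis S z)}
    (h : RightBasis.one S z ∈ ws) :
    ∃ w ∈ D.placeRight (ws.map RightBasis.toWord), w.letters = [] := by
  induction ws with
  | nil => simp at h
  | cons b ws ih =>
    rcases List.mem_cons.1 h with rfl | h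
    · exact ⟨_, List.mem_cons_self, rfl⟩
    · obtain ⟨w, hw, hw'⟩ := ih h
      exact ⟨w, List.mem_cons_of_mem _ hw, hw'⟩

/-- If the unit is among the arguments, the only web is the one which multiplies two words. -/
theorem rightCoeff_ne_zero_of_one_mem (hz : IsAsymptoticallyParabolic z)
    {ws : List (RightBasis S z)} {o : RightBasis S z}
    (h : RightBasis.one S z ∈ ws) (hne : rightCoeff D z ws o ≠ 0) :
    ∃ b c, ws = [b, c] ∧
      o.toWord.letters.length = b.toWord.letters.length + c.toWord.letters.length ∧
      o.toWord.letters = (D.placeRight (ws.map RightBasis.toWord)).flatMap Word.letters := by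
  have hws : ws ≠ [] := List.ne_nil_of_mem h
  rw [rightCoeff, if_neg hws] at hne
  rcases shape_of_halfPlaneCoeff_right_ne_zero hz
    (placeRight_ne_nil D (List.map_eq_nil_iff.not.2 hws)) hne with
    ⟨w₁, w₂, h1, h2⟩ | ⟨ss, s, h1, -⟩
  · have hlen := congrArg List.length h1
    rw [length_placeRight] at hlen
    obtain ⟨b, c, rfl⟩ := List.length_eq_two.1 ((List.length_map _).symm.trans hlen)
    refine ⟨b, c, rfl, ?_, by rw [h1, h2]; simp⟩
    simp only [List.map_cons, List.map_nil, InfraredData.placeRight, List.cons.injEq,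
      and_true] at h1
    rw [h2, ← h1.1, ← h1.2]
    simp [InfraredData.shiftWord]
  · obtain ⟨w, hw, hw'⟩ := exists_letters_eq_nil_of_one_mem D h
    rw [h1] at hw
    obtain ⟨a, -, rfl⟩ := List.mem_map.1 hw
    simp [letterWord] at hw'

theorem rightOp_one (hz : IsAsymptoticallyParabolic z) : rightOp D hz [RightBasis.one S z] = 0 := by
  ext o
  by_contra h
  obtain ⟨b, c, h1, -⟩ := rightCoeff_ne_zero_of_one_mem D hz
    (List.mem_singleton_self (RightBasis.one S z)) h
  simp at h1

theorem rightOp_of_one_mem (hz : IsAsymptoticallyParabolic z) {ws : List (RightBasis S z)}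
    (hlen : 3 ≤ ws.length)
    (h : RightBasis.one S z ∈ ws) : rightOp D hz ws = 0 := by
  ext o
  by_contra h'
  obtain ⟨b, c, h1, -⟩ := rightCoeff_ne_zero_of_one_mem D hz h h'
  rw [h1] at hlen
  simp at hlen

theorem shiftWord_zero (w : Word S) : D.shiftWord 0 w = w := by
  ext1 <;> simp [InfraredData.shiftWord]

theorem shiftWord_nil (k l : ℤ) : D.shiftWord k ⟨l, []⟩ = ⟨l + k, []⟩ := by
  simp [InfraredData.shiftWord]

theorem isStableFan_nil {ν : ℂ} (k : ℤ) : (⟨k, []⟩ : Word S).IsStableFan z ν :=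
  Eventually.of_forall fun _ => by
    simp [Word.IsHalfPlaneFan, Word.Composable, Word.vacua, HalfPlaneClockwise]

theorem rightOp_one_left (hz : IsAsymptoticallyParabolic z) (b : RightBasis S z) :
    rightOp D hz [RightBasis.one S z, b] = Finsupp.single b 1 := by
  have hplace : D.placeRight ([RightBasis.one S z, b].map RightBasis.toWord) =
      [⟨b.toWord.start, []⟩, b.toWord] := by
    simp only [List.map_cons, List.map_nil, InfraredData.placeRight, List.sum_cons, List.sum_nil,
      shiftWord_zero, shiftWord_nil, RightBasis.toWord_one, add_zero, zero_add]
  ext o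
  rw [rightOp_apply]
  by_cases ho : o = b
  · subst ho
    rw [Finsupp.single_eq_same, rightCoeff, if_neg (by simp), hplace,
      halfPlaneCoeff_pair_right hz (isStableFan_nil _) o.isStableFan o.isStableFan rfl rfl rfl rfl]
    simp [InfraredData.degWord]
  · rw [Finsupp.single_eq_of_ne ho]
    by_contra h
    obtain ⟨-, -, -, -, h2⟩ := rightCoeff_ne_zero_of_one_mem D hz (by simp) h
    rw [hplace] at h2
    exact ho (RightBasis.eq_of_letters hz (by simpa using h2))

theorem rightOp_one_right (hz : IsAsymptoticallyParabolic z) (b : RightBasis S z) :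
    rightOp D hz [b, RightBasis.one S z] = sgn (D.degWord b.toWord) • Finsupp.single b 1 := by
  have hplace : D.placeRight ([b, RightBasis.one S z].map RightBasis.toWord) =
      [b.toWord, ⟨0, []⟩] := by
    simp only [List.map_cons, List.map_nil, InfraredData.placeRight, List.sum_cons, List.sum_nil,
      shiftWord_zero, shiftWord_nil, RightBasis.toWord_one, add_zero]
  ext o
  rw [rightOp_apply]
  by_cases ho : o = b
  · subst ho
    rw [Finsupp.smul_single, Finsupp.single_eq_same, rightCoeff, if_neg (by simp), hplace,
      halfPlaneCoeff_pair_right hz o.isStableFan (isStableFan_nil _) o.isStableFan (by simp)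
        o.final_toWord rfl
        o.final_toWord.symm, smul_eq_mul, mul_one]
  · rw [Finsupp.smul_single, Finsupp.single_eq_of_ne ho]
    by_contra h
    obtain ⟨-, -, -, -, h2⟩ := rightCoeff_ne_zero_of_one_mem D hz (by simp) h
    rw [hplace] at h2
    exact ho (RightBasis.eq_of_letters hz (by simpa using h2))

theorem placeRight_map_of (hz : IsAsymptoticallyParabolic z) (gs : List (RightGen S)) :
    D.placeRight ((gs.map (RightBasis.of hz)).map RightBasis.toWord) =
      (D.place (gs.map Subtype.val)).map letterWord := by
  rw [← D.placeRight_map_letterWord, List.map_map, List.map_map]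
  rfl

theorem rightCoeff_map_of_one (hz : IsAsymptoticallyParabolic z) (gs : List (RightGen S)) :
    rightCoeff D z (gs.map (RightBasis.of hz)) (RightBasis.one S z) = 0 := by
  by_contra hne
  have hgs : gs.map (RightBasis.of hz) ≠ [] := by
    rintro h
    simp [rightCoeff, h] at hne
  rw [rightCoeff, if_neg hgs] at hne
  rcases shape_of_halfPlaneCoeff_right_ne_zero hz
    (placeRight_ne_nil D (List.map_eq_nil_iff.not.2 hgs)) hne with
    ⟨w₁, w₂, h1, h2⟩ | ⟨ss, s, -, h2⟩
  · rw [placeRight_map_of] at h1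
    have h3 : w₁ ∈ (D.place (gs.map Subtype.val)).map letterWord := by rw [h1]; simp
    obtain ⟨a, -, rfl⟩ := List.mem_map.1 h3
    simp [letterWord] at h2
  · simp  at h2

/-- On solitons, the operations are given by the interior amplitude. -/
theorem rightCoeff_map_of (hz : IsAsymptoticallyParabolic z) (gs : List (RightGen S))
    (a : RightGen S) :
    rightCoeff D z (gs.map (RightBasis.of hz)) (RightBasis.of hz a) =
      if ((gs.map Subtype.val).map S.src).sum = S.src a.1 then
        sgn (D.deg a.1) * D.amp (a.1 :: ((D.place (gs.map Subtype.val)).map S.bar).reverse)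
      else 0 := by
  have ha := a.2
  rcases gs with _ | ⟨g, gs⟩
  · have : ¬ (0 : ℤ) = S.src a.1 := by
      have := ha.1
      unfold Spectrum.IsDown at this
      omega
    simp [rightCoeff, this]
  · have hpath := D.isPath_place (L := (g :: gs).map Subtype.val) (by
      intro s hs
      obtain ⟨x, -, rfl⟩ := List.mem_map.1 hs
      exact x.2.2)
    rw [rightCoeff, if_neg (by simp), placeRight_map_of]
    split_ifs with h
    · rw [h] at hpath
      refine halfPlaneCoeff_star hz ?_ (D.isDown_place ?_) ?_ rfl ?_
      · simp [InfraredData.place]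
      · intro s hs
        obtain ⟨x, -, rfl⟩ := List.mem_map.1 hs
        exact x.2.1
      · rw [(RightBasis.of hz a).final_toWord]
        exact hpath
      · rw [Word.composable_iff]
        exact ⟨rfl, (final_letterWord a.1).symm⟩
    · by_contra hne
      refine h (Eq.trans ?_ (label_first_of_coeff_ne_zero hne _ rfl))
      exact hpath.1.symm

end Right

section RightAssoc

variable {S : Spectrum.{u}} {z : ℝ → ℤ → ℂ} (D : InfraredData S)

theorem sum_map_deg_reverse_bar (L : List S.Gen) :
    (((L.map S.bar).reverse).map D.deg).sum = L.length - (L.map D.deg).sum := by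
  rw [List.map_reverse, List.sum_reverse]
  induction L with
  | nil => simp
  | cons s L ih =>
    have := D.deg_bar s
    simp only [List.map_cons, List.sum_cons, ih, List.length_cons]
    push_cast
    linarith

theorem sum_map_add_one {ι : Type*} (f : ι → ℤ) (L : List ι) :
    (L.map fun x => f x + 1).sum = (L.map f).sum + L.length := by
  rw [List.sum_map_add]
  simp

theorem sum_src_pos {q : List (RightGen S)} (hq : q ≠ []) :
    0 < ((q.map Subtype.val).map S.src).sum := by
  refine List.sum_pos _ (fun x hx => ?_)
    (List.map_eq_nil_iff.not.2 (List.map_eq_nil_iff.not.2 hq))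
  obtain ⟨s, hs, rfl⟩ := List.mem_map.1 hx
  obtain ⟨a, -, rfl⟩ := List.mem_map.1 hs
  have h1 : S.tgt a.1 < S.src a.1 := a.2.1
  rw [a.2.2] at h1
  exact h1

/-- One term of the associativity relation on solitons, expressed by the interior amplitude: the
intermediate soliton `c` corresponds to the soliton `s` dual to a translate of `c`. -/
theorem rightOp_comp_map_of (hz : IsAsymptoticallyParabolic z) {p q r : List (RightGen S)}
    (hq : q ≠ []) (a : RightGen S)
    (htot : (((p ++ q ++ r).map Subtype.val).map S.src).sum = S.src a.1) {k : ℤ}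
    (hk : k = ((r.map Subtype.val).map S.src).sum) {l : ℤ}
    (hl : l = ((q.map Subtype.val).map S.src).sum + k) :
    sgn ((p.map fun x => D.deg x.1 + 1).sum) *
        ((rightOp D hz (q.map (RightBasis.of hz))).sum fun c x =>
          x * rightCoeff D z (p.map (RightBasis.of hz) ++ c :: r.map (RightBasis.of hz))
            (RightBasis.of hz a)) =
      sgn (((p ++ q ++ r).map fun x => D.deg x.1 + 1).sum + D.deg a.1) *
        (sgn (((((D.place (r.map Subtype.val)).map S.bar).reverse).map D.deg).sum) *
          ∑ s ∈ (D.finite k l).toFinset,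
            D.amp (a.1 :: (((D.place (r.map Subtype.val)).map S.bar).reverse ++ s ::
              (((D.place (p.map Subtype.val)).map (D.shift ^ l)).map S.bar).reverse)) *
            D.amp (S.bar s ::
              (((D.place (q.map Subtype.val)).map (D.shift ^ k)).map S.bar).reverse)) := by
  have hqpos := sum_src_pos hq
  rw [Finsupp.sum, Finset.mul_sum, Finset.mul_sum, Finset.mul_sum]
  have hgen : ∀ s ∈ (D.finite k l).toFinset, S.IsDown ((D.shift ^ (-k)) (S.bar s)) ∧
      S.tgt ((D.shift ^ (-k)) (S.bar s)) = 0 := by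
    intro s hs
    obtain ⟨h1, h2⟩ := (Set.Finite.mem_toFinset _).1 hs
    rw [D.isDown_zpow, Spectrum.isDown_bar, D.tgt_zpow, S.tgt_bar, Spectrum.IsUp]
    constructor <;> omega
  have hsrc : ∀ c : RightGen S, S.src c.1 = ((q.map Subtype.val).map S.src).sum →
      rightCoeff D z (p.map (RightBasis.of hz) ++ RightBasis.of hz c :: r.map (RightBasis.of hz))
        (RightBasis.of hz a) = sgn (D.deg a.1) * D.amp (a.1 ::
          (((D.place (r.map Subtype.val)).map S.bar).reverse ++ S.bar ((D.shift ^ k) c.1) ::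
              (((D.place (p.map Subtype.val)).map (D.shift ^ l)).map S.bar).reverse)) := by
    intro c hc
    have h1 := rightCoeff_map_of D hz (p ++ c :: r) a
    rw [List.map_append, List.map_cons] at h1
    rw [h1, if_pos]
    · simp only [List.map_append, List.map_cons, D.place_append, InfraredData.place, ← hk,
        List.sum_cons, hc, ← hl, List.reverse_append, List.reverse_cons, List.append_assoc,
        List.singleton_append]
    · rw [← htot]
      simp only [List.map_append, List.map_cons, List.sum_append, List.sum_cons, hc]
      ring
  have hQ : ∀ c : S.Gen, D.amp ((D.shift ^ k) c ::
      (((D.place (q.map Subtype.val)).map (D.shift ^ k)).map S.bar).reverse) =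
        D.amp (c :: ((D.place (q.map Subtype.val)).map S.bar).reverse) := by
    intro c
    rw [← D.amp_map_zpow k (c :: _), List.map_cons, List.map_reverse, List.map_map, List.map_map]
    congr 3
    exact List.map_congr_left fun x _ => D.bar_zpow k x
  have key : ∀ c : RightGen S, S.src c.1 = ((q.map Subtype.val).map S.src).sum →
      sgn ((p.map fun x => D.deg x.1 + 1).sum) * (rightOp D hz (q.map (RightBasis.of hz))
        (RightBasis.of hz c) * rightCoeff D z (p.map (RightBasis.of hz) ++
          RightBasis.of hz c :: r.map (RightBasis.of hz)) (RightBasis.of hz a)) =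
      sgn (((p ++ q ++ r).map fun x => D.deg x.1 + 1).sum + D.deg a.1) *
        (sgn (((((D.place (r.map Subtype.val)).map S.bar).reverse).map D.deg).sum) *
          (D.amp (a.1 :: (((D.place (r.map Subtype.val)).map S.bar).reverse ++
            S.bar ((D.shift ^ k) c.1) ::
              (((D.place (p.map Subtype.val)).map (D.shift ^ l)).map S.bar).reverse)) *
            D.amp (S.bar (S.bar ((D.shift ^ k) c.1)) ::
              (((D.place (q.map Subtype.val)).map (D.shift ^ k)).map S.bar).reverse))) := by
    intro c hc
    rw [hsrc c hc, rightOp_apply, rightCoeff_map_of, if_pos hc.symm, S.bar_bar, hQ]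
    rcases eq_or_ne (D.amp (c.1 :: ((D.place (q.map Subtype.val)).map S.bar).reverse)) 0 with h | h
    · simp only [h, mul_zero, zero_mul]
    have h1 := D.amp_deg _ h
    rw [List.map_cons, List.sum_cons, sum_map_deg_reverse_bar, D.map_deg_place,
      D.length_place] at h1
    rw [sum_map_deg_reverse_bar, D.map_deg_place, D.length_place]
    -- where the inner amplitude does not vanish, its degree fixes the degree of `c`
    have h2 : sgn ((p.map fun x => D.deg x.1 + 1).sum + D.deg c.1 + D.deg a.1) =
        sgn (((p ++ q ++ r).map fun x => D.deg x.1 + 1).sum + D.deg a.1 +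
          (((r.map Subtype.val).length : ℤ) - ((r.map Subtype.val).map D.deg).sum)) := by
      refine sgn_congr ?_
      have e : ∀ x : List (RightGen S), (x.map fun x => D.deg x.1 + 1).sum =
          ((x.map Subtype.val).map D.deg).sum + (x.map Subtype.val).length := by
        intro x
        rw [sum_map_add_one, List.map_map, List.length_map]
        rfl
      simp only [List.map_append, List.sum_append, e]
      exact ⟨1 - (q.map Subtype.val).length - (r.map Subtype.val).length, by linarith⟩
    rw [sgn_add, sgn_add, sgn_add, sgn_add] at h2
    rw [sgn_add]
    linear_combination (D.amp (c.1 :: ((D.place (q.map Subtype.val)).map S.bar).reverse) *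
      D.amp (a.1 :: (((D.place (r.map Subtype.val)).map S.bar).reverse ++
            S.bar ((D.shift ^ k) c.1) ::
              (((D.place (p.map Subtype.val)).map (D.shift ^ l)).map S.bar).reverse))) * h2
  symm
  have hinv : ∀ s : S.Gen, S.bar ((D.shift ^ k) ((D.shift ^ (-k)) (S.bar s))) = s := by
    intro s
    rw [D.zpow_apply_zpow, add_neg_cancel, zpow_zero, Equiv.Perm.one_apply, S.bar_bar]
  have hval : ∀ s (hs : s ∈ (D.finite k l).toFinset), _ := fun s hs =>
    key ⟨_, hgen s hs⟩ (by
      obtain ⟨h1, h2⟩ := (Set.Finite.mem_toFinset _).1 hs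
      rw [D.src_zpow, S.src_bar, h2]
      omega)
  simp only [hinv] at hval
  -- an output `c` of the inner operation is the soliton on the diagonal of the polygon, reversed
  -- and translated so as to end at `0`
  refine Finset.sum_bij_ne_zero (fun s hs _ => RightBasis.of hz ⟨_, hgen s hs⟩) ?_ ?_ ?_ ?_
  · intro s hs hne
    rw [← hval s hs] at hne
    exact Finsupp.mem_support_iff.2 (left_ne_zero_of_mul (right_ne_zero_of_mul hne))
  · intro s hs _ s' hs' _ h
    have h1 := Subtype.ext_iff.1 (RightBasis.of_injective hz h)
    have h2 := (D.shift ^ (-k)).injective h1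
    rw [← S.bar_bar s, h2, S.bar_bar]
  · intro c hc hne
    obtain rfl | ⟨c, rfl⟩ := RightBasis.eq_one_or_of hz c
    · rw [Finsupp.mem_support_iff, rightOp_apply, rightCoeff_map_of_one] at hc
      exact absurd rfl hc
    · rw [Finsupp.mem_support_iff, rightOp_apply, rightCoeff_map_of] at hc
      have hc' : S.src c.1 = ((q.map Subtype.val).map S.src).sum := by
        by_contra h
        exact hc (if_neg (Ne.symm h))
      rw [key c hc'] at hne
      refine ⟨S.bar ((D.shift ^ k) c.1), (Set.Finite.mem_toFinset _).2 ⟨?_, ?_⟩, hne, ?_⟩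
      · rw [S.src_bar, D.tgt_zpow, c.2.2, zero_add]
      · rw [S.tgt_bar, D.src_zpow, hc', hl]
      · congr 1
        refine Subtype.ext ?_
        change (D.shift ^ (-k)) (S.bar (S.bar ((D.shift ^ k) c.1))) = c.1
        rw [S.bar_bar, D.zpow_apply_zpow, neg_add_cancel, zpow_zero, Equiv.Perm.one_apply]
  · exact fun s hs _ => (hval s hs).symm

/-- Summation over the subwords of a word and of the word read backwards. -/
theorem sum_range_range_reflect {V : Type*} [AddCommMonoid V] (n : ℕ) (f : ℕ → ℕ → V) :
    ∑ i ∈ Finset.range n, ∑ j ∈ Finset.range (n - i), f i j =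
      ∑ i ∈ Finset.range n, ∑ j ∈ Finset.range (n - i), f (n - 1 - i - j) j := by
  rw [Finset.sum_sigma', Finset.sum_sigma']
  refine Finset.sum_nbij' (fun x => ⟨n - 1 - x.1 - x.2, x.2⟩) (fun x => ⟨n - 1 - x.1 - x.2, x.2⟩)
    ?_ ?_ ?_ ?_ ?_
  · rintro ⟨i, j⟩ h
    simp only [Finset.mem_sigma, Finset.mem_range] at h ⊢
    omega
  · rintro ⟨i, j⟩ h
    simp only [Finset.mem_sigma, Finset.mem_range] at h ⊢
    omega
  · rintro ⟨i, j⟩ h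
    simp only [Finset.mem_sigma, Finset.mem_range] at h
    simp only [Sigma.mk.injEq, heq_eq_eq, and_true]
    omega
  · rintro ⟨i, j⟩ h
    simp only [Finset.mem_sigma, Finset.mem_range] at h
    simp only [Sigma.mk.injEq, heq_eq_eq, and_true]
    omega
  · rintro ⟨i, j⟩ h
    simp only [Finset.mem_sigma, Finset.mem_range] at h
    simp only
    congr 1
    omega

/-- On solitons, the associativity relations of `A^R` are the Maurer–Cartan equation for the fans
which consist of the soliton at infinity and the duals of the arguments. -/
theorem rightOp_assoc_map_of (hz : IsAsymptoticallyParabolic z) (hβ : D.IsInteriorAmplitude z)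
    (gs : List (RightGen S)) :
    ∑ i ∈ Finset.range (gs.map (RightBasis.of hz)).length,
      ∑ j ∈ Finset.range ((gs.map (RightBasis.of hz)).length - i),
        sgn ((((gs.map (RightBasis.of hz)).take i).map fun b => D.degWord b.toWord + 1).sum) •
          ((rightOp D hz (((gs.map (RightBasis.of hz)).drop i).take (j + 1))).sum fun c r =>
            r • rightOp D hz ((gs.map (RightBasis.of hz)).take i ++
              c :: (gs.map (RightBasis.of hz)).drop (i + j + 1))) = 0 := by
  ext o
  simp only [Finsupp.coe_finsetSum, Finset.sum_apply, Finsupp.smul_apply, Finsupp.sum_apply,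
    Finsupp.coe_zero, Pi.zero_apply, rightOp_apply, smul_eq_mul, ← List.map_take, ← List.map_drop,
    List.length_map, List.map_map, Function.comp_def, degWord_of]
  obtain rfl | ⟨a, rfl⟩ := RightBasis.eq_one_or_of hz o
  · refine Finset.sum_eq_zero fun i _ => Finset.sum_eq_zero fun j _ => ?_
    rw [Finsupp.sum, Finset.sum_eq_zero, mul_zero]
    intro c hc
    obtain rfl | ⟨c, rfl⟩ := RightBasis.eq_one_or_of hz c
    · rw [Finsupp.mem_support_iff, rightOp_apply, rightCoeff_map_of_one] at hc
      exact absurd rfl hc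
    · rw [← List.map_cons, ← List.map_append, rightCoeff_map_of_one, mul_zero]
  have hsplit : ∀ i j, gs = gs.take i ++ (gs.drop i).take (j + 1) ++ gs.drop (i + j + 1) := by
    intro i j
    rw [List.append_assoc, add_assoc, ← List.drop_drop, List.take_append_drop,
      List.take_append_drop]
  -- the operations preserve the total translation; if it differs from that of the output, both
  -- sides vanish
  by_cases htot : ((gs.map Subtype.val).map S.src).sum = S.src a.1
  · set P := D.place (gs.map Subtype.val) with hP
    set L := (P.map S.bar).reverse with hL
    have hPlen : P.length = gs.length := by rw [hP, D.length_place, List.length_map]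
    have hLlen : L.length = gs.length := by simp [hL, hPlen]
    have hPpath : IsPath (S.src a.1) 0 P := by
      rw [← htot]
      refine D.isPath_place fun s hs => ?_
      obtain ⟨x, -, rfl⟩ := List.mem_map.1 hs
      exact x.2.2
    have hLpath : IsPath (S.tgt a.1) (S.src a.1) L := by
      rw [a.2.2]
      exact hPpath.reverse
    have hLup : ∀ x ∈ L, S.IsUp x := by
      intro x hx
      rw [hL, List.mem_reverse, List.mem_map] at hx
      obtain ⟨y, hy, rfl⟩ := hx
      rw [Spectrum.isUp_bar]
      refine D.isDown_place ?_ y hy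
      intro s hs
      obtain ⟨x, -, rfl⟩ := List.mem_map.1 hs
      exact x.2.1
    have hMC := hβ.sum_eq_zero hz hLpath hLup
    rw [hLlen, sum_range_range_reflect] at hMC
    rw [← mul_zero (sgn ((gs.map fun x => D.deg x.1 + 1).sum + D.deg a.1)), ← hMC, Finset.mul_sum]
    refine Finset.sum_congr rfl fun i hi => ?_
    rw [Finset.mul_sum]
    refine Finset.sum_congr rfl fun j hj => ?_
    rw [Finset.mem_range] at hi hj
    set p := gs.take i with hp
    set q := (gs.drop i).take (j + 1) with hq
    set r := gs.drop (i + j + 1) with hr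
    have hpqr : gs = p ++ q ++ r := hsplit i j
    have hrlen : r.length = gs.length - 1 - i - j := by rw [hr, List.length_drop]; omega
    have hqlen : q.length = j + 1 := by rw [hq, List.length_take, List.length_drop]; omega
    have hqne : q ≠ [] := List.ne_nil_of_length_pos (by omega)
    have hPs : P = ((D.place (p.map Subtype.val)).map
          (D.shift ^ (((q.map Subtype.val).map S.src).sum + ((r.map Subtype.val).map S.src).sum)) ++
        (D.place (q.map Subtype.val)).map (D.shift ^ ((r.map Subtype.val).map S.src).sum)) ++
        D.place (r.map Subtype.val) := by
      rw [hP, hpqr]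
      simp only [List.map_append, D.place_append, List.map_map, ← Equiv.Perm.coe_mul, ← zpow_add,
        add_comm]
    have hLs : L = ((D.place (r.map Subtype.val)).map S.bar).reverse ++
        ((((D.place (q.map Subtype.val)).map
          (D.shift ^ ((r.map Subtype.val).map S.src).sum)).map S.bar).reverse ++
        (((D.place (p.map Subtype.val)).map (D.shift ^ (((q.map Subtype.val).map S.src).sum +
          ((r.map Subtype.val).map S.src).sum))).map S.bar).reverse) := by
      rw [hL, hPs]
      simp only [List.map_append, List.reverse_append]
    have htgt : ∀ x : List (RightGen S), ∀ s ∈ x.map Subtype.val, S.tgt s = 0 := by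
      intro x s hs
      obtain ⟨y, -, rfl⟩ := List.mem_map.1 hs
      exact y.2.2
    have e1 : L.take (gs.length - 1 - i - j) =
        ((D.place (r.map Subtype.val)).map S.bar).reverse := by
      rw [hLs, List.take_left' (by simp [hrlen])]
    have e2 : (L.drop (gs.length - 1 - i - j)).take (j + 1) = (((D.place (q.map Subtype.val)).map
          (D.shift ^ ((r.map Subtype.val).map S.src).sum)).map S.bar).reverse := by
      rw [hLs, List.drop_left' (by simp [hrlen]), List.take_left' (by simp [hqlen])]
    have e3 : L.drop (gs.length - 1 - i - j + (j + 1)) = (((D.place (p.map Subtype.val)).map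
          (D.shift ^ (((q.map Subtype.val).map S.src).sum +
            ((r.map Subtype.val).map S.src).sum))).map S.bar).reverse := by
      rw [hLs, ← List.drop_drop, List.drop_left' (by simp [hrlen]),
        List.drop_left' (by simp [hqlen])]
    have v1 : vacuumAt (S.tgt a.1) L (gs.length - 1 - i - j) =
        ((r.map Subtype.val).map S.src).sum := by
      have h1 := (hLpath.split (gs.length - 1 - i - j)).1
      rw [e1, a.2.2] at h1
      rw [a.2.2]
      exact h1.end_unique (D.isPath_place (htgt r)).reverse
    have v2 : vacuumAt (S.tgt a.1) L (gs.length - 1 - i - j + (j + 1)) =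
        ((q.map Subtype.val).map S.src).sum + ((r.map Subtype.val).map S.src).sum := by
      have h1 := (hLpath.split (gs.length - 1 - i - j + (j + 1))).1
      have h2 := (D.isPath_place (htgt (q ++ r))).reverse
      rw [List.take_add, e1, e2, a.2.2] at h1
      simp only [List.map_append, D.place_append, List.reverse_append, List.sum_append] at h2
      rw [a.2.2]
      exact h1.end_unique h2
    have hcomp := rightOp_comp_map_of D hz hqne a (by rw [← hpqr]; exact htot) rfl rfl
    rw [← hpqr] at hcomp
    rw [hcomp, e1, e2, e3, v1, v2]
  · refine Finset.sum_eq_zero fun i _ => Finset.sum_eq_zero fun j _ => ?_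
    rw [Finsupp.sum, Finset.sum_eq_zero, mul_zero]
    intro c hc
    obtain rfl | ⟨c, rfl⟩ := RightBasis.eq_one_or_of hz c
    · rw [Finsupp.mem_support_iff, rightOp_apply, rightCoeff_map_of_one] at hc
      exact absurd rfl hc
    · rw [Finsupp.mem_support_iff, rightOp_apply, rightCoeff_map_of] at hc
      have hc' : S.src c.1 = ((((gs.drop i).take (j + 1)).map Subtype.val).map S.src).sum := by
        by_contra h
        exact hc (if_neg (Ne.symm h))
      rw [← List.map_cons, ← List.map_append, rightCoeff_map_of, if_neg, mul_zero]
      intro h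
      refine htot (Eq.trans ?_ h)
      have h3 := congrArg (fun x => ((x.map Subtype.val).map S.src).sum) (hsplit i j)
      refine h3.trans ?_
      simp only [List.map_append, List.map_cons, List.sum_append, List.sum_cons, hc']
      ring

end RightAssoc

section RightAlgebra

variable {S : Spectrum.{u}} {z : ℝ → ℤ → ℂ} (D : InfraredData S)

theorem rightOp_degree (hz : IsAsymptoticallyParabolic z) (l : List (RightBasis S z))
    (o : RightBasis S z) (h : rightOp D hz l o ≠ 0) :
    D.degWord o.toWord = (l.map fun b => D.degWord b.toWord).sum + 2 - l.length := by
  by_cases hl : RightBasis.one S z ∈ l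
  · obtain ⟨b, c, rfl, -⟩ := rightCoeff_ne_zero_of_one_mem D hz hl h
    have hcase : rightOp D hz [b, c] o ≠ 0 → D.degWord o.toWord =
        D.degWord b.toWord + D.degWord c.toWord := by
      intro h'
      rcases List.mem_cons.1 hl with rfl | hl
      · rw [rightOp_one_left] at h'
        rw [(Finsupp.single_apply_ne_zero.1 h').1, degWord_one, zero_add]
      · rw [List.mem_singleton] at hl
        subst hl
        rw [rightOp_one_right, Finsupp.smul_single] at h'
        rw [(Finsupp.single_apply_ne_zero.1 h').1, degWord_one, add_zero]
    simp [hcase h]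
  · obtain ⟨gs, rfl⟩ := RightBasis.exists_eq_map_of hz hl
    rw [rightOp_apply] at h
    obtain rfl | ⟨a, rfl⟩ := RightBasis.eq_one_or_of hz o
    · exact absurd (rightCoeff_map_of_one D hz gs) h
    · rw [rightCoeff_map_of] at h
      have h1 := D.amp_deg _ (right_ne_zero_of_mul (ite_ne_right_iff.1 h).2)
      rw [List.map_cons, List.sum_cons, sum_map_deg_reverse_bar, D.map_deg_place,
        D.length_place, List.length_map, List.map_map] at h1
      simp only [Function.comp_def] at h1
      simp only [degWord_of, List.map_map, Function.comp_def, List.length_map]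
      linarith

/-- The `A_∞`-algebra `A^R` of the right half-plane. -/
def rightAlgebra (hz : IsAsymptoticallyParabolic z) (hβ : D.IsInteriorAmplitude z) :
    AInfinity (RightBasis S z) fun b => D.degWord b.1 where
  m := rightOp D hz
  m_nil := rightOp_nil D hz
  degree := rightOp_degree D hz
  assoc l := by
    by_cases hl : RightBasis.one S z ∈ l
    · exact assoc_of_mem_unit (rightOp_degree D hz) (degWord_one D) (rightOp_one D hz)
        (rightOp_one_left D hz) (rightOp_one_right D hz)
        (fun _ h h' => rightOp_of_one_mem D hz h h') hl
    · obtain ⟨gs, rfl⟩ := RightBasis.exists_eq_map_of hz hl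
      exact rightOp_assoc_map_of D hz hβ gs

theorem isStrictUnit_rightAlgebra (hz : IsAsymptoticallyParabolic z)
    (hβ : D.IsInteriorAmplitude z) :
    (rightAlgebra D hz hβ).IsStrictUnit (RightBasis.one S z) where
  deg_unit := degWord_one D
  d_unit := rightOp_one D hz
  left := rightOp_one_left D hz
  right := rightOp_one_right D hz
  higher _ h h' := rightOp_of_one_mem D hz h h'

theorem rightOp_apply_one (hz : IsAsymptoticallyParabolic z) {l : List (RightBasis S z)}
    (hl : RightBasis.one S z ∉ l) : rightOp D hz l (RightBasis.one S z) = 0 := by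
  obtain ⟨gs, rfl⟩ := RightBasis.exists_eq_map_of hz hl
  exact rightCoeff_map_of_one D hz gs

theorem isAugmentedAt_rightAlgebra (hz : IsAsymptoticallyParabolic z)
    (hβ : D.IsInteriorAmplitude z) :
    (rightAlgebra D hz hβ).IsAugmentedAt (RightBasis.one S z) := by
  refine ⟨degWord_one D, fun b => ?_, fun b c => ?_, fun l hl => ?_⟩
  · change rightOp D hz [b] _ = 0
    obtain rfl | ⟨a, rfl⟩ := RightBasis.eq_one_or_of hz b
    · rw [rightOp_one]; rfl
    · exact rightCoeff_map_of_one D hz [a]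
  · change rightOp D hz [b, c] _ = _
    obtain rfl | ⟨a, rfl⟩ := RightBasis.eq_one_or_of hz b
    · rw [rightOp_one_left, Finsupp.single_eq_same, one_mul]
    · rw [Finsupp.single_eq_of_ne (RightBasis.of_ne_one hz a).symm, zero_mul]
      obtain rfl | ⟨a', rfl⟩ := RightBasis.eq_one_or_of hz c
      · rw [rightOp_one_right, Finsupp.smul_apply,
          Finsupp.single_eq_of_ne (RightBasis.of_ne_one hz a).symm, smul_zero]
      · exact rightCoeff_map_of_one D hz [a, a']
  · change rightOp D hz l _ = 0
    by_cases h : RightBasis.one S z ∈ l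
    · rw [rightOp_of_one_mem D hz hl h]; rfl
    · exact rightOp_apply_one D hz h

theorem isRightWebAlgebra_rightAlgebra (hz : IsAsymptoticallyParabolic z)
    (hβ : D.IsInteriorAmplitude z) : IsRightWebAlgebra D z (rightAlgebra D hz hβ) := by
  intro ws hws o
  refine ⟨halfPlaneTaut_right_finite hz (placeRight_ne_nil D (List.map_eq_nil_iff.not.2 hws)), ?_⟩
  exact if_neg hws

end RightAlgebra

/-! ### The cobar differential -/

namespace Cobar

variable {B : Type*} {e : B}

open FreeMonoid in
open Classical in
theorem coeff_mul_word (x : Cobar e) (u v : List {b : B // b ≠ e}) :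
    (x * word (ofList v)).coeff (ofList u) =
      if u = u.take (u.length - v.length) ++ v then
        x.coeff (ofList (u.take (u.length - v.length))) else 0 := by
  rw [word, MonoidAlgebra.of_apply]
  split_ifs with h
  · conv_lhs => rw [h, ofList_append]
    rw [MonoidAlgebra.coeff_mul_single_mul, mul_one]
  · refine MonoidAlgebra.coeff_mul_single_of_forall_mul_ne _ _ fun d hd => h ?_
    have h1 : u = toList d ++ v := by
      have := congrArg toList hd
      simpa using this.symm
    rw [h1]
    simp

open FreeMonoid in
theorem coeff_of_mul_nil (x : Cobar e) (a : {b : B // b ≠ e}) :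
    (word (FreeMonoid.of a) * x).coeff (ofList []) = 0 := by
  rw [word, MonoidAlgebra.of_apply]
  refine MonoidAlgebra.coeff_single_mul_of_forall_mul_ne _ _ fun d hd => ?_
  have := congrArg toList hd
  simp at this

open FreeMonoid in
open Classical in
theorem coeff_of_mul_cons (x : Cobar e) (a b : {b : B // b ≠ e}) (u : List {b : B // b ≠ e}) :
    (word (FreeMonoid.of a) * x).coeff (ofList (b :: u)) =
      if b = a then x.coeff (ofList u) else 0 := by
  rw [word, MonoidAlgebra.of_apply]
  split_ifs with h
  · rw [h, ofList_cons, MonoidAlgebra.coeff_single_mul_mul, one_mul]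
  · refine MonoidAlgebra.coeff_single_mul_of_forall_mul_ne _ _ fun d hd => h ?_
    have := congrArg toList hd
    simp at this
    exact this.1.symm

theorem word_mul (u v : FreeMonoid {b : B // b ≠ e}) : word (u * v) = word u * word v :=
  map_mul _ _ _

theorem word_one : word (1 : FreeMonoid {b : B // b ≠ e}) = 1 := map_one _

variable {deg : B → ℤ} (A : AInfinity B deg)

/-- Each basis vector occurs in only finitely many of the operations on words in the augmentation
ideal. -/
def IsLocallyFinite (e : B) : Prop :=
  ∀ a : B, {u : FreeMonoid {b : B // b ≠ e} | A.m (u.toList.map Subtype.val) a ≠ 0}.Finite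

variable {A}

/-- The cobar differential on a generator. -/
def deltaGen (hA : IsLocallyFinite A e) (a : {b : B // b ≠ e}) : Cobar e :=
  .ofCoeff (Finsupp.ofSupportFinite (fun u => A.m (u.toList.map Subtype.val) a.1) (hA a.1))

theorem coeff_deltaGen (hA : IsLocallyFinite A e) (a : {b : B // b ≠ e})
    (u : FreeMonoid {b : B // b ≠ e}) :
    (deltaGen hA a).coeff u = A.m (u.toList.map Subtype.val) a.1 := rfl

/-- The cobar differential on a word. -/
def deltaList (hA : IsLocallyFinite A e) : List {b : B // b ≠ e} → Cobar e
  | [] => 0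
  | a :: u => deltaGen hA a * word (FreeMonoid.ofList u) +
      sgn (1 - deg a.1) • (word (FreeMonoid.of a) * deltaList hA u)

/-- The cobar differential. -/
def differential (hA : IsLocallyFinite A e) : Cobar e →ₗ[ℂ] Cobar e :=
  Finsupp.linearCombination ℂ (fun u : FreeMonoid {b : B // b ≠ e} => deltaList hA u.toList) ∘ₗ
    (MonoidAlgebra.coeffLinearEquiv ℂ).toLinearMap

theorem differential_word (hA : IsLocallyFinite A e) (u : FreeMonoid {b : B // b ≠ e}) :
    differential hA (word u) = deltaList hA u.toList := by
  change Finsupp.linearCombination ℂ _ (word u).coeff = _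
  rw [word, MonoidAlgebra.of_apply, MonoidAlgebra.coeff_single, Finsupp.linearCombination_single,
    one_smul]

theorem deltaList_singleton (hA : IsLocallyFinite A e) (a : {b : B // b ≠ e}) :
    deltaList hA [a] = deltaGen hA a := by
  simp [deltaList, word_one]

theorem deltaList_append (hA : IsLocallyFinite A e) (u v : List {b : B // b ≠ e}) :
    deltaList hA (u ++ v) = deltaList hA u * word (FreeMonoid.ofList v) +
      sgn ((u.map fun a => 1 - deg a.1).sum) •
        (word (FreeMonoid.ofList u) * deltaList hA v) := by
  induction u with
  | nil => simp [deltaList, word_one]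
  | cons a u ih =>
    rw [List.cons_append, deltaList, deltaList, ih, FreeMonoid.ofList_append, word_mul,
      List.map_cons, List.sum_cons, sgn_add, FreeMonoid.ofList_cons, word_mul]
    simp only [mul_add, add_mul, smul_add, smul_smul, mul_smul_comm, smul_mul_assoc, mul_assoc]
    abel

theorem eq_sum_word (x : Cobar e) : x = ∑ u ∈ x.coeff.support, x.coeff u • word u := by
  conv_lhs => rw [← MonoidAlgebra.sum_coeff_single x]
  refine Finset.sum_congr rfl fun u _ => ?_
  rw [word, MonoidAlgebra.of_apply, MonoidAlgebra.smul_single, smul_eq_mul, mul_one]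

theorem linearMap_ext {V : Type*} [AddCommMonoid V] [Module ℂ V] {f g : Cobar e →ₗ[ℂ] V}
    (h : ∀ u, f (word u) = g (word u)) : f = g := by
  refine LinearMap.ext fun x => ?_
  rw [eq_sum_word x, map_sum, map_sum]
  simp only [map_smul, h]

theorem differential_word_mul (hA : IsLocallyFinite A e) (u v : FreeMonoid {b : B // b ≠ e}) :
    differential hA (word (u * v)) = differential hA (word u) * word v +
      sgn (degree deg u) • (word u * differential hA (word v)) := by
  rw [differential_word, differential_word, differential_word, FreeMonoid.toList_mul,
    deltaList_append]
  rfl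

theorem differential_of_mul (hA : IsLocallyFinite A e) (a : {b : B // b ≠ e}) (y : Cobar e) :
    differential hA (word (FreeMonoid.of a) * y) = deltaGen hA a * y +
      sgn (1 - deg a.1) • (word (FreeMonoid.of a) * differential hA y) := by
  have h : differential hA ∘ₗ LinearMap.mulLeft ℂ (word (FreeMonoid.of a)) =
      LinearMap.mulLeft ℂ (deltaGen hA a) + sgn (1 - deg a.1) •
        (LinearMap.mulLeft ℂ (word (FreeMonoid.of a)) ∘ₗ differential hA) := by
    refine linearMap_ext fun v => ?_
    simp only [LinearMap.comp_apply, LinearMap.mulLeft_apply, LinearMap.add_apply,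
      LinearMap.smul_apply]
    rw [← word_mul, differential_word_mul, differential_word, FreeMonoid.toList_of,
      deltaList_singleton]
    simp [degree]
  exact LinearMap.congr_fun h y

theorem differential_mul_word (hA : IsLocallyFinite A e) {x : Cobar e} {d : ℤ}
    (hx : ∀ u, x.coeff u ≠ 0 → Even (degree deg u - d)) (v : FreeMonoid {b : B // b ≠ e}) :
    differential hA (x * word v) = differential hA x * word v +
      sgn d • (x * differential hA (word v)) := by
  conv_lhs => rw [eq_sum_word x]
  conv_rhs => rw [eq_sum_word x]
  simp only [Finset.sum_mul, map_sum, Finset.smul_sum, ← Finset.sum_add_distrib]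
  refine Finset.sum_congr rfl fun u hu => ?_
  rw [smul_mul_assoc, map_smul, ← word_mul, differential_word_mul,
    sgn_congr (hx u (Finsupp.mem_support_iff.1 hu)), map_smul, smul_mul_assoc, smul_mul_assoc,
    smul_add, smul_comm]

theorem sum_map_one_sub (u : List {b : B // b ≠ e}) :
    (u.map fun a => 1 - deg a.1).sum = u.length - (u.map fun a => deg a.1).sum := by
  induction u with
  | nil => simp
  | cons a u ih =>
    simp only [List.map_cons, List.sum_cons, ih, List.length_cons]
    push_cast
    ring

theorem degree_of_coeff_deltaGen (hA : IsLocallyFinite A e) (a : {b : B // b ≠ e})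
    (u : FreeMonoid {b : B // b ≠ e}) (h : (deltaGen hA a).coeff u ≠ 0) :
    degree deg u = 2 - deg a.1 := by
  rw [coeff_deltaGen] at h
  have h1 := A.degree _ _ h
  rw [List.map_map, List.length_map] at h1
  rw [degree, sum_map_one_sub, h1]
  simp only [Function.comp_def]
  ring

open Classical in
theorem sum_ite_cons_eq (f : B →₀ ℂ) (a : B) (v d : List B) :
    (f.sum fun c r => if a :: v = c :: d then r else 0) = if v = d then f a else 0 := by
  by_cases h : v = d
  · rw [if_pos h, Finsupp.sum, Finset.sum_eq_single a]
    · simp [h]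
    · intro c _ hc
      simp [hc.symm]
    · intro ha
      rw [Finsupp.notMem_support_iff.1 ha, ite_self]
  · simp [h]

open Classical in
/-- The matrix elements of the cobar differential: a word occurs in `δ v` for each way to contract
one of its subwords to a letter so that `v` is obtained. -/
theorem coeff_deltaList (hA : IsLocallyFinite A e) (v u : List {b : B // b ≠ e}) :
    (deltaList hA v).coeff (FreeMonoid.ofList u) =
      ∑ i ∈ Finset.range u.length, ∑ j ∈ Finset.range (u.length - i),
        sgn (((u.take i).map fun a => deg a.1 + 1).sum) *
          ((A.m (((u.drop i).take (j + 1)).map Subtype.val)).sum fun c r =>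
            if v.map Subtype.val = (u.take i).map Subtype.val ++
              c :: (u.drop (i + j + 1)).map Subtype.val then r else 0) := by
  induction v generalizing u with
  | nil =>
    simp [deltaList]
  | cons a v ih =>
    rw [deltaList, MonoidAlgebra.coeff_add, Finsupp.add_apply, MonoidAlgebra.coeff_smul_apply,
      coeff_mul_word]
    rcases u with _ | ⟨b, u⟩
    · rw [coeff_of_mul_nil, coeff_deltaGen]
      simp [A.m_nil]
    rw [coeff_of_mul_cons, ih, List.length_cons, Finset.sum_range_succ', add_comm]
    congr 1
    · by_cases hab : b = a
      · subst hab
        rw [if_pos rfl, smul_eq_mul, Finset.mul_sum]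
        refine Finset.sum_congr rfl fun i _ => ?_
        rw [Nat.add_sub_add_right, Finset.mul_sum]
        refine Finset.sum_congr rfl fun j _ => ?_
        rw [← mul_assoc, ← sgn_add, show i + 1 + j + 1 = i + j + 1 + 1 by omega]
        simp only [List.take_succ_cons, List.drop_succ_cons, List.map_cons, List.sum_cons,
          List.cons_append, List.cons.injEq, true_and]
        congr 1
        exact sgn_congr ⟨- deg b.1, by ring⟩
      · rw [if_neg hab, smul_zero]
        refine (Finset.sum_eq_zero fun i _ => Finset.sum_eq_zero fun j _ => ?_).symm
        simp [Subtype.ext_iff.not.1 (Ne.symm hab)]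
    · simp only [List.take_zero, List.map_nil, List.sum_nil, sgn_zero, one_mul, List.nil_append,
        List.drop_zero, zero_add, Nat.sub_zero, List.map_cons, sum_ite_cons_eq]
      rcases Nat.lt_or_ge u.length v.length with hlen | hlen
      · rw [Nat.sub_eq_zero_of_le hlen, List.take_zero, coeff_deltaGen]
        rw [Finset.sum_eq_zero]
        · simp [A.m_nil]
        · intro j _
          refine if_neg fun h => ?_
          have := congrArg List.length h
          simp at this
          omega
      · rw [Finset.sum_eq_single (u.length - v.length)]
        · rw [show u.length + 1 - v.length = u.length - v.length + 1 by omega, coeff_deltaGen,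
            FreeMonoid.toList_ofList]
          refine if_congr ?_ rfl rfl
          rw [(List.map_injective_iff.2 Subtype.val_injective).eq_iff]
          generalize u.length - v.length + 1 = n
          constructor
          · intro h
            exact (List.append_cancel_left ((List.take_append_drop n (b :: u)).trans h)).symm
          · rintro rfl
            rw [List.take_append_drop]
        · intro j hjr hj
          refine if_neg fun h => ?_
          have := congrArg List.length h
          rw [Finset.mem_range] at hjr
          simp at this
          omega
        · intro h
          simp at h

theorem apply_eq_zero_of_isAugmentedAt (hA : A.IsAugmentedAt e) (u : List {b : B // b ≠ e}) :
    A.m (u.map Subtype.val) e = 0 := by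
  rcases u with _ | ⟨a, _ | ⟨b, _ | ⟨c, u⟩⟩⟩
  · simp [A.m_nil]
  · exact hA.2.1 _
  · refine (hA.2.2.1 _ _).trans ?_
    rw [Finsupp.single_eq_of_ne a.2.symm, zero_mul]
  · exact hA.2.2.2 _ (by simp)

/-- The coefficients of the square of the differential on a generator are the relations of the
`A_∞`-algebra for arguments in the augmentation ideal. -/
theorem differential_deltaGen (hA : IsLocallyFinite A e) (haug : A.IsAugmentedAt e)
    (a : {b : B // b ≠ e}) : differential hA (deltaGen hA a) = 0 := by
  classical
  refine MonoidAlgebra.ext (Finsupp.ext fun u => ?_)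
  have hassoc := DFunLike.congr_fun (A.assoc (u.toList.map Subtype.val)) a.1
  simp only [Finsupp.coe_finsetSum, Finset.sum_apply, Finsupp.smul_apply, Finsupp.sum_apply,
    Finsupp.coe_zero, Pi.zero_apply, smul_eq_mul, ← List.map_take, ← List.map_drop,
    List.length_map, List.map_map, Function.comp_def] at hassoc
  rw [MonoidAlgebra.coeff_zero, Finsupp.coe_zero, Pi.zero_apply, ← hassoc]
  conv_lhs => rw [eq_sum_word (deltaGen hA a)]
  simp only [map_sum, map_smul, differential_word, MonoidAlgebra.coeff_sum,
    MonoidAlgebra.coeff_smul, Finsupp.coe_finsetSum, Finset.sum_apply, Finsupp.smul_apply,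
    smul_eq_mul]
  have hcoeff : ∀ v : FreeMonoid {b : B // b ≠ e}, (deltaList hA v.toList).coeff u = _ :=
    fun v => coeff_deltaList hA v.toList u.toList
  simp only [hcoeff, Finset.mul_sum]
  rw [Finset.sum_comm]
  refine Finset.sum_congr rfl fun i _ => ?_
  rw [Finset.sum_comm]
  refine Finset.sum_congr rfl fun j _ => ?_
  rw [Finsupp.sum, Finset.mul_sum]
  simp only [Finsupp.sum, Finset.mul_sum]
  rw [Finset.sum_comm]
  refine Finset.sum_congr rfl fun c hc => ?_
  -- the inner operation has no component along the unit, because of the augmentation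
  have hce : c ≠ e := by
    rintro rfl
    exact Finsupp.mem_support_iff.1 hc (apply_eq_zero_of_isAugmentedAt haug _)
  set w : FreeMonoid {b : B // b ≠ e} := FreeMonoid.ofList
    (u.toList.take i ++ ⟨c, hce⟩ :: u.toList.drop (i + j + 1)) with hw
  have hiff : ∀ v : FreeMonoid {b : B // b ≠ e}, v.toList.map Subtype.val =
      (u.toList.take i).map Subtype.val ++ c :: (u.toList.drop (i + j + 1)).map Subtype.val ↔
        v = w := by
    intro v
    rw [show (u.toList.take i).map Subtype.val ++ c :: (u.toList.drop (i + j + 1)).map Subtype.val =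
      w.toList.map Subtype.val by simp [hw],
      (List.map_injective_iff.2 Subtype.val_injective).eq_iff, FreeMonoid.toList.injective.eq_iff]
  simp only [hiff]
  rw [Finset.sum_eq_single w]
  · rw [if_pos rfl, coeff_deltaGen, (hiff w).2 rfl]
    ring
  · intro v _ hv
    rw [if_neg hv, mul_zero, mul_zero]
  · intro h
    rw [Finsupp.notMem_support_iff.1 h, zero_mul]

/-- The relations of an `A_∞`-algebra say that the cobar differential squares to zero. -/
theorem differential_differential (hA : IsLocallyFinite A e) (haug : A.IsAugmentedAt e) :
    differential hA ∘ₗ differential hA = 0 := by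
  refine linearMap_ext fun u => ?_
  rw [LinearMap.comp_apply, LinearMap.zero_apply, ← FreeMonoid.ofList_toList u]
  generalize FreeMonoid.toList u = l
  induction l with
  | nil => rw [differential_word, FreeMonoid.toList_ofList, deltaList, map_zero]
  | cons a l ih =>
    rw [FreeMonoid.ofList_cons, word_mul, differential_of_mul, map_add, map_smul,
      differential_of_mul, ih, mul_zero, smul_zero, add_zero,
      differential_mul_word hA (d := 2 - deg a.1), differential_deltaGen hA haug, zero_mul,
      zero_add, ← add_smul]
    · rw [show 2 - deg a.1 = 1 + (1 - deg a.1) by ring, sgn_add, sgn_one, neg_one_mul,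
        neg_add_cancel, zero_smul]
    · intro v hv
      rw [degree_of_coeff_deltaGen hA a v hv, sub_self]
      exact Even.zero

theorem isDifferential_differential (hA : IsLocallyFinite A e) (haug : A.IsAugmentedAt e) :
    IsDifferential A (differential hA) where
  gen a u := by
    rw [differential_word, FreeMonoid.toList_of, deltaList_singleton, coeff_deltaGen]
  leibniz := differential_word_mul hA
  square := differential_differential hA haug

end Cobar

/-! ### The basis of the algebra of the left half-plane -/

section LeftBasis

variable {S : Spectrum.{u}} {z : ℝ → ℤ → ℂ} (D : InfraredData S)

/-- The first vacuum of the path into which solitons ending at `0` are placed. -/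
def srcSum (gs : List (RightGen S)) : ℤ := ((gs.map Subtype.val).map S.src).sum

theorem srcSum_append (gs gs' : List (RightGen S)) :
    srcSum (gs ++ gs') = srcSum gs + srcSum gs' := by
  simp only [srcSum, List.map_append, List.sum_append]

theorem srcSum_cons (a : RightGen S) (gs : List (RightGen S)) :
    srcSum (a :: gs) = S.src a.1 + srcSum gs := by
  simp only [srcSum, List.map_cons, List.sum_cons]

theorem one_le_src (a : RightGen S) : 1 ≤ S.src a.1 := by
  have h : S.tgt a.1 < S.src a.1 := a.2.1
  rw [a.2.2] at h
  exact h

theorem finite_setOf_srcSum_eq (D : InfraredData S) (k : ℤ) :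
    {gs : List (RightGen S) | srcSum gs = k}.Finite := by
  have hT : {a : RightGen S | S.src a.1 ≤ k}.Finite := by
    refine (Set.Finite.biUnion (Set.finite_Icc 1 k) fun l _ => Set.Finite.of_finite_image
      (s := {a : RightGen S | S.src a.1 = l}) ((D.finite l 0).subset ?_)
        Subtype.val_injective.injOn).subset fun a ha => ?_
    · rintro _ ⟨a, ha, rfl⟩
      exact ⟨ha, a.2.2⟩
    · exact Set.mem_biUnion (x := S.src a.1) ⟨one_le_src a, ha⟩ rfl
  have := hT.to_subtype
  refine ((List.finite_length_le {a : RightGen S | S.src a.1 ≤ k} k.toNat).image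
    (List.map Subtype.val)).subset fun gs hgs => ?_
  have hbound : ∀ gs : List (RightGen S), (gs.length : ℤ) ≤ srcSum gs ∧
      ∀ a ∈ gs, S.src a.1 ≤ srcSum gs := by
    intro gs
    induction gs with
    | nil => simp [srcSum]
    | cons a gs ih =>
      have h1 := one_le_src a
      rw [srcSum_cons, List.length_cons]
      refine ⟨by push_cast; linarith [ih.1], fun b hb => ?_⟩
      rcases List.mem_cons.1 hb with rfl | hb
      · linarith [ih.1, Int.natCast_nonneg gs.length]
      · linarith [ih.2 b hb]
  have hk : srcSum gs = k := hgs
  have h := hbound gs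
  rw [hk] at h
  refine ⟨gs.attach.map fun a => ⟨a.1, h.2 a.1 a.2⟩, ?_, ?_⟩
  · change (List.map _ gs.attach).length ≤ k.toNat
    rw [List.length_map, List.length_attach]
    have := h.1
    omega
  · rw [List.map_map]
    exact gs.attach_map_subtype_val

theorem place_injective {L L' : List S.Gen} (h : D.place L = D.place L') : L = L' := by
  induction L generalizing L' with
  | nil =>
    cases L' with
    | nil => rfl
    | cons s L' => simp [InfraredData.place] at h
  | cons s L ih =>
    cases L' with
    | nil => simp [InfraredData.place] at h
    | cons s' L' =>
      simp only [InfraredData.place, List.cons.injEq] at h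
      obtain rfl := ih h.2
      rw [(D.shift ^ (L.map S.src).sum).injective h.1]

theorem exists_place_eq {k : ℤ} {P : List S.Gen} (hP : IsPath k 0 P) (hd : ∀ s ∈ P, S.IsDown s) :
    ∃ gs : List (RightGen S), D.place (gs.map Subtype.val) = P := by
  induction P generalizing k with
  | nil => exact ⟨[], rfl⟩
  | cons s P ih =>
    obtain ⟨gs, hgs⟩ := ih hP.2 fun a ha => hd a (by simp [ha])
    have h1 := D.isPath_place (L := gs.map Subtype.val) (by
      intro s hs
      obtain ⟨x, -, rfl⟩ := List.mem_map.1 hs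
      exact x.2.2)
    rw [hgs] at h1
    have h2 := hP.2.start_unique h1
    refine ⟨⟨(D.shift ^ (-S.tgt s)) s, D.isDown_zpow.2 (hd s (by simp)), ?_⟩ :: gs, ?_⟩
    · rw [D.tgt_zpow, add_neg_cancel]
    · rw [List.map_cons, InfraredData.place, hgs, D.zpow_apply_zpow, h2, add_neg_cancel, zpow_zero,
        Equiv.Perm.one_apply]

theorem tgt_of_mem_map_val {gs : List (RightGen S)} : ∀ s ∈ gs.map Subtype.val, S.tgt s = 0 := by
  intro s hs
  obtain ⟨x, -, rfl⟩ := List.mem_map.1 hs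
  exact x.2.2

theorem isDown_of_mem_map_val {gs : List (RightGen S)} :
    ∀ s ∈ gs.map Subtype.val, S.IsDown s := by
  intro s hs
  obtain ⟨x, -, rfl⟩ := List.mem_map.1 hs
  exact x.2.1

/-- The solitons are placed so that they form a path ending at `0`, which is read backwards, with
each soliton replaced by its dual. -/
def dualList (gs : List (RightGen S)) : List S.Gen :=
  ((D.place (gs.map Subtype.val)).map S.bar).reverse

theorem isPath_dualList (gs : List (RightGen S)) : IsPath 0 (srcSum gs) (dualList D gs) :=
  (D.isPath_place tgt_of_mem_map_val).reverse

theorem isUp_dualList (gs : List (RightGen S)) : ∀ s ∈ dualList D gs, S.IsUp s := by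
  intro s hs
  rw [dualList, List.mem_reverse, List.mem_map] at hs
  obtain ⟨y, hy, rfl⟩ := hs
  rw [Spectrum.isUp_bar]
  exact D.isDown_place isDown_of_mem_map_val y hy

@[simp]
theorem length_dualList (gs : List (RightGen S)) : (dualList D gs).length = gs.length := by
  simp only [dualList, List.length_reverse, List.length_map, D.length_place]

theorem bar_injective : Function.Injective S.bar := Function.LeftInverse.injective S.bar_bar

theorem dualList_injective : Function.Injective (dualList D) := fun gs gs' h => by
  have h1 := List.map_injective_iff.2 bar_injective (List.reverse_injective h)
  exact List.map_injective_iff.2 Subtype.val_injective (place_injective D h1)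

theorem map_zpow_dualList (k : ℤ) (gs : List (RightGen S)) :
    (dualList D gs).map (D.shift ^ k) =
      (((D.place (gs.map Subtype.val)).map (D.shift ^ k)).map S.bar).reverse := by
  rw [dualList, List.map_reverse, List.map_map, List.map_map]
  congr 2
  funext s
  exact (D.bar_zpow k s).symm

theorem dualList_append (gs gs' : List (RightGen S)) :
    dualList D (gs ++ gs') =
      dualList D gs' ++ (dualList D gs).map (D.shift ^ srcSum gs') := by
  rw [map_zpow_dualList, dualList, List.map_append, D.place_append, List.map_append,
    List.reverse_append]
  rfl

theorem dualList_singleton (a : RightGen S) : dualList D [a] = [S.bar a.1] := by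
  simp [dualList, InfraredData.place]

theorem sum_deg_dualList (gs : List (RightGen S)) :
    ((dualList D gs).map D.deg).sum = (gs.map fun a => 1 - D.deg a.1).sum := by
  rw [dualList, sum_map_deg_reverse_bar, D.map_deg_place, D.length_place]
  induction gs with
  | nil => simp
  | cons a gs ih =>
    simp only [List.map_cons, List.sum_cons, List.length_cons] at ih ⊢
    push_cast
    linarith

/-- The word of a basis vector of `A^L`. -/
def LeftBasis.toWord (b : LeftBasis S z) : Word S := b.1

theorem LeftBasis.toWord_injective :
    Function.Injective (LeftBasis.toWord (S := S) (z := z)) := Subtype.val_injective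

theorem LeftBasis.isStableFan (b : LeftBasis S z) : b.toWord.IsStableFan z (-1) := b.2.1

theorem LeftBasis.start_toWord (b : LeftBasis S z) : b.toWord.start = 0 := b.2.2

/-- The basis vector of `A^L` dual to a word in the solitons spanning the augmentation ideal
of `A^R`. -/
def LeftBasis.of (hz : IsAsymptoticallyParabolic z) (gs : List (RightGen S)) : LeftBasis S z :=
  ⟨⟨0, dualList D gs⟩, (isStableFan_left_iff hz).2
    ⟨by rw [(isPath_dualList D gs).final_eq]; exact isPath_dualList D gs, isUp_dualList D gs⟩, rfl⟩

theorem LeftBasis.letters_of (hz : IsAsymptoticallyParabolic z) (gs : List (RightGen S)) :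
    (LeftBasis.of D hz gs).toWord.letters = dualList D gs := rfl

theorem LeftBasis.final_of (hz : IsAsymptoticallyParabolic z) (gs : List (RightGen S)) :
    (LeftBasis.of D hz gs).toWord.final = srcSum gs := (isPath_dualList D gs).final_eq

theorem LeftBasis.of_injective (hz : IsAsymptoticallyParabolic z) :
    Function.Injective (LeftBasis.of (z := z) D hz) := fun gs gs' h => by
  have := congrArg (fun w : LeftBasis S z => w.toWord.letters) h
  exact dualList_injective D this

theorem LeftBasis.exists_of (hz : IsAsymptoticallyParabolic z) (b : LeftBasis S z) :
    ∃ gs, LeftBasis.of D hz gs = b := by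
  obtain ⟨hp, hup⟩ := (isStableFan_left_iff hz).1 b.isStableFan
  rw [b.start_toWord] at hp
  obtain ⟨gs, hgs⟩ := exists_place_eq D hp.reverse (by
    intro s hs
    rw [List.mem_reverse, List.mem_map] at hs
    obtain ⟨y, hy, rfl⟩ := hs
    exact Spectrum.isDown_bar.2 (hup y hy))
  refine ⟨gs, LeftBasis.toWord_injective (Word.ext b.start_toWord.symm ?_)⟩
  rw [LeftBasis.letters_of, dualList, hgs, List.map_reverse, List.reverse_reverse, List.map_map]
  exact (List.map_congr_left fun s _ => S.bar_bar s).trans (List.map_id _)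

theorem degWord_leftOf (hz : IsAsymptoticallyParabolic z) (gs : List (RightGen S)) :
    D.degWord (LeftBasis.of D hz gs).toWord = (gs.map fun a => 1 - D.deg a.1).sum :=
  sum_deg_dualList D gs

/-- The words in the solitons spanning the augmentation ideal of `A^R` are a basis of `A^L`. -/
def leftEquiv (hz : IsAsymptoticallyParabolic z) : List (RightGen S) ≃ LeftBasis S z :=
  Equiv.ofBijective (LeftBasis.of D hz) ⟨LeftBasis.of_injective D hz, LeftBasis.exists_of D hz⟩

theorem leftEquiv_apply (hz : IsAsymptoticallyParabolic z) (gs : List (RightGen S)) :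
    leftEquiv D hz gs = LeftBasis.of D hz gs := rfl

/-- The basis vector of the augmentation ideal of `A^R` given by a soliton. -/
def nonunit (hz : IsAsymptoticallyParabolic z) (a : RightGen S) :
    {b : RightBasis S z // b ≠ RightBasis.one S z} :=
  ⟨RightBasis.of hz a, RightBasis.of_ne_one hz a⟩

/-- The solitons ending at `0` whose edges point to the right are a basis of the augmentation
ideal of `A^R`. -/
def nonunitEquiv (hz : IsAsymptoticallyParabolic z) :
    RightGen S ≃ {b : RightBasis S z // b ≠ RightBasis.one S z} :=
  Equiv.ofBijective (nonunit hz) ⟨fun _ _ h => RightBasis.of_injective hz (Subtype.ext_iff.1 h),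
    fun b => ((RightBasis.eq_one_or_of hz b.1).resolve_left b.2).imp fun _ ha =>
      Subtype.ext ha.symm⟩

/-- The basis of the cobar complex of `A^R`. -/
def wordEquiv (hz : IsAsymptoticallyParabolic z) : List (RightGen S) ≃
    FreeMonoid {b : RightBasis S z // b ≠ RightBasis.one S z} :=
  (Equiv.listEquivOfEquiv (nonunitEquiv hz)).trans FreeMonoid.ofList

theorem wordEquiv_apply (hz : IsAsymptoticallyParabolic z) (gs : List (RightGen S)) :
    wordEquiv hz gs = FreeMonoid.ofList (gs.map (nonunit hz)) := rfl

theorem isLocallyFinite_rightAlgebra (hz : IsAsymptoticallyParabolic z)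
    (hβ : D.IsInteriorAmplitude z) :
    Cobar.IsLocallyFinite (rightAlgebra D hz hβ) (RightBasis.one S z) := by
  intro o
  refine ((finite_setOf_srcSum_eq D o.toWord.start).image (wordEquiv hz)).subset fun u hu => ?_
  obtain ⟨gs, rfl⟩ := (wordEquiv hz).surjective u
  refine ⟨gs, ?_, rfl⟩
  have hu' : rightOp D hz (((gs.map (nonunit hz))).map Subtype.val) o ≠ 0 := hu
  rw [List.map_map, show (Subtype.val ∘ nonunit hz) = RightBasis.of hz from rfl,
    rightOp_apply] at hu'
  obtain rfl | ⟨a, rfl⟩ := RightBasis.eq_one_or_of hz o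
  · exact absurd (rightCoeff_map_of_one D hz gs) hu'
  · rw [rightCoeff_map_of] at hu'
    exact (ite_ne_right_iff.1 hu').1

end LeftBasis

open Classical in
/-- The matrix elements of the cobar differential: a word occurs in `δ v` for each way to replace
one of the letters of `v` so that it is obtained. -/
theorem Cobar.coeff_deltaList_eq_sum_fin {B : Type*} {e : B} {deg : B → ℤ} {A : AInfinity B deg}
    (hA : IsLocallyFinite A e) (v u : List {b : B // b ≠ e}) :
    (deltaList hA v).coeff (FreeMonoid.ofList u) =
      ∑ p : Fin v.length, if u = v.take p ++ (u.drop p).take (u.length + 1 - v.length) ++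
          v.drop (p + 1) then
        sgn (((v.take p).map fun a => deg a.1 + 1).sum) *
          A.m (((u.drop p).take (u.length + 1 - v.length)).map Subtype.val) (v[p] : {b // b ≠ e}).1
        else 0 := by
  induction v generalizing u with
  | nil => simp [deltaList]
  | cons a v ih =>
    rw [deltaList, MonoidAlgebra.coeff_add, Finsupp.add_apply, MonoidAlgebra.coeff_smul_apply,
      coeff_mul_word]
    change _ = ∑ p : Fin (v.length + 1), _
    rw [Fin.sum_univ_succ]
    congr 1
    · simp [coeff_deltaGen]
    · rcases u with _ | ⟨b, u⟩
      · rw [coeff_of_mul_nil, smul_zero]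
        simp
      · rw [coeff_of_mul_cons, ih]
        by_cases hab : b = a
        · subst hab
          rw [if_pos rfl, smul_eq_mul, Finset.mul_sum]
          refine Finset.sum_congr rfl fun p _ => ?_
          rw [mul_ite, mul_zero, ← mul_assoc, ← sgn_add]
          simp only [Fin.val_succ, List.take_succ_cons, List.drop_succ_cons, List.length_cons,
            Nat.add_sub_add_right, List.cons_append, List.cons.injEq, true_and, List.map_cons,
            List.sum_cons]
          refine if_congr Iff.rfl ?_ rfl
          congr 1
          exact sgn_congr ⟨- deg b.1, by ring⟩
        · rw [if_neg hab, smul_zero]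
          simp [hab]

/-! ### The algebra of the left half-plane -/

section LeftOp

variable {S : Spectrum.{u}} {z : ℝ → ℤ → ℂ} (D : InfraredData S)

theorem label_last_of_coeff_ne_zero {D : InfraredData S} {ν : ℂ} {ws : List (Word S)} {o : Word S}
    (h : D.halfPlaneCoeff z ν ws o ≠ 0) : ∀ a ∈ ws.getLast?, a.final = o.final := by
  obtain ⟨w, hw⟩ := exists_halfPlaneTaut_of_coeff_ne_zero h
  obtain ⟨t, ⟨ξ, hξ⟩, -⟩ := (eventually_of_mem_halfPlaneTaut hw).exists
  exact hξ.label_last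

/-- The matrix elements of the operations on `A^L`. -/
def leftCoeff (z : ℝ → ℤ → ℂ) (ws : List (LeftBasis S z)) (o : LeftBasis S z) : ℂ :=
  if ws = [] then 0 else D.halfPlaneCoeff z (-1) (D.placeLeft (ws.map LeftBasis.toWord)) o.toWord

theorem length_placeLeft (ws : List (Word S)) : (D.placeLeft ws).length = ws.length := by
  induction ws with
  | nil => rfl
  | cons w ws ih => simp [InfraredData.placeLeft, ih]

theorem placeLeft_ne_nil {ws : List (Word S)} (h : ws ≠ []) : D.placeLeft ws ≠ [] := by
  rw [← List.length_pos_iff, length_placeLeft, List.length_pos_iff]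
  exact h

theorem placeLeft_singleton (w : Word S) : D.placeLeft [w] = [w] := rfl

theorem placeLeft_pair (w w' : Word S) : D.placeLeft [w, w'] = [w, D.shiftWord w.final w'] := rfl

theorem leftCoeff_eq_zero (hz : IsAsymptoticallyParabolic z) {ws : List (LeftBasis S z)}
    (hws : 3 ≤ ws.length) (o : LeftBasis S z) : leftCoeff D z ws o = 0 := by
  by_contra h
  have hne : ws ≠ [] := List.ne_nil_of_length_pos (by omega)
  rw [leftCoeff, if_neg hne] at h
  have hlen := (length_placeLeft D (ws.map LeftBasis.toWord)).trans (List.length_map _)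
  rcases shape_of_halfPlaneCoeff_left_ne_zero hz
    (placeLeft_ne_nil D (List.map_eq_nil_iff.not.2 hne)) h with ⟨w₁, w₂, h1, -⟩ | ⟨w₁, h1⟩
  · rw [h1] at hlen
    simp at hlen
    omega
  · rw [h1] at hlen
    simp at hlen
    omega

/-- The product of two words is their composition. -/
theorem leftCoeff_pair (hz : IsAsymptoticallyParabolic z) (v u : List (RightGen S))
    (o : LeftBasis S z) : leftCoeff D z [LeftBasis.of D hz v, LeftBasis.of D hz u] o =
      (sgn (D.degWord (LeftBasis.of D hz v).toWord) •
        Finsupp.single (LeftBasis.of D hz (u ++ v)) (1 : ℂ)) o := by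
  have hw : D.shiftWord (srcSum v) (LeftBasis.of D hz u).toWord =
      ⟨srcSum v, (dualList D u).map (D.shift ^ srcSum v)⟩ := Word.ext (zero_add _) rfl
  have hpath := isPath_dualList D (u ++ v)
  rw [dualList_append] at hpath
  obtain ⟨m, hp₁, hp₂⟩ := isPath_append.1 hpath
  obtain rfl := (isPath_dualList D v).end_unique hp₁
  rw [leftCoeff, if_neg (List.cons_ne_nil _ _), List.map_cons, List.map_cons, List.map_nil,
    placeLeft_pair, LeftBasis.final_of, hw, Finsupp.smul_single, smul_eq_mul, mul_one]
  by_cases ho : o = LeftBasis.of D hz (u ++ v)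
  · subst ho
    rw [Finsupp.single_eq_same]
    refine halfPlaneCoeff_pair_left hz (LeftBasis.isStableFan _) ?_ (LeftBasis.isStableFan _)
      ((LeftBasis.letters_of D hz _).trans (dualList_append D u v)) (LeftBasis.final_of D hz v)
        rfl ?_
    · rw [isStableFan_left_iff hz, hp₂.final_eq]
      exact ⟨hp₂, fun s hs => isUp_dualList D (u ++ v) s (by
        rw [dualList_append]; exact List.mem_append_right _ hs)⟩
    · rw [LeftBasis.final_of, hp₂.final_eq]
  · rw [Finsupp.single_eq_of_ne ho]
    by_contra h
    rcases shape_of_halfPlaneCoeff_left_ne_zero hz (by simp) h with ⟨w₁, w₂, h1, h2⟩ | ⟨w₁, h1⟩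
    · simp only [List.cons.injEq, and_true] at h1
      rw [← h1.1, ← h1.2] at h2
      exact ho (LeftBasis.toWord_injective
        (Word.ext o.start_toWord (h2.trans (dualList_append D u v).symm)))
    · simp at h1

theorem leftCoeff_singleton_support_subset (hz : IsAsymptoticallyParabolic z)
    (v : List (RightGen S)) : Function.support (leftCoeff D z [LeftBasis.of D hz v]) ⊆
      LeftBasis.of D hz '' {u | srcSum u = srcSum v} := by
  intro o ho
  obtain ⟨u, rfl⟩ := LeftBasis.exists_of D hz o
  rw [Function.mem_support, leftCoeff, if_neg (List.cons_ne_nil _ _), List.map_cons, List.map_nil,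
    placeLeft_singleton] at ho
  have h : (LeftBasis.of D hz v).toWord.final = (LeftBasis.of D hz u).toWord.final :=
    label_last_of_coeff_ne_zero ho _ rfl
  rw [LeftBasis.final_of, LeftBasis.final_of] at h
  exact ⟨u, h.symm, rfl⟩

theorem leftCoeff_support_finite (hz : IsAsymptoticallyParabolic z) (ws : List (LeftBasis S z)) :
    (Function.support (leftCoeff D z ws)).Finite := by
  rcases ws with _ | ⟨b, _ | ⟨c, _ | ⟨d, ws⟩⟩⟩
  · simp [leftCoeff, Function.support]
  · obtain ⟨v, rfl⟩ := LeftBasis.exists_of D hz b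
    exact ((finite_setOf_srcSum_eq D _).image _).subset (leftCoeff_singleton_support_subset D hz v)
  · obtain ⟨v, rfl⟩ := LeftBasis.exists_of D hz b
    obtain ⟨u, rfl⟩ := LeftBasis.exists_of D hz c
    rw [show leftCoeff D z [LeftBasis.of D hz v, LeftBasis.of D hz u] = _ from
      funext (leftCoeff_pair D hz v u)]
    exact Finsupp.hasFiniteSupport _
  · convert Set.finite_empty
    rw [Function.support_eq_empty_iff]
    exact funext (leftCoeff_eq_zero D hz (by simp))

/-- The operations of `A^L` on basis vectors. -/
def leftOp (hz : IsAsymptoticallyParabolic z) (ws : List (LeftBasis S z)) : LeftBasis S z →₀ ℂ :=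
  Finsupp.ofSupportFinite (leftCoeff D z ws) (leftCoeff_support_finite D hz ws)

theorem leftOp_apply (hz : IsAsymptoticallyParabolic z) (ws : List (LeftBasis S z))
    (o : LeftBasis S z) : leftOp D hz ws o = leftCoeff D z ws o := rfl

theorem leftOp_nil (hz : IsAsymptoticallyParabolic z) : leftOp D hz [] = 0 := by
  ext o
  simp [leftOp_apply, leftCoeff]

theorem leftOp_of_three_le (hz : IsAsymptoticallyParabolic z) {ws : List (LeftBasis S z)}
    (hws : 3 ≤ ws.length) : leftOp D hz ws = 0 :=
  Finsupp.ext fun o => leftCoeff_eq_zero D hz hws o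

theorem leftOp_pair (hz : IsAsymptoticallyParabolic z) (v u : List (RightGen S)) :
    leftOp D hz [LeftBasis.of D hz v, LeftBasis.of D hz u] =
      sgn (D.degWord (LeftBasis.of D hz v).toWord) •
        Finsupp.single (LeftBasis.of D hz (u ++ v)) (1 : ℂ) :=
  Finsupp.ext fun o => leftCoeff_pair D hz v u o

end LeftOp

/-! ### The differential of the algebra of the left half-plane -/

/-- The sign `(-1)^{d(d+1)/2}`. -/
def dualSign (d : ℤ) : ℂ := sgn (d * (d + 1) / 2)

theorem dualSign_mul_self (d : ℤ) : dualSign d * dualSign d = 1 := sgn_mul_self _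

theorem dualSign_add (a b : ℤ) : dualSign (a + b) = dualSign a * dualSign b * sgn (a * b) := by
  obtain ⟨x, hx⟩ := Int.even_mul_succ_self a
  obtain ⟨y, hy⟩ := Int.even_mul_succ_self b
  rw [dualSign, dualSign, dualSign, ← sgn_add, ← sgn_add]
  congr 1
  have h : (a + b) * (a + b + 1) = 2 * (x + y + a * b) := by linear_combination hx + hy
  rw [h, hx, hy]
  omega

theorem dualSign_add_one (a : ℤ) : dualSign (a + 1) = dualSign a * sgn (a + 1) := by
  rw [dualSign_add, mul_one, show dualSign 1 = -1 by simp [dualSign, sgn], sgn_add, sgn_one]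
  ring

section LeftDifferential

variable {S : Spectrum.{u}} {z : ℝ → ℤ → ℂ} (D : InfraredData S)

theorem dualList_append_cons (X Y : List (RightGen S)) (c : RightGen S) :
    dualList D (X ++ c :: Y) = dualList D Y ++ S.bar ((D.shift ^ srcSum Y) c.1) ::
      (dualList D X).map (D.shift ^ (S.src c.1 + srcSum Y)) := by
  have h : ⇑(D.shift ^ srcSum Y) ∘ ⇑(D.shift ^ S.src c.1) =
      ⇑(D.shift ^ (S.src c.1 + srcSum Y)) := by
    rw [← Equiv.Perm.coe_mul, ← zpow_add, add_comm]
  rw [show X ++ c :: Y = X ++ [c] ++ Y by simp, dualList_append, dualList_append,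
    dualList_singleton, srcSum_cons, show srcSum ([] : List (RightGen S)) = 0 from rfl, add_zero,
    List.map_append, List.map_map, h, List.map_cons, List.map_nil, ← D.bar_zpow]
  rfl

theorem dualList_append_append (X M Y : List (RightGen S)) :
    dualList D (X ++ M ++ Y) = dualList D Y ++ (dualList D M).map (D.shift ^ srcSum Y) ++
      (dualList D X).map (D.shift ^ (srcSum M + srcSum Y)) := by
  have h : ⇑(D.shift ^ srcSum Y) ∘ ⇑(D.shift ^ srcSum M) =
      ⇑(D.shift ^ (srcSum M + srcSum Y)) := by
    rw [← Equiv.Perm.coe_mul, ← zpow_add, add_comm]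
  rw [dualList_append, dualList_append, List.map_append, List.map_map, h, List.append_assoc]

theorem IsPath.map_zpow {k l : ℤ} {L : List S.Gen} (h : IsPath k l L) (m : ℤ) :
    IsPath (k + m) (l + m) (L.map (D.shift ^ m)) := by
  induction L generalizing k with
  | nil => exact congrArg (· + m) h
  | cons s L ih =>
    refine ⟨by rw [D.src_zpow, h.1], ?_⟩
    rw [D.tgt_zpow]
    exact ih h.2

/-- The part of the dual word into which a letter is expanded. -/
theorem take_drop_dualList (U₁ M U₃ : List (RightGen S)) :
    ((dualList D (U₁ ++ M ++ U₃)).drop U₃.length).take M.length =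
      (dualList D M).map (D.shift ^ srcSum U₃) := by
  rw [dualList_append_append, List.append_assoc, List.drop_left' (length_dualList D U₃),
    List.take_left' (by rw [List.length_map, length_dualList])]

/-- Words which differ by expanding a letter `c` into `M` have duals which differ by expanding the
dual letter, at the mirror position. -/
theorem isGraftAt_dual_iff (hz : IsAsymptoticallyParabolic z) {X Y U₁ M U₃ : List (RightGen S)}
    {c : RightGen S} (h₁ : U₁.length = X.length) (h₃ : U₃.length = Y.length)
    (hsum : srcSum (U₁ ++ M ++ U₃) = srcSum (X ++ c :: Y))
    (i : Fin (LeftBasis.of (z := z) D hz (X ++ c :: Y)).toWord.letters.length)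
    (hi : i.1 = Y.length) :
    IsGraftAt (LeftBasis.of (z := z) D hz (X ++ c :: Y)).toWord
      (LeftBasis.of (z := z) D hz (U₁ ++ M ++ U₃)).toWord i ↔ U₁ = X ∧ U₃ = Y := by
  obtain ⟨i, hlt⟩ := i
  obtain rfl : i = Y.length := hi
  have hK : (dualList D (U₁ ++ M ++ U₃)).length + 1 - (dualList D (X ++ c :: Y)).length =
      M.length := by
    simp only [length_dualList, List.length_append, List.length_cons]
    omega
  have hget : (dualList D (X ++ c :: Y))[Y.length]'hlt = S.bar ((D.shift ^ srcSum Y) c.1) := by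
    simp only [dualList_append_cons]
    rw [List.getElem_append_right (by rw [length_dualList])]
    simp
  have htake : (dualList D (X ++ c :: Y)).take Y.length = dualList D Y := by
    rw [dualList_append_cons, List.take_left' (length_dualList D Y)]
  have hdrop : (dualList D (X ++ c :: Y)).drop (Y.length + 1) =
      (dualList D X).map (D.shift ^ (S.src c.1 + srcSum Y)) := by
    rw [dualList_append_cons, ← List.drop_drop, List.drop_left' (length_dualList D Y)]
    rfl
  have hmid := take_drop_dualList D U₁ M U₃
  rw [h₃] at hmid
  have hpath := (isPath_dualList D M).map_zpow D (srcSum U₃)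
  rw [zero_add] at hpath
  simp only [srcSum_append, srcSum_cons] at hsum
  change (dualList D (U₁ ++ M ++ U₃) = (dualList D (X ++ c :: Y)).take Y.length ++
    ((dualList D (U₁ ++ M ++ U₃)).drop Y.length).take
      ((dualList D (U₁ ++ M ++ U₃)).length + 1 - (dualList D (X ++ c :: Y)).length) ++
    (dualList D (X ++ c :: Y)).drop (Y.length + 1)) ∧
    IsPath (S.src ((dualList D (X ++ c :: Y))[Y.length]'hlt))
      (S.tgt ((dualList D (X ++ c :: Y))[Y.length]'hlt))
      (((dualList D (U₁ ++ M ++ U₃)).drop Y.length).take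
        ((dualList D (U₁ ++ M ++ U₃)).length + 1 - (dualList D (X ++ c :: Y)).length)) ↔ _
  rw [hget, htake, hdrop, hK, hmid, S.src_bar, S.tgt_bar, D.src_zpow, D.tgt_zpow, c.2.2, zero_add]
  rw [dualList_append_append]
  constructor
  · rintro ⟨h1, h2⟩
    rw [List.append_assoc, List.append_assoc] at h1
    obtain ⟨h4, h5⟩ := List.append_inj h1 (by rw [length_dualList, length_dualList, h₃])
    obtain rfl := dualList_injective D h4
    have h6 := h2.end_unique hpath
    rw [← h6] at h5
    exact ⟨dualList_injective D (List.map_injective_iff.2 (D.shift ^ _).injective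
      (List.append_cancel_left h5)), rfl⟩
  · rintro ⟨rfl, rfl⟩
    have h6 : srcSum M = S.src c.1 := by linarith
    rw [h6] at hpath ⊢
    exact ⟨rfl, hpath⟩

theorem map_nonunit_map_val (hz : IsAsymptoticallyParabolic z) (gs : List (RightGen S)) :
    (gs.map (nonunit hz)).map Subtype.val = gs.map (RightBasis.of hz) := by
  rw [List.map_map]
  rfl

theorem sum_degWord_nonunit (hz : IsAsymptoticallyParabolic z) (X : List (RightGen S)) :
    ((X.map (nonunit hz)).map fun a => D.degWord a.1.1 + 1).sum =
      (X.map fun a => 1 - D.deg a.1).sum + 2 * (X.map fun a => D.deg a.1).sum := by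
  induction X with
  | nil => simp
  | cons a X ih =>
    have h : D.degWord (nonunit hz a).1.1 = D.deg a.1 := degWord_of D hz a
    simp only [List.map_cons, List.sum_cons, ih, h]
    ring

open Classical in
/-- The term of the differential of `A^L` in which the dual of the soliton `c` is expanded is the
term of the cobar differential in which `c` is expanded. -/
theorem graft_term_eq (hz : IsAsymptoticallyParabolic z) {X Y u : List (RightGen S)}
    {c : RightGen S} (hsum : srcSum u = srcSum (X ++ c :: Y))
    (i : Fin (LeftBasis.of (z := z) D hz (X ++ c :: Y)).toWord.letters.length)
    (hi : i.1 = Y.length) :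
    (if IsGraftAt (LeftBasis.of (z := z) D hz (X ++ c :: Y)).toWord
        (LeftBasis.of (z := z) D hz u).toWord i then
      sgn (((dualList D (X ++ c :: Y)).take i).map D.deg).sum *
        D.amp (S.bar ((dualList D (X ++ c :: Y))[i.1]'i.2) :: ((dualList D u).drop i).take
          ((dualList D u).length + 1 - (dualList D (X ++ c :: Y)).length)) else 0) =
    dualSign (u.map fun a => 1 - D.deg a.1).sum *
      dualSign ((X ++ c :: Y).map fun a => 1 - D.deg a.1).sum *
      (if u = X ++ (u.drop X.length).take (u.length + 1 - (X ++ c :: Y).length) ++ Y then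
        sgn (((X.map (nonunit hz)).map fun a => D.degWord a.1.1 + 1).sum) *
          rightCoeff D z (((u.drop X.length).take
            (u.length + 1 - (X ++ c :: Y).length)).map (RightBasis.of hz)) (RightBasis.of hz c)
      else 0) := by
  by_cases hlen : X.length + Y.length ≤ u.length
  · obtain ⟨U₁, M, U₃, rfl, h₁, h₃⟩ : ∃ U₁ M U₃, u = U₁ ++ M ++ U₃ ∧ U₁.length = X.length ∧
        U₃.length = Y.length := by
      refine ⟨u.take X.length, (u.drop X.length).take (u.length - (X.length + Y.length)),
        (u.drop X.length).drop (u.length - (X.length + Y.length)), ?_, ?_, ?_⟩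
      · rw [List.append_assoc, List.take_append_drop, List.take_append_drop]
      · rw [List.length_take]; omega
      · rw [List.length_drop, List.length_drop]; omega
    have hk : (U₁ ++ M ++ U₃).length + 1 - (X ++ c :: Y).length = M.length := by
      simp only [List.length_append, List.length_cons]
      omega
    have hM : ((U₁ ++ M ++ U₃).drop X.length).take M.length = M := by
      rw [List.append_assoc, List.drop_left' h₁, List.take_left' rfl]
    have hmid := take_drop_dualList D U₁ M U₃
    rw [h₃] at hmid
    have hget : (dualList D (X ++ c :: Y))[i.1]'i.2 = S.bar ((D.shift ^ srcSum Y) c.1) := by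
      simp only [dualList_append_cons, hi]
      rw [List.getElem_append_right (by rw [length_dualList])]
      simp
    have htake : (dualList D (X ++ c :: Y)).take Y.length = dualList D Y := by
      rw [dualList_append_cons, List.take_left' (length_dualList D Y)]
    have hiff : U₁ ++ M ++ U₃ = X ++ M ++ Y ↔ U₁ = X ∧ U₃ = Y := by
      refine ⟨fun h => ?_, fun h => by rw [h.1, h.2]⟩
      obtain ⟨h1, h2⟩ := List.append_inj' h h₃
      exact ⟨List.append_cancel_right h1, h2⟩
    have hgraft := isGraftAt_dual_iff D hz h₁ h₃ hsum i hi
    rw [hget, length_dualList, length_dualList, hk, hM, hi, hmid, htake]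
    by_cases h : U₁ = X ∧ U₃ = Y
    swap
    · rw [if_neg (mt hgraft.1 h), if_neg (mt hiff.1 h), mul_zero]
    rw [if_pos (hgraft.2 h), if_pos (hiff.2 h)]
    obtain ⟨rfl, rfl⟩ := h
    simp only [srcSum_append, srcSum_cons] at hsum
    have h6 : srcSum M = S.src c.1 := by linarith
    rw [rightCoeff_map_of,
      if_pos (show ((M.map Subtype.val).map S.src).sum = S.src c.1 from h6), S.bar_bar,
      ← List.map_cons, D.amp_map_zpow, sum_deg_dualList, sum_degWord_nonunit]
    change _ = _ * (_ * (_ * D.amp (c.1 :: dualList D M)))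
    rcases eq_or_ne (D.amp (c.1 :: dualList D M)) 0 with h | h
    · rw [h]
      ring
    -- the amplitude has degree two, so the degree of `M` exceeds that of `c` by one
    have hdeg := D.amp_deg _ h
    rw [List.map_cons, List.sum_cons, sum_deg_dualList] at hdeg
    simp only [List.map_append, List.map_cons, List.sum_append, List.sum_cons]
    set x := (U₁.map fun a => 1 - D.deg a.1).sum
    set y := (U₃.map fun a => 1 - D.deg a.1).sum
    set m := (M.map fun a => 1 - D.deg a.1).sum
    set E := (U₁.map fun a => D.deg a.1).sum
    rw [show x + m + y = x + (1 - D.deg c.1 + y) + 1 by linarith, dualSign_add_one]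
    -- the sign of moving past `Y` is exchanged for that of moving past `X`, because the order of
    -- the letters is reversed and the total degrees differ by one
    have hs : sgn y = sgn (x + (1 - D.deg c.1 + y) + 1) * sgn (x + 2 * E) * sgn (D.deg c.1) := by
      rw [← sgn_add, ← sgn_add]
      exact sgn_congr ⟨-(x + E + 1), by ring⟩
    rw [hs]
    linear_combination (-(sgn (x + (1 - D.deg c.1 + y) + 1) * sgn (x + 2 * E) * sgn (D.deg c.1) *
      D.amp (c.1 :: dualList D M))) * dualSign_mul_self (x + (1 - D.deg c.1 + y))
  · rw [if_neg, if_neg, mul_zero]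
    · intro h
      have := congrArg List.length h
      simp only [List.length_append] at this
      omega
    · rintro ⟨h, -⟩
      have := congrArg List.length h
      simp only [LeftBasis.letters_of, List.length_append, List.length_take, length_dualList,
        List.length_drop, List.length_cons] at this
      omega

/-- The differential of `A^L` is the cobar differential of `A^R`. -/
theorem leftCoeff_singleton (hz : IsAsymptoticallyParabolic z) (hβ : D.IsInteriorAmplitude z)
    (v u : List (RightGen S)) :
    leftCoeff D z [LeftBasis.of D hz v] (LeftBasis.of D hz u) =
      dualSign (u.map fun a => 1 - D.deg a.1).sum * dualSign (v.map fun a => 1 - D.deg a.1).sum *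
        (Cobar.deltaList (isLocallyFinite_rightAlgebra D hz hβ) (v.map (nonunit hz))).coeff
          (wordEquiv hz u) := by
  classical
  have hinj : Function.Injective (List.map (nonunit (S := S) hz)) :=
    List.map_injective_iff.2 (nonunitEquiv hz).injective
  rw [wordEquiv_apply, Cobar.coeff_deltaList_eq_sum_fin, Finset.mul_sum]
  have hm : ∀ l o, (rightAlgebra D hz hβ).m l o = rightCoeff D z l o := fun _ _ => rfl
  simp only [← List.map_take, ← List.map_drop, ← List.map_append, hinj.eq_iff, hm,
    map_nonunit_map_val, List.length_map, Fin.getElem_fin, List.getElem_map]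
  by_cases hsum : srcSum u = srcSum v
  · rw [leftCoeff, if_neg (List.cons_ne_nil _ _), List.map_cons, List.map_nil, placeLeft_singleton,
      halfPlaneCoeff_left_one (w := (LeftBasis.of (z := z) D hz v).toWord)
        (o := (LeftBasis.of (z := z) D hz u).toWord) hz (LeftBasis.isStableFan _)
          (LeftBasis.isStableFan _) rfl
        (by rw [LeftBasis.final_of, LeftBasis.final_of, hsum])]
    -- dualizing reverses the order of the letters
    refine Fintype.sum_equiv (Fin.revPerm.trans (finCongr (by
      rw [LeftBasis.letters_of, length_dualList, List.length_map]))) _ _ fun i => ?_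
    have hi : i.1 < v.length := lt_of_lt_of_eq i.2 (length_dualList D v)
    obtain ⟨X, c, Y, rfl, hY⟩ : ∃ X c Y, v = X ++ c :: Y ∧ i.1 = Y.length := by
      refine ⟨v.take (v.length - 1 - i), v[v.length - 1 - i], v.drop (v.length - 1 - i + 1), ?_, ?_⟩
      · rw [← List.drop_eq_getElem_cons, List.take_append_drop]
      · rw [List.length_drop]
        omega
    have hp : ((Fin.revPerm.trans (finCongr (by
        rw [LeftBasis.letters_of, length_dualList, List.length_map]))) i :
        Fin ((X ++ c :: Y).map (nonunit hz)).length).1 = X.length := by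
      change (LeftBasis.of (z := z) D hz (X ++ c :: Y)).toWord.letters.length - (i.1 + 1) = _
      have h : (LeftBasis.of (z := z) D hz (X ++ c :: Y)).toWord.letters.length = _ :=
        length_dualList D (X ++ c :: Y)
      rw [List.length_append, List.length_cons] at h
      omega
    generalize (Fin.revPerm.trans (finCongr _)) i = p at hp ⊢
    obtain ⟨p, hlt⟩ := p
    obtain rfl : p = X.length := hp
    have hget : (X ++ c :: Y)[X.length]'(by simp) = c := by simp
    have hdrop : (X ++ c :: Y).drop (X.length + 1) = Y := by
      rw [← List.drop_drop, List.drop_left' rfl]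
      rfl
    have := graft_term_eq D hz hsum i hY
    simp only [hget, hdrop, List.take_left' rfl]
    refine Eq.trans ?_ (this.trans ?_)
    · rfl
    · congr!
  · have h0 : leftCoeff D z [LeftBasis.of D hz v] (LeftBasis.of D hz u) = 0 := by
      by_contra h
      obtain ⟨u', hu', h'⟩ := leftCoeff_singleton_support_subset D hz v (Function.mem_support.2 h)
      exact hsum (LeftBasis.of_injective D hz h' ▸ hu')
    rw [h0]
    refine (Finset.sum_eq_zero fun p _ => ?_).symm
    have hp : p.1 < v.length := by simpa using p.2
    split_ifs with h
    · rw [show rightCoeff D z _ (nonunit hz v[p.1]).1 = _ from rightCoeff_map_of D hz _ v[p.1],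
        if_neg, mul_zero, mul_zero]
      intro h'
      apply hsum
      have hv : v = v.take p ++ v[p.1] :: v.drop (p + 1) := by
        rw [← List.drop_eq_getElem_cons, List.take_append_drop]
      rw [h, srcSum_append, srcSum_append]
      conv_rhs => rw [hv, srcSum_append, srcSum_cons, ← h']
      simp only [srcSum, List.map_map, Function.comp_def]
      ring
    · rw [mul_zero]

end LeftDifferential

/-! ### Koszul duality -/

/-- The cobar differential has degree `1`. -/
theorem Cobar.degree_of_coeff_deltaList {B : Type*} {e : B} {deg : B → ℤ} {A : AInfinity B deg}
    (hA : IsLocallyFinite A e) {v u : List {b : B // b ≠ e}}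
    (h : (deltaList hA v).coeff (FreeMonoid.ofList u) ≠ 0) :
    (u.map fun a => 1 - deg a.1).sum = (v.map fun a => 1 - deg a.1).sum + 1 := by
  rw [coeff_deltaList_eq_sum_fin] at h
  obtain ⟨p, -, hp⟩ := Finset.exists_ne_zero_of_sum_ne_zero h
  split_ifs at hp with hu
  swap
  · exact absurd rfl hp
  have hdeg := A.degree _ _ (right_ne_zero_of_mul hp)
  have hv : v = v.take p ++ v[p] :: v.drop (p + 1) := by
    rw [Fin.getElem_fin, ← List.drop_eq_getElem_cons, List.take_append_drop]
  have h1 := congrArg (fun l => (l.map fun a => 1 - deg a.1).sum) hu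
  have h2 := congrArg (fun l => (l.map fun a => 1 - deg a.1).sum) hv
  have h3 := sum_map_one_sub (deg := deg) ((u.drop p).take (u.length + 1 - v.length))
  simp only [List.map_append, List.sum_append, List.map_cons, List.sum_cons] at h1 h2
  rw [List.map_map, List.length_map] at hdeg
  simp only [Function.comp_def] at hdeg
  linarith

theorem involutive_linearCombination_smul_single {B : Type*} (σ : B → ℂ) (hσ : ∀ b, σ b * σ b = 1) :
    Function.Involutive
      (Finsupp.linearCombination ℂ fun b : B => σ b • Finsupp.single b (1 : ℂ)) := by
  intro x
  induction x using Finsupp.induction_linear with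
  | zero => simp
  | add f g hf hg => rw [map_add, map_add, hf, hg]
  | single b r =>
    rw [Finsupp.linearCombination_single, map_smul, map_smul, Finsupp.linearCombination_single,
      one_smul, smul_smul (σ b), hσ, one_smul, Finsupp.smul_single, smul_eq_mul, mul_one]

section Duality

variable {S : Spectrum.{u}} {z : ℝ → ℤ → ℂ} (D : InfraredData S)

/-- The degree in the cobar complex of a word in the solitons which span the augmentation ideal. -/
def dualDegree (gs : List (RightGen S)) : ℤ := (gs.map fun a => 1 - D.deg a.1).sum

theorem dualDegree_append (u v : List (RightGen S)) :
    dualDegree D (u ++ v) = dualDegree D u + dualDegree D v := by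
  simp [dualDegree]

theorem degWord_leftOf_eq (hz : IsAsymptoticallyParabolic z) (u : List (RightGen S)) :
    D.degWord (LeftBasis.of (z := z) D hz u).toWord = dualDegree D u := degWord_leftOf D hz u

theorem sum_map_nonunit (hz : IsAsymptoticallyParabolic z) (u : List (RightGen S)) :
    ((u.map (nonunit hz)).map fun a => 1 - D.degWord a.1.1).sum = dualDegree D u := by
  rw [List.map_map, dualDegree]
  congr 1
  refine List.map_congr_left fun a _ => ?_
  rw [Function.comp_apply, ← degWord_of D hz a]
  rfl

theorem degree_wordEquiv (hz : IsAsymptoticallyParabolic z) (u : List (RightGen S)) :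
    Cobar.degree (fun b => D.degWord b.1) (wordEquiv hz u) = dualDegree D u :=
  sum_map_nonunit D hz u

/-- The isomorphism of the cobar complex of `A^R` with `A^L`. -/
def dualMap (hz : IsAsymptoticallyParabolic z) :
    Cobar (RightBasis.one S z) ≃ₗ[ℂ] (LeftBasis S z →₀ ℂ) :=
  (MonoidAlgebra.coeffLinearEquiv ℂ).trans
    ((Finsupp.domLCongr ((wordEquiv hz).symm.trans (leftEquiv D hz))).trans
      (LinearEquiv.ofInvolutive
        (Finsupp.linearCombination ℂ fun b : LeftBasis S z =>
          dualSign (D.degWord b.toWord) • Finsupp.single b (1 : ℂ))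
        (involutive_linearCombination_smul_single _ fun _ => dualSign_mul_self _)))

theorem dualMap_word (hz : IsAsymptoticallyParabolic z) (u : List (RightGen S)) :
    dualMap D hz (Cobar.word (wordEquiv hz u)) =
      dualSign (dualDegree D u) • Finsupp.single (LeftBasis.of D hz u) 1 := by
  have h : (MonoidAlgebra.coeffLinearEquiv ℂ) (Cobar.word (wordEquiv hz u)) =
      Finsupp.single (wordEquiv hz u) (1 : ℂ) := rfl
  rw [dualMap, LinearEquiv.trans_apply, h, LinearEquiv.trans_apply, Finsupp.domLCongr_single,
    Equiv.trans_apply, Equiv.symm_apply_apply, leftEquiv_apply]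
  change Finsupp.linearCombination ℂ _ _ = _
  rw [Finsupp.linearCombination_single, one_smul, degWord_leftOf_eq]

theorem dualMap_apply_of (hz : IsAsymptoticallyParabolic z) (x : Cobar (RightBasis.one S z))
    (u : List (RightGen S)) : dualMap D hz x (LeftBasis.of D hz u) =
      dualSign (dualDegree D u) * x.coeff (wordEquiv hz u) := by
  classical
  conv_lhs => rw [Cobar.eq_sum_word x]
  rw [map_sum, Finsupp.finsetSum_apply, Finset.sum_eq_single (wordEquiv hz u)]
  · rw [map_smul, dualMap_word]
    simp [mul_comm]
  · intro w _ hw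
    obtain ⟨w, rfl⟩ := (wordEquiv hz).surjective w
    rw [map_smul, dualMap_word, Finsupp.smul_apply, Finsupp.smul_apply,
      Finsupp.single_eq_of_ne (fun h => hw (congrArg _ (LeftBasis.of_injective D hz h).symm)),
      smul_zero, smul_zero]
  · intro h
    rw [Finsupp.notMem_support_iff.1 h, zero_smul, map_zero]
    rfl

theorem dualMap_differential_word (hz : IsAsymptoticallyParabolic z)
    (hβ : D.IsInteriorAmplitude z) (v : List (RightGen S)) :
    dualMap D hz (Cobar.differential (isLocallyFinite_rightAlgebra D hz hβ)
      (Cobar.word (wordEquiv hz v))) =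
      dualSign (dualDegree D v) • leftOp D hz [LeftBasis.of D hz v] := by
  ext o
  obtain ⟨u, rfl⟩ := LeftBasis.exists_of D hz o
  rw [dualMap_apply_of, Cobar.differential_word, Finsupp.smul_apply, leftOp_apply,
    leftCoeff_singleton D hz hβ]
  change _ = dualSign (dualDegree D v) * (dualSign (dualDegree D u) * dualSign (dualDegree D v) *
    (Cobar.deltaList _ (wordEquiv hz v).toList).coeff (wordEquiv hz u))
  linear_combination (-(dualSign (dualDegree D u) *
    (Cobar.deltaList (isLocallyFinite_rightAlgebra D hz hβ) (wordEquiv hz v).toList).coeff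
      (wordEquiv hz u))) * dualSign_mul_self (dualDegree D v)

theorem wordEquiv_append (hz : IsAsymptoticallyParabolic z) (u v : List (RightGen S)) :
    wordEquiv hz (u ++ v) = wordEquiv hz u * wordEquiv hz v := by
  rw [wordEquiv_apply, List.map_append]
  rfl

/-- The operation `m₁` of `A^L`, as a linear map. -/
def leftD (hz : IsAsymptoticallyParabolic z) : (LeftBasis S z →₀ ℂ) →ₗ[ℂ] (LeftBasis S z →₀ ℂ) :=
  Finsupp.linearCombination ℂ fun b => leftOp D hz [b]

theorem dualMap_differential (hz : IsAsymptoticallyParabolic z) (hβ : D.IsInteriorAmplitude z)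
    (x : Cobar (RightBasis.one S z)) :
    dualMap D hz (Cobar.differential (isLocallyFinite_rightAlgebra D hz hβ) x) =
      leftD D hz (dualMap D hz x) := by
  have h : (dualMap D hz).toLinearMap ∘ₗ
      Cobar.differential (isLocallyFinite_rightAlgebra D hz hβ) =
      leftD D hz ∘ₗ (dualMap D hz).toLinearMap := by
    refine Cobar.linearMap_ext fun w => ?_
    obtain ⟨w, rfl⟩ := (wordEquiv hz).surjective w
    rw [LinearMap.comp_apply, LinearMap.comp_apply, LinearEquiv.coe_coe,
      dualMap_differential_word, dualMap_word, map_smul, leftD, Finsupp.linearCombination_single,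
      one_smul]
  exact LinearMap.congr_fun h x

theorem leftD_leftOp (hz : IsAsymptoticallyParabolic z) (hβ : D.IsInteriorAmplitude z)
    (b : LeftBasis S z) : leftD D hz (leftOp D hz [b]) = 0 := by
  have h : leftOp D hz [b] = leftD D hz (Finsupp.single b 1) := by
    rw [leftD, Finsupp.linearCombination_single, one_smul]
  obtain ⟨x, hx⟩ := (dualMap D hz).surjective (Finsupp.single b 1)
  have h0 := LinearMap.congr_fun (Cobar.differential_differential
    (isLocallyFinite_rightAlgebra D hz hβ) (isAugmentedAt_rightAlgebra D hz hβ)) x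
  rw [h, ← hx, ← dualMap_differential D hz hβ, ← dualMap_differential D hz hβ]
  exact (congrArg _ h0).trans (map_zero _)

/-- The operation `m₁` of `A^L` has degree `1`. -/
theorem leftOp_singleton_degree (hz : IsAsymptoticallyParabolic z) (hβ : D.IsInteriorAmplitude z)
    {v u : List (RightGen S)} (h : leftOp D hz [LeftBasis.of D hz v] (LeftBasis.of D hz u) ≠ 0) :
    dualDegree D u = dualDegree D v + 1 := by
  rw [leftOp_apply, leftCoeff_singleton D hz hβ] at h
  rw [← sum_map_nonunit D hz, ← sum_map_nonunit D hz]
  exact Cobar.degree_of_coeff_deltaList _ (right_ne_zero_of_mul h)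

end Duality

section LeftAlgebra

variable {S : Spectrum.{u}} {z : ℝ → ℤ → ℂ} (D : InfraredData S)

/-- The basis vectors of `A^L` obtained by appending the word `v` to the dual words. -/
def appendRight (hz : IsAsymptoticallyParabolic z) (v : List (RightGen S)) (b : LeftBasis S z) :
    LeftBasis S z := LeftBasis.of D hz ((leftEquiv D hz).symm b ++ v)

/-- The basis vectors of `A^L` obtained by prepending the word `v` to the dual words. -/
def appendLeft (hz : IsAsymptoticallyParabolic z) (v : List (RightGen S)) (b : LeftBasis S z) :
    LeftBasis S z := LeftBasis.of D hz (v ++ (leftEquiv D hz).symm b)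

theorem appendRight_of (hz : IsAsymptoticallyParabolic z) (u v : List (RightGen S)) :
    appendRight (z := z) D hz v (LeftBasis.of D hz u) = LeftBasis.of D hz (u ++ v) := by
  rw [appendRight, show (leftEquiv D hz).symm (LeftBasis.of D hz u) = u from
    (leftEquiv D hz).symm_apply_apply u]

theorem appendLeft_of (hz : IsAsymptoticallyParabolic z) (u v : List (RightGen S)) :
    appendLeft (z := z) D hz v (LeftBasis.of D hz u) = LeftBasis.of D hz (v ++ u) := by
  rw [appendLeft, show (leftEquiv D hz).symm (LeftBasis.of D hz u) = u from
    (leftEquiv D hz).symm_apply_apply u]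

theorem dualMap_mul_word (hz : IsAsymptoticallyParabolic z) {x : Cobar (RightBasis.one S z)} {d : ℤ}
    (hx : ∀ w, x.coeff (wordEquiv hz w) ≠ 0 → dualDegree D w = d) (v : List (RightGen S)) :
    dualMap D hz (x * Cobar.word (wordEquiv hz v)) =
      (dualSign (dualDegree D v) * sgn (d * dualDegree D v)) •
        Finsupp.mapDomain (appendRight D hz v) (dualMap D hz x) := by
  rw [Cobar.eq_sum_word x]
  simp only [Finset.sum_mul, map_sum, Finsupp.mapDomain_finsetSum, Finset.smul_sum]
  refine Finset.sum_congr rfl fun w hw => ?_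
  obtain ⟨w, rfl⟩ := (wordEquiv hz).surjective w
  obtain rfl := hx w (Finsupp.mem_support_iff.1 hw)
  rw [smul_mul_assoc, ← Cobar.word_mul, ← wordEquiv_append, map_smul, map_smul, dualMap_word,
    dualMap_word, Finsupp.mapDomain_smul, Finsupp.mapDomain_smul, Finsupp.mapDomain_single,
    appendRight_of, dualDegree_append, dualSign_add]
  simp only [smul_smul]
  congr 1
  ring

theorem dualMap_word_mul (hz : IsAsymptoticallyParabolic z) {x : Cobar (RightBasis.one S z)} {d : ℤ}
    (hx : ∀ w, x.coeff (wordEquiv hz w) ≠ 0 → dualDegree D w = d) (v : List (RightGen S)) :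
    dualMap D hz (Cobar.word (wordEquiv hz v) * x) =
      (dualSign (dualDegree D v) * sgn (dualDegree D v * d)) •
        Finsupp.mapDomain (appendLeft D hz v) (dualMap D hz x) := by
  rw [Cobar.eq_sum_word x]
  simp only [Finset.mul_sum, map_sum, Finsupp.mapDomain_finsetSum, Finset.smul_sum]
  refine Finset.sum_congr rfl fun w hw => ?_
  obtain ⟨w, rfl⟩ := (wordEquiv hz).surjective w
  obtain rfl := hx w (Finsupp.mem_support_iff.1 hw)
  rw [mul_smul_comm, ← Cobar.word_mul, ← wordEquiv_append, map_smul, map_smul, dualMap_word,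
    dualMap_word, Finsupp.mapDomain_smul, Finsupp.mapDomain_smul, Finsupp.mapDomain_single,
    appendLeft_of, dualDegree_append, dualSign_add]
  simp only [smul_smul]
  congr 1
  ring

theorem dualDegree_of_coeff_differential (hz : IsAsymptoticallyParabolic z)
    (hβ : D.IsInteriorAmplitude z) (v w : List (RightGen S))
    (h : (Cobar.differential (isLocallyFinite_rightAlgebra D hz hβ)
      (Cobar.word (wordEquiv hz v))).coeff (wordEquiv hz w) ≠ 0) :
    dualDegree D w = dualDegree D v + 1 := by
  rw [Cobar.differential_word] at h
  rw [← sum_map_nonunit D hz, ← sum_map_nonunit D hz]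
  exact Cobar.degree_of_coeff_deltaList _ h

/-- The Leibniz rule in `A^L`, transported from the cobar complex. -/
theorem leftOp_append (hz : IsAsymptoticallyParabolic z) (hβ : D.IsInteriorAmplitude z)
    (u v : List (RightGen S)) :
    leftOp D hz [LeftBasis.of D hz (u ++ v)] =
      sgn (dualDegree D v) •
        Finsupp.mapDomain (appendRight D hz v) (leftOp D hz [LeftBasis.of D hz u]) +
      Finsupp.mapDomain (appendLeft D hz u) (leftOp D hz [LeftBasis.of D hz v]) := by
  have h := congrArg (dualMap D hz) (Cobar.differential_word_mul
    (isLocallyFinite_rightAlgebra D hz hβ) (wordEquiv hz u) (wordEquiv hz v))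
  rw [← wordEquiv_append, dualMap_differential_word, map_add, map_smul,
    dualMap_mul_word D hz (dualDegree_of_coeff_differential D hz hβ u),
    dualMap_word_mul D hz (dualDegree_of_coeff_differential D hz hβ v),
    dualMap_differential_word, dualMap_differential_word, degree_wordEquiv, dualDegree_append,
    dualSign_add, Finsupp.mapDomain_smul, Finsupp.mapDomain_smul] at h
  set x := dualDegree D u
  set y := dualDegree D v
  -- the sign relating `dualMap` of a product to the product of the values is its own inverse
  have hc : (dualSign x * dualSign y * sgn (x * y)) * (dualSign x * dualSign y * sgn (x * y)) =
      1 := by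
    linear_combination (dualSign y * dualSign y * sgn (x * y) * sgn (x * y)) * dualSign_mul_self x +
      (sgn (x * y) * sgn (x * y)) * dualSign_mul_self y + sgn_mul_self (x * y)
  have h1 : sgn ((x + 1) * y) = sgn (x * y) * sgn y := by rw [← sgn_add]; congr 1; ring
  have h2 : sgn (x * (y + 1)) = sgn (x * y) * sgn x := by rw [← sgn_add]; congr 1; ring
  have h' := congrArg ((dualSign x * dualSign y * sgn (x * y)) • ·) h
  simp only [smul_add, smul_smul, hc, one_smul, h1, h2] at h'
  rw [h']
  congr 2
  · linear_combination sgn y * hc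
  · refine Eq.trans ?_ (one_smul ℂ _)
    congr 1
    linear_combination hc + (dualSign x * dualSign y * sgn (x * y)) *
      (dualSign x * dualSign y * sgn (x * y)) * sgn_mul_self x

theorem leftOp_pair_dualDegree (hz : IsAsymptoticallyParabolic z) (v u : List (RightGen S)) :
    leftOp D hz [LeftBasis.of D hz v, LeftBasis.of D hz u] =
      sgn (dualDegree D v) • Finsupp.single (LeftBasis.of D hz (u ++ v)) (1 : ℂ) := by
  rw [leftOp_pair, degWord_leftOf_eq]

theorem leftOp_degree (hz : IsAsymptoticallyParabolic z) (hβ : D.IsInteriorAmplitude z)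
    (l : List (LeftBasis S z)) (o : LeftBasis S z) (h : leftOp D hz l o ≠ 0) :
    D.degWord o.toWord = (l.map fun b => D.degWord b.toWord).sum + 2 - l.length := by
  rcases l with _ | ⟨b, _ | ⟨c, _ | ⟨d, l⟩⟩⟩
  · exact absurd (by rw [leftOp_nil]; rfl) h
  · obtain ⟨v, rfl⟩ := LeftBasis.exists_of D hz b
    obtain ⟨u, rfl⟩ := LeftBasis.exists_of D hz o
    have := leftOp_singleton_degree D hz hβ h
    simp only [List.map_cons, List.map_nil, List.sum_cons, List.sum_nil, degWord_leftOf_eq,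
      List.length_cons, List.length_nil, this]
    push_cast
    ring
  · obtain ⟨v, rfl⟩ := LeftBasis.exists_of D hz b
    obtain ⟨u, rfl⟩ := LeftBasis.exists_of D hz c
    rw [leftOp_pair_dualDegree, Finsupp.smul_single] at h
    rw [(Finsupp.single_apply_ne_zero.1 h).1]
    simp only [List.map_cons, List.map_nil, List.sum_cons, List.sum_nil, degWord_leftOf_eq,
      List.length_cons, List.length_nil, dualDegree_append]
    push_cast
    ring
  · exact absurd (by rw [leftOp_of_three_le D hz (by simp)]; rfl) h

theorem leftOp_sum_pair_left (hz : IsAsymptoticallyParabolic z) (hβ : D.IsInteriorAmplitude z)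
    (v u : List (RightGen S)) :
    ((leftOp D hz [LeftBasis.of D hz v]).sum fun c r => r • leftOp D hz [c, LeftBasis.of D hz u]) =
      sgn (dualDegree D v + 1) •
        Finsupp.mapDomain (appendLeft D hz u) (leftOp D hz [LeftBasis.of D hz v]) := by
  rw [Finsupp.mapDomain, Finsupp.smul_sum]
  refine Finset.sum_congr rfl fun o ho => ?_
  obtain ⟨w, rfl⟩ := LeftBasis.exists_of D hz o
  dsimp only
  rw [leftOp_pair_dualDegree, appendLeft_of,
    leftOp_singleton_degree D hz hβ (Finsupp.mem_support_iff.1 ho), smul_comm, Finsupp.smul_single,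
    smul_eq_mul, mul_one]

theorem leftOp_sum_pair_right (hz : IsAsymptoticallyParabolic z) (v u : List (RightGen S)) :
    ((leftOp D hz [LeftBasis.of D hz u]).sum fun c r => r • leftOp D hz [LeftBasis.of D hz v, c]) =
      sgn (dualDegree D v) •
        Finsupp.mapDomain (appendRight D hz v) (leftOp D hz [LeftBasis.of D hz u]) := by
  rw [Finsupp.mapDomain, Finsupp.smul_sum]
  refine Finset.sum_congr rfl fun o ho => ?_
  obtain ⟨w, rfl⟩ := LeftBasis.exists_of D hz o
  dsimp only
  rw [leftOp_pair_dualDegree, appendRight_of, smul_comm, Finsupp.smul_single, smul_eq_mul, mul_one]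

theorem sum_leftOp_pair (hz : IsAsymptoticallyParabolic z) (v u : List (RightGen S))
    (f : LeftBasis S z → LeftBasis S z →₀ ℂ) :
    ((leftOp D hz [LeftBasis.of D hz v, LeftBasis.of D hz u]).sum fun c r => r • f c) =
      sgn (dualDegree D v) • f (LeftBasis.of D hz (u ++ v)) := by
  rw [leftOp_pair_dualDegree, Finsupp.smul_single, smul_eq_mul, mul_one]
  exact Finsupp.sum_single_index (zero_smul _ _)

/-- With one argument the relation is `d² = 0`, with two the Leibniz rule, with three the
associativity of composition. With more, one of the two operations takes three arguments. -/
theorem leftOp_assoc (hz : IsAsymptoticallyParabolic z) (hβ : D.IsInteriorAmplitude z)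
    (l : List (LeftBasis S z)) :
    ∑ i ∈ Finset.range l.length, ∑ j ∈ Finset.range (l.length - i),
      sgn (((l.take i).map fun b => D.degWord b.toWord + 1).sum) •
        ((leftOp D hz ((l.drop i).take (j + 1))).sum fun c r =>
          r • leftOp D hz (l.take i ++ c :: l.drop (i + j + 1))) = 0 := by
  rcases l with _ | ⟨b, _ | ⟨c, _ | ⟨d, _ | ⟨e, l⟩⟩⟩⟩
  · simp
  · have h := leftD_leftOp D hz hβ b
    rw [leftD, Finsupp.linearCombination_apply] at h
    simpa [Finset.sum_range_succ] using h
  · obtain ⟨v, rfl⟩ := LeftBasis.exists_of D hz b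
    obtain ⟨u, rfl⟩ := LeftBasis.exists_of D hz c
    have h1 := leftOp_sum_pair_left D hz hβ v u
    have h2 := sum_leftOp_pair D hz v u fun c => leftOp D hz [c]
    have h3 := leftOp_sum_pair_right D hz v u
    rw [leftOp_append D hz hβ] at h2
    simp only [Finset.sum_range_succ, Finset.sum_range_zero, List.length_cons, List.length_nil,
      zero_add, Nat.sub_zero, add_zero, Nat.reduceAdd, Nat.reduceSub,
      List.take_zero, List.drop_zero, List.map_nil, List.sum_nil, List.take_succ_cons,
      List.drop_succ_cons, List.nil_append, List.map_cons, List.sum_cons, degWord_leftOf_eq,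
      List.cons_append, h1, h2, h3, List.take_nil, List.drop_nil]
    simp only [sgn_add, sgn_one, show sgn 0 = 1 by simp [sgn], smul_add, smul_smul]
    module
  · obtain ⟨w, rfl⟩ := LeftBasis.exists_of D hz b
    obtain ⟨v, rfl⟩ := LeftBasis.exists_of D hz c
    obtain ⟨u, rfl⟩ := LeftBasis.exists_of D hz d
    have h3 : ∀ b c d, leftOp D hz [b, c, d] = 0 := fun b c d =>
      leftOp_of_three_le D hz (by simp)
    have h1 := sum_leftOp_pair D hz w v fun c => leftOp D hz [c, LeftBasis.of D hz u]
    have h2 := sum_leftOp_pair D hz v u fun c => leftOp D hz [LeftBasis.of D hz w, c]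
    simp only [Finset.sum_range_succ, Finset.sum_range_zero, List.length_cons, List.length_nil,
      zero_add, Nat.sub_zero, add_zero, Nat.reduceAdd, Nat.reduceSub,
      List.take_zero, List.drop_zero, List.map_nil, List.sum_nil, List.take_succ_cons,
      List.drop_succ_cons, List.nil_append, List.map_cons, List.sum_cons, degWord_leftOf_eq,
      List.cons_append, h1, h2, h3, List.take_nil, List.drop_nil, smul_zero,
      Finsupp.sum_zero_index]
    simp only [leftOp_pair_dualDegree, List.append_assoc, dualDegree_append, Finsupp.sum,
      Finset.sum_const_zero, smul_zero, sgn_add, sgn_one, show sgn 0 = 1 by simp [sgn], smul_smul]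
    module
  · refine Finset.sum_eq_zero fun i hi => Finset.sum_eq_zero fun j hj => ?_
    rw [Finset.mem_range] at hi hj
    rcases le_or_gt 2 j with h | h
    · rw [leftOp_of_three_le D hz, Finsupp.sum_zero_index, smul_zero]
      rw [List.length_take, List.length_drop]
      omega
    · have h0 : ∀ x, leftOp D hz ((b :: c :: d :: e :: l).take i ++
          x :: (b :: c :: d :: e :: l).drop (i + j + 1)) = 0 := fun x => by
        refine leftOp_of_three_le D hz ?_
        rw [List.length_append, List.length_take, List.length_cons (a := x), List.length_drop]
        simp only [List.length_cons] at hi hj ⊢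
        omega
      simp only [h0, smul_zero, Finsupp.sum, Finset.sum_const_zero]

/-- The differential graded algebra `A^L` of the left half-plane. -/
def leftAlgebra (hz : IsAsymptoticallyParabolic z) (hβ : D.IsInteriorAmplitude z) :
    AInfinity (LeftBasis S z) fun b => D.degWord b.1 where
  m := leftOp D hz
  m_nil := leftOp_nil D hz
  degree := leftOp_degree D hz hβ
  assoc := leftOp_assoc D hz hβ

theorem isDG_leftAlgebra (hz : IsAsymptoticallyParabolic z) (hβ : D.IsInteriorAmplitude z) :
    (leftAlgebra D hz hβ).IsDG := fun _ h => leftOp_of_three_le D hz h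

theorem isStrictUnit_leftAlgebra (hz : IsAsymptoticallyParabolic z)
    (hβ : D.IsInteriorAmplitude z) :
    (leftAlgebra D hz hβ).IsStrictUnit (LeftBasis.one S z) where
  deg_unit := degWord_leftOf_eq (z := z) D hz []
  d_unit := by
    change leftOp D hz [LeftBasis.of D hz []] = 0
    ext o
    obtain ⟨u, rfl⟩ := LeftBasis.exists_of D hz o
    rw [leftOp_apply, leftCoeff_singleton D hz hβ]
    exact mul_eq_zero_of_right _ rfl
  left b := by
    change leftOp D hz [LeftBasis.of D hz [], b] = _
    obtain ⟨u, rfl⟩ := LeftBasis.exists_of D hz b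
    rw [leftOp_pair_dualDegree, List.append_nil]
    simp [dualDegree, sgn]
  right b := by
    change leftOp D hz [b, LeftBasis.of D hz []] = _
    obtain ⟨u, rfl⟩ := LeftBasis.exists_of D hz b
    rw [leftOp_pair_dualDegree, List.nil_append, ← degWord_leftOf_eq D hz]
    rfl
  higher _ h _ := leftOp_of_three_le D hz h

theorem isLeftWebAlgebra_leftAlgebra (hz : IsAsymptoticallyParabolic z)
    (hβ : D.IsInteriorAmplitude z) : IsLeftWebAlgebra D z (leftAlgebra D hz hβ) := by
  intro ws hws o
  exact ⟨halfPlaneTaut_left_finite hz (placeLeft_ne_nil D (List.map_eq_nil_iff.not.2 hws)),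
    if_neg hws⟩

theorem toWord_leftOf_eq_dualWord (hz : IsAsymptoticallyParabolic z) (u : List (RightGen S)) :
    (LeftBasis.of D hz u).toWord = dualWord D (wordEquiv hz u) := by
  have h : ((wordEquiv hz u).toList.map fun a => a.1.1) =
      (u.map (RightBasis.of hz)).map RightBasis.toWord := by
    rw [wordEquiv_apply, FreeMonoid.toList_ofList, List.map_map, List.map_map]
    rfl
  rw [dualWord, h, placeRight_map_of]
  have h' : ∀ L : List S.Gen, (L.map letterWord).flatMap Word.letters = L := fun L => by
    induction L with
    | nil => rfl
    | cons s L ih =>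
      rw [List.map_cons, List.flatMap_cons, ih]
      rfl
  rw [h']
  rfl

/-- The cobar complex of `A^R` is `A^L`, with the opposite product. -/
theorem isKoszulDual_rightAlgebra_leftAlgebra (hz : IsAsymptoticallyParabolic z)
    (hβ : D.IsInteriorAmplitude z) :
    IsKoszulDual D (rightAlgebra D hz hβ) (leftAlgebra D hz hβ) := by
  refine ⟨isStrictUnit_rightAlgebra D hz hβ, isAugmentedAt_rightAlgebra D hz hβ,
    isStrictUnit_leftAlgebra D hz hβ, isDG_leftAlgebra D hz hβ,
    Cobar.differential (isLocallyFinite_rightAlgebra D hz hβ),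
    Cobar.isDifferential_differential _ (isAugmentedAt_rightAlgebra D hz hβ),
    dualMap D hz, fun w => ?_, dualMap_differential D hz hβ, fun v w => ?_⟩
  · obtain ⟨u, rfl⟩ := (wordEquiv hz).surjective w
    refine ⟨LeftBasis.of D hz u, toWord_leftOf_eq_dualWord D hz u, ?_, ?_⟩
    · rw [degree_wordEquiv]
      exact degWord_leftOf_eq D hz u
    · rw [dualMap_word, ← degWord_leftOf_eq D hz]
      rfl
  · obtain ⟨u, rfl⟩ := (wordEquiv hz).surjective v
    obtain ⟨v, rfl⟩ := (wordEquiv hz).surjective w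
    have hmul : (leftAlgebra D hz hβ).mul (Finsupp.single (LeftBasis.of D hz v) 1)
        (Finsupp.single (LeftBasis.of D hz u) 1) =
        Finsupp.single (LeftBasis.of D hz (u ++ v)) 1 := by
      rw [AInfinity.mul, Finsupp.linearCombination_single, one_smul, LinearMap.smul_apply,
        Finsupp.linearCombination_single, one_smul]
      change sgn (D.degWord (LeftBasis.of D hz v).toWord) •
        leftOp D hz [LeftBasis.of D hz v, LeftBasis.of D hz u] = _
      rw [leftOp_pair_dualDegree, degWord_leftOf_eq, smul_smul, sgn_mul_self, one_smul]
    rw [← wordEquiv_append, degree_wordEquiv, degree_wordEquiv, dualMap_word, dualMap_word,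
      dualMap_word, map_smul, map_smul, LinearMap.smul_apply, hmul, smul_smul, smul_smul,
      dualDegree_append, dualSign_add]
    congr 1
    ring

end LeftAlgebra

end KoszulWebs

end

theorem theorem5p1 {n : ℕ} {X X' : Type*}
    [TopologicalSpace X] [T2Space X] [SecondCountableTopology X] [ConnectedSpace X]
    [ChartedSpace (KoszulWebs.Cn n) X] [IsManifold 𝓘(ℂ, KoszulWebs.Cn n) ω X]
    [TopologicalSpace X'] [T2Space X'] [SecondCountableTopology X'] [ConnectedSpace X']
    [ChartedSpace (KoszulWebs.Cn n) X'] [IsManifold 𝓘(ℂ, KoszulWebs.Cn n) ω X']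
    (M : KoszulWebs.LGModel n X X') (ε₀ : ℂ) (hε₀ : 0 < ε₀.re)
    (vac : ℤ → ℝ → X') (hvac : M.IsPerturbedVacua ε₀ vac)
    (D : KoszulWebs.InfraredData (M.spectrum ε₀ vac))
    (hβ : D.IsInteriorAmplitude (M.weight ε₀ vac)) :
    ∃ (AR : KoszulWebs.AInfinity (KoszulWebs.RightBasis (M.spectrum ε₀ vac) (M.weight ε₀ vac))
        fun b => D.degWord b.1)
      (AL : KoszulWebs.AInfinity (KoszulWebs.LeftBasis (M.spectrum ε₀ vac) (M.weight ε₀ vac))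
        fun b => D.degWord b.1),
      KoszulWebs.IsRightWebAlgebra D (M.weight ε₀ vac) AR ∧
      KoszulWebs.IsLeftWebAlgebra D (M.weight ε₀ vac) AL ∧
      KoszulWebs.IsKoszulDual D AR AL := by
  have hz := M.isAsymptoticallyParabolic_weight hε₀ hvac
  exact ⟨KoszulWebs.rightAlgebra D hz hβ, KoszulWebs.leftAlgebra D hz hβ,
    KoszulWebs.isRightWebAlgebra_rightAlgebra D hz hβ,
    KoszulWebs.isLeftWebAlgebra_leftAlgebra D hz hβ,
    KoszulWebs.isKoszulDual_rightAlgebra_leftAlgebra D hz hβ⟩
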